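/- Conventions. Let $p\neq q$ be integers and $\mathcal D=[1,2]^2$. The modes are $j_+$ (variable $a_j$) and $j_-$ (variable $b_j$), $j\in\mathbb Z$. The internal modes are $p_+$ and $q_-$; all others are external and are denoted $\zeta_{j+}=a_j$, $\zeta_{j-}=b_j$; $\mathcal L=\{j_\pm: j\ne p,q\}$ are the elliptic ones and $\mathcal F=\{p_-,q_+\}$ the hyperbolic ones. The clusters of $\mathcal L$ are the sets of modes $j_\pm$ with the same $|j|$. Let $\|\zeta\|_s^2=\sum_\alpha|\zeta_\alpha|^2w_\alpha^{2s}$ with $w_{j\pm}=\max(1,|j|)$ on $\mathcal L$ and $w=1$ on $\mathcal F$; let $Z_s$ and $Y_s$ be the corresponding weighted $\ell^2$ spaces over all external modes and over $\mathcal L$. Write $z=(\zeta,\bar\zeta)\in Z_s\times Z_s$ with $\bar\zeta$ independent of $\zeta$ and $\|z\|_s=\max(\|\zeta\|_s,\|\bar\zeta\|_s)$; a point $(r,\theta,z)$ is real if $r,\theta$ are real and $\bar\zeta$ is the conjugate of $\zeta$. On $\mathbb C^2$, $|\cdot|$ is the maximum norm. Set $$\mathcal O^s(\sigma,\mu)=\{(r,\theta,z):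 |r|<\mu^2,\ \theta\in\mathbb C^2/2\pi\mathbb Z^2,\ |\mathrm{Im}\,\theta|<\sigma,\ \|z\|_s<\mu\},$$ $$\mathbf T_\rho(\nu,\sigma,\mu,s)=\{(I,\theta,z): |I-\nu\rho|<\nu\mu^2,\ |\mathrm{Im}\,\theta|<\sigma,\ \|z\|_s<\nu^{1/2}\mu\}.$$ A point $(I,\theta,z)$ represents the modes $a_p=\sqrt{I_1}e^{i\theta_1}$, $b_q=\sqrt{I_2}e^{i\theta_2}$, $\bar a_p=\sqrt{I_1}e^{-i\theta_1}$, $\bar b_q=\sqrt{I_2}e^{-i\theta_2}$, the other modes being those of $z$. Let $\mathcal P_s$ be the space of all $(a,b,\bar a,\bar b)$, the bars independent, with norm the maximum of the $\ell^2_s$ norms (weight $(1+j^2)^{s}$ on squares) of $(a,b)$ and $(\bar a,\bar b)$, with symplectic form $-i\sum da_j\wedge d\bar a_j-i\sum db_j\wedge d\bar b_j$, and put $$P_2=\sum_j j^2(a_j\bar a_j+b_j\bar b_j),\quad P_4=\sum_{i+j=k+l}a_kb_l\bar a_i\bar b_j,\quad Z_4=\sum_{i+j=k+l,\ i^2+j^2=k^2+l^2}a_kb_l\bar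 a_i\bar b_j,$$ $$R_5=\frac1{2\pi}\int_0^{2\pi}g\Big(\sum_j a_je^{ijx},\sum_j\bar a_je^{-ijx},\sum_j b_je^{ijx},\sum_j\bar b_je^{-ijx}\Big)dx,\qquad H=P_2+P_4+R_5,$$ where $g(u,\bar u,v,\bar v)$ is analytic near $0\in\mathbb C^4$, real when $\bar u,\bar v$ are the conjugates of $u,v$, of order at least $5$ at $0$, and a function of $|u|^2,|v|^2,u\bar v,v\bar u$. A point has finite energy if $\sum_j j^2(|a_j|^2+|\bar a_j|^2+|b_j|^2+|\bar b_j|^2)<\infty$ (automatic if $s\ge1$; for $1/2<s<1$, $H$ is only densely defined). $\mathcal T^s(\sigma,\mu,\mathcal D)$ is the set of $C^1$ functions $f:\mathcal O^s(\sigma,\mu)\times\mathcal D\to\mathbb C$, holomorphic in $x=(r,\theta,z)$, real at real points, whose gradient $\nabla_zf$ takes values in $Z_s\times Z_s$ and whose matrix $\nabla^2_{\zeta_{\mathcal L}\bar\zeta_{\mathcal L}}f=(\partial^2f/\partial\zeta_\alpha\partial\bar\zeta_\beta)_{\alpha,\beta\in\mathcal L}$ takes values in the bounded operators on $Y_s$,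 both being holomorphic in $x$ and $C^1$ in $\rho$; and $$[f]^s_{\sigma,\mu,\mathcal D}=\sup_{j=0,1;\ x\in\mathcal O^s(\sigma,\mu);\ \rho\in\mathcal D}\max\big(|\partial^j_\rho f|,\ \mu\|\partial_\rho^j\nabla_zf\|_s,\ \mu^2|\partial^j_\rho\nabla^2_{\zeta_{\mathcal L}\bar\zeta_{\mathcal L}}f|_s\big),$$ with $|\cdot|_s$ the operator norm on $Y_s$. The jet is $f^T=f(0,\theta,0)+d_rf(0,\theta,0)[r]+d_zf(0,\theta,0)[z]+\frac12d_z^2f(0,\theta,0)[z,z]$. One has $f\in\mathcal T^s_{\rm res}(\sigma,\mu,\mathcal D)$ if $f\in\mathcal T^s(\sigma,\mu,\mathcal D)$ and there is $M$ such that, whenever $k\in\mathbb Z^2\setminus\{0\}$, $\alpha,\beta\in\mathcal L$ are in the same cluster and the monomial $e^{ik\cdot\theta}\zeta_\alpha\bar\zeta_\beta$ occurs in $f^T$ for some $\rho\in\mathcal D$, then $\alpha=\beta$ or $w_\alpha\le M|k|$. Theorem. There are $0<\sigma_0\le\frac12$ and $0<\mu_0\le\frac{e^{-1/2}}2$ such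 that for every $s>\frac12$ there are $\nu_0,C,\varepsilon>0$ and a map $\tau:B_s(\varepsilon)\to B_s(2\varepsilon)$ between balls of $\mathcal P_s$ with the following properties. The map $\tau$ is an injective, real, holomorphic and symplectic local diffeomorphism that conserves the mass $\sum_j(a_j\bar a_j+b_j\bar b_j)$ and the momentum $\sum_jj(a_j\bar a_j+b_j\bar b_j)$, with $\|\tau(w)-w\|_s\le C\|w\|_s^3$. There is a holomorphic $R_6$ with $R_6(0)=0$ and a holomorphic $\mathcal P_s$-valued gradient bounded by $C\|w\|_s^5$ such that, if $w\in B_s(\varepsilon)$ has finite energy, then so has $\tau(w)$, and $(P_2+P_4)(\tau(w))=(P_2+Z_4+R_6)(w)$. For every $0<\nu\le\nu_0$ there are maps $\Phi_\rho:\mathcal O^s(\frac12,\frac{e^{-1/2}}2)\to\mathbf T_\rho(\nu,1,1,s)$ and functions $f(\cdot;\rho)$, $\rho\in\mathcal D$, such that: (i) Each $\Phi_\rho$ is an injective, real, holomorphic local diffeomorphism (lifting to the universal cover of the angles as a map that commutes with the translations of $\theta$ by $2\pi\mathbb Z^2$), $\Phi_\rho(x)$ is analytic in $(\rho,x)$,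 and the pullback under $\Phi_\rho$ of the form $-dI\wedge d\theta-i\,d\zeta\wedge d\bar\zeta$ is $\nu(-dr\wedge d\theta-i\,d\zeta\wedge d\bar\zeta)$. In terms of the modes, $\Phi_\rho=\tau\circ\Psi_\rho$, where $\Psi_\rho$ takes values whose modes lie in $B_s(\varepsilon)$ and sends $(r,\theta,(c,d))$ to $(I,\theta,(a,b))$ with $$I_1=\nu(\rho_1+r_1-d_p\bar d_p),\quad I_2=\nu(\rho_2+r_2-c_q\bar c_q),\quad a_q=\nu^{1/2}e^{i\theta_2}c_q,\quad b_p=\nu^{1/2}e^{i\theta_1}d_p,$$ $\bar a_q=\nu^{1/2}e^{-i\theta_2}\bar c_q$, $\bar b_p=\nu^{1/2}e^{-i\theta_1}\bar d_p$, and all elliptic modes multiplied by $\nu^{1/2}$. The $z$-components of $\Phi_\rho$ and $\Psi_\rho$ differ by at most $C\nu^{3/2}$ in $\|\cdot\|_s$. (ii) At every $x=(r,\theta,z)\in\mathcal O^s(\frac12,\frac{e^{-1/2}}2)$ of finite energy, $\Phi_\rho(x)$ has finite energy and $$\frac1\nu\big(H\circ\Phi_\rho-C_{\nu,\rho}\big)(x)=h_0(r,z)+f(x;\rho),\qquad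 C_{\nu,\rho}=\nu^2\rho_1\rho_2+\nu p^2\rho_1+\nu q^2\rho_2,$$ $$h_0=\Omega(\rho)\cdot r+\sum_{j\ne p,q}\big((j^2+\nu\rho_2)a_j\bar a_j+(j^2+\nu\rho_1)b_j\bar b_j\big)+\tfrac12\langle z_f,K(\rho)z_f\rangle,\qquad \Omega(\rho)=(p^2+\nu\rho_2,\ q^2+\nu\rho_1),$$ where $a_j,b_j$ are the components of $z$, $z_f=(b_p,a_q,\bar b_p,\bar a_q)$, $\langle\cdot,\cdot\rangle$ is bilinear, and $$K(\rho)=\nu\begin{pmatrix}0&\sqrt{\rho_1\rho_2}&\rho_1-\rho_2&0\\ \sqrt{\rho_1\rho_2}&0&0&\rho_2-\rho_1\\ \rho_1-\rho_2&0&0&\sqrt{\rho_1\rho_2}\\ 0&\rho_2-\rho_1&\sqrt{\rho_1\rho_2}&0\end{pmatrix}.$$ (iii) For all $0<\sigma\le\sigma_0$ and $0<\mu\le\mu_0$, $f\in\mathcal T^s_{\rm res}(\sigma,\mu,\mathcal D)$, $f^T\in\mathcal T^s(\sigma,\mu,\mathcal D)$, and $$[f]^s_{\sigma,\mu,\mathcal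 D}\le C\nu,\qquad [f^T]^s_{\sigma,\mu,\mathcal D}\le C\nu^{3/2}.$$ -/

import Mathlib

open Filter Topology Set MeasureTheory
open scoped ENNReal ComplexConjugate Matrix

namespace CoupledNLS

noncomputable section

/-! Weighted `ℓ²` spaces of sequences. -/

/-- A positive weight on an index set. -/
structure Weight (ι : Type) where
  val : ι → ℝ
  pos : ∀ α, 0 < val α

/-- The complex sequences `ζ` with `∑ |ζ_α|² w_α^{2s} < ∞`. -/
def weightedSubmodule {ι : Type} (w : Weight ι) (s : ℝ) : Submodule ℂ (ι → ℂ) where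
  carrier := {ζ | Summable fun α => ‖ζ α‖ ^ 2 * w.val α ^ (2 * s)}
  zero_mem' := by simp [summable_zero]
  add_mem' := by
    intro x y hx hy
    refine Summable.of_nonneg_of_le (fun α => ?_) (fun α => ?_) ((hx.add hy).mul_left 2)
    · have := Real.rpow_nonneg (w.pos α).le (2 * s)
      positivity
    · have h1 := Real.rpow_nonneg (w.pos α).le (2 * s)
      have h2 : ‖x α + y α‖ ^ 2 ≤ 2 * (‖x α‖ ^ 2 + ‖y α‖ ^ 2) := by
        have h3 := norm_add_le (x α) (y α)
        have h4 := norm_nonneg (x α + y α)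
        nlinarith [sq_nonneg (‖x α‖ - ‖y α‖)]
      calc ‖x α + y α‖ ^ 2 * w.val α ^ (2 * s)
          ≤ 2 * (‖x α‖ ^ 2 + ‖y α‖ ^ 2) * w.val α ^ (2 * s) :=
            mul_le_mul_of_nonneg_right h2 h1
        _ = _ := by ring
  smul_mem' := by
    intro c x hx
    refine (Summable.mul_left (‖c‖ ^ 2) hx).congr (fun α => ?_)
    simp only [Pi.smul_apply, smul_eq_mul, norm_mul]
    ring

/-- The weighted space, as a type of its own: its topology is that of the norm
`‖ζ‖_s = (∑ |ζ_α|² w_α^{2s})^{1/2}`. -/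
def WSeq {ι : Type} (w : Weight ι) (s : ℝ) : Type := weightedSubmodule w s

namespace WSeq

variable {ι : Type} {w : Weight ι} {s : ℝ}

instance : AddCommGroup (WSeq w s) := inferInstanceAs (AddCommGroup (weightedSubmodule w s))

instance : Module ℂ (WSeq w s) := inferInstanceAs (Module ℂ (weightedSubmodule w s))

/-- The coordinates of a sequence. -/
instance : CoeFun (WSeq w s) (fun _ => ι → ℂ) := ⟨fun x => x.1⟩

theorem summable (x : WSeq w s) : Summable fun α => ‖x α‖ ^ 2 * w.val α ^ (2 * s) := x.2

theorem sq_weight (α : ι) (z : ℂ) :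
    ‖((w.val α ^ s : ℝ) : ℂ) * z‖ ^ 2 = ‖z‖ ^ 2 * w.val α ^ (2 * s) := by
  have h := Real.rpow_nonneg (w.pos α).le s
  rw [norm_mul, Complex.norm_real, Real.norm_of_nonneg h, mul_pow, mul_comm 2 s,
    Real.rpow_mul (w.pos α).le, Real.rpow_two]
  ring

/-- Multiplication by `w^s`, into the unweighted `ℓ²`. -/
def toLp : WSeq w s →ₗ[ℂ] lp (fun _ : ι => ℂ) 2 where
  toFun x := ⟨fun α => ((w.val α ^ s : ℝ) : ℂ) * x α, by
    refine memℓp_gen (x.summable.congr fun α => ?_)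
    have := sq_weight (w := w) (s := s) α (x α)
    simp only [ENNReal.toReal_ofNat, Real.rpow_two]
    exact this.symm⟩
  map_add' x y := by
    ext α
    exact mul_add _ _ _
  map_smul' c x := by
    ext α
    exact mul_left_comm _ _ _

theorem toLp_injective : Function.Injective (toLp : WSeq w s →ₗ[ℂ] _) := by
  intro x y h
  apply Subtype.ext
  funext α
  have h1 : ((w.val α ^ s : ℝ) : ℂ) * x α = ((w.val α ^ s : ℝ) : ℂ) * y α :=
    congrFun (congrArg Subtype.val h) α
  have h2 : ((w.val α ^ s : ℝ) : ℂ) ≠ 0 := by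
    exact_mod_cast (Real.rpow_pos_of_pos (w.pos α) s).ne'
  exact mul_left_cancel₀ h2 h1

instance : NormedAddCommGroup (WSeq w s) :=
  NormedAddCommGroup.induced (WSeq w s) (lp (fun _ : ι => ℂ) 2) toLp toLp_injective

instance : NormedSpace ℂ (WSeq w s) :=
  NormedSpace.induced ℂ (WSeq w s) (lp (fun _ : ι => ℂ) 2) toLp

theorem norm_sq_eq (x : WSeq w s) : ‖x‖ ^ 2 = ∑' α, ‖x α‖ ^ 2 * w.val α ^ (2 * s) := by
  have h : ‖x‖ = ‖(toLp x : lp (fun _ : ι => ℂ) 2)‖ := rfl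
  have h2 := lp.norm_rpow_eq_tsum (p := 2) (by norm_num) (toLp x : lp (fun _ : ι => ℂ) 2)
  simp only [ENNReal.toReal_ofNat, Real.rpow_two] at h2
  rw [h, h2]
  exact tsum_congr fun α => sq_weight α (x α)

open Classical in
/-- The sequence `u` as an element of the weighted space (`0` if it does not lie there). -/
def ofFun (w : Weight ι) (s : ℝ) (u : ι → ℂ) : WSeq w s :=
  if h : u ∈ weightedSubmodule w s then ⟨u, h⟩ else 0

open Classical in
theorem single_mem (α : ι) : (Pi.single α (1 : ℂ) : ι → ℂ) ∈ weightedSubmodule w s := by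
  refine summable_of_ne_finset_zero (s := {α}) fun β hβ => ?_
  have : β ≠ α := by simpa using hβ
  simp [this]

open Classical in
/-- The basis vector `e_α`. -/
def single (α : ι) : WSeq w s := ⟨Pi.single α 1, single_mem α⟩

/-- Multiplication of a sequence by a bounded sequence. -/
def mulBdd (m : ι → ℂ) (hm : ∃ B : ℝ, ∀ α, ‖m α‖ ≤ B) (x : WSeq w s) : WSeq w s :=
  ⟨fun α => m α * x α, by
    obtain ⟨B, hB⟩ := hm
    refine Summable.of_nonneg_of_le (fun α => ?_) (fun α => ?_) (x.summable.mul_left (B ^ 2))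
    · have := Real.rpow_nonneg (w.pos α).le (2 * s)
      positivity
    · have h1 := Real.rpow_nonneg (w.pos α).le (2 * s)
      rw [norm_mul, mul_pow, mul_assoc]
      refine mul_le_mul_of_nonneg_right (pow_le_pow_left₀ (norm_nonneg _) (hB α) 2) ?_
      positivity⟩

end WSeq

/-! Modes and phase spaces. -/

/-- The Fourier modes: `(j, true)` is the mode `j₊` (the variable `a_j`) and `(j, false)` is
the mode `j₋` (the variable `b_j`). -/
abbrev Mode := ℤ × Bool

/-- The external modes: all modes except the two internal ones, `p₊` and `q₋`. -/
abbrev Ext (p q : ℤ) := {α : Mode // α ≠ (p, true) ∧ α ≠ (q, false)}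

/-- The elliptic external modes `j±`, `j ≠ p, q`. The other external modes, `p₋` and `q₊`,
are the hyperbolic ones. -/
abbrev Ell (p q : ℤ) := {α : Mode // α.1 ≠ p ∧ α.1 ≠ q}

def Ell.toExt {p q : ℤ} (α : Ell p q) : Ext p q :=
  ⟨α.1, fun h => α.2.1 (by rw [h]), fun h => α.2.2 (by rw [h])⟩

/-- `(1 + j²)^{1/2}` on all modes. -/
def fullWeight : Weight Mode where
  val α := Real.sqrt (1 + (α.1 : ℝ) ^ 2)
  pos α := Real.sqrt_pos.2 (by positivity)

/-- `max (1, |j|)` on the elliptic modes. -/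
def ellWeight (p q : ℤ) : Weight (Ell p q) where
  val α := max 1 |((α.1.1 : ℤ) : ℝ)|
  pos _ := lt_max_of_lt_left one_pos

/-- `max (1, |j|)` on the elliptic modes and `1` on the hyperbolic modes. -/
def extWeight (p q : ℤ) : Weight (Ext p q) where
  val α := if α.1.1 ≠ p ∧ α.1.1 ≠ q then max 1 |((α.1.1 : ℤ) : ℝ)| else 1
  pos α := by
    split_ifs
    · exact lt_max_of_lt_left one_pos
    · exact one_pos

/-- The phase space of all modes, with points `(u, ū)` where `u = (a, b)` and where `ū = (ā, b̄)`
is an independent variable. -/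
abbrev PSpace (s : ℝ) := WSeq fullWeight s × WSeq fullWeight s

/-- External modes. -/
abbrev ZSpace (p q : ℤ) (s : ℝ) := WSeq (extWeight p q) s

/-- Elliptic external modes. -/
abbrev YSpace (p q : ℤ) (s : ℝ) := WSeq (ellWeight p q) s

/-- Points `(r, θ, (ζ, ζ̄))`, with `r, θ ∈ ℂ²` and with `ζ̄` independent of `ζ`. The angles are
taken in the universal cover of `ℂ² / 2πℤ²`. -/
abbrev Coord (p q : ℤ) (s : ℝ) :=
  (Fin 2 → ℂ) × (Fin 2 → ℂ) × (ZSpace p q s × ZSpace p q s)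

/-- Real points of the phase space of all modes. -/
def IsRealPoint {s : ℝ} (w : PSpace s) : Prop := ∀ α, w.2 α = conj (w.1 α)

/-- Real points in the coordinates `(r, θ, z)`. -/
def IsRealCoord {p q : ℤ} {s : ℝ} (x : Coord p q s) : Prop :=
  (∀ i, (x.1 i).im = 0) ∧ (∀ i, (x.2.1 i).im = 0) ∧ ∀ α, x.2.2.2 α = conj (x.2.2.1 α)

/-- The domain `𝒪^s(σ, μ)` (its preimage in the universal cover). -/
def domO (p q : ℤ) (s σ μ : ℝ) : Set (Coord p q s) :=
  {x | ‖x.1‖ < μ ^ 2 ∧ (∀ i, |(x.2.1 i).im| < σ) ∧ ‖x.2.2‖ < μ}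

/-- The toroidal neighbourhood `𝐓_ρ(ν, σ, μ, s)` (its preimage in the universal cover). -/
def domT (p q : ℤ) (ρ : Fin 2 → ℝ) (ν σ μ s : ℝ) : Set (Coord p q s) :=
  {x | ‖x.1 - (fun i => ((ν * ρ i : ℝ) : ℂ))‖ < ν * μ ^ 2 ∧ (∀ i, |(x.2.1 i).im| < σ) ∧
    ‖x.2.2‖ < Real.sqrt ν * μ}

/-- The set of parameters `𝒟 = [1, 2]²`. -/
def paramD : Set (Fin 2 → ℝ) := Set.Icc 1 2

/-- Translation of the angles by `2πk`. -/
def shiftAngle {p q : ℤ} {s : ℝ} (k : Fin 2 → ℤ) (x : Coord p q s) : Coord p q s :=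
  (x.1, fun i => x.2.1 i + 2 * Real.pi * (k i : ℂ), x.2.2)

/-- The symplectic form `-dr ∧ dθ - i dζ ∧ dζ̄`. -/
def omegaCoord {p q : ℤ} {s : ℝ} (u v : Coord p q s) : ℂ :=
  -(∑ i, (u.1 i * v.2.1 i - u.2.1 i * v.1 i)) -
    Complex.I * ∑' α, (u.2.2.1 α * v.2.2.2 α - u.2.2.2 α * v.2.2.1 α)

/-- The symplectic form `-i ∑ da ∧ dā - i ∑ db ∧ db̄`. -/
def omegaP {s : ℝ} (u v : PSpace s) : ℂ :=
  -Complex.I * ∑' α, (u.1 α * v.2 α - u.2 α * v.1 α)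

/-! The Hamiltonian. -/

def P2 {s : ℝ} (w : PSpace s) : ℂ := ∑' α : Mode, (α.1 : ℂ) ^ 2 * (w.1 α * w.2 α)

/-- Sum over `(i, j, k)`, with `l = i + j - k`, of `a_k b_l ā_i b̄_j`. -/
def P4 {s : ℝ} (w : PSpace s) : ℂ :=
  ∑' t : ℤ × ℤ × ℤ, w.1 (t.2.2, true) * w.1 (t.1 + t.2.1 - t.2.2, false) *
    w.2 (t.1, true) * w.2 (t.2.1, false)

/-- The resonant part of `P4`: the terms with `k² + l² = i² + j²`. -/
def Z4 {s : ℝ} (w : PSpace s) : ℂ :=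
  ∑' t : ℤ × ℤ × ℤ,
    if t.2.2 ^ 2 + (t.1 + t.2.1 - t.2.2) ^ 2 = t.1 ^ 2 + t.2.1 ^ 2 then
      w.1 (t.2.2, true) * w.1 (t.1 + t.2.1 - t.2.2, false) *
        w.2 (t.1, true) * w.2 (t.2.1, false)
    else 0

/-- `∫_𝕋 g(u, ū, v, v̄) dx`, where the circle has total mass one. -/
def R5 {s : ℝ} (g : (Fin 4 → ℂ) → ℂ) (w : PSpace s) : ℂ :=
  ((2 * Real.pi : ℝ) : ℂ)⁻¹ * ∫ x in (0 : ℝ)..(2 * Real.pi),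
    g ![∑' j : ℤ, w.1 (j, true) * Complex.exp (Complex.I * j * x),
        ∑' j : ℤ, w.2 (j, true) * Complex.exp (-(Complex.I * j * x)),
        ∑' j : ℤ, w.1 (j, false) * Complex.exp (Complex.I * j * x),
        ∑' j : ℤ, w.2 (j, false) * Complex.exp (-(Complex.I * j * x))]

/-- The Hamiltonian `H = P₂ + P₄ + R₅`. -/
def hamH {s : ℝ} (g : (Fin 4 → ℂ) → ℂ) (w : PSpace s) : ℂ := P2 w + P4 w + R5 g w

/-- The points at which the series `P₂` converges absolutely with all its majorants; this is no
restriction for `s ≥ 1`. -/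
def FiniteEnergy {s : ℝ} (w : PSpace s) : Prop :=
  Summable fun α : Mode => (α.1 : ℝ) ^ 2 * (‖w.1 α‖ ^ 2 + ‖w.2 α‖ ^ 2)

def FiniteEnergyCoord {p q : ℤ} {s : ℝ} (x : Coord p q s) : Prop :=
  Summable fun α : Ext p q => (α.1.1 : ℝ) ^ 2 * (‖x.2.2.1 α‖ ^ 2 + ‖x.2.2.2 α‖ ^ 2)

def mass {s : ℝ} (w : PSpace s) : ℂ := ∑' α : Mode, w.1 α * w.2 α

def momentum {s : ℝ} (w : PSpace s) : ℂ := ∑' α : Mode, (α.1 : ℂ) * (w.1 α * w.2 α)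

/-- Admissible nonlinearities `g(u, ū, v, v̄)`: analytic near the origin of `ℂ⁴`, real, of order
at least five, and a function of `|u|², |v|², u v̄, v ū`. -/
structure Admissible (g : (Fin 4 → ℂ) → ℂ) : Prop where
  analytic : AnalyticAt ℂ g 0
  real : ∀ᶠ z : ℂ × ℂ in 𝓝 0, (g ![z.1, conj z.1, z.2, conj z.2]).im = 0
  order : g =O[𝓝 0] fun z => ‖z‖ ^ 5
  gauge : ∃ F : ℂ × ℂ × ℂ × ℂ → ℂ, ∀ᶠ z : ℂ × ℂ in 𝓝 0,
    g ![z.1, conj z.1, z.2, conj z.2] =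
      F (z.1 * conj z.1, z.2 * conj z.2, z.1 * conj z.2, z.2 * conj z.1)

/-! The three changes of variables. -/

/-- A Birkhoff change of variables of order four for `P₂ + P₄`, on the ball of radius `ε`. -/
structure IsBirkhoff (s ε C : ℝ) (τ : PSpace s → PSpace s) : Prop where
  mapsTo : MapsTo τ (Metric.ball 0 ε) (Metric.ball 0 (2 * ε))
  holo : DifferentiableOn ℂ τ (Metric.ball 0 ε)
  injOn : InjOn τ (Metric.ball 0 ε)
  invertible : ∀ w ∈ Metric.ball (0 : PSpace s) ε, (fderiv ℂ τ w).IsInvertible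
  real : ∀ w ∈ Metric.ball (0 : PSpace s) ε, IsRealPoint w → IsRealPoint (τ w)
  symplectic : ∀ w ∈ Metric.ball (0 : PSpace s) ε, ∀ u v,
    omegaP (fderiv ℂ τ w u) (fderiv ℂ τ w v) = omegaP u v
  near_id : ∀ w ∈ Metric.ball (0 : PSpace s) ε, ‖τ w - w‖ ≤ C * ‖w‖ ^ 3
  mass_eq : ∀ w ∈ Metric.ball (0 : PSpace s) ε, mass (τ w) = mass w
  momentum_eq : ∀ w ∈ Metric.ball (0 : PSpace s) ε, momentum (τ w) = momentum w
  normalForm : ∃ (R6 : PSpace s → ℂ) (G : PSpace s → PSpace s),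
    DifferentiableOn ℂ R6 (Metric.ball 0 ε) ∧ DifferentiableOn ℂ G (Metric.ball 0 ε) ∧
    R6 0 = 0 ∧
    (∀ w ∈ Metric.ball (0 : PSpace s) ε,
      (∀ α, (G w).1 α = fderiv ℂ R6 w (WSeq.single α, 0)) ∧
      (∀ α, (G w).2 α = fderiv ℂ R6 w (0, WSeq.single α)) ∧
      ‖G w‖ ≤ C * ‖w‖ ^ 5) ∧
    ∀ w ∈ Metric.ball (0 : PSpace s) ε, FiniteEnergy w →
      FiniteEnergy (τ w) ∧ P2 (τ w) + P4 (τ w) = P2 w + Z4 w + R6 w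

/-- The rescaling `(r, θ, z) ↦ (νr, θ, ν^{1/2} z)`. -/
def rescale {p q : ℤ} {s : ℝ} (ν : ℝ) (x : Coord p q s) : Coord p q s :=
  ((ν : ℂ) • x.1, x.2.1, (Real.sqrt ν : ℂ) • x.2.2)

/-- `e^{i c θ₂}` on the mode `q₊`, `e^{i c θ₁}` on the mode `p₋`, and `1` on the elliptic modes. -/
def phase {p q : ℤ} (c : ℂ) (θ : Fin 2 → ℂ) (α : Ext p q) : ℂ :=
  if α.1 = (q, true) then Complex.exp (Complex.I * c * θ 1)
  else if α.1 = (p, false) then Complex.exp (Complex.I * c * θ 0)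
  else 1

theorem phase_bdd {p q : ℤ} (c : ℂ) (θ : Fin 2 → ℂ) :
    ∃ B : ℝ, ∀ α : Ext p q, ‖phase c θ α‖ ≤ B := by
  refine ⟨‖Complex.exp (Complex.I * c * θ 1)‖ + ‖Complex.exp (Complex.I * c * θ 0)‖ + 1,
    fun α => ?_⟩
  have h1 := norm_nonneg (Complex.exp (Complex.I * c * θ 1))
  have h2 := norm_nonneg (Complex.exp (Complex.I * c * θ 0))
  unfold phase
  split_ifs
  · linarith
  · linarith
  · rw [norm_one]; linarith

open Classical in
/-- The coordinate of `ζ` on the mode `α` (zero if `α` is internal). -/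
def extCoord {p q : ℤ} {s : ℝ} (ζ : ZSpace p q s) (α : Mode) : ℂ :=
  if h : α ≠ (p, true) ∧ α ≠ (q, false) then ζ ⟨α, h⟩ else 0

/-- The angle elimination `(y, θ, (c, d)) ↦ (x, θ, (a, b))` with
`a_q = c_q e^{iθ₂}`, `b_p = d_p e^{iθ₁}`, `x₁ = y₁ - |d_p|²`, `x₂ = y₂ - |c_q|²`. -/
def angleElim {p q : ℤ} {s : ℝ} (x : Coord p q s) : Coord p q s :=
  (![x.1 0 - extCoord x.2.2.1 (p, false) * extCoord x.2.2.2 (p, false),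
     x.1 1 - extCoord x.2.2.1 (q, true) * extCoord x.2.2.2 (q, true)],
   x.2.1,
   (WSeq.mulBdd (phase 1 x.2.1) (phase_bdd 1 x.2.1) x.2.2.1,
    WSeq.mulBdd (phase (-1) x.2.1) (phase_bdd (-1) x.2.1) x.2.2.2))

/-- The translation of the actions `I = νρ + x`. -/
def shiftAction {p q : ℤ} {s : ℝ} (ν : ℝ) (ρ : Fin 2 → ℝ) (x : Coord p q s) : Coord p q s :=
  ((fun i => ((ν * ρ i : ℝ) : ℂ)) + x.1, x.2)

open Classical in
/-- The sequence over all modes with the values `c₁` at `p₊`, `c₂` at `q₋`, and `ζ` elsewhere. -/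
def fullSeq {p q : ℤ} (c₁ c₂ : ℂ) (ζ : Ext p q → ℂ) (α : Mode) : ℂ :=
  if h : α ≠ (p, true) ∧ α ≠ (q, false) then ζ ⟨α, h⟩
  else if α = (p, true) then c₁ else c₂

theorem weight_compare (s x : ℝ) :
    Real.sqrt (1 + x ^ 2) ^ (2 * s) ≤ (2 : ℝ) ^ |s| * max 1 |x| ^ (2 * s) := by
  have hm : (1 : ℝ) ≤ max 1 |x| := le_max_left _ _
  have hx : |x| ≤ max 1 |x| := le_max_right _ _
  have hx2 : x ^ 2 ≤ max 1 |x| ^ 2 := by rw [← sq_abs]; gcongr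
  have e1 : Real.sqrt (1 + x ^ 2) ^ (2 * s) = (1 + x ^ 2) ^ s := by
    rw [Real.rpow_mul (Real.sqrt_nonneg _), Real.rpow_two, Real.sq_sqrt (by positivity)]
  have e2 : max 1 |x| ^ (2 * s) = (max 1 |x| ^ 2) ^ s := by
    rw [Real.rpow_mul (by positivity), Real.rpow_two]
  rw [e1, e2]
  rcases le_total 0 s with hs | hs
  · rw [abs_of_nonneg hs, ← Real.mul_rpow (by norm_num) (by positivity)]
    refine Real.rpow_le_rpow (by positivity) ?_ hs
    nlinarith
  · have h1 : (1 + x ^ 2) ^ s ≤ (max 1 |x| ^ 2) ^ s := by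
      refine Real.rpow_le_rpow_of_nonpos (by positivity) ?_ hs
      rcases max_cases 1 |x| with ⟨h, _⟩ | ⟨h, _⟩
      · rw [h]; nlinarith [sq_nonneg x]
      · rw [h, sq_abs]; linarith
    have h2 : (1 : ℝ) ≤ 2 ^ |s| := Real.one_le_rpow (by norm_num) (abs_nonneg s)
    have h3 : 0 ≤ (max 1 |x| ^ 2) ^ s := by positivity
    nlinarith

theorem fullSeq_mem {p q : ℤ} {s : ℝ} (c₁ c₂ : ℂ) (ζ : ZSpace p q s) :
    fullSeq c₁ c₂ ζ ∈ weightedSubmodule fullWeight s := by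
  classical
  set S : Finset Mode := {(p, true), (q, false), (q, true), (p, false)} with hS
  have hinj : Function.Injective (Subtype.val : Ext p q → Mode) := Subtype.val_injective
  have hsum := (ζ.summable.mul_left ((2 : ℝ) ^ |s|))
  have hz : Summable (Function.extend (Subtype.val : Ext p q → Mode)
      (fun α => (2 : ℝ) ^ |s| * (‖ζ α‖ ^ 2 * (extWeight p q).val α ^ (2 * s))) 0) :=
    (hinj.summable_iff (f := Function.extend (Subtype.val : Ext p q → Mode) _ 0) (by
      intro x hx
      rw [Function.extend_apply' _ _ _ (by simpa using hx)]
      rfl)).1 (by simpa [Function.extend_comp hinj] using hsum)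
  have hfin : Summable fun α : Mode => if α ∈ S then
      ‖fullSeq c₁ c₂ ζ α‖ ^ 2 * fullWeight.val α ^ (2 * s) else 0 :=
    summable_of_ne_finset_zero (s := S) fun β hβ => by simp [hβ]
  refine Summable.of_nonneg_of_le (fun α => ?_) (fun α => ?_) (hz.add hfin)
  · have := Real.rpow_nonneg (fullWeight.pos α).le (2 * s)
    positivity
  · have hpos : 0 ≤ Function.extend (Subtype.val : Ext p q → Mode)
        (fun α => (2 : ℝ) ^ |s| * (‖ζ α‖ ^ 2 * (extWeight p q).val α ^ (2 * s))) 0 α := by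
      by_cases h : ∃ a : Ext p q, a.1 = α
      · obtain ⟨a, rfl⟩ := h
        rw [hinj.extend_apply]
        have := Real.rpow_nonneg ((extWeight p q).pos a).le (2 * s)
        positivity
      · rw [Function.extend_apply' _ _ _ h]
        rfl
    by_cases hα : α ∈ S
    · simp only [hα, if_true]
      linarith
    · simp only [hα, if_false, add_zero]
      have hS' : α.1 ≠ p ∧ α.1 ≠ q := by
        obtain ⟨j, b⟩ := α
        constructor
        · rintro rfl
          cases b <;> simp [hS] at hα
        · rintro rfl
          cases b <;> simp [hS] at hα
      have hE : α ≠ (p, true) ∧ α ≠ (q, false) :=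
        ⟨fun h => hS'.1 (by rw [h]), fun h => hS'.2 (by rw [h])⟩
      have e1 := hinj.extend_apply
        (fun α => (2 : ℝ) ^ |s| * (‖ζ α‖ ^ 2 * (extWeight p q).val α ^ (2 * s))) 0 ⟨α, hE⟩
      change Function.extend _ _ _ α = _ at e1
      rw [e1]
      have e2 : fullSeq c₁ c₂ ζ α = ζ ⟨α, hE⟩ := by
        unfold fullSeq
        rw [dif_pos hE]
      have e3 : (extWeight p q).val ⟨α, hE⟩ = max 1 |((α.1 : ℤ) : ℝ)| := if_pos hS'
      rw [e2, e3]
      have h4 := weight_compare s (α.1 : ℝ)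
      have h5 : fullWeight.val α = Real.sqrt (1 + (α.1 : ℝ) ^ 2) := rfl
      rw [h5]
      have h6 : 0 ≤ ‖ζ ⟨α, hE⟩‖ ^ 2 := by positivity
      nlinarith [mul_le_mul_of_nonneg_left h4 h6]

/-- From `(I, θ, z)` to all modes: `a_p = √I₁ e^{iθ₁}`, `ā_p = √I₁ e^{-iθ₁}`,
`b_q = √I₂ e^{iθ₂}`, `b̄_q = √I₂ e^{-iθ₂}`, the other modes being those of `z`. -/
def toModes {p q : ℤ} {s : ℝ} (x : Coord p q s) : PSpace s :=
  (⟨fullSeq (x.1 0 ^ (1 / 2 : ℂ) * Complex.exp (Complex.I * x.2.1 0))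
      (x.1 1 ^ (1 / 2 : ℂ) * Complex.exp (Complex.I * x.2.1 1)) x.2.2.1, fullSeq_mem _ _ _⟩,
   ⟨fullSeq (x.1 0 ^ (1 / 2 : ℂ) * Complex.exp (-(Complex.I * x.2.1 0)))
      (x.1 1 ^ (1 / 2 : ℂ) * Complex.exp (-(Complex.I * x.2.1 1))) x.2.2.2, fullSeq_mem _ _ _⟩)

/-! The classes of Hamiltonian functions. -/

section classes

variable {p q : ℤ} {s : ℝ}

/-- The direction of `ζ_α`. -/
def eZeta (α : Ext p q) : Coord p q s := (0, 0, (WSeq.single α, 0))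

/-- The direction of `ζ̄_α`. -/
def eZetaBar (α : Ext p q) : Coord p q s := (0, 0, (0, WSeq.single α))

/-- `∂f/∂ζ_α`. -/
def dZeta (f : Coord p q s → ℂ) (x : Coord p q s) (α : Ext p q) : ℂ := fderiv ℂ f x (eZeta α)

/-- `∂f/∂ζ̄_α`. -/
def dZetaBar (f : Coord p q s → ℂ) (x : Coord p q s) (α : Ext p q) : ℂ :=
  fderiv ℂ f x (eZetaBar α)

/-- The gradient lies in `Z_s × Z_s`. -/
def HasGradZ (f : Coord p q s → ℂ) (x : Coord p q s) : Prop :=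
  dZeta f x ∈ weightedSubmodule (extWeight p q) s ∧
    dZetaBar f x ∈ weightedSubmodule (extWeight p q) s

/-- The gradient `∇_z f = (∂f/∂ζ, ∂f/∂ζ̄)`. -/
def gradZ (f : Coord p q s → ℂ) (x : Coord p q s) : ZSpace p q s × ZSpace p q s :=
  (WSeq.ofFun _ _ (dZeta f x), WSeq.ofFun _ _ (dZetaBar f x))

/-- The entries `∂²f/∂ζ_α ∂ζ̄_β` of the matrix `∇²_{ζ_ℒ ζ̄_ℒ} f`. -/
def hessEntry (f : Coord p q s → ℂ) (x : Coord p q s) (α β : Ell p q) : ℂ :=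
  fderiv ℂ (fun y => dZetaBar f y β.toExt) x (eZeta α.toExt)

/-- The operator `T` on `Y_s` is given by the infinite matrix `A`. -/
def IsMatrixOp (A : Ell p q → Ell p q → ℂ) (T : YSpace p q s →L[ℂ] YSpace p q s) : Prop :=
  ∀ (y : YSpace p q s) (α : Ell p q), HasSum (fun β => A α β * y β) (T y α)

/-- The matrix `∇²_{ζ_ℒ ζ̄_ℒ} f(x)` defines a bounded operator on `Y_s`. -/
def HasHess (f : Coord p q s → ℂ) (x : Coord p q s) : Prop :=
  ∃ T : YSpace p q s →L[ℂ] YSpace p q s, IsMatrixOp (hessEntry f x) T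

open Classical in
/-- `∇²_{ζ_ℒ ζ̄_ℒ} f(x)` as an operator on `Y_s`. -/
def hess (f : Coord p q s → ℂ) (x : Coord p q s) : YSpace p q s →L[ℂ] YSpace p q s :=
  if h : HasHess f x then h.choose else 0

/-- The class `𝒯^s(σ, μ, 𝒟)`. The derivatives with respect to the parameter `ρ` in the square
`𝒟` are taken within the square. -/
structure MemT (σ μ : ℝ) (f : (Fin 2 → ℝ) → Coord p q s → ℂ) : Prop where
  periodic : ∀ ρ ∈ paramD, ∀ x ∈ domO p q s σ μ, ∀ k, f ρ (shiftAngle k x) = f ρ x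
  contDiff : ContDiffOn ℝ 1 (fun y : (Fin 2 → ℝ) × Coord p q s => f y.1 y.2)
    (paramD ×ˢ domO p q s σ μ)
  holo : ∀ ρ ∈ paramD, DifferentiableOn ℂ (f ρ) (domO p q s σ μ)
  real : ∀ ρ ∈ paramD, ∀ x ∈ domO p q s σ μ, IsRealCoord x → (f ρ x).im = 0
  grad_mem : ∀ ρ ∈ paramD, ∀ x ∈ domO p q s σ μ, HasGradZ (f ρ) x
  grad_holo : ∀ ρ ∈ paramD, DifferentiableOn ℂ (gradZ (f ρ)) (domO p q s σ μ)
  grad_contDiff : ∀ x ∈ domO p q s σ μ, ContDiffOn ℝ 1 (fun ρ => gradZ (f ρ) x) paramD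
  hess_mem : ∀ ρ ∈ paramD, ∀ x ∈ domO p q s σ μ, HasHess (f ρ) x
  hess_holo : ∀ ρ ∈ paramD, DifferentiableOn ℂ (hess (f ρ)) (domO p q s σ μ)
  hess_contDiff : ∀ x ∈ domO p q s σ μ, ContDiffOn ℝ 1 (fun ρ => hess (f ρ) x) paramD

/-- The norm `[f]^s_{σ,μ,𝒟}` of a function of the class `𝒯^s(σ, μ, 𝒟)`. -/
def normT (σ μ : ℝ) (f : (Fin 2 → ℝ) → Coord p q s → ℂ) : ℝ≥0∞ :=
  ⨆ ρ ∈ paramD, ⨆ x ∈ domO p q s σ μ,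
    max
      (max ‖f ρ x‖ₑ ‖fderivWithin ℝ (fun ρ' => f ρ' x) paramD ρ‖ₑ)
      (max
        (ENNReal.ofReal μ *
          max ‖gradZ (f ρ) x‖ₑ ‖fderivWithin ℝ (fun ρ' => gradZ (f ρ') x) paramD ρ‖ₑ)
        (ENNReal.ofReal (μ ^ 2) *
          max ‖hess (f ρ) x‖ₑ ‖fderivWithin ℝ (fun ρ' => hess (f ρ') x) paramD ρ‖ₑ))

/-- The jet `f^T`: the Taylor polynomial
`f(0,θ,0) + d_r f(0,θ,0)[r] + d_z f(0,θ,0)[z] + ½ d²_z f(0,θ,0)[z,z]`. -/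
def jet (f : Coord p q s → ℂ) (x : Coord p q s) : ℂ :=
  f (0, x.2.1, 0) + fderiv ℂ f (0, x.2.1, 0) (x.1, 0, 0) +
    fderiv ℂ f (0, x.2.1, 0) (0, 0, x.2.2) +
    (1 / 2 : ℂ) * fderiv ℂ (fun y => fderiv ℂ f y (0, 0, x.2.2)) (0, x.2.1, 0) (0, 0, x.2.2)

/-- Up to the factor `(2π)⁻²`, the coefficient of the monomial `e^{ik·θ} ζ_α ζ̄_β` in the
jet of `f`: a Fourier coefficient of `∂²f/∂ζ_α ∂ζ̄_β (0, θ, 0)`. -/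
def jetCoeff (f : Coord p q s → ℂ) (k : Fin 2 → ℤ) (α β : Ell p q) : ℂ :=
  ∫ θ in Set.Icc (0 : Fin 2 → ℝ) (fun _ => 2 * Real.pi),
    Complex.exp (-(Complex.I * ∑ i, (k i : ℂ) * (θ i : ℂ))) *
      hessEntry f (0, (fun i => (θ i : ℂ)), 0) α β

/-- The restricted class `𝒯^s_res(σ, μ, 𝒟)`. Two elliptic modes `j±` and `l±` are in the same
cluster if and only if `|j| = |l|`. -/
structure MemTRes (σ μ : ℝ) (f : (Fin 2 → ℝ) → Coord p q s → ℂ) : Prop where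
  memT : MemT σ μ f
  restricted : ∃ M : ℝ, ∀ ρ ∈ paramD, ∀ k : Fin 2 → ℤ, k ≠ 0 → ∀ α β : Ell p q,
    |α.1.1| = |β.1.1| → jetCoeff (f ρ) k α β ≠ 0 →
      α = β ∨ (ellWeight p q).val α ≤ M * ‖k‖

/-! The effective Hamiltonian. -/

/-- The frequencies `Ω(ρ) = (p² + νρ₂, q² + νρ₁)`. -/
def Omega (p q : ℤ) (ν : ℝ) (ρ : Fin 2 → ℝ) : Fin 2 → ℝ :=
  ![(p : ℝ) ^ 2 + ν * ρ 1, (q : ℝ) ^ 2 + ν * ρ 0]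

/-- The eigenvalues `Λ^a_j(ρ) = j² + νρ₂` and `Λ^b_j(ρ) = j² + νρ₁`. -/
def Lam (ν : ℝ) (ρ : Fin 2 → ℝ) (α : Mode) : ℝ :=
  if α.2 then (α.1 : ℝ) ^ 2 + ν * ρ 1 else (α.1 : ℝ) ^ 2 + ν * ρ 0

/-- The hyperbolic block. -/
def hypK (ν : ℝ) (ρ : Fin 2 → ℝ) : Matrix (Fin 4) (Fin 4) ℝ :=
  ν • !![0, Real.sqrt (ρ 0 * ρ 1), ρ 0 - ρ 1, 0;
         Real.sqrt (ρ 0 * ρ 1), 0, 0, ρ 1 - ρ 0;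
         ρ 0 - ρ 1, 0, 0, Real.sqrt (ρ 0 * ρ 1);
         0, ρ 1 - ρ 0, Real.sqrt (ρ 0 * ρ 1), 0]

/-- The vector `z_f = (b_p, a_q, b̄_p, ā_q)` of the hyperbolic variables. -/
def zHyp (x : Coord p q s) : Fin 4 → ℂ :=
  ![extCoord x.2.2.1 (p, false), extCoord x.2.2.1 (q, true),
    extCoord x.2.2.2 (p, false), extCoord x.2.2.2 (q, true)]

/-- The effective Hamiltonian
`h₀ = Ω(ρ)·r + ∑_{j ≠ p,q} (Λ^a_j |a_j|² + Λ^b_j |b_j|²) + ½ ⟨z_f, K(ρ) z_f⟩`, where `⟨,⟩` is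
bilinear. -/
def h0 (ν : ℝ) (ρ : Fin 2 → ℝ) (x : Coord p q s) : ℂ :=
  ∑ i, (Omega p q ν ρ i : ℂ) * x.1 i +
    ∑' α : Ell p q, (Lam ν ρ α.1 : ℂ) * (x.2.2.1 α.toExt * x.2.2.2 α.toExt) +
    (1 / 2 : ℂ) * (zHyp x ⬝ᵥ ((hypK ν ρ).map (fun t : ℝ => (t : ℂ)) *ᵥ zHyp x))

/-- The constant `C = ν²ρ₁ρ₂ + νp²ρ₁ + νq²ρ₂`. -/
def constC (p q : ℤ) (ν : ℝ) (ρ : Fin 2 → ℝ) : ℝ :=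
  ν ^ 2 * (ρ 0 * ρ 1) + ν * (p : ℝ) ^ 2 * ρ 0 + ν * (q : ℝ) ^ 2 * ρ 1

end classes

/-- The domain `𝒪^s(1/2, e^{-1/2}/2)` of the change of variables. -/
def domPhi (p q : ℤ) (s : ℝ) : Set (Coord p q s) :=
  domO p q s (1 / 2) (Real.exp (-(1 / 2)) / 2)

/-- `Φ_ρ`, `ρ ∈ 𝒟`, is a family of changes of variables from `𝒪^s(1/2, e^{-1/2}/2)` into
`𝐓_ρ(ν, 1, 1, s)`, real holomorphic, analytic in `ρ`, and conformally symplectic with factor `ν`. -/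
structure IsSymplecticFamily {p q : ℤ} {s : ℝ} (ν : ℝ)
    (Φ : (Fin 2 → ℝ) → Coord p q s → Coord p q s) : Prop where
  mapsTo : ∀ ρ ∈ paramD, MapsTo (Φ ρ) (domPhi p q s) (domT p q ρ ν 1 1 s)
  equivariant : ∀ ρ ∈ paramD, ∀ x ∈ domPhi p q s, ∀ k,
    Φ ρ (shiftAngle k x) = shiftAngle k (Φ ρ x)
  holo : ∀ ρ ∈ paramD, DifferentiableOn ℂ (Φ ρ) (domPhi p q s)
  injOn : ∀ ρ ∈ paramD, InjOn (Φ ρ) (domPhi p q s)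
  invertible : ∀ ρ ∈ paramD, ∀ x ∈ domPhi p q s, (fderiv ℂ (Φ ρ) x).IsInvertible
  real : ∀ ρ ∈ paramD, ∀ x ∈ domPhi p q s, IsRealCoord x → IsRealCoord (Φ ρ x)
  analytic : AnalyticOnNhd ℝ (fun y : (Fin 2 → ℝ) × Coord p q s => Φ y.1 y.2)
    (paramD ×ˢ domPhi p q s)
  symplectic : ∀ ρ ∈ paramD, ∀ x ∈ domPhi p q s, ∀ u v,
    omegaCoord (fderiv ℂ (Φ ρ) x u) (fderiv ℂ (Φ ρ) x v) = ν * omegaCoord u v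

end

end CoupledNLS

open CoupledNLS

/-!
The proof has three steps: a Birkhoff normal form of order four in the phase space, the passage to
action-angle coordinates at the scale `√ν`, and the bounds for the remaining perturbation.

**Normal form.** Let `χ` be the quartic Hamiltonian with the multiplier `1 / (k² + l² - i² - j²)` on
the non-resonant monomials. It solves the homological equation `{P₂, χ} = Z₄ - P₄` up to sign, and
its vector field `X` is a bounded cubic map, because `ℓ²_s` is a convolution algebra for `s > 1/2`.
In place of the flow of `χ`, the transformation `τ` is one step of the implicit midpoint rule,
`τ(w) = 2m - w` with `m - X(m)/2 = w` (`exists_isMidpoint`). The derivative of `τ` is a Cayley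
transform, hence symplectic (`IsMidpoint.symplectic`). For a quadratic form `Q`, the difference
`Q(τ(w)) - Q(w)` is exactly the derivative of `Q` at `m` in the direction `X(m)`: so mass and
momentum are conserved (`modePair_midpoint`), and `P₂` changes by `Z₄(m) - P₄(m)` at points of
finite energy (`P2_midpoint`), which a tame estimate shows to be preserved
(`finiteEnergy_of_midpoint`). All that is left of `P₂ + P₄` is of order six. The term `R₅` is
analytic with an analytic gradient, since analytic functions act on the convolution algebra
(`exists_superposition`, `exists_isGrad_R5`). Hence `H ∘ τ = P₂ + Z₄ + W` with `W` of order five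
(`exists_isNormalForm`), and `W` inherits the invariance of `H` under gauge transformations and
translations of the circle.

**Coordinates.** The map `Ψ_ρ` is `√ν psi ρ` in terms of the modes. Since `τ` moves it by only
`O(ν^{3/2})`, the angles of its image can be continued from the old ones by logarithms near one
(`recoord`); this defines `Φ_ρ = PhiC`, and gives its properties (`isSymplecticFamily`).

**The effective Hamiltonian.** For `i + j = k + l` one has `k² + l² - i² - j² = 2(k - i)(k - j)`, so
that `Z₄` is explicit (`resFun_eq`). Its expansion at the torus of the actions `ρ` produces the
constant, the frequencies, and the quadratic form `K(ρ)`, whose coupling of the two hyperbolic modes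
is `cross` (`isBigO_resFun`). So `f = ν (resFun ∘ psi - cross) + ν⁻¹ W(√ν psi)`
(`hamiltonian_identity`). The first term is `O(ν)` and has a vanishing jet; the second one is
`O(ν^{3/2})`.

All functions of `ρ` extend holomorphically to a neighbourhood `paramC` of the square, so the class
`𝒯` and its norm are controlled by bounds for functions and gradients through Cauchy estimates
(`IsGood`, `IsGood.memT`, `IsGood.normT_le`), and jets inherit these bounds (`IsGood.jet`). In the
coordinates, the symmetries become translations of the angles combined with rotations of the
elliptic modes: a monomial `e^{ik·θ} ζ_α ζ̄_β` that occurs in the jet satisfies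
`j_α - j_β = k₂(p - q)`, which gives the restricted class with `M = |p - q|` (`IsGood.memTRes`).

Local notations: `Λ` for the phase space, `𝓩` for the external modes, `Ξ` for the coordinates, `Ω`
for the domain of `Φ_ρ`, `ι` for the internal and `η` for the hyperbolic modes, `½` for `1/2` in
`ℂ`.
-/

namespace CoupledNLS

open Complex (I exp log exp_add exp_zero)
open Metric (ball)
open ContinuousLinearMap (fst snd proj compL inr inl)

noncomputable section

section

/-- The sequences over all modes. -/
abbrev MSeq (s : ℝ) := WSeq fullWeight s

/-- The actions or the angles of the internal modes. -/
abbrev C2 := Fin 2 → ℂ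

/-- Indices `(i, j, k)` of quartic monomials. -/
abbrev Quad := ℤ × ℤ × ℤ

/-! ### Weighted sequence spaces -/

namespace WSeq

variable {ι κ : Type} {w : Weight ι} {w' : Weight κ} {s : ℝ}

@[ext] theorem ext {x y : WSeq w s} (h : ∀ α, x α = y α) : x = y := Subtype.ext (funext h)

@[simp] theorem add_apply (x y : WSeq w s) (α : ι) : (x + y) α = x α + y α := rfl
@[simp] theorem sub_apply (x y : WSeq w s) (α : ι) : (x - y) α = x α - y α := rfl
@[simp] theorem neg_apply (x : WSeq w s) (α : ι) : (-x) α = -x α := rfl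
@[simp] theorem zero_apply (α : ι) : (0 : WSeq w s) α = 0 := rfl
@[simp] theorem smul_apply (c : ℂ) (x : WSeq w s) (α : ι) : (c • x) α = c * x α := rfl

open Classical in
theorem single_apply (α β : ι) : (single α : WSeq w s) β = if β = α then 1 else 0 := by
  change (Pi.single α (1 : ℂ) : ι → ℂ) β = _
  rw [Pi.single_apply]

@[simp] theorem single_same (α : ι) : (single α : WSeq w s) α = 1 := by simp [single_apply]

theorem single_of_ne {α β : ι} (h : β ≠ α) : (single α : WSeq w s) β = 0 := by
  simp [single_apply, h]

/-- The square of the weighted norm of an arbitrary sequence, with values in `[0, ∞]`. -/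
def eSq (w : Weight ι) (s : ℝ) (u : ι → ℂ) : ℝ≥0∞ :=
  ∑' α, (ENNReal.ofReal (w.val α ^ s) * ‖u α‖ₑ) ^ 2

theorem eSq_term (u : ι → ℂ) (α : ι) : (ENNReal.ofReal (w.val α ^ s) * ‖u α‖ₑ) ^ 2 =
    ENNReal.ofReal (‖u α‖ ^ 2 * w.val α ^ (2 * s)) := by
  have h := Real.rpow_nonneg (w.pos α).le s
  rw [← ofReal_norm, ← ENNReal.ofReal_mul h, ← ENNReal.ofReal_pow (by positivity),
    mul_comm 2 s, Real.rpow_mul (w.pos α).le, Real.rpow_two]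
  ring_nf

theorem mem_iff_eSq {u : ι → ℂ} : u ∈ weightedSubmodule w s ↔ eSq w s u ≠ ⊤ := by
  have h : ∀ α, 0 ≤ ‖u α‖ ^ 2 * w.val α ^ (2 * s) := fun α => by
    have := Real.rpow_nonneg (w.pos α).le (2 * s)
    positivity
  constructor
  · intro hu
    unfold eSq
    simp_rw [eSq_term]
    exact (Summable.tsum_ofReal_ne_top (show Summable _ from hu))
  · intro hu
    unfold eSq at hu
    simp_rw [eSq_term] at hu
    have := ENNReal.summable_toReal hu
    exact this.congr fun α => (ENNReal.toReal_ofReal (h α))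

theorem eSq_coe (x : WSeq w s) : eSq w s x = ‖x‖ₑ ^ 2 := by
  have h : ∀ α, 0 ≤ ‖x α‖ ^ 2 * w.val α ^ (2 * s) := fun α => by
    have := Real.rpow_nonneg (w.pos α).le (2 * s)
    positivity
  unfold eSq
  simp_rw [eSq_term]
  rw [← ENNReal.ofReal_tsum_of_nonneg h x.summable, ← norm_sq_eq, ← ofReal_norm,
    ENNReal.ofReal_pow (norm_nonneg _)]

theorem mem_of_eSq_le {u : ι → ℂ} {R : ℝ} (h : eSq w s u ≤ ENNReal.ofReal R ^ 2) :
    u ∈ weightedSubmodule w s :=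
  mem_iff_eSq.2 (ne_top_of_le_ne_top (by finiteness) h)

theorem norm_le_of_eSq_le {x : WSeq w s} {R : ℝ} (hR : 0 ≤ R)
    (h : eSq w s x ≤ ENNReal.ofReal R ^ 2) : ‖x‖ ≤ R := by
  rw [eSq_coe] at h
  have h2 : ‖x‖ₑ ≤ ENNReal.ofReal R := (ENNReal.pow_le_pow_left_iff two_ne_zero).1 h
  rw [← ofReal_norm] at h2
  exact (ENNReal.ofReal_le_ofReal_iff hR).1 h2

theorem weight_mul_norm_le (x : WSeq w s) (α : ι) : w.val α ^ s * ‖x α‖ ≤ ‖x‖ := by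
  have h := Real.rpow_nonneg (w.pos α).le s
  have h1 : (ENNReal.ofReal (w.val α ^ s) * ‖x α‖ₑ) ^ 2 ≤ ‖x‖ₑ ^ 2 := by
    rw [← eSq_coe]
    exact ENNReal.le_tsum α
  have h2 := (ENNReal.pow_le_pow_left_iff two_ne_zero).1 h1
  rw [← ofReal_norm, ← ofReal_norm, ← ENNReal.ofReal_mul h] at h2
  exact (ENNReal.ofReal_le_ofReal_iff (norm_nonneg _)).1 h2

/-- The coordinate functionals. -/
def coord (w : Weight ι) (s : ℝ) (α : ι) : WSeq w s →L[ℂ] ℂ :=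
  LinearMap.mkContinuous
    { toFun := fun x => x α, map_add' := fun _ _ => rfl, map_smul' := fun _ _ => rfl }
    (w.val α ^ s)⁻¹ (fun x => by
      have h := Real.rpow_pos_of_pos (w.pos α) s
      have := weight_mul_norm_le x α
      rw [inv_mul_eq_div, le_div_iff₀ h, mul_comm]
      exact this)

@[simp] theorem coord_apply (α : ι) (x : WSeq w s) : coord w s α x = x α := rfl

theorem norm_apply_le (hs : 0 ≤ s) {α : ι} (hw : 1 ≤ w.val α) (x : WSeq w s) : ‖x α‖ ≤ ‖x‖ := by
  have h := weight_mul_norm_le x α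
  have h1 : 1 ≤ w.val α ^ s := Real.one_le_rpow hw hs
  nlinarith [norm_nonneg (x α)]

theorem toLp_surjective : Function.Surjective (toLp : WSeq w s →ₗ[ℂ] _) := by
  intro y
  have hw : ∀ α, ((w.val α ^ s : ℝ) : ℂ) ≠ 0 := fun α => by
    exact_mod_cast (Real.rpow_pos_of_pos (w.pos α) s).ne'
  have hy : Summable fun α => ‖y α‖ ^ (2 : ℝ) := by
    simpa using (lp.memℓp y).summable (by norm_num)
  refine ⟨⟨fun α => ((w.val α ^ s : ℝ) : ℂ)⁻¹ * y α, ?_⟩, ?_⟩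
  · refine hy.congr fun α => ?_
    rw [← sq_weight, mul_inv_cancel_left₀ (hw α), Real.rpow_two]
  · ext α
    exact mul_inv_cancel_left₀ (hw α) _

/-- The weighted space is isometric to `ℓ²`. -/
def toLpEquiv (w : Weight ι) (s : ℝ) : WSeq w s ≃ₗᵢ[ℂ] lp (fun _ : ι => ℂ) 2 where
  toLinearEquiv := LinearEquiv.ofBijective toLp ⟨toLp_injective, toLp_surjective⟩
  norm_map' _ := rfl

instance : CompleteSpace (WSeq w s) :=
  (toLpEquiv w s).toIsometryEquiv.completeSpace

theorem norm_single (α : ι) : ‖(single α : WSeq w s)‖ = w.val α ^ s := by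
  have h0 := Real.rpow_nonneg (w.pos α).le s
  have h : ‖(single α : WSeq w s)‖ ^ 2 = (w.val α ^ s) ^ 2 := by
    rw [norm_sq_eq, tsum_eq_single α (fun β hβ => by simp [single_of_ne hβ])]
    rw [mul_comm 2 s, Real.rpow_mul (w.pos α).le, Real.rpow_two]
    simp
  exact (pow_left_inj₀ (norm_nonneg _) h0 two_ne_zero).1 h

theorem hasSum_single (x : WSeq w s) : HasSum (fun α => x α • (single α : WSeq w s)) x := by
  classical
  have h := lp.hasSum_single (p := 2) (by norm_num) (toLpEquiv w s x)
  have h2 := ((toLpEquiv w s).symm.toContinuousLinearEquiv.hasSum').2 h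
  convert h2 using 1
  · funext α
    apply (toLpEquiv w s).injective
    ext β
    simp only [LinearIsometryEquiv.coe_toContinuousLinearEquiv,
      LinearIsometryEquiv.apply_symm_apply]
    change ((w.val β ^ s : ℝ) : ℂ) * (x α * (single α : WSeq w s) β) = _
    by_cases hβ : β = α
    · subst hβ
      simp only [lp.single_apply_self, single_same, mul_one]
      rfl
    · rw [lp.single_apply_ne _ _ _ hβ]
      simp [single_of_ne hβ]
  · simp

/-- Two continuous maps that agree on finitely supported sequences agree. -/
theorem eq_of_eq_on_finsupp {T : Type*} [TopologicalSpace T] [T2Space T]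
    {f g : WSeq w s × WSeq w s → T} (hf : Continuous f) (hg : Continuous g)
    (h : ∀ x : WSeq w s × WSeq w s, (∀ᶠ α in cofinite, x.1 α = 0 ∧ x.2 α = 0) → f x = g x)
    (x : WSeq w s × WSeq w s) : f x = g x := by
  classical
  have h1 : Tendsto (fun F : Finset ι => ∑ α ∈ F, x.1 α • (single α : WSeq w s)) atTop (𝓝 x.1) :=
    hasSum_single x.1
  have h2 : Tendsto (fun F : Finset ι => ∑ α ∈ F, x.2 α • (single α : WSeq w s)) atTop (𝓝 x.2) :=
    hasSum_single x.2
  have h3 := h1.prodMk_nhds h2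
  refine tendsto_nhds_unique ((hf.tendsto x).comp h3) (((hg.tendsto x).comp h3).congr ?_)
  intro F
  refine (h _ ?_).symm
  have key : ∀ (y : ι → ℂ) (β : ι), β ∉ F → (∑ α ∈ F, y α • (single α : WSeq w s)) β = 0 := by
    intro y β hβ
    have : (∑ α ∈ F, y α • (single α : WSeq w s)) β =
      coord w s β (∑ α ∈ F, y α • (single α : WSeq w s)) := rfl
    rw [this, map_sum]
    refine Finset.sum_eq_zero fun α hα => ?_
    have hne : β ≠ α := fun h => hβ (h ▸ hα)
    simp [single_of_ne hne]
  filter_upwards [F.finite_toSet.compl_mem_cofinite] with β hβ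
  exact ⟨key _ _ hβ, key _ _ hβ⟩

theorem ofFun_of_eq {u : ι → ℂ} {x : WSeq w s} (h : ∀ α, u α = x α) : ofFun w s u = x := by
  have hu : u = x.1 := funext h
  subst hu
  exact dif_pos x.2

theorem eSq_comp_le {φ : κ → ι} (hφ : Function.Injective φ) {C : ℝ} (hC0 : 0 ≤ C)
    (hC : ∀ k, w'.val k ^ s ≤ C * w.val (φ k) ^ s) (u : ι → ℂ) :
    eSq w' s (fun k => u (φ k)) ≤ ENNReal.ofReal C ^ 2 * eSq w s u := by
  unfold eSq
  rw [← ENNReal.tsum_mul_left]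
  refine le_trans (ENNReal.tsum_le_tsum fun k => ?_) (ENNReal.tsum_comp_le_tsum_of_injective hφ (fun
    α => ENNReal.ofReal C ^ 2 * (ENNReal.ofReal (w.val α ^ s) * ‖u α‖ₑ) ^ 2))
  rw [← mul_pow, ← mul_assoc, ← ENNReal.ofReal_mul hC0]
  gcongr
  exact hC k

theorem enorm_mul_eq {C : ℝ} (hC0 : 0 ≤ C) (x : WSeq w s) :
    ENNReal.ofReal C ^ 2 * eSq w s x = ENNReal.ofReal (C * ‖x‖) ^ 2 := by
  rw [eSq_coe, ENNReal.ofReal_mul hC0, mul_pow, ofReal_norm]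

/-- Restriction along an injection of the index sets. -/
def pull (w : Weight ι) (w' : Weight κ) (s : ℝ) (φ : κ → ι)
    (h : Function.Injective φ ∧ ∃ C : ℝ, 0 ≤ C ∧ ∀ k, w'.val k ^ s ≤ C * w.val (φ k) ^ s) :
    WSeq w s →L[ℂ] WSeq w' s :=
  LinearMap.mkContinuousOfExistsBound
    { toFun := fun x => ⟨fun k => x (φ k), by
        obtain ⟨hφ, C, hC0, hC⟩ := h
        refine mem_of_eSq_le (R := C * ‖x‖) ?_
        rw [← enorm_mul_eq hC0]
        exact eSq_comp_le hφ hC0 hC _⟩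
      map_add' := fun _ _ => rfl
      map_smul' := fun _ _ => rfl }
    (by
      obtain ⟨hφ, C, hC0, hC⟩ := h
      refine ⟨C, fun x => norm_le_of_eSq_le (by positivity) ?_⟩
      rw [← enorm_mul_eq hC0]
      exact eSq_comp_le hφ hC0 hC _)

theorem norm_pull_le {φ : κ → ι} {h} {C : ℝ} (hC0 : 0 ≤ C) (hC : ∀ k,
    w'.val k ^ s ≤ C * w.val (φ k) ^ s) (x : WSeq w s) : ‖pull w w' s φ h x‖ ≤ C * ‖x‖ := by
  refine norm_le_of_eSq_le (by positivity) ?_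
  rw [← enorm_mul_eq hC0]
  exact eSq_comp_le h.1 hC0 hC _

theorem eSq_extend_le {φ : κ → ι} (hφ : Function.Injective φ) {C : ℝ} (hC0 : 0 ≤ C)
    (hC : ∀ k, w.val (φ k) ^ s ≤ C * w'.val k ^ s) (u : κ → ℂ) :
    eSq w s (Function.extend φ u 0) ≤ ENNReal.ofReal C ^ 2 * eSq w' s u := by
  unfold eSq
  rw [← ENNReal.tsum_mul_left, ← hφ.tsum_eq]
  · refine ENNReal.tsum_le_tsum fun k => ?_
    rw [hφ.extend_apply, ← mul_pow, ← mul_assoc, ← ENNReal.ofReal_mul hC0]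
    gcongr
    exact hC k
  · intro α hα
    by_contra hne
    apply hα
    simp [Function.extend_apply' u (0 : ι → ℂ) α (by simpa using hne)]

/-- Extension by zero along an injection of the index sets. -/
def push (w' : Weight κ) (w : Weight ι) (s : ℝ) (φ : κ → ι)
    (h : Function.Injective φ ∧ ∃ C : ℝ, 0 ≤ C ∧ ∀ k, w.val (φ k) ^ s ≤ C * w'.val k ^ s) :
    WSeq w' s →L[ℂ] WSeq w s :=
  LinearMap.mkContinuousOfExistsBound
    { toFun := fun x => ⟨Function.extend φ x 0, by
        obtain ⟨hφ, C, hC0, hC⟩ := h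
        refine mem_of_eSq_le (R := C * ‖x‖) ?_
        rw [← enorm_mul_eq hC0]
        exact eSq_extend_le hφ hC0 hC _⟩
      map_add' := fun x y => by
        apply Subtype.ext
        have := Function.extend_add φ x.1 y.1 0 0
        rw [add_zero] at this
        exact this
      map_smul' := fun c x => by
        apply Subtype.ext
        have := Function.extend_smul c φ x.1 0
        rw [smul_zero] at this
        exact this }
    (by
      obtain ⟨hφ, C, hC0, hC⟩ := h
      refine ⟨C, fun x => norm_le_of_eSq_le (by positivity) ?_⟩
      rw [← enorm_mul_eq hC0]
      exact eSq_extend_le hφ hC0 hC _)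

@[simp] theorem push_apply {φ : κ → ι} {h} (x : WSeq w' s) (k : κ) :
    push w' w s φ h x (φ k) = x k := h.1.extend_apply _ _ _

theorem push_apply_of_notMem {φ : κ → ι} {h} (x : WSeq w' s) {α : ι} (hα : ∀ k,
    φ k ≠ α) : push w' w s φ h x α = 0 := Function.extend_apply' _ _ _ (by simpa using hα)

theorem norm_push_le {φ : κ → ι} {h} {C : ℝ} (hC0 : 0 ≤ C) (hC : ∀ k,
    w.val (φ k) ^ s ≤ C * w'.val k ^ s) (x : WSeq w' s) : ‖push w' w s φ h x‖ ≤ C * ‖x‖ := by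
  refine norm_le_of_eSq_le (by positivity) ?_
  rw [← enorm_mul_eq hC0]
  exact eSq_extend_le h.1 hC0 hC _

theorem push_single {φ : κ → ι} {h} (k : κ) : push w' w s φ h (single k) = single (φ k) := by
  ext α
  by_cases hα : ∃ l, φ l = α
  · obtain ⟨l, rfl⟩ := hα
    by_cases hl : l = k
    · subst hl; simp
    · rw [push_apply, single_of_ne hl, single_of_ne fun e => hl (h.1 e)]
  · rw [push_apply_of_notMem _ (by simpa using hα), single_of_ne fun e => hα ⟨k, e.symm⟩]

/-! Bilinear pairings. -/

theorem pairing_bound {m : ι → ℂ} (hm : ∀ α, ‖m α‖ ≤ w.val α ^ (2 * s)) (x y : WSeq w s) :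
    (Summable fun α => ‖m α * (x α * y α)‖) ∧ ∑' α, ‖m α * (x α * y α)‖ ≤ ‖x‖ * ‖y‖ := by
  have hw : ∀ α, 0 ≤ w.val α ^ s := fun α => Real.rpow_nonneg (w.pos α).le s
  have hsq : ∀ z : WSeq w s, ∀ α, (w.val α ^ s * ‖z α‖) ^ (2 : ℝ) = ‖z α‖ ^ 2 * w.val α ^ (2 * s) := by
    intro z α
    rw [mul_comm 2 s, Real.rpow_mul (w.pos α).le, Real.rpow_two, Real.rpow_two]
    ring
  have key := Real.summable_and_inner_le_Lp_mul_Lq_tsum_of_nonneg (p := 2) (q := 2)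
    (f := fun α => w.val α ^ s * ‖x α‖) (g := fun α => w.val α ^ s * ‖y α‖)
    Real.HolderConjugate.two_two (fun α => mul_nonneg (hw α) (norm_nonneg _))
    (fun α => mul_nonneg (hw α) (norm_nonneg _))
    (by simp_rw [hsq x]; exact x.summable) (by simp_rw [hsq y]; exact y.summable)
  simp_rw [hsq] at key
  rw [← norm_sq_eq, ← norm_sq_eq, ← Real.sqrt_eq_rpow, ← Real.sqrt_eq_rpow,
    Real.sqrt_sq (norm_nonneg _), Real.sqrt_sq (norm_nonneg _)] at key
  have hle : ∀ α, ‖m α * (x α * y α)‖ ≤ w.val α ^ s * ‖x α‖ * (w.val α ^ s * ‖y α‖) := by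
    intro α
    have h1 := hm α
    rw [mul_comm 2 s, Real.rpow_mul (w.pos α).le, Real.rpow_two] at h1
    rw [norm_mul, norm_mul]
    have := mul_le_mul_of_nonneg_right h1 (mul_nonneg (norm_nonneg (x α)) (norm_nonneg (y α)))
    linarith
  have hsum := Summable.of_nonneg_of_le (fun α => norm_nonneg _) hle key.1
  exact ⟨hsum, (hsum.tsum_le_tsum hle key.1).trans key.2⟩

/-- The bilinear form `∑ m_α x_α y_α`, for a multiplier of size at most `w^{2s}`. -/
def pairing (w : Weight ι) (s : ℝ) (m : ι → ℂ) (hm : ∀ α, ‖m α‖ ≤ w.val α ^ (2 * s)) :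
    WSeq w s →L[ℂ] WSeq w s →L[ℂ] ℂ := LinearMap.mkContinuous₂
    (LinearMap.mk₂ ℂ (fun x y : WSeq w s => ∑' α, m α * (x α * y α)) (fun x x' y => by
        rw [← (pairing_bound hm x y).1.of_norm.tsum_add (pairing_bound hm x' y).1.of_norm]
        exact tsum_congr fun α => by simp only [add_apply]; ring)
      (fun c x y => by
        rw [smul_eq_mul, ← tsum_mul_left]
        exact tsum_congr fun α => by simp only [smul_apply]; ring)
      (fun x y y' => by
        rw [← (pairing_bound hm x y).1.of_norm.tsum_add (pairing_bound hm x y').1.of_norm]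
        exact tsum_congr fun α => by simp only [add_apply]; ring)
      (fun c x y => by
        rw [smul_eq_mul, ← tsum_mul_left]
        exact tsum_congr fun α => by simp only [smul_apply]; ring))
    1 (fun x y => by
      rw [one_mul]
      exact (norm_tsum_le_tsum_norm (pairing_bound hm x y).1).trans (pairing_bound hm x y).2)

theorem pairing_apply {m : ι → ℂ} {hm : ∀ α, ‖m α‖ ≤ w.val α ^ (2 * s)} (x y : WSeq w s) :
    pairing w s m hm x y = ∑' α, m α * (x α * y α) := rfl

theorem pairing_single_right {m : ι → ℂ} {hm : ∀ α, ‖m α‖ ≤ w.val α ^ (2 * s)} (x : WSeq w s)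
    (α : ι) : pairing w s m hm x (single α) = m α * x α := by
  rw [pairing_apply, tsum_eq_single α]
  · simp
  · intro β hβ; simp [single_of_ne hβ]

end WSeq

end

open CoupledNLS.WSeq (single single_of_ne single_same coord)

section

/-! ### Convolution estimates -/

/-- The weighted Cauchy–Schwarz inequality. -/
theorem ennreal_cauchy_schwarz {ι : Type*} (p F : ι → ℝ≥0∞) :
    (∑' a, p a * F a) ^ 2 ≤ (∑' a, p a) * ∑' a, p a * F a ^ 2 := by
  have amgm : ∀ x y : ℝ≥0∞, 2 * (x * y) ≤ x ^ 2 + y ^ 2 := by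
    intro x y
    rcases eq_or_ne x ⊤ with rfl | hx
    · simp
    rcases eq_or_ne y ⊤ with rfl | hy
    · simp
    lift x to NNReal using hx
    lift y to NNReal using hy
    norm_cast
    rw [← NNReal.coe_le_coe]
    push_cast
    nlinarith [sq_nonneg ((x : ℝ) - y)]
  have h1 : (∑' a, p a * F a) ^ 2 = ∑' a, ∑' b, p a * F a * (p b * F b) := by
    rw [sq, ← ENNReal.tsum_mul_right]
    exact tsum_congr fun a => ENNReal.tsum_mul_left.symm
  have h2 : (∑' a, p a) * ∑' a, p a * F a ^ 2 = ∑' a, ∑' b, p a * (p b * F b ^ 2) := by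
    rw [← ENNReal.tsum_mul_right]
    exact tsum_congr fun a => ENNReal.tsum_mul_left.symm
  have h3 : (∑' a, p a) * ∑' a, p a * F a ^ 2 = ∑' a, ∑' b, p a * (p b * F a ^ 2) := by
    rw [h2, ENNReal.tsum_comm]
    exact tsum_congr fun a => tsum_congr fun b => by ring
  have h4 : 2 * (∑' a, p a * F a) ^ 2 ≤ 2 * ((∑' a, p a) * ∑' a, p a * F a ^ 2) := by
    rw [two_mul (_ * _)]
    nth_rewrite 1 [h3]
    rw [h2, h1, ← ENNReal.tsum_add, ← ENNReal.tsum_mul_left]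
    refine ENNReal.tsum_le_tsum fun a => ?_
    rw [← ENNReal.tsum_add, ← ENNReal.tsum_mul_left]
    refine ENNReal.tsum_le_tsum fun b => ?_
    calc 2 * (p a * F a * (p b * F b)) = p a * p b * (2 * (F a * F b)) := by ring
      _ ≤ p a * p b * (F a ^ 2 + F b ^ 2) := by gcongr; exact amgm _ _
      _ = _ := by ring
  exact (ENNReal.mul_le_mul_iff_right two_ne_zero ENNReal.ofNat_ne_top).1 h4

/-- The convolution of three sequences. -/
def conv3 (x y z : ℤ → ℝ≥0∞) (N : ℤ) : ℝ≥0∞ := ∑' t : ℤ × ℤ, x t.1 * y t.2 * z (N - t.1 - t.2)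

theorem conv3_swap (x y z : ℤ → ℝ≥0∞) (N : ℤ) : conv3 x y z N = conv3 y x z N := by
  unfold conv3
  rw [← (Equiv.prodComm ℤ ℤ).tsum_eq]
  refine tsum_congr fun t => ?_
  simp only [Equiv.prodComm_apply, Prod.fst_swap, Prod.snd_swap]
  rw [mul_comm (x _), show N - t.2 - t.1 = N - t.1 - t.2 by ring]

/-- The involution `(i, j) ↦ (N - i - j, j)`. -/
def convEquiv (N : ℤ) : ℤ × ℤ ≃ ℤ × ℤ where
  toFun t := (N - t.1 - t.2, t.2)
  invFun t := (N - t.1 - t.2, t.2)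
  left_inv t := by ext <;> simp; ring
  right_inv t := by ext <;> simp; ring

theorem conv3_rev (x y z : ℤ → ℝ≥0∞) (N : ℤ) : conv3 x y z N = conv3 z y x N := by
  unfold conv3
  rw [← (convEquiv N).tsum_eq]
  refine tsum_congr fun t => ?_
  simp only [convEquiv, Equiv.coe_fn_mk]
  rw [show N - (N - t.1 - t.2) - t.2 = t.1 by ring]
  ring

/-- Young's inequality `ℓ¹ * ℓ¹ * ℓ² ⊂ ℓ²`. -/
theorem tsum_conv3_sq_le (x y z : ℤ → ℝ≥0∞) :
    ∑' N, conv3 x y z N ^ 2 ≤ (∑' i, x i) ^ 2 * (∑' j, y j) ^ 2 * ∑' k, z k ^ 2 := by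
  have hp : ∑' t : ℤ × ℤ, x t.1 * y t.2 = (∑' i, x i) * ∑' j, y j := by
    rw [ENNReal.tsum_prod (f := fun i j => x i * y j), ← ENNReal.tsum_mul_right]
    exact tsum_congr fun i => ENNReal.tsum_mul_left
  calc ∑' N, conv3 x y z N ^ 2
      ≤ ∑' N, (∑' t : ℤ × ℤ, x t.1 * y t.2) *
          ∑' t : ℤ × ℤ, x t.1 * y t.2 * z (N - t.1 - t.2) ^ 2 :=
        ENNReal.tsum_le_tsum fun N => ennreal_cauchy_schwarz _ _
    _ = (∑' i, x i) * (∑' j, y j) *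
          ∑' t : ℤ × ℤ, x t.1 * y t.2 * ∑' N, z (N - t.1 - t.2) ^ 2 := by
        rw [ENNReal.tsum_mul_left, hp, ENNReal.tsum_comm]
        congr 1
        exact tsum_congr fun t => ENNReal.tsum_mul_left
    _ = (∑' i, x i) * (∑' j, y j) * ∑' t : ℤ × ℤ, x t.1 * y t.2 * ∑' k, z k ^ 2 := by
        congr 1
        refine tsum_congr fun t => ?_
        congr 1
        rw [← (Equiv.subRight (t.1 + t.2)).tsum_eq (fun k => z k ^ 2)]
        refine tsum_congr fun N => ?_
        simp [sub_sub]
    _ = _ := by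
        rw [ENNReal.tsum_mul_right, hp]; ring

theorem weighted_conv3_le {ω : ℤ → ℝ≥0∞} {κ : ℝ≥0∞}
    (hω : ∀ i j k, ω (i + j + k) ≤ κ * (ω i + ω j + ω k)) (x y z : ℤ → ℝ≥0∞) :
    ∑' N, (ω N * conv3 x y z N) ^ 2 ≤ 3 * κ ^ 2 * ((∑' i, y i) ^ 2 * (∑' j, z j) ^ 2 * ∑' k,
    (ω k * x k) ^ 2 + (∑' i, x i) ^ 2 * (∑' j, z j) ^ 2 * ∑' k,
    (ω k * y k) ^ 2 + (∑' i, x i) ^ 2 * (∑' j, y j) ^ 2 * ∑' k, (ω k * z k) ^ 2) := by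
  have sq3 : ∀ a b c : ℝ≥0∞, (a + b + c) ^ 2 ≤ 3 * (a ^ 2 + b ^ 2 + c ^ 2) := by
    intro a b c
    rcases eq_or_ne a ⊤ with rfl | ha
    · simp
    rcases eq_or_ne b ⊤ with rfl | hb
    · simp
    rcases eq_or_ne c ⊤ with rfl | hc
    · simp
    lift a to NNReal using ha
    lift b to NNReal using hb
    lift c to NNReal using hc
    norm_cast
    rw [← NNReal.coe_le_coe]
    push_cast
    nlinarith [sq_nonneg ((a : ℝ) - b), sq_nonneg ((a : ℝ) - c), sq_nonneg ((b : ℝ) - c)]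
  have hpt : ∀ N, ω N * conv3 x y z N ≤ κ * (conv3 (fun i => ω i * x i) y z N +
    conv3 x (fun i => ω i * y i) z N + conv3 x y (fun i => ω i * z i) N) := by
    intro N
    unfold conv3
    rw [← ENNReal.tsum_mul_left, ← ENNReal.tsum_add, ← ENNReal.tsum_add, ← ENNReal.tsum_mul_left]
    refine ENNReal.tsum_le_tsum fun t => ?_
    have h := hω t.1 t.2 (N - t.1 - t.2)
    rw [show t.1 + t.2 + (N - t.1 - t.2) = N by ring] at h
    calc _ ≤ κ * (ω t.1 + ω t.2 + ω (N - t.1 - t.2)) * (x t.1 * y t.2 * z (N - t.1 - t.2)) := by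
          gcongr
      _ = _ := by ring
  calc ∑' N, (ω N * conv3 x y z N) ^ 2
      ≤ ∑' N, 3 * κ ^ 2 * (conv3 (fun i => ω i * x i) y z N ^ 2 +
        conv3 x (fun i => ω i * y i) z N ^ 2 + conv3 x y (fun i => ω i * z i) N ^ 2) := by
        refine ENNReal.tsum_le_tsum fun N => ?_
        refine (pow_le_pow_left₀ zero_le (hpt N) 2).trans ?_
        rw [mul_pow, mul_comm 3, mul_assoc]
        gcongr
        exact sq3 _ _ _
    _ ≤ _ := by
        rw [ENNReal.tsum_mul_left, ENNReal.tsum_add, ENNReal.tsum_add]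
        gcongr
        · simp_rw [conv3_rev _ y z]
          refine (tsum_conv3_sq_le _ _ _).trans (le_of_eq ?_)
          ring
        · simp_rw [fun N => conv3_rev x (fun i => ω i * y i) z N, fun N =>
            conv3_swap z (fun i => ω i * y i) x N, fun N => conv3_rev (fun i => ω i * y i) z x N]
          exact tsum_conv3_sq_le _ _ _
        · exact tsum_conv3_sq_le _ _ _

/-! ### Fourier coefficient sequences -/

/-- The weight `(1 + n²)^{1/2}` on the integers. -/
def zWeight : Weight ℤ where
  val n := √(1 + (n : ℝ) ^ 2)
  pos n := Real.sqrt_pos.2 (by positivity)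

/-- Fourier coefficient sequences with finite `H^s` norm. -/
abbrev Four (s : ℝ) := WSeq zWeight s

theorem one_le_zWeight (n : ℤ) : 1 ≤ zWeight.val n :=
  Real.one_le_sqrt.2 (by nlinarith [sq_nonneg (n : ℝ)])

theorem abs_le_zWeight (n : ℤ) : |(n : ℝ)| ≤ zWeight.val n := Real.abs_le_sqrt (by linarith)

theorem zWeight_neg (n : ℤ) : zWeight.val (-n) = zWeight.val n := by
  simp [zWeight]

theorem zWeight_add_le (m n : ℤ) : zWeight.val (m + n) ≤ zWeight.val m + zWeight.val n := by
  have h1 := one_le_zWeight m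
  have h2 := one_le_zWeight n
  have e1 : zWeight.val m ^ 2 = 1 + (m : ℝ) ^ 2 := Real.sq_sqrt (by positivity)
  have e2 : zWeight.val n ^ 2 = 1 + (n : ℝ) ^ 2 := Real.sq_sqrt (by positivity)
  have h3 := mul_le_mul (abs_le_zWeight m) (abs_le_zWeight n) (abs_nonneg _) (by linarith)
  rw [← abs_mul] at h3
  have h4 := (le_abs_self _).trans h3
  refine Real.sqrt_le_iff.2 ⟨by linarith, ?_⟩
  push_cast
  nlinarith

theorem zWeight_rpow_add3_le {s : ℝ} (hs : 0 ≤ s) (i j k : ℤ) : ENNReal.ofReal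
    (zWeight.val (i + j + k) ^ s) ≤ ENNReal.ofReal (3 ^ s) * (ENNReal.ofReal (zWeight.val i ^ s) +
    ENNReal.ofReal (zWeight.val j ^ s) + ENNReal.ofReal (zWeight.val k ^ s)) := by
  have hp : ∀ n, 0 ≤ zWeight.val n ^ s := fun n => Real.rpow_nonneg (zWeight.pos n).le s
  rw [← ENNReal.ofReal_add (hp _) (hp _), ← ENNReal.ofReal_add (add_nonneg (hp _) (hp _)) (hp _),
    ← ENNReal.ofReal_mul (by positivity)]
  refine ENNReal.ofReal_le_ofReal ?_
  have hle : zWeight.val (i + j + k) ≤ zWeight.val i + zWeight.val j + zWeight.val k :=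
    (zWeight_add_le _ _).trans (by gcongr; exact zWeight_add_le _ _)
  have key : ∀ n, zWeight.val (i + j + k) ≤ 3 * zWeight.val n →
    zWeight.val (i + j + k) ^ s ≤ 3 ^ s * zWeight.val n ^ s := fun n hn => by
    rw [← Real.mul_rpow (by norm_num) (zWeight.pos n).le]
    exact Real.rpow_le_rpow (zWeight.pos _).le hn hs
  have hi := hp i
  have hj := hp j
  have hk := hp k
  have h3 : (0 : ℝ) ≤ 3 ^ s := by positivity
  by_cases h1 : zWeight.val (i + j + k) ≤ 3 * zWeight.val i
  · exact (key i h1).trans (by gcongr; linarith)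
  by_cases h2 : zWeight.val (i + j + k) ≤ 3 * zWeight.val j
  · exact (key j h2).trans (by gcongr; linarith)
  · exact (key k (by linarith)).trans (by gcongr; linarith)

theorem summable_zWeight_rpow {s : ℝ} [hs : Fact (1 / 2 < s)] :
    Summable fun n => zWeight.val n ^ (-(2 * s)) := by
  have h := (Real.summable_one_div_int_add_rpow 0 (2 * s)).2 (by linarith [hs.out])
  refine Summable.of_norm_bounded_eventually h ?_
  filter_upwards [(Set.finite_singleton (0 : ℤ)).compl_mem_cofinite] with n hn
  have hn0 : (0 : ℝ) < |(n : ℝ)| := abs_pos.2 (by exact_mod_cast hn)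
  rw [Real.norm_of_nonneg (Real.rpow_nonneg (zWeight.pos n).le _), add_zero, one_div,
    ← Real.rpow_neg hn0.le]
  exact Real.rpow_le_rpow_of_nonpos hn0 (abs_le_zWeight n) (by linarith [hs.out])

/-- The constant of the embedding of the weighted `ℓ²` space into `ℓ¹`. -/
def l1Const (s : ℝ) : ℝ := √(∑' n, zWeight.val n ^ (-(2 * s)))

theorem l1Const_nonneg (s : ℝ) : 0 ≤ l1Const s := Real.sqrt_nonneg _

theorem tsum_enorm_le {s : ℝ} [hs : Fact (1 / 2 < s)] (x : Four s) :
    ∑' n, ‖x n‖ₑ ≤ ENNReal.ofReal (l1Const s) * ‖x‖ₑ := by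
  have hpos : ∀ n, 0 < zWeight.val n ^ s := fun n => Real.rpow_pos_of_pos (zWeight.pos n) s
  have h := ennreal_cauchy_schwarz (fun n => ENNReal.ofReal (zWeight.val n ^ (-(2 * s))))
    (fun n => ENNReal.ofReal (zWeight.val n ^ (2 * s)) * ‖x n‖ₑ)
  have e0 : ∀ n, ENNReal.ofReal (zWeight.val n ^ (-(2 * s))) * ENNReal.ofReal
    (zWeight.val n ^ (2 * s)) = 1 := fun n => by
    rw [← ENNReal.ofReal_mul (Real.rpow_nonneg (zWeight.pos n).le _),
      ← Real.rpow_add (zWeight.pos n)]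
    simp
  have e1 : ∀ n, ENNReal.ofReal (zWeight.val n ^ (-(2 * s))) *
    (ENNReal.ofReal (zWeight.val n ^ (2 * s)) * ‖x n‖ₑ) = ‖x n‖ₑ := fun n => by
    rw [← mul_assoc, e0, one_mul]
  have e2 : ∀ n, ENNReal.ofReal (zWeight.val n ^ (-(2 * s))) * (ENNReal.ofReal (zWeight.val n ^ (2 *
    s)) * ‖x n‖ₑ) ^ 2 = (ENNReal.ofReal (zWeight.val n ^ s) * ‖x n‖ₑ) ^ 2 := fun n => by
    rw [sq (ENNReal.ofReal (zWeight.val n ^ (2 * s)) * ‖x n‖ₑ), ← mul_assoc, e1, mul_pow,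
      mul_comm 2 s, Real.rpow_mul (zWeight.pos n).le, Real.rpow_two, ENNReal.ofReal_pow (hpos n).le]
    ring
  simp_rw [e1, e2] at h
  rw [← ENNReal.ofReal_tsum_of_nonneg (fun n => Real.rpow_nonneg (zWeight.pos n).le _)
    (summable_zWeight_rpow)] at h
  have h2 : ENNReal.ofReal (∑' n, zWeight.val n ^ (-(2 * s))) = ENNReal.ofReal (l1Const s) ^ 2 := by
    rw [← ENNReal.ofReal_pow (l1Const_nonneg s), l1Const, Real.sq_sqrt]
    exact tsum_nonneg fun n => Real.rpow_nonneg (zWeight.pos n).le _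
  have h3 : ∑' n, (ENNReal.ofReal (zWeight.val n ^ s) * ‖x n‖ₑ) ^ 2 = ‖x‖ₑ ^ 2 := WSeq.eSq_coe x
  rw [h2, h3, ← mul_pow] at h
  exact (ENNReal.pow_le_pow_left_iff two_ne_zero).1 h

theorem Four.summable_norm {s : ℝ} [hs : Fact (1 / 2 < s)] (x : Four s) : Summable fun n => ‖x n‖ := by
  have h := tsum_enorm_le x
  have h2 : ∑' n, ‖x n‖ₑ ≠ ⊤ := ne_top_of_le_ne_top (by finiteness) h
  exact (ENNReal.summable_toReal h2).congr fun n => by simp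

theorem Four.tsum_norm_le {s : ℝ} [hs : Fact (1 / 2 < s)] (x : Four s) :
    ∑' n, ‖x n‖ ≤ l1Const s * ‖x‖ := by
  have h := tsum_enorm_le x
  simp_rw [← ofReal_norm] at h
  rw [← ENNReal.ofReal_tsum_of_nonneg (fun n => norm_nonneg _) (Four.summable_norm x),
    ← ENNReal.ofReal_mul (l1Const_nonneg s)] at h
  exact (ENNReal.ofReal_le_ofReal_iff (mul_nonneg (l1Const_nonneg s) (norm_nonneg _))).1 h

theorem Four.norm_apply_le {s : ℝ} [hs : Fact (1 / 2 < s)] (x : Four s) (n : ℤ) : ‖x n‖ ≤ ‖x‖ :=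
  WSeq.norm_apply_le (by linarith [hs.out]) (one_le_zWeight n) x

end

section

/-! ### Trilinear convolutions with a bounded multiplier -/

/-- Multipliers of size at most one. -/
abbrev Mult (T : Type) := {c : T → ℂ // ∀ t, ‖c t‖ ≤ 1}

/-- The convolution of three sequences with the multiplier `c (N, i, j)`. -/
def triFun (c : Mult Quad) (x y z : ℤ → ℂ) (N : ℤ) : ℂ :=
  ∑' t : ℤ × ℤ, c.1 (N, t.1, t.2) * (x t.1 * y t.2 * z (N - t.1 - t.2))

theorem enorm_mult_mul_le {T : Type} (c : Mult T) (t : T) (a : ℂ) : ‖c.1 t * a‖ₑ ≤ ‖a‖ₑ := by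
  rw [enorm_mul]
  have h : ‖c.1 t‖ₑ ≤ 1 := by
    rw [← ofReal_norm]
    exact ENNReal.ofReal_le_one.2 (c.2 t)
  calc _ ≤ 1 * ‖a‖ₑ := by gcongr
    _ = _ := one_mul _

theorem enorm_triFun_le (c : Mult Quad) (x y z : ℤ → ℂ) (N : ℤ) :
    ‖triFun c x y z N‖ₑ ≤ conv3 (fun i => ‖x i‖ₑ) (fun i => ‖y i‖ₑ) (fun i => ‖z i‖ₑ) N := by
  refine (enorm_tsum_le_tsum_enorm).trans (ENNReal.tsum_le_tsum fun t => ?_)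
  refine (enorm_mult_mul_le c _ _).trans (le_of_eq ?_)
  rw [enorm_mul, enorm_mul]

/-- Convolution estimate for an arbitrary weight `ω` that is subadditive up to a constant. -/
theorem weighted_triFun_le {ω : ℤ → ℝ≥0∞} {κ : ℝ≥0∞} (hω : ∀ i j k, ω (i + j + k) ≤
    κ * (ω i + ω j + ω k)) {s : ℝ} [hs : Fact (1 / 2 < s)] (c : Mult Quad) (x y z : Four s) :
    ∑' N, (ω N * ‖triFun c x y z N‖ₑ) ^ 2 ≤ 3 * κ ^ 2 * ENNReal.ofReal
    (l1Const s) ^ 4 * (‖y‖ₑ ^ 2 * ‖z‖ₑ ^ 2 * ∑' k, (ω k * ‖x k‖ₑ) ^ 2 + ‖x‖ₑ ^ 2 * ‖z‖ₑ ^ 2 * ∑' k,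
    (ω k * ‖y k‖ₑ) ^ 2 + ‖x‖ₑ ^ 2 * ‖y‖ₑ ^ 2 * ∑' k, (ω k * ‖z k‖ₑ) ^ 2) := by
  have hx := tsum_enorm_le x
  have hy := tsum_enorm_le y
  have hz := tsum_enorm_le z
  calc _ ≤ ∑' N, (ω N * conv3 (fun i => ‖x i‖ₑ) (fun i => ‖y i‖ₑ) (fun i => ‖z i‖ₑ) N) ^ 2 := by
        refine ENNReal.tsum_le_tsum fun N => ?_
        gcongr
        exact enorm_triFun_le c x y z N
    _ ≤ _ := weighted_conv3_le hω _ _ _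
    _ ≤ 3 * κ ^ 2 * ((ENNReal.ofReal (l1Const s) * ‖y‖ₑ) ^ 2 *
          (ENNReal.ofReal (l1Const s) * ‖z‖ₑ) ^ 2 * ∑' k, (ω k * ‖x k‖ₑ) ^ 2 +
        (ENNReal.ofReal (l1Const s) * ‖x‖ₑ) ^ 2 * (ENNReal.ofReal (l1Const s) * ‖z‖ₑ) ^ 2 * ∑' k,
          (ω k * ‖y k‖ₑ) ^ 2 +
        (ENNReal.ofReal (l1Const s) * ‖x‖ₑ) ^ 2 * (ENNReal.ofReal (l1Const s) * ‖y‖ₑ) ^ 2 * ∑' k,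
          (ω k * ‖z k‖ₑ) ^ 2) := by
        gcongr
    _ = _ := by ring

/-- The constant of the algebra property. -/
def triConst (s : ℝ) : ℝ := 3 * 3 ^ s * l1Const s ^ 2

theorem triConst_nonneg (s : ℝ) : 0 ≤ triConst s := by
  unfold triConst; positivity

variable {s : ℝ} [hs : Fact (1 / 2 < s)]

local notation "Λ" => PSpace s
local notation "½" => (1 / 2 : ℂ)

theorem eSq_triFun_le (c : Mult Quad) (x y z : Four s) :
    WSeq.eSq zWeight s (triFun c x y z) ≤ ENNReal.ofReal (triConst s * ‖x‖ * ‖y‖ * ‖z‖) ^ 2 := by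
  have hL := l1Const_nonneg s
  have h := weighted_triFun_le (zWeight_rpow_add3_le (by linarith [hs.out] : 0 ≤ s)) c x y z
  refine h.trans (le_of_eq ?_)
  have e : ∀ x : Four s, ∑' k, (ENNReal.ofReal (zWeight.val k ^ s) * ‖x k‖ₑ) ^ 2 = ‖x‖ₑ ^ 2 :=
    WSeq.eSq_coe
  rw [e, e, e, triConst, ENNReal.ofReal_mul (by positivity), ENNReal.ofReal_mul (by positivity),
    ENNReal.ofReal_mul (by positivity), ENNReal.ofReal_mul (by positivity),
    ENNReal.ofReal_mul (by positivity), ENNReal.ofReal_pow hL, ofReal_norm, ofReal_norm,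
    ofReal_norm, ENNReal.ofReal_ofNat]
  ring

theorem summable_triFun (c : Mult Quad) (x y z : Four s) (N : ℤ) :
    Summable fun t : ℤ × ℤ => c.1 (N, t.1, t.2) * (x t.1 * y t.2 * z (N - t.1 - t.2)) := by
  have hxy : Summable fun t : ℤ × ℤ => ‖x t.1‖ * ‖y t.2‖ * ‖z‖ := ((Four.summable_norm
    x).mul_of_nonneg (Four.summable_norm y) (fun _ => norm_nonneg _) (fun _ => norm_nonneg
    _)).mul_right _
  refine Summable.of_norm_bounded hxy fun t => ?_
  rw [norm_mul, norm_mul, norm_mul]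
  calc _ ≤ 1 * (‖x t.1‖ * ‖y t.2‖ * ‖z‖) := by
        gcongr
        · exact c.2 _
        · exact Four.norm_apply_le z _
    _ = _ := one_mul _

/-- The trilinear convolution as a bounded linear map of its last argument. -/
def triInner (c : Mult Quad) (x y : Four s) : Four s →L[ℂ] Four s :=
  LinearMap.mkContinuous
    { toFun := fun z => ⟨triFun c x y z, WSeq.mem_of_eSq_le (eSq_triFun_le c x y z)⟩
      map_add' := fun z z' => by
        ext N
        change triFun c x y (z + z').1 N = triFun c x y z N + triFun c x y z' N
        unfold triFun
        rw [← (summable_triFun c x y z N).tsum_add (summable_triFun c x y z' N)]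
        refine tsum_congr fun t => ?_
        change _ * (_ * _ * (z _ + z' _)) = _
        ring
      map_smul' := fun a z => by
        ext N
        change triFun c x y (a • z).1 N = a * triFun c x y z N
        unfold triFun
        rw [← tsum_mul_left]
        refine tsum_congr fun t => ?_
        change _ * (_ * _ * (a * z _)) = _
        ring }
    (triConst s * ‖x‖ * ‖y‖) (fun z => by
      have := triConst_nonneg s
      exact WSeq.norm_le_of_eSq_le (by positivity) (eSq_triFun_le c x y z))

theorem norm_triInner_le (c : Mult Quad) (x y : Four s) :
    ‖triInner c x y‖ ≤ triConst s * ‖x‖ * ‖y‖ := by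
  have := triConst_nonneg s
  exact LinearMap.mkContinuous_norm_le _ (by positivity) _

/-- The trilinear convolution `(x, y, z) ↦ ∑ c(N, i, j) x_i y_j z_{N-i-j}`. -/
def tri (c : Mult Quad) : Four s →L[ℂ] Four s →L[ℂ] Four s →L[ℂ] Four s :=
    LinearMap.mkContinuous₂ (LinearMap.mk₂ ℂ (triInner c) (fun x x' y => by
        ext z N
        change triFun c (x + x').1 y z N = triFun c x y z N + triFun c x' y z N
        unfold triFun
        rw [← (summable_triFun c x y z N).tsum_add (summable_triFun c x' y z N)]
        refine tsum_congr fun t => ?_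
        change _ * ((x _ + x' _) * _ * _) = _
        ring)
      (fun a x y => by
        ext z N
        change triFun c (a • x).1 y z N = a * triFun c x y z N
        unfold triFun
        rw [← tsum_mul_left]
        refine tsum_congr fun t => ?_
        change _ * ((a * x _) * _ * _) = _
        ring)
      (fun x y y' => by
        ext z N
        change triFun c x (y + y').1 z N = triFun c x y z N + triFun c x y' z N
        unfold triFun
        rw [← (summable_triFun c x y z N).tsum_add (summable_triFun c x y' z N)]
        refine tsum_congr fun t => ?_
        change _ * (_ * (y _ + y' _) * _) = _
        ring)
      (fun a x y => by
        ext z N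
        change triFun c x (a • y).1 z N = a * triFun c x y z N
        unfold triFun
        rw [← tsum_mul_left]
        refine tsum_congr fun t => ?_
        change _ * (_ * (a * y _) * _) = _
        ring))
    (triConst s) (norm_triInner_le c)

theorem tri_apply (c : Mult Quad) (x y z : Four s) (N : ℤ) : tri c x y z N = triFun c x y z N := rfl

theorem norm_tri_le (c : Mult Quad) (x y z : Four s) :
    ‖tri c x y z‖ ≤ triConst s * ‖x‖ * ‖y‖ * ‖z‖ := by
  have := triConst_nonneg s
  exact WSeq.norm_le_of_eSq_le (by positivity) (eSq_triFun_le c x y z)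

/-! ### Quartic forms -/

/-- The reflection `n ↦ -n` of a sequence. -/
def reflect (s : ℝ) : Four s →L[ℂ] Four s :=
    WSeq.pull zWeight zWeight s (fun n => -n) ⟨neg_injective, 1, zero_le_one,
    fun n => by rw [zWeight_neg, one_mul]⟩

@[simp] theorem reflect_apply (x : Four s) (n : ℤ) : reflect s x n = x (-n) := rfl

/-- The bilinear form `∑ x_n y_{-n}`: the mean value of the product of the two functions. -/
def bpair : Four s →L[ℂ] Four s →L[ℂ] ℂ := ((compL ℂ (Four s) (Four s) ℂ).flip (reflect s)).comp
    (WSeq.pairing zWeight s (fun _ => 1) (fun n => by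
      rw [norm_one]; exact Real.one_le_rpow (one_le_zWeight n) (by linarith [hs.out])))

theorem bpair_apply (x y : Four s) : bpair x y = ∑' n, x n * y (-n) := by
  change ∑' n, (1 : ℂ) * (x n * y (-n)) = _
  simp

/-- The quartic form with the multiplier `c (i, j, k)` on `a_k b_l ā_i b̄_j`, `l = i + j - k`, in
terms of the Fourier coefficients of `a`, `ā`, `b`, `b̄`. -/
def quart (c : Mult Quad) (a a' b b' : ℤ → ℂ) : ℂ :=
  ∑' t : Quad, c.1 t * (a t.2.2 * b (t.1 + t.2.1 - t.2.2) * a' (-t.1) * b' (-t.2.1))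

/-- Change of the variables of a multiplier. -/
def Mult.comp {T T' : Type} (c : Mult T) (φ : T' → T) : Mult T' := ⟨c.1 ∘ φ, fun t => c.2 (φ t)⟩

/-- The substitution `n ↦ -N` turns the pairing with a trilinear convolution into an absolutely
convergent sum over triples of indices. -/
theorem bpair_tri (c : Mult Quad) (x y z h : Four s) : (Summable fun u : Quad =>
      c.1 u * (x u.2.1 * y u.2.2 * z (u.1 - u.2.1 - u.2.2) * h (-u.1))) ∧
    bpair (tri c x y z) h =
      ∑' u : Quad, c.1 u * (x u.2.1 * y u.2.2 * z (u.1 - u.2.1 - u.2.2) * h (-u.1)) := by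
  have hh : Summable fun n => ‖h (-n)‖ := (Four.summable_norm (reflect s h))
  have hsum : Summable fun u : Quad =>
      c.1 u * (x u.2.1 * y u.2.2 * z (u.1 - u.2.1 - u.2.2) * h (-u.1)) := by
    have h1 : Summable fun u : Quad => ‖h (-u.1)‖ * (‖x u.2.1‖ * ‖y u.2.2‖) * ‖z‖ :=
      (hh.mul_of_nonneg ((Four.summable_norm x).mul_of_nonneg (Four.summable_norm y) (fun _ =>
      norm_nonneg _) (fun _ => norm_nonneg _)) (fun _ => norm_nonneg _) (fun _ => mul_nonneg
      (norm_nonneg _) (norm_nonneg _))).mul_right _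
    refine Summable.of_norm_bounded h1 fun u => ?_
    rw [norm_mul, norm_mul, norm_mul, norm_mul]
    calc _ ≤ 1 * (‖x u.2.1‖ * ‖y u.2.2‖ * ‖z‖ * ‖h (-u.1)‖) := by
          gcongr
          · exact c.2 _
          · exact Four.norm_apply_le z _
      _ = _ := by ring
  refine ⟨hsum, ?_⟩
  rw [bpair_apply, hsum.tsum_prod]
  refine tsum_congr fun N => ?_
  rw [tri_apply, triFun, ← tsum_mul_right]
  exact tsum_congr fun t => by ring

/-- A triple of indices determines a quartic monomial by `i + j = k + l`. This is the choice of the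
triple in which the index of `a` is solved for. -/
def solveA : Quad ≃ Quad where
  toFun u := (-u.2.1, -u.2.2, -u.1)
  invFun t := (-t.2.2, -t.1, -t.2.1)
  left_inv u := by simp
  right_inv t := by simp

/-- The relation `i + j = k + l` solved for the index of `ā`. -/
def solveA' : Quad ≃ Quad where
  toFun u := (u.1, -u.2.2, u.2.1)
  invFun t := (t.1, t.2.2, -t.2.1)
  left_inv u := by simp
  right_inv t := by simp

/-- The relation solved for the index of `b`. -/
def solveB : Quad ≃ Quad where
  toFun u := (-u.2.1, -u.2.2, u.1 - u.2.1 - u.2.2)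
  invFun t := (t.2.2 - t.1 - t.2.1, -t.1, -t.2.1)
  left_inv u := by ext <;> simp; ring
  right_inv t := by ext <;> simp; ring

/-- The relation solved for the index of `b̄`. -/
def solveB' : Quad ≃ Quad where
  toFun u := (-u.2.2, u.1, u.2.1)
  invFun t := (t.2.1, t.2.2, -t.1)
  left_inv u := by simp
  right_inv t := by simp

theorem bpair_tri_a (c : Mult Quad) (a a' b b' : Four s) :
    bpair (tri (c.comp solveA) a' b' b) a = quart c a a' b b' := by
  rw [(bpair_tri _ _ _ _ _).2, quart]
  refine Eq.trans (tsum_congr fun u => ?_) (solveA.tsum_eq _)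
  simp only [Mult.comp, Function.comp_apply, solveA, Equiv.coe_fn_mk, neg_neg]
  rw [show -u.2.1 + -u.2.2 - -u.1 = u.1 - u.2.1 - u.2.2 by ring]
  ring

theorem bpair_tri_a' (c : Mult Quad) (a a' b b' : Four s) :
    bpair (tri (c.comp solveA') a b' b) a' = quart c a a' b b' := by
  rw [(bpair_tri _ _ _ _ _).2, quart]
  refine Eq.trans (tsum_congr fun u => ?_) (solveA'.tsum_eq _)
  simp only [Mult.comp, Function.comp_apply, solveA', Equiv.coe_fn_mk, neg_neg]
  rw [show u.1 + -u.2.2 - u.2.1 = u.1 - u.2.1 - u.2.2 by ring]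
  ring

theorem bpair_tri_b (c : Mult Quad) (a a' b b' : Four s) :
    bpair (tri (c.comp solveB) a' b' a) b = quart c a a' b b' := by
  rw [(bpair_tri _ _ _ _ _).2, quart]
  refine Eq.trans (tsum_congr fun u => ?_) (solveB.tsum_eq _)
  simp only [Mult.comp, Function.comp_apply, solveB, Equiv.coe_fn_mk, neg_neg]
  rw [show -u.2.1 + -u.2.2 - (u.1 - u.2.1 - u.2.2) = -u.1 by ring]
  ring

theorem bpair_tri_b' (c : Mult Quad) (a a' b b' : Four s) :
    bpair (tri (c.comp solveB') a a' b) b' = quart c a a' b b' := by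
  rw [(bpair_tri _ _ _ _ _).2, quart]
  refine Eq.trans (tsum_congr fun u => ?_) (solveB'.tsum_eq _)
  simp only [Mult.comp, Function.comp_apply, solveB', Equiv.coe_fn_mk, neg_neg]
  rw [show -u.2.2 + u.1 - u.2.1 = u.1 - u.2.1 - u.2.2 by ring]
  ring

theorem summable_quart (c : Mult Quad) (a a' b b' : Four s) : Summable fun t : Quad =>
      c.1 t * (a t.2.2 * b (t.1 + t.2.1 - t.2.2) * a' (-t.1) * b' (-t.2.1)) := by
  rw [← solveB'.summable_iff]
  refine (bpair_tri (c.comp solveB') a a' b b').1.congr fun u => ?_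
  simp only [Mult.comp, Function.comp_apply, solveB', Equiv.coe_fn_mk, neg_neg]
  rw [show -u.2.2 + u.1 - u.2.1 = u.1 - u.2.1 - u.2.2 by ring]
  ring

/-! ### Gradients on the phase space -/

/-- The four sequences of Fourier coefficients of a point, in the order `a, ā, b, b̄`, where
`ā` and `b̄` are the functions `∑ ā_j e^{-ijx}` and `∑ b̄_j e^{-ijx}`. -/
abbrev VSpace (s : ℝ) := Fin 4 → Four s

theorem inj_mode (b : Bool) : Function.Injective fun j : ℤ => ((j, b) : Mode) :=
  fun _ _ h => (Prod.ext_iff.1 h).1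

/-- The coefficients of `a` or of `b`. -/
def modeComp (s : ℝ) (b : Bool) : MSeq s →L[ℂ] Four s := WSeq.pull fullWeight zWeight s (fun j =>
    (j, b)) ⟨inj_mode b, 1, zero_le_one, fun _ => (one_mul _).ge⟩

/-- The inclusion of the coefficients of `a` or of `b`. -/
def modeIncl (s : ℝ) (b : Bool) : Four s →L[ℂ] MSeq s := WSeq.push zWeight fullWeight s (fun j =>
    (j, b)) ⟨inj_mode b, 1, zero_le_one, fun _ => (one_mul _).ge⟩

@[simp] theorem modeIncl_apply (b : Bool) (x : Four s) (j : ℤ) :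
    modeIncl s b x (j, b) = x j := WSeq.push_apply (φ := fun j : ℤ => ((j, b) : Mode)) x j

theorem modeIncl_apply_ne {b b' : Bool} (h : b' ≠ b) (x : Four s) (j : ℤ) :
    modeIncl s b x (j, b') = 0 := WSeq.push_apply_of_notMem _ fun _ e => h (Prod.ext_iff.1 e).2.symm

/-- From a point to the Fourier coefficients of `a, ā, b, b̄`. -/
def toV (s : ℝ) : PSpace s →L[ℂ] VSpace s := ContinuousLinearMap.pi ![(modeComp s true).comp (fst ℂ
    _ _), ((reflect s).comp (modeComp s true)).comp (snd ℂ _ _), (modeComp s false).comp (fst ℂ _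
    _), ((reflect s).comp (modeComp s false)).comp (snd ℂ _ _)]

@[simp] theorem toV_zero (w : Λ) (n : ℤ) : toV s w 0 n = w.1 (n, true) := rfl
@[simp] theorem toV_one (w : Λ) (n : ℤ) : toV s w 1 n = w.2 (-n, true) := rfl
@[simp] theorem toV_two (w : Λ) (n : ℤ) : toV s w 2 n = w.1 (n, false) := rfl
@[simp] theorem toV_three (w : Λ) (n : ℤ) : toV s w 3 n = w.2 (-n, false) := rfl

/-- The transpose of `toV`: from the partial gradients with respect to `a, ā, b, b̄`, as functions,
to the gradient on the phase space. -/
def gradP (s : ℝ) : VSpace s →L[ℂ] PSpace s :=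
  let pr : ∀ _ : Fin 4, VSpace s →L[ℂ] Four s := fun i => proj i
  (((modeIncl s true).comp ((reflect s).comp (pr 0))) +
    ((modeIncl s false).comp ((reflect s).comp (pr 2)))).prod
  (((modeIncl s true).comp (pr 1)) + ((modeIncl s false).comp (pr 3)))

theorem gradP_fst_true (Γ : VSpace s) (j : ℤ) : (gradP s Γ).1 (j, true) = Γ 0 (-j) := by
  change modeIncl s true (reflect s (Γ 0)) (j, true) + modeIncl s false (reflect s (Γ 2)) (j, true) = _
  rw [modeIncl_apply, modeIncl_apply_ne (by decide), add_zero, reflect_apply]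

theorem gradP_fst_false (Γ : VSpace s) (j : ℤ) : (gradP s Γ).1 (j, false) = Γ 2 (-j) := by
  change modeIncl s true (reflect s (Γ 0)) (j, false) + modeIncl s false (reflect s (Γ 2)) (j, false) = _
  rw [modeIncl_apply, modeIncl_apply_ne (by decide), zero_add, reflect_apply]

theorem gradP_snd_true (Γ : VSpace s) (j : ℤ) : (gradP s Γ).2 (j, true) = Γ 1 j := by
  change modeIncl s true (Γ 1) (j, true) + modeIncl s false (Γ 3) (j, true) = _
  rw [modeIncl_apply, modeIncl_apply_ne (by decide), add_zero]

theorem gradP_snd_false (Γ : VSpace s) (j : ℤ) : (gradP s Γ).2 (j, false) = Γ 3 j := by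
  change modeIncl s true (Γ 1) (j, false) + modeIncl s false (Γ 3) (j, false) = _
  rw [modeIncl_apply, modeIncl_apply_ne (by decide), zero_add]

theorem one_le_fullWeight (α : Mode) : 1 ≤ fullWeight.val α := one_le_zWeight α.1

/-- The form `∑ κ_j x_{j±} y_{j±}`. -/
def modePair (s : ℝ) (κ : ℤ → ℂ) (hκ : ∀ n, ‖κ n‖ ≤ zWeight.val n ^ (2 * s)) :
    MSeq s →L[ℂ] MSeq s →L[ℂ] ℂ := WSeq.pairing fullWeight s (fun α => κ α.1) (fun α => hκ α.1)

theorem norm_one_le_zWeight (n : ℤ) : ‖(1 : ℂ)‖ ≤ zWeight.val n ^ (2 * s) := by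
  rw [norm_one]; exact Real.one_le_rpow (one_le_zWeight n) (by linarith [hs.out])

/-- The form `∑ x_α y_α`. -/
def dotM : MSeq s →L[ℂ] MSeq s →L[ℂ] ℂ := modePair s (fun _ => 1) (norm_one_le_zWeight)

theorem dotM_apply (x y : MSeq s) : dotM x y = ∑' α, x α * y α := by
  change ∑' α, (1 : ℂ) * (x α * y α) = _
  simp

theorem summable_dotM (x y : MSeq s) : Summable fun α => x α * y α := by
  have := (WSeq.pairing_bound (w := fullWeight) (s := s) (m := fun _ => 1)
    (fun α => norm_one_le_zWeight α.1) x y).1.of_norm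
  simpa using this

theorem dotM_comm (x y : MSeq s) : dotM x y = dotM y x := by
  rw [dotM_apply, dotM_apply]
  exact tsum_congr fun α => mul_comm _ _

/-- The bilinear form `∑ (u_α v_α + ū_α v̄_α)` with respect to which gradients are taken. -/
def beta : Λ →L[ℂ] Λ →L[ℂ] ℂ := ((compL ℂ Λ (MSeq s) ℂ).flip (fst ℂ _ _)).comp ((dotM).comp (fst ℂ _
    _)) + ((compL ℂ Λ (MSeq s) ℂ).flip (snd ℂ _ _)).comp ((dotM).comp (snd ℂ _ _))

theorem beta_apply (u v : Λ) : beta u v = dotM u.1 v.1 + dotM u.2 v.2 := rfl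

theorem beta_comm (u v : Λ) : beta u v = beta v u := by
  rw [beta_apply, beta_apply, dotM_comm u.1, dotM_comm u.2]

theorem dotM_single (x : MSeq s) (α : Mode) : dotM x (single α) = x α := by
  have := WSeq.pairing_single_right (w := fullWeight) (s := s) (m := fun _ => 1)
    (hm := fun α => norm_one_le_zWeight α.1) x α
  rw [one_mul] at this
  exact this

theorem beta_single_fst (u : Λ) (α : Mode) : beta u (single α, 0) = u.1 α := by
  rw [beta_apply]
  simp only [map_zero, add_zero]
  exact dotM_single _ _

theorem beta_single_snd (u : Λ) (α : Mode) : beta u (0, single α) = u.2 α := by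
  rw [beta_apply]
  simp only [map_zero, zero_add]
  exact dotM_single _ _

theorem dotM_modeIncl (b : Bool) (x : Four s) (y : MSeq s) :
    dotM (modeIncl s b x) y = ∑' j, x j * y (j, b) := by
  rw [dotM_apply, ← (inj_mode b).tsum_eq]
  · exact tsum_congr fun j => by rw [modeIncl_apply]
  · rintro ⟨j, b'⟩ hj
    by_contra hne
    have : b' ≠ b := fun e => hne ⟨j, by rw [e]⟩
    exact hj (by simp [modeIncl_apply_ne this])

theorem beta_gradP (Γ : VSpace s) (h : Λ) : beta (gradP s Γ) h = ∑ i, bpair (Γ i) (toV s h i) := by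
  have e : ∀ x : Four s, ∀ y : ℤ → ℂ, ∑' j, reflect s x j * y j = ∑' j, x j * y (-j) := by
    intro x y
    rw [← (Equiv.neg ℤ).tsum_eq]
    exact tsum_congr fun j => by simp
  have h1 : dotM (gradP s Γ).1 h.1 = bpair (Γ 0) (toV s h 0) + bpair (Γ 2) (toV s h 2) := by
    change dotM (modeIncl s true (reflect s (Γ 0)) + modeIncl s false (reflect s (Γ 2))) h.1 = _
    rw [map_add, add_apply, dotM_modeIncl, dotM_modeIncl, e, e, bpair_apply, bpair_apply]
    rfl
  have h2 : dotM (gradP s Γ).2 h.2 = bpair (Γ 1) (toV s h 1) + bpair (Γ 3) (toV s h 3) := by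
    change dotM (modeIncl s true (Γ 1) + modeIncl s false (Γ 3)) h.2 = _
    rw [map_add, add_apply, dotM_modeIncl, dotM_modeIncl, bpair_apply, bpair_apply]
    simp
  rw [beta_apply, h1, h2, Fin.sum_univ_four]
  ring

/-- `G` is an analytic gradient of the analytic function `F` on `U`. -/
structure IsGrad (F : Λ → ℂ) (G : Λ → Λ)
    (U : Set Λ) : Prop where
  analytic : AnalyticOnNhd ℂ F U
  analytic_grad : AnalyticOnNhd ℂ G U
  hasFDerivAt : ∀ w ∈ U, HasFDerivAt F (beta (G w)) w

/-- The derivative of a gradient is symmetric. -/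
theorem IsGrad.symm {F : Λ → ℂ} {G : Λ → Λ} {U : Set Λ} (h : IsGrad F G U) (hU : IsOpen U) {w : Λ}
    (hw : w ∈ U) (u v : Λ) : beta (fderiv ℂ G w u) v = beta (fderiv ℂ G w v) u := by
  have h1 : ∀ᶠ y in 𝓝 w, HasFDerivAt F (beta (G y)) y := by
    filter_upwards [hU.mem_nhds hw] with y hy using h.hasFDerivAt y hy
  have h2 : HasFDerivAt (fun y => beta (G y)) ((beta).comp (fderiv ℂ G w)) w :=
    (beta).hasFDerivAt.comp w (h.analytic_grad w hw).differentiableAt.hasFDerivAt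
  exact second_derivative_symmetric_of_eventually h1 h2 u v

theorem IsGrad.mono {F : Λ → ℂ} {G : Λ → Λ} {U U' : Set Λ} (h : IsGrad F G U) (hU : U' ⊆ U) : IsGrad
    F G U' := ⟨h.analytic.mono hU, h.analytic_grad.mono hU, fun w hw => h.hasFDerivAt w (hU hw)⟩

theorem IsGrad.add {F F' : Λ → ℂ} {G G' : Λ → Λ} {U : Set Λ} (h : IsGrad F G U)
    (h' : IsGrad F' G' U) : IsGrad (fun w => F w + F' w) (fun w => G w + G' w) U :=
    ⟨h.analytic.add h'.analytic, h.analytic_grad.add h'.analytic_grad, fun w hw => by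
    rw [map_add]; exact (h.hasFDerivAt w hw).add (h'.hasFDerivAt w hw)⟩

theorem IsGrad.sub {F F' : Λ → ℂ} {G G' : Λ → Λ} {U : Set Λ} (h : IsGrad F G U)
    (h' : IsGrad F' G' U) : IsGrad (fun w => F w - F' w) (fun w => G w - G' w) U :=
    ⟨h.analytic.sub h'.analytic, h.analytic_grad.sub h'.analytic_grad, fun w hw => by
    rw [map_sub]; exact (h.hasFDerivAt w hw).sub (h'.hasFDerivAt w hw)⟩

/-! ### Quartic Hamiltonians -/

/-- The quartic Hamiltonian with the multiplier `c`. -/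
def quartP (c : Mult Quad) (w : Λ) : ℂ := quart c (toV s w 0) (toV s w 1) (toV s w 2) (toV s w 3)

/-- The gradient of a quartic Hamiltonian. -/
def quartGrad (c : Mult Quad) (w : Λ) : Λ := gradP s ![tri (c.comp solveA) (toV s w 1) (toV s w 3)
    (toV s w 2), tri (c.comp solveA') (toV s w 0) (toV s w 3) (toV s w 2), tri (c.comp solveB) (toV
    s w 1) (toV s w 3) (toV s w 0), tri (c.comp solveB') (toV s w 0) (toV s w 1) (toV s w 2)]

theorem beta_quartGrad (c : Mult Quad) (w h : Λ) :
    beta (quartGrad c w) h = quart c (toV s h 0) (toV s w 1) (toV s w 2) (toV s w 3) +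
    quart c (toV s w 0) (toV s h 1) (toV s w 2) (toV s w 3) + quart c (toV s w 0) (toV s w 1)
    (toV s h 2) (toV s w 3) + quart c (toV s w 0) (toV s w 1) (toV s w 2) (toV s h 3) := by
  rw [quartGrad, beta_gradP, Fin.sum_univ_four, ← bpair_tri_a, ← bpair_tri_a',
    ← bpair_tri_b, ← bpair_tri_b']
  rfl

/-- The coefficients of one of the functions `a, ā, b, b̄`. -/
def toVi (s : ℝ) (i : Fin 4) : PSpace s →L[ℂ] Four s :=
  (proj (R := ℂ) (φ := fun _ : Fin 4 => Four s) i).comp (toV s)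

theorem analyticAt_toV (w : Λ) (i : Fin 4) : AnalyticAt ℂ (fun w => toV s w i) w :=
  (toVi s i).analyticAt w

theorem analyticAt_clm_apply {E F G : Type*} [NormedAddCommGroup E] [NormedSpace ℂ E]
    [NormedAddCommGroup F] [NormedSpace ℂ F] [NormedAddCommGroup G] [NormedSpace ℂ G]
    {f : E → F →L[ℂ] G} {g : E → F} {x : E} (hf : AnalyticAt ℂ f x) (hg : AnalyticAt ℂ g x) :
    AnalyticAt ℂ (fun y => f y (g y)) x :=
    ((ContinuousLinearMap.id ℂ (F →L[ℂ] G)).analyticAt_bilinear (f x, g x)).comp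
    (f := fun y => (f y, g y)) (hf.prod hg)

theorem analyticAt_tri (c : Mult Quad) (i j k : Fin 4) (w : Λ) :
    AnalyticAt ℂ (fun w => tri c (toV s w i) (toV s w j) (toV s w k)) w := by
  have ht : ∀ x : Four s, AnalyticAt ℂ (tri c) x := fun x =>
    ContinuousLinearMap.analyticAt (𝕜 := ℂ) (E := Four s)
      (F := Four s →L[ℂ] Four s →L[ℂ] Four s) (tri c) x
  have h0 : AnalyticAt ℂ (fun w => tri c (toV s w i)) w := (ht _).comp (analyticAt_toV w i)
  exact analyticAt_clm_apply (analyticAt_clm_apply h0 (analyticAt_toV w j)) (analyticAt_toV w k)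

/-- By Euler's identity the four partial gradients are trilinear convolutions. -/
theorem isGrad_quart (c : Mult Quad) : IsGrad (s := s) (quartP c) (quartGrad c) univ := by
  have hQ : (quartP c : Λ → ℂ) =
    fun w => bpair (tri (c.comp solveB') (toV s w 0) (toV s w 1) (toV s w 2)) (toV s w 3) := by
    funext w
    rw [bpair_tri_b']
    rfl
  refine ⟨fun w _ => ?_, fun w _ => ?_, fun w _ => ?_⟩
  · rw [hQ]
    refine analyticAt_clm_apply ?_ (analyticAt_toV w 3)
    exact (ContinuousLinearMap.analyticAt (bpair) _).comp (analyticAt_tri _ 0 1 2 w)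
  · refine ((gradP s).analyticAt _).comp (AnalyticAt.pi ?_)
    intro i
    fin_cases i
    · exact analyticAt_tri (c.comp solveA) 1 3 2 w
    · exact analyticAt_tri (c.comp solveA') 0 3 2 w
    · exact analyticAt_tri (c.comp solveB) 1 3 0 w
    · exact analyticAt_tri (c.comp solveB') 0 1 2 w
  · have hV : ∀ i, HasFDerivAt (fun w => toV s w i) (toVi s i) w := fun i => (toVi s i).hasFDerivAt
    have h0 : HasFDerivAt (fun w => tri (c.comp solveB') (toV s w 0))
      ((tri (c.comp solveB')).comp (toVi s 0)) w := ContinuousLinearMap.hasFDerivAt (E := Λ)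
      (F := Four s →L[ℂ] Four s →L[ℂ] Four s) ((tri (c.comp solveB')).comp (toVi s 0))
    have h1 := (h0.clm_apply (hV 1)).clm_apply (hV 2)
    have hb : ∀ x, HasFDerivAt (bpair (s := s)) bpair x := fun x =>
      ContinuousLinearMap.hasFDerivAt bpair
    have h2 := ((hb _).comp w h1).clm_apply (hV 3)
    rw [hQ]
    refine h2.congr_fderiv ?_
    refine ContinuousLinearMap.ext fun h => ?_
    rw [beta_quartGrad, ← bpair_tri_b' c, ← bpair_tri_b' c, ← bpair_tri_b' c, ← bpair_tri_b' c]
    simp only [add_apply, ContinuousLinearMap.comp_apply,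
      ContinuousLinearMap.flip_apply, Function.comp_apply, map_add]
    have e : ∀ i, toVi s i h = toV s h i := fun i => rfl
    simp only [e]
    ring

/-- Cauchy's estimate for the derivative of a bounded holomorphic map. -/
theorem norm_fderiv_le_of_bound {E F : Type*} [NormedAddCommGroup E] [NormedSpace ℂ E]
    [NormedAddCommGroup F] [NormedSpace ℂ F] {f : E → F} {x : E} {r B : ℝ} (hr : 0 < r)
    (hd : DifferentiableOn ℂ f (ball x r)) (hB : ∀ y ∈ ball x r, ‖f y‖ ≤ B) :
    ‖fderiv ℂ f x‖ ≤ 2 * B / r := by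
  refine Complex.norm_fderiv_le_div_of_mapsTo_ball hd (fun y hy => ?_) hr
  rw [Metric.mem_closedBall, dist_eq_norm]
  have h1 := hB y hy
  have h2 := hB x (Metric.mem_ball_self hr)
  exact (norm_sub_le _ _).trans (by linarith)

theorem norm_fderiv_le_pow {E F : Type*} [NormedAddCommGroup E] [NormedSpace ℂ E]
    [NormedAddCommGroup F] [NormedSpace ℂ F] {g : E → F} {K r : ℝ} {N : ℕ}
    (hg : ∀ y, ‖y‖ < r → DifferentiableAt ℂ g y ∧ ‖g y‖ ≤ K * ‖y‖ ^ (N + 2)) {z : E}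
    (hz : ‖z‖ < r / 2) : ‖fderiv ℂ g z‖ ≤ K * 2 ^ (N + 3) * ‖z‖ ^ (N + 1) := by
  rcases eq_or_ne z 0 with rfl | hz0
  · rw [norm_zero] at hz
    have : g =O[𝓝 0] fun y => ‖y - 0‖ ^ (N + 2) := by
      refine Asymptotics.IsBigO.of_bound K ?_
      filter_upwards [Metric.ball_mem_nhds (0 : E) (by linarith : 0 < r)] with y hy
      simpa using (hg y (mem_ball_zero_iff.1 hy)).2
    simp [(this.hasFDerivAt (𝕜 := ℂ) (by omega)).fderiv]
  · have hz1 : 0 < ‖z‖ := norm_pos_iff.2 hz0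
    have hK : 0 ≤ K :=
      nonneg_of_mul_nonneg_left ((norm_nonneg _).trans (hg z (by linarith)).2) (by positivity)
    have hle : ∀ y ∈ ball z ‖z‖, ‖y‖ < 2 * ‖z‖ := fun y hy => by
      rw [Metric.mem_ball, dist_eq_norm] at hy
      linarith [norm_le_norm_add_norm_sub' y z]
    refine (norm_fderiv_le_of_bound (B := K * (2 * ‖z‖) ^ (N + 2)) hz1
      (fun y hy => (hg y (by linarith [hle y hy])).1.differentiableWithinAt)
      fun y hy => (hg y (by linarith [hle y hy])).2.trans ?_).trans (le_of_eq ?_)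
    · have := (hle y hy).le
      gcongr
    · field_simp
      ring

theorem norm_toV_le (w : Λ) (i : Fin 4) : ‖toV s w i‖ ≤ ‖w‖ := by
  have hm : ∀ b x, ‖modeComp s b x‖ ≤ ‖x‖ := fun b x => by
    have := WSeq.norm_pull_le (w := fullWeight) (w' := zWeight) (s := s)
      (φ := fun j : ℤ => ((j, b) : Mode)) (h := ⟨inj_mode b, 1, zero_le_one, fun _ => (one_mul _).ge⟩)
      zero_le_one (fun _ => (one_mul _).ge) x
    rwa [one_mul] at this
  have hr : ∀ x : Four s, ‖reflect s x‖ ≤ ‖x‖ := fun x => by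
    have := WSeq.norm_pull_le (w := zWeight) (w' := zWeight) (s := s) (φ := fun n : ℤ => -n)
      (h := ⟨neg_injective, 1, zero_le_one, fun n => by rw [zWeight_neg, one_mul]⟩)
      zero_le_one (fun n => by rw [zWeight_neg, one_mul]) x
    rwa [one_mul] at this
  fin_cases i
  · exact (hm true w.1).trans (norm_fst_le w)
  · exact ((hr _).trans (hm true w.2)).trans (norm_snd_le w)
  · exact (hm false w.1).trans (norm_fst_le w)
  · exact ((hr _).trans (hm false w.2)).trans (norm_snd_le w)

theorem norm_quartGrad_le (c : Mult Quad) (w : Λ) :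
    ‖quartGrad c w‖ ≤ ‖gradP s‖ * triConst s * ‖w‖ ^ 3 := by
  have := triConst_nonneg s
  have h : ∀ c i j k, ‖tri c (toV s w i) (toV s w j) (toV s w k)‖ ≤ triConst s * ‖w‖ ^ 3 :=
    fun c i j k => (norm_tri_le _ _ _ _).trans (by
      have := norm_toV_le w
      calc _ ≤ triConst s * ‖w‖ * ‖w‖ * ‖w‖ := by gcongr <;> exact this _
        _ = _ := by ring)
  refine ((gradP s).le_opNorm _).trans ?_
  rw [mul_assoc]
  refine mul_le_mul_of_nonneg_left ((pi_norm_le_iff_of_nonneg (by positivity)).2 fun i => ?_)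
    (norm_nonneg _)
  fin_cases i <;> exact h _ _ _ _

theorem exists_quartGrad_bound (c : Mult Quad) : ∃ K : ℝ, 0 ≤ K ∧ (∀ w : Λ,
    ‖fderiv ℂ (quartGrad c) w‖ ≤ K * ‖w‖ ^ 2) ∧ (∀ w : Λ, ‖quartGrad c w‖ ≤ K * ‖w‖ ^ 3) ∧ ∀ r : ℝ,
    ∀ u v : Λ, ‖u‖ ≤ r → ‖v‖ ≤ r → ‖quartGrad c u - quartGrad c v‖ ≤ K * r ^ 2 * ‖u - v‖ := by
  have hdiff : ∀ w : Λ, DifferentiableAt ℂ (quartGrad c) w := fun w =>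
    ((isGrad_quart c).analytic_grad w (mem_univ w)).differentiableAt
  have hT : 0 ≤ ‖gradP s‖ * triConst s := mul_nonneg (norm_nonneg _) (triConst_nonneg s)
  have hKb : ∀ w : Λ, ‖fderiv ℂ (quartGrad c) w‖ ≤ ‖gradP s‖ * triConst s * 2 ^ 4 * ‖w‖ ^ 2 :=
    fun w => norm_fderiv_le_pow (N := 1) (r := 2 * ‖w‖ + 1)
      (fun y _ => ⟨hdiff y, norm_quartGrad_le c y⟩) (by linarith)
  refine ⟨_, by positivity, hKb, fun w => (norm_quartGrad_le c w).trans ?_, fun r u v hu hv => ?_⟩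
  · have := mul_nonneg hT (pow_nonneg (norm_nonneg w) 3)
    linarith
  · refine (convex_closedBall (0 : Λ) r).norm_image_sub_le_of_norm_fderiv_le (𝕜 := ℂ)
      (fun x _ => hdiff x) (fun x hx => (hKb x).trans ?_) (by simpa using hv) (by simpa using hu)
    have : ‖x‖ ≤ r := by simpa using hx
    gcongr

/-! ### The implicit midpoint map -/

/-- The solution `m` of `m - X(m)/2 = w`, for a map `X` that is small to third order. -/
theorem exists_midpoint {E : Type*} [NormedAddCommGroup E] [NormedSpace ℂ E] [CompleteSpace E]
    [Nontrivial E] {X : E → E} (hX : AnalyticOnNhd ℂ X univ) {K : ℝ} (hK0 : 0 ≤ K)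
    (hK : ∀ w, ‖fderiv ℂ X w‖ ≤ K * ‖w‖ ^ 2) (hXb : ∀ w, ‖X w‖ ≤ K * ‖w‖ ^ 3) :
    ∃ δ : ℝ, 0 < δ ∧ K * (2 * δ) ^ 2 ≤ 1 / 2 ∧ ∃ m : E → E, AnalyticOnNhd ℂ m (ball 0 δ) ∧
    ∀ w ∈ ball (0 : E) δ, m w - ½ • X (m w) = w ∧ ‖m w‖ ≤ 2 * ‖w‖ ∧ ∀ m',
    ‖m'‖ < 2 * δ → m' - ½ • X m' = w → m' = m w := by
  have hdiff : ∀ w, HasFDerivAt X (fderiv ℂ X w) w := fun w =>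
    (hX w (mem_univ w)).differentiableAt.hasFDerivAt
  set δ : ℝ := 1 / (4 * (K + 1)) with hδ
  have hδ0 : 0 < δ := by positivity
  have hKδ : K * (2 * δ) ^ 2 ≤ 1 / 2 := by
    have h1 : (K + 1) * δ = 1 / 4 := by rw [hδ]; field_simp
    have h2 : δ ≤ 1 / 4 := by nlinarith
    nlinarith
  set φ : E → E := fun m => m - ½ • X m with hφ
  have hφd : ∀ w, HasFDerivAt φ (ContinuousLinearMap.id ℂ E - ½ • fderiv ℂ X w) w :=
    fun w => (hasFDerivAt_id w).sub ((hdiff w).const_smul _)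
  have hhalf : ‖½‖ = 1 / 2 := by norm_num
  have hsm : ∀ w ∈ ball (0 : E) (2 * δ), ‖½ • fderiv ℂ X w‖ ≤ 1 / 4 := by
    intro w hw
    have hw' : ‖w‖ < 2 * δ := by simpa using hw
    have h1 : K * ‖w‖ ^ 2 ≤ K * (2 * δ) ^ 2 := by gcongr
    rw [norm_smul, hhalf]
    linarith [hK w]
  have happ : ApproximatesLinearOn φ (ContinuousLinearEquiv.refl ℂ E : E →L[ℂ] E) (ball 0 (2 * δ))
    (1 / 4) := by
    refine LipschitzOnWith.approximatesLinearOn ?_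
    refine (convex_ball (0 : E) (2 * δ)).lipschitzOnWith_of_nnnorm_hasFDerivWithin_le (𝕜 := ℂ)
      (f' := fun w => -(½ • fderiv ℂ X w)) (fun w _ => ?_) fun w hw => ?_
    · refine (((hφd w).sub (hasFDerivAt_id w)).congr_fderiv ?_).hasFDerivWithinAt
      ext x; simp
    · rw [nnnorm_neg, ← NNReal.coe_le_coe]
      simpa using hsm w hw
  have hN : (‖((ContinuousLinearEquiv.refl ℂ E).symm : E →L[ℂ] E)‖₊)⁻¹ = 1 := by
    have : ((ContinuousLinearEquiv.refl ℂ E).symm : E →L[ℂ] E) = ContinuousLinearMap.id ℂ E := rfl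
    rw [this]
    simp
  have hc : Subsingleton E ∨ (1 / 4 : NNReal) <
    (‖((ContinuousLinearEquiv.refl ℂ E).symm : E →L[ℂ] E)‖₊)⁻¹ := by
    right; rw [hN, ← NNReal.coe_lt_coe]; norm_num
  set e := happ.toOpenPartialHomeomorph φ _ hc Metric.isOpen_ball with he
  have hX0 : X 0 = 0 := by simpa using hXb 0
  have hφ0 : φ 0 = 0 := by simp [hφ, hX0]
  have htarget : ball (0 : E) δ ⊆ e.target := by
    intro w hw
    have hsub := happ.closedBall_subset_target hc Metric.isOpen_ball (b := 0) (ε := 3 / 2 * δ)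
      (by positivity) (Metric.closedBall_subset_ball (by linarith))
    apply hsub
    rw [hφ0, hN]
    have hw' : ‖w‖ < δ := by simpa using hw
    simp only [mem_closedBall_zero_iff]
    norm_num
    linarith
  refine ⟨δ, hδ0, hKδ, e.symm, fun w hw => ?_, fun w hw => ?_⟩
  · have hsrc : e.symm w ∈ ball (0 : E) (2 * δ) := e.map_target (htarget hw)
    have hlt : ‖½ • fderiv ℂ X (e.symm w)‖ < 1 := by linarith [hsm _ hsrc]
    set u := Units.oneSub (½ • fderiv ℂ X (e.symm w)) hlt with hu
    refine OpenPartialHomeomorph.analyticAt_symm e (i := ContinuousLinearEquiv.unitsEquiv ℂ E u)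
      (htarget hw) ?_ ?_
    · exact analyticAt_id.sub (analyticAt_const.smul (hX _ (mem_univ _)))
    · refine ((hφd (e.symm w)).fderiv).trans ?_
      ext x
      simp [hu]
  · have hsrc : e.symm w ∈ ball (0 : E) (2 * δ) := e.map_target (htarget hw)
    have heq : φ (e.symm w) = w := e.right_inv (htarget hw)
    refine ⟨heq, ?_, fun m' hm' hm'w => ?_⟩
    · have hn : ‖e.symm w‖ < 2 * δ := by simpa using hsrc
      have h1 : ‖½ • X (e.symm w)‖ ≤ 1 / 4 * ‖e.symm w‖ := by
        rw [norm_smul, hhalf]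
        have h2 := hXb (e.symm w)
        have h3 : K * ‖e.symm w‖ ^ 3 ≤ K * (2 * δ) ^ 2 * ‖e.symm w‖ := by
          have : K * ‖e.symm w‖ ^ 3 = K * ‖e.symm w‖ ^ 2 * ‖e.symm w‖ := by ring
          rw [this]
          gcongr
        nlinarith [norm_nonneg (e.symm w)]
      have h4 : ‖e.symm w‖ ≤ ‖φ (e.symm w)‖ + ‖½ • X (e.symm w)‖ := by
        have : e.symm w = φ (e.symm w) + ½ • X (e.symm w) := by simp [hφ]
        nth_rewrite 1 [this]
        exact norm_add_le _ _
      rw [heq] at h4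
      linarith [norm_nonneg w]
    · have hm's : m' ∈ e.source := by
        change m' ∈ ball (0 : E) (2 * δ)
        simpa using hm'
      have := e.left_inv hm's
      rw [← this]
      congr 1

/-! ### The Hamiltonian of the Birkhoff transformation -/

instance : Nontrivial Λ := by
  refine ⟨⟨(single (0, true), 0), 0, fun h => ?_⟩⟩
  have := congrArg (fun x : Λ => x.1 (0, true)) h
  simp at this

/-- The constant multiplier. -/
def oneMult : Mult Quad := ⟨fun _ => 1, fun _ => by simp⟩

/-- The frequency `k² + l² - i² - j²`, `l = i + j - k`, of a quartic monomial. -/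
def freq (t : Quad) : ℤ := t.2.2 ^ 2 + (t.1 + t.2.1 - t.2.2) ^ 2 - t.1 ^ 2 - t.2.1 ^ 2

/-- The multiplier of the resonant part. -/
def resMult : Mult Quad :=
  ⟨fun t => if freq t = 0 then 1 else 0, fun t => by by_cases h : freq t = 0 <;> simp [h]⟩

/-- The multiplier `1 / (k² + l² - i² - j²)` on the non-resonant monomials, which solves the
homological equation. -/
def chiMult : Mult Quad := ⟨fun t => ((freq t : ℤ) : ℂ)⁻¹, fun t => by
    rw [norm_inv, Complex.norm_intCast]
    rcases eq_or_ne (freq t) 0 with h | h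
    · simp [h]
    · exact inv_le_one_of_one_le₀ (by exact_mod_cast Int.one_le_abs h)⟩

theorem P4_eq (w : Λ) : P4 w = quartP oneMult w := by
  unfold P4 quartP quart
  refine tsum_congr fun t => ?_
  simp [oneMult]

theorem Z4_eq (w : Λ) : Z4 w = quartP resMult w := by
  unfold Z4 quartP quart
  refine tsum_congr fun t => ?_
  have : t.2.2 ^ 2 + (t.1 + t.2.1 - t.2.2) ^ 2 = t.1 ^ 2 + t.2.1 ^ 2 ↔ freq t = 0 := by
    unfold freq; omega
  simp [resMult, this]

/-- The map `(u, ū) ↦ (ū, -u)`. -/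
def symJ (s : ℝ) : PSpace s →L[ℂ] PSpace s := (snd ℂ _ _).prod (-fst ℂ _ _)

@[simp] theorem symJ_apply (u : Λ) : symJ s u = (u.2, -u.1) := rfl

theorem norm_symJ_apply (u : Λ) : ‖symJ s u‖ = ‖u‖ := by
  rw [symJ_apply, Prod.norm_def, Prod.norm_def, norm_neg, max_comm]

theorem beta_symJ (u v : Λ) : beta (symJ s u) v = -beta u (symJ s v) := by
  simp only [beta_apply, symJ_apply, map_neg, neg_apply]
  ring

theorem omegaP_eq (u v : Λ) : omegaP u v = -I * beta u (symJ s v) := by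
  have h : ∑' α : Mode, (u.1 α * v.2 α - u.2 α * v.1 α) = dotM u.1 v.2 - dotM u.2 v.1 := by
    rw [dotM_apply, dotM_apply, (summable_dotM _ _).tsum_sub (summable_dotM _ _)]
  rw [omegaP, h, beta_apply]
  simp only [symJ_apply, map_neg]
  ring

/-- The Hamiltonian vector field of the transformation. -/
def vecX (w : Λ) : Λ := symJ s (quartGrad chiMult w)

theorem analytic_vecX : AnalyticOnNhd ℂ (vecX (s := s)) univ := fun w _ =>
  ((symJ s).analyticAt _).comp ((isGrad_quart chiMult).analytic_grad w (mem_univ w))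

theorem fderiv_vecX (w : Λ) :
    fderiv ℂ (vecX) w = (symJ s).comp (fderiv ℂ (quartGrad chiMult) w) := ((symJ s).hasFDerivAt.comp
    w ((isGrad_quart chiMult).analytic_grad w (mem_univ w)).differentiableAt.hasFDerivAt).fderiv

/-- Symmetry of the second derivative of the Hamiltonian `χ`. -/
theorem beta_fderiv_chi_symm (w u v : Λ) : beta (fderiv ℂ (quartGrad chiMult) w u) v = beta
    (fderiv ℂ (quartGrad chiMult) w v) u := (isGrad_quart chiMult).symm isOpen_univ (mem_univ w) u v

theorem omegaP_fderiv_vecX (w u v : Λ) :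
    omegaP (fderiv ℂ (vecX) w u) v = -omegaP u (fderiv ℂ (vecX) w v) := by
  have e : ∀ x : Λ, symJ s (symJ s x) = -x := fun x => rfl
  rw [omegaP_eq, omegaP_eq, fderiv_vecX, ContinuousLinearMap.comp_apply,
    ContinuousLinearMap.comp_apply, e, beta_symJ, e, map_neg, map_neg, beta_fderiv_chi_symm,
    beta_comm u, beta_fderiv_chi_symm]
  ring

/-- The sequence `(κ_j x_{j±})` for a finitely supported `x`. -/
def mulFin (κ : ℤ → ℂ) (x : MSeq s) (hx : ∀ᶠ α in cofinite, x α = 0) :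
    MSeq s := ⟨fun α => κ α.1 * x α, by
    refine summable_of_hasFiniteSupport ((show {α | ¬ x α = 0}.Finite from hx).subset fun α hα => ?_)
    intro h
    simp [h] at hα⟩

theorem modePair_apply {κ : ℤ → ℂ} {hκ : ∀ n, ‖κ n‖ ≤ zWeight.val n ^ (2 * s)}
    (x y : MSeq s) : modePair s κ hκ x y = ∑' α : Mode, κ α.1 * (x α * y α) := rfl

/-- The Poisson bracket of a quartic Hamiltonian with `∑ κ_j (a_j ā_j + b_j b̄_j)`. -/
theorem modePair_quartGrad {κ : ℤ → ℂ} {hκ : ∀ n, ‖κ n‖ ≤ zWeight.val n ^ (2 * s)} {c c' :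
    Mult Quad} (hc : ∀ t, c'.1 t = c.1 t * (κ t.1 + κ t.2.1 - κ t.2.2 - κ (t.1 + t.2.1 - t.2.2)))
    (w : Λ) : modePair s κ hκ w.2 (quartGrad c w).2 - modePair s κ hκ w.1 (quartGrad c w).1 =
    quartP c' w := by
  have hG : Continuous (quartGrad (s := s) c) := continuous_iff_continuousAt.2 fun w =>
    ((isGrad_quart c).analytic_grad w (mem_univ w)).continuousAt
  have hQ : Continuous (quartP c' : Λ → ℂ) := continuous_iff_continuousAt.2 fun w =>
    ((isGrad_quart c').analytic w (mem_univ w)).continuousAt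
  have hP : ∀ f g : Λ → MSeq s, Continuous f → Continuous g →
    Continuous fun w => modePair s κ hκ (f w) (g w) := fun f g hf hg =>
    ((modePair s κ hκ).continuous.comp hf).clm_apply hg
  refine WSeq.eq_of_eq_on_finsupp (f := fun w : Λ => modePair s κ hκ w.2 (quartGrad c w).2 -
    modePair s κ hκ w.1 (quartGrad c w).1) (g := quartP c') ((hP _ _ continuous_snd
    (continuous_snd.comp hG)).sub (hP _ _ continuous_fst (continuous_fst.comp hG))) hQ (fun w hw =>
    ?_) w
  have h1 : ∀ᶠ α in cofinite, w.1 α = 0 := hw.mono fun α h => h.1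
  have h2 : ∀ᶠ α in cofinite, w.2 α = 0 := hw.mono fun α h => h.2
  have hpair : ∀ (x y : MSeq s) (hx : ∀ᶠ α in cofinite, x α = 0),
      modePair s κ hκ x y = dotM y (mulFin κ x hx) := fun x y hx => by
    rw [dotM_apply, modePair_apply]
    refine tsum_congr fun α => ?_
    change _ = _ * (κ α.1 * x α)
    ring
  have e1 : modePair s κ hκ w.1 (quartGrad c w).1 = beta (quartGrad c w) (mulFin κ w.1 h1, 0) := by
    rw [beta_apply, hpair _ _ h1, map_zero, add_zero]
  have e2 : modePair s κ hκ w.2 (quartGrad c w).2 = beta (quartGrad c w) (0, mulFin κ w.2 h2) := by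
    rw [beta_apply, hpair _ _ h2, map_zero, zero_add]
  have hzero : ∀ a a' b b' : ℤ → ℂ, quart c 0 a' b b' = 0 ∧ quart c a 0 b b' = 0 ∧ quart c a a' 0 b'
    = 0 ∧ quart c a a' b 0 = 0 := by
    intro a a' b b'
    simp [quart]
  have hs0 : ∀ a a' b b' : Four s, HasSum (fun t : Quad =>
      c.1 t * (a t.2.2 * b (t.1 + t.2.1 - t.2.2) * a' (-t.1) * b' (-t.2.1)))
      (quart c a a' b b') := fun a a' b b' => (summable_quart c a a' b b').hasSum
  change modePair s κ hκ w.2 (quartGrad c w).2 - modePair s κ hκ w.1 (quartGrad c w).1 = _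
  rw [e1, e2, beta_quartGrad, beta_quartGrad]
  rw [show quart c (toV s (0, mulFin κ w.2 h2) 0) (toV s w 1) (toV s w 2) (toV s w 3) = 0 from
      (hzero 0 _ _ _).1,
    show quart c (toV s w 0) (toV s w 1) (toV s (0, mulFin κ w.2 h2) 2) (toV s w 3) = 0 from
      (hzero _ _ 0 _).2.2.1]
  have z1 : (toV s (mulFin κ w.1 h1, 0) 1).1 = 0 := rfl
  have z3 : (toV s (mulFin κ w.1 h1, 0) 3).1 = 0 := rfl
  rw [z1, z3, (hzero _ 0 _ _).2.1, (hzero _ _ _ 0).2.2.2]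
  have hA := (((hs0 (toV s w 0) (toV s (0, mulFin κ w.2 h2) 1) (toV s w 2) (toV s w 3)).add
    (hs0 (toV s w 0) (toV s w 1) (toV s w 2) (toV s (0, mulFin κ w.2 h2) 3))).sub
    ((hs0 (toV s (mulFin κ w.1 h1, 0) 0) (toV s w 1) (toV s w 2) (toV s w 3)).add
    (hs0 (toV s w 0) (toV s w 1) (toV s (mulFin κ w.1 h1, 0) 2) (toV s w 3))))
  simp only [zero_add, add_zero]
  refine hA.unique ?_
  have hB := (summable_quart c' (toV s w 0) (toV s w 1) (toV s w 2) (toV s w 3)).hasSum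
  refine HasSum.congr_fun hB fun t => ?_
  have v1 : ∀ n, (toV s (mulFin κ w.1 h1, 0) 0) n = κ n * w.1 (n, true) := fun _ => rfl
  have v2 : ∀ n, (toV s (mulFin κ w.1 h1, 0) 2) n = κ n * w.1 (n, false) := fun _ => rfl
  have v3 : ∀ n, (toV s (0, mulFin κ w.2 h2) 1) n = κ (-n) * w.2 (-n, true) := fun _ => rfl
  have v4 : ∀ n, (toV s (0, mulFin κ w.2 h2) 3) n = κ (-n) * w.2 (-n, false) := fun _ => rfl
  simp only [v1, v2, v3, v4, toV_zero, toV_one, toV_two, toV_three, neg_neg, hc]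
  ring

/-! ### Weighted sums over the modes -/

/-- The square of a weighted norm on the phase space. -/
def energy (ω : ℤ → ℝ≥0∞) (w : Λ) : ℝ≥0∞ := ∑ i, ∑' n, (ω n * ‖toV s w i n‖ₑ) ^ 2

/-- The components of the vector field as functions on the circle. -/
theorem toV_vecX (w : Λ) (n : ℤ) :
    toV s (vecX w) 0 n = tri (chiMult.comp solveA') (toV s w 0) (toV s w 3) (toV s w 2) n ∧
    toV s (vecX w) 1 n = -tri (chiMult.comp solveA) (toV s w 1) (toV s w 3) (toV s w 2) n ∧
    toV s (vecX w) 2 n = tri (chiMult.comp solveB') (toV s w 0) (toV s w 1) (toV s w 2) n ∧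
    toV s (vecX w) 3 n = -tri (chiMult.comp solveB) (toV s w 1) (toV s w 3) (toV s w 0) n := by
  refine ⟨?_, ?_, ?_, ?_⟩
  · exact gradP_snd_true _ n
  · change -(quartGrad chiMult w).1 (-n, true) = _
    rw [quartGrad, gradP_fst_true, neg_neg]
    rfl
  · exact gradP_snd_false _ n
  · change -(quartGrad chiMult w).1 (-n, false) = _
    rw [quartGrad, gradP_fst_false, neg_neg]
    rfl

/-- The tame estimate: the weight `ω` falls on one factor only. -/
theorem energy_vecX_le {ω : ℤ → ℝ≥0∞} (hω : ∀ i j k, ω (i + j + k) ≤ ω i + ω j + ω k) (w : Λ) :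
    energy ω (vecX w) ≤ 36 * ENNReal.ofReal (l1Const s) ^ 4 * ‖w‖ₑ ^ 4 * energy ω w := by
  have hω1 : ∀ i j k, ω (i + j + k) ≤ 1 * (ω i + ω j + ω k) := fun i j k => by
    rw [one_mul]; exact hω i j k
  have hle : ∀ i, ‖toV s w i‖ₑ ≤ ‖w‖ₑ := fun i => by
    rw [← ofReal_norm, ← ofReal_norm]
    exact ENNReal.ofReal_le_ofReal (norm_toV_le w i)
  have hE : ∀ i, ∑' n, (ω n * ‖toV s w i n‖ₑ) ^ 2 ≤ energy ω w := fun i =>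
    Finset.single_le_sum (f := fun i => ∑' n, (ω n * ‖toV s w i n‖ₑ) ^ 2) (fun _ _ => zero_le)
      (Finset.mem_univ i)
  have key : ∀ (c : Mult Quad) (i j k : Fin 4), ∑' n, (ω n * ‖tri c (toV s w i) (toV s w j) (toV s w
    k) n‖ₑ) ^ 2 ≤ 9 * ENNReal.ofReal (l1Const s) ^ 4 * ‖w‖ₑ ^ 4 * energy ω w := by
    intro c i j k
    refine (weighted_triFun_le hω1 c (toV s w i) (toV s w j) (toV s w k)).trans ?_
    calc _ ≤ 3 * 1 ^ 2 * ENNReal.ofReal (l1Const s) ^ 4 *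
          (‖w‖ₑ ^ 2 * ‖w‖ₑ ^ 2 * energy ω w + ‖w‖ₑ ^ 2 * ‖w‖ₑ ^ 2 * energy ω w +
            ‖w‖ₑ ^ 2 * ‖w‖ₑ ^ 2 * energy ω w) := by
          gcongr <;> first | exact hle _ | exact hE _
      _ = _ := by ring
  rw [energy, Fin.sum_univ_four]
  simp_rw [fun n => (toV_vecX w n).1, fun n => (toV_vecX w n).2.1,
    fun n => (toV_vecX w n).2.2.1, fun n => (toV_vecX w n).2.2.2, enorm_neg]
  refine (add_le_add (add_le_add (add_le_add (key _ _ _ _) (key _ _ _ _)) (key _ _ _ _))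
    (key _ _ _ _)).trans (le_of_eq ?_)
  ring

theorem energy_congr {s' : ℝ} (ω : ℤ → ℝ≥0∞) {w : Λ} {w' : PSpace s'}
    (h : ∀ α, w.1 α = w'.1 α ∧ w.2 α = w'.2 α) : energy ω w = energy ω w' := by
  unfold energy
  refine Finset.sum_congr rfl fun i _ => tsum_congr fun n => ?_
  have : toV s w i n = toV s' w' i n := by
    fin_cases i
    · exact (h _).1
    · exact (h _).2
    · exact (h _).1
    · exact (h _).2
  rw [this]

theorem energy_sub_le (ω : ℤ → ℝ≥0∞) (u v : Λ) :
    energy ω (u + v) ≤ 2 * energy ω u + 2 * energy ω v := by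
  have sq2 : ∀ a b : ℝ≥0∞, (a + b) ^ 2 ≤ 2 * a ^ 2 + 2 * b ^ 2 := by
    intro a b
    rcases eq_or_ne a ⊤ with rfl | ha
    · simp
    rcases eq_or_ne b ⊤ with rfl | hb
    · simp
    lift a to NNReal using ha
    lift b to NNReal using hb
    norm_cast
    rw [← NNReal.coe_le_coe]
    push_cast
    nlinarith [sq_nonneg ((a : ℝ) - b)]
  unfold energy
  rw [Finset.mul_sum, Finset.mul_sum, ← Finset.sum_add_distrib]
  refine Finset.sum_le_sum fun i _ => ?_
  rw [← ENNReal.tsum_mul_left, ← ENNReal.tsum_mul_left, ← ENNReal.tsum_add]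
  refine ENNReal.tsum_le_tsum fun n => ?_
  have : toV s (u + v) i n = toV s u i n + toV s v i n := by
    rw [map_add, Pi.add_apply, WSeq.add_apply]
  rw [this]
  calc _ ≤ (ω n * ‖toV s u i n‖ₑ + ω n * ‖toV s v i n‖ₑ) ^ 2 := by
        rw [← mul_add]
        gcongr
        exact enorm_add_le _ _
    _ ≤ _ := sq2 _ _

theorem energy_half (ω : ℤ → ℝ≥0∞) (u : Λ) : 4 * energy ω (½ • u) = energy ω u := by
  unfold energy
  rw [Finset.mul_sum]
  refine Finset.sum_congr rfl fun i _ => ?_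
  rw [← ENNReal.tsum_mul_left]
  refine tsum_congr fun n => ?_
  have : toV s u i n = 2 * toV s (½ • u) i n := by
    rw [map_smul, Pi.smul_apply, WSeq.smul_apply]
    ring
  rw [this, enorm_mul]
  have h2 : ‖(2 : ℂ)‖ₑ = 2 := by rw [← ofReal_norm]; simp
  rw [h2]
  ring

theorem energy_lt_top_of_bounded {ω : ℤ → ℝ≥0∞} {B : ℝ≥0∞} (hB : B ≠ ⊤)
    (hω : ∀ n, ω n ≤ B) (w : Λ) : energy ω w ≠ ⊤ := by
  unfold energy
  refine (ENNReal.sum_lt_top.2 fun i _ => ?_).ne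
  refine lt_of_le_of_lt (b := B ^ 2 * ‖toV s w i‖ₑ ^ 2) ?_ (by
    refine ENNReal.mul_lt_top (ENNReal.pow_lt_top (lt_top_iff_ne_top.2 hB)) (by finiteness))
  rw [← WSeq.eSq_coe, WSeq.eSq, ← ENNReal.tsum_mul_left]
  refine ENNReal.tsum_le_tsum fun n => ?_
  rw [mul_pow, mul_pow]
  gcongr
  · exact hω n
  · calc ‖toV s w i n‖ₑ ^ 2 = 1 ^ 2 * ‖toV s w i n‖ₑ ^ 2 := by ring
      _ ≤ _ := by
        gcongr
        exact ENNReal.one_le_ofReal.2 (Real.one_le_rpow (one_le_zWeight n) (by linarith [hs.out]))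

/-- Finite energy in terms of the weight `(1 + n²)^{1/2}`. -/
theorem finiteEnergy_iff (w : Λ) : FiniteEnergy w ↔ w.1.1 ∈ weightedSubmodule fullWeight 1 ∧ w.2.1 ∈
    weightedSubmodule fullWeight 1 := by
  have hsq : ∀ α : Mode, fullWeight.val α ^ (2 * (1 : ℝ)) = 1 + (α.1 : ℝ) ^ 2 := fun α => by
    rw [mul_one, Real.rpow_two]
    exact Real.sq_sqrt (by positivity)
  have hbase : ∀ x : MSeq s, Summable fun α => ‖x α‖ ^ 2 := fun x => by
    refine Summable.of_nonneg_of_le (fun α => by positivity) (fun α => ?_) x.summable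
    have := Real.one_le_rpow (one_le_fullWeight α) (by linarith [hs.out] : 0 ≤ 2 * s)
    nlinarith [sq_nonneg ‖x α‖]
  have hmem : ∀ x : MSeq s, x.1 ∈ weightedSubmodule fullWeight 1 ↔ Summable fun α : Mode => (α.1 :
    ℝ) ^ 2 * ‖x α‖ ^ 2 := fun x => by
    change (Summable fun α => ‖x α‖ ^ 2 * fullWeight.val α ^ (2 * (1 : ℝ))) ↔ _
    simp_rw [hsq]
    constructor
    · intro h
      exact (h.sub (hbase x)).congr fun α => by ring
    · intro h
      exact (h.add (hbase x)).congr fun α => by ring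
  rw [hmem, hmem, FiniteEnergy]
  constructor
  · intro h
    exact ⟨Summable.of_nonneg_of_le (fun α => by positivity) (fun α => by
        gcongr; linarith [sq_nonneg ‖w.2 α‖]) h,
      Summable.of_nonneg_of_le (fun α => by positivity) (fun α => by
        gcongr; linarith [sq_nonneg ‖w.1 α‖]) h⟩
  · rintro ⟨h1, h2⟩
    exact (h1.add h2).congr fun α => by ring

instance : Fact ((1 : ℝ) / 2 < 1) := ⟨by norm_num⟩

/-- A point of finite energy as a point of the phase space with `s = 1`. -/
theorem FiniteEnergy.exists_lift {w : Λ} (hw : FiniteEnergy w) : ∃ w' : PSpace 1, ∀ α,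
    w.1 α = w'.1 α ∧ w.2 α = w'.2 α := ⟨(⟨w.1.1, ((finiteEnergy_iff w).1 hw).1⟩,
    ⟨w.2.1, ((finiteEnergy_iff w).1 hw).2⟩), fun _ => ⟨rfl, rfl⟩⟩

theorem finiteEnergy_of_lift {w : Λ} {w' : PSpace 1}
    (h : ∀ α, w.1 α = w'.1 α ∧ w.2 α = w'.2 α) : FiniteEnergy w := by
  refine (finiteEnergy_iff w).2 ⟨?_, ?_⟩
  · have : w.1.1 = w'.1.1 := funext fun α => (h α).1
    rw [this]; exact w'.1.2
  · have : w.2.1 = w'.2.1 := funext fun α => (h α).2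
    rw [this]; exact w'.2.2

/-- The weight `(1 + n²)^{1/2}` with values in `[0, ∞]`. -/
def eWeight (n : ℤ) : ℝ≥0∞ := ENNReal.ofReal (zWeight.val n ^ (1 : ℝ))

theorem finiteEnergy_iff_energy (w : Λ) : FiniteEnergy w ↔ energy eWeight w ≠ ⊤ := by
  constructor
  · intro hw
    obtain ⟨w', h⟩ := hw.exists_lift
    rw [energy_congr eWeight h, energy]
    refine (ENNReal.sum_lt_top.2 fun i _ => ?_).ne
    have : ∑' n, (eWeight n * ‖toV 1 w' i n‖ₑ) ^ 2 = ‖toV 1 w' i‖ₑ ^ 2 := WSeq.eSq_coe _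
    rw [this]
    finiteness
  · intro hw
    have hi : ∀ i, (toV s w i).1 ∈ weightedSubmodule zWeight 1 := fun i =>
      WSeq.mem_iff_eSq.2 (ne_top_of_le_ne_top hw (Finset.single_le_sum (f := fun i => ∑' n,
        (eWeight n * ‖toV s w i n‖ₑ) ^ 2) (fun _ _ => zero_le) (Finset.mem_univ i)))
    have hy : ∀ i, ∃ y : Four 1, ∀ n, y n = toV s w i n := fun i => ⟨⟨_, hi i⟩, fun _ => rfl⟩
    choose y hy using hy
    refine finiteEnergy_of_lift (w' := (modeIncl 1 true (y 0) + modeIncl 1 false (y 2),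
      modeIncl 1 true (reflect 1 (y 1)) + modeIncl 1 false (reflect 1 (y 3)))) fun α => ?_
    obtain ⟨j, b⟩ := α
    cases b
    · refine ⟨?_, ?_⟩
      · rw [WSeq.add_apply, modeIncl_apply, modeIncl_apply_ne (by decide), zero_add, hy]
        rfl
      · rw [WSeq.add_apply, modeIncl_apply, modeIncl_apply_ne (by decide), zero_add, reflect_apply, hy]
        exact (congrArg (fun k => w.2 (k, false)) (neg_neg j)).symm
    · refine ⟨?_, ?_⟩
      · rw [WSeq.add_apply, modeIncl_apply, modeIncl_apply_ne (by decide), add_zero, hy]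
        rfl
      · rw [WSeq.add_apply, modeIncl_apply, modeIncl_apply_ne (by decide), add_zero, reflect_apply, hy]
        exact (congrArg (fun k => w.2 (k, true)) (neg_neg j)).symm

/-- If `m - X(m)/2 = w` with `m` small, then `m` has finite energy with `w`. -/
theorem finiteEnergy_of_midpoint {m w : Λ} (hm : m - ½ • vecX m = w)
    (hsmall : 6 * l1Const s * ‖m‖ ≤ 1) (hw : FiniteEnergy w) : FiniteEnergy m := by
  rw [finiteEnergy_iff_energy] at hw ⊢
  have hL := l1Const_nonneg s
  have hmw : w + ½ • vecX m = m := by rw [← hm]; abel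
  have hcoef : 36 * ENNReal.ofReal (l1Const s) ^ 4 * ‖m‖ₑ ^ 4 ≤ 1 := by
    rw [← ofReal_norm, ← ENNReal.ofReal_pow hL, ← ENNReal.ofReal_pow (norm_nonneg _),
      ← ENNReal.ofReal_ofNat 36, ← ENNReal.ofReal_mul (by norm_num),
      ← ENNReal.ofReal_mul (by positivity)]
    refine ENNReal.ofReal_le_one.2 ?_
    have h1 : 0 ≤ l1Const s * ‖m‖ := by positivity
    have h2 : l1Const s * ‖m‖ ≤ 1 / 6 := by linarith
    have h3 : 36 * l1Const s ^ 4 * ‖m‖ ^ 4 = 36 * (l1Const s * ‖m‖) ^ 4 := by ring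
    rw [h3]
    have h4 : (l1Const s * ‖m‖) ^ 4 ≤ (1 / 6) ^ 4 := by gcongr
    linarith
  have hbdd : ∀ B : ℝ≥0∞, B ≠ ⊤ → energy (fun n => min B (eWeight n)) m ≤ 4 * energy eWeight w := by
    intro B hB
    set ω : ℤ → ℝ≥0∞ := fun n => min B (eWeight n) with hω
    have hsub : ∀ i j k, ω (i + j + k) ≤ ω i + ω j + ω k := by
      have two : ∀ i j, ω (i + j) ≤ ω i + ω j := by
        intro i j
        have h1 : eWeight (i + j) ≤ eWeight i + eWeight j := by
          unfold eWeight
          simp only [Real.rpow_one]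
          rw [← ENNReal.ofReal_add (zWeight.pos i).le (zWeight.pos j).le]
          exact ENNReal.ofReal_le_ofReal (zWeight_add_le i j)
        exact (min_le_min_left B h1).trans ((min_add_distrib _ _ _).le.trans (min_le_right _ _))
      intro i j k
      exact (two _ _).trans (by gcongr; exact two _ _)
    have hfin : energy ω m ≠ ⊤ := energy_lt_top_of_bounded hB (fun n => min_le_left _ _) m
    have h1 : energy ω m ≤ 2 * energy ω w + 2 * energy ω (½ • vecX m) := by
      nth_rewrite 1 [← hmw]
      exact energy_sub_le ω _ _
    have h2 : 4 * energy ω (½ • vecX m) ≤ energy ω m := by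
      rw [energy_half]
      refine (energy_vecX_le hsub m).trans ?_
      calc _ ≤ 1 * energy ω m := by gcongr
        _ = _ := one_mul _
    have h3 : 2 * energy ω m ≤ 4 * energy ω w + energy ω m := by
      calc 2 * energy ω m ≤ 2 * (2 * energy ω w + 2 * energy ω (½ • vecX m)) := by
            gcongr
        _ = 4 * energy ω w + 4 * energy ω (½ • vecX m) := by ring
        _ ≤ _ := by gcongr
    rw [two_mul] at h3
    have h4 := (ENNReal.add_le_add_iff_right hfin).1 h3
    refine h4.trans ?_
    unfold energy
    gcongr
    exact min_le_right _ _
  have hlim : energy eWeight m ≤ 4 * energy eWeight w := by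
    have e : energy eWeight m = ∑' n, ∑ i, (eWeight n * ‖toV s m i n‖ₑ) ^ 2 := by
      unfold energy
      rw [Summable.tsum_finsetSum fun i _ => ENNReal.summable]
    rw [e, ENNReal.tsum_eq_iSup_sum]
    refine iSup_le fun F => ?_
    refine le_trans ?_
      (hbdd (∑ n ∈ F, eWeight n) (ENNReal.sum_lt_top.2 fun n _ => ENNReal.ofReal_lt_top).ne)
    unfold energy
    rw [Finset.sum_comm]
    refine Finset.sum_le_sum fun i _ => ?_
    refine le_trans (Finset.sum_le_sum fun n hn => ?_) (ENNReal.sum_le_tsum F)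
    exact pow_le_pow_left' (mul_le_mul_left (le_min
      (Finset.single_le_sum (f := eWeight) (fun _ _ => zero_le) hn) le_rfl) _) 2
  exact ne_top_of_le_ne_top (by finiteness) hlim

/-- Points with the same coordinates in different spaces have vector fields with the same
coordinates. -/
theorem quartGrad_congr {s' : ℝ} [hs' : Fact (1 / 2 < s')] (c : Mult Quad) {w : Λ} {w' : PSpace s'}
    (h : ∀ α, w.1 α = w'.1 α ∧ w.2 α = w'.2 α) (α : Mode) :
    (quartGrad c w).1 α = (quartGrad c w').1 α ∧ (quartGrad c w).2 α = (quartGrad c w').2 α := by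
  have hV : ∀ i, (toV s w i).1 = (toV s' w' i).1 := by
    intro i
    funext n
    fin_cases i
    · exact (h _).1
    · exact (h _).2
    · exact (h _).1
    · exact (h _).2
  have ht : ∀ c i j k n, tri c (toV s w i) (toV s w j) (toV s w k) n =
    tri c (toV s' w' i) (toV s' w' j) (toV s' w' k) n := by
    intro c i j k n
    rw [tri_apply, tri_apply, hV, hV, hV]
  obtain ⟨j, b⟩ := α
  cases b
  · refine ⟨?_, ?_⟩
    · rw [quartGrad, quartGrad, gradP_fst_false, gradP_fst_false]
      exact ht _ 1 3 0 _
    · rw [quartGrad, quartGrad, gradP_snd_false, gradP_snd_false]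
      exact ht _ 0 1 2 _
  · refine ⟨?_, ?_⟩
    · rw [quartGrad, quartGrad, gradP_fst_true, gradP_fst_true]
      exact ht _ 1 3 2 _
    · rw [quartGrad, quartGrad, gradP_snd_true, gradP_snd_true]
      exact ht _ 0 3 2 _

theorem quartP_congr {s' : ℝ} [hs' : Fact (1 / 2 < s')] (c : Mult Quad) {w : Λ} {w' : PSpace s'}
    (h : ∀ α, w.1 α = w'.1 α ∧ w.2 α = w'.2 α) : quartP c w = quartP c w' := by
  unfold quartP quart
  refine tsum_congr fun t => ?_
  simp only [toV_zero, toV_one, toV_two, toV_three, (h _).1, (h _).2]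

/-- The quadratic integrals along one step of the midpoint map. -/
theorem modePair_midpoint {κ : ℤ → ℂ} {hκ : ∀ n, ‖κ n‖ ≤ zWeight.val n ^ (2 * s)} {c' : Mult Quad}
    (hc : ∀ t, c'.1 t = chiMult.1 t * (κ t.1 + κ t.2.1 - κ t.2.2 - κ (t.1 + t.2.1 - t.2.2)))
    (m h : Λ) (hh : h = ½ • vecX m) :
    modePair s κ hκ (m + h).1 (m + h).2 = modePair s κ hκ (m - h).1 (m - h).2 + quartP c' m := by
  have comm : ∀ x y, modePair s κ hκ x y = modePair s κ hκ y x := fun x y => by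
    rw [modePair_apply, modePair_apply]
    exact tsum_congr fun α => by ring
  rw [← modePair_quartGrad hc m (hκ := hκ)]
  have e1 : h.1 = ½ • (quartGrad chiMult m).2 := by rw [hh]; rfl
  have e2 : h.2 = ½ • -(quartGrad chiMult m).1 := by rw [hh]; rfl
  simp only [Prod.fst_add, Prod.snd_add, Prod.fst_sub, Prod.snd_sub, e1, e2, map_add, map_sub,
    map_smul, map_neg, add_apply, sub_apply, smul_apply, smul_eq_mul, smul_neg]
  rw [comm (quartGrad chiMult m).2 m.2]
  ring

theorem freq_mul_chi (t : Quad) : chiMult.1 t * (freq t : ℂ) = oneMult.1 t - resMult.1 t := by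
  by_cases h : freq t = 0
  · simp [chiMult, oneMult, resMult, h]
  · simp [chiMult, oneMult, resMult, h]

/-- The multiplier of `Z₄ - P₄`. -/
def homMult : Mult Quad := ⟨fun t => resMult.1 t - oneMult.1 t, fun t => by
    by_cases h : freq t = 0 <;> simp [oneMult, resMult, h]⟩

theorem quartP_homMult (w : Λ) : quartP homMult w = Z4 w - P4 w := by
  rw [Z4_eq, P4_eq]
  unfold quartP quart
  rw [← (summable_quart resMult _ _ _ _).tsum_sub (summable_quart oneMult _ _ _ _)]
  refine tsum_congr fun t => ?_
  rw [← sub_mul]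
  rfl

theorem mass_midpoint (m h : Λ) (hh : h = ½ • vecX m) : mass (m + h) = mass (m - h) := by
  have := modePair_midpoint (κ := fun _ => 1) (hκ := norm_one_le_zWeight)
    (c' := ⟨fun _ => 0, fun _ => by simp⟩) (fun t => by simp) m h hh
  have h0 : quartP ⟨fun _ => 0, fun _ => by simp⟩ m = 0 := by simp [quartP, quart]
  rw [h0, add_zero, modePair_apply, modePair_apply] at this
  simpa [mass] using this

theorem momentum_midpoint (m h : Λ)
    (hh : h = ½ • vecX m) : momentum (m + h) = momentum (m - h) := by
  have hκ : ∀ n : ℤ, ‖((n : ℤ) : ℂ)‖ ≤ zWeight.val n ^ (2 * s) := fun n => by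
    rw [Complex.norm_intCast]
    refine (abs_le_zWeight n).trans ?_
    exact Real.self_le_rpow_of_one_le (one_le_zWeight n) (by linarith [hs.out])
  have := modePair_midpoint (κ := fun n => (n : ℂ)) (hκ := hκ)
    (c' := ⟨fun _ => 0, fun _ => by simp⟩) (fun t => by push_cast; ring) m h hh
  have h0 : quartP ⟨fun _ => 0, fun _ => by simp⟩ m = 0 := by simp [quartP, quart]
  rw [h0, add_zero, modePair_apply, modePair_apply] at this
  exact this

/-- The homological equation: along one step of the midpoint map, the change of `P₂` is
`Z₄ - P₄` at the midpoint. -/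
theorem P2_midpoint (m h : Λ) (hh : h = ½ • vecX m) (hm : FiniteEnergy m) :
    FiniteEnergy (m + h) ∧ P2 (m + h) = P2 (m - h) + (Z4 m - P4 m) := by
  obtain ⟨m', hm'⟩ := hm.exists_lift
  set h' : PSpace 1 := ½ • vecX m' with hh'
  have hX : ∀ α, h.1 α = h'.1 α ∧ h.2 α = h'.2 α := by
    intro α
    have := quartGrad_congr chiMult hm' α
    rw [hh, hh']
    refine ⟨?_, ?_⟩
    · change _ * (quartGrad chiMult m).2 α = _ * (quartGrad chiMult m').2 α
      rw [this.2]
    · change _ * -(quartGrad chiMult m).1 α = _ * -(quartGrad chiMult m').1 α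
      rw [this.1]
  have hadd : ∀ α, (m + h).1 α = (m' + h').1 α ∧ (m + h).2 α = (m' + h').2 α := fun α =>
    ⟨congrArg₂ (· + ·) (hm' α).1 (hX α).1, congrArg₂ (· + ·) (hm' α).2 (hX α).2⟩
  have hsub : ∀ α, (m - h).1 α = (m' - h').1 α ∧ (m - h).2 α = (m' - h').2 α := fun α =>
    ⟨congrArg₂ (· - ·) (hm' α).1 (hX α).1, congrArg₂ (· - ·) (hm' α).2 (hX α).2⟩
  refine ⟨finiteEnergy_of_lift hadd, ?_⟩
  have hκ : ∀ n : ℤ, ‖((n : ℤ) : ℂ) ^ 2‖ ≤ zWeight.val n ^ (2 * (1 : ℝ)) := fun n => by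
    rw [norm_pow, Complex.norm_intCast, mul_one, Real.rpow_two]
    gcongr
    exact abs_le_zWeight n
  have key := modePair_midpoint (κ := fun n => (n : ℂ) ^ 2) (hκ := hκ) (c' := homMult) (fun t => by
      have e : ((t.1 : ℤ) : ℂ) ^ 2 + (t.2.1 : ℂ) ^ 2 - (t.2.2 : ℂ) ^ 2 -
        ((t.1 + t.2.1 - t.2.2 : ℤ) : ℂ) ^ 2 = -(freq t : ℂ) := by
        unfold freq; push_cast; ring
      rw [e, mul_neg, freq_mul_chi]
      change resMult.1 t - oneMult.1 t = _
      ring) m' h' hh'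
  have hP2 : ∀ (u : Λ) (u' : PSpace 1), (∀ α, u.1 α = u'.1 α ∧ u.2 α = u'.2 α) →
    P2 u = modePair 1 (fun n => (n : ℂ) ^ 2) hκ u'.1 u'.2 := by
    intro u u' hu
    rw [modePair_apply, P2]
    exact tsum_congr fun α => by rw [(hu α).1, (hu α).2]
  rw [hP2 _ _ hadd, hP2 _ _ hsub, key, ← quartP_congr homMult hm', quartP_homMult]

/-! ### The Birkhoff transformation -/

theorem analyticAt_const_smul {E F : Type*} [NormedAddCommGroup E] [NormedSpace ℂ E]
    [NormedAddCommGroup F] [NormedSpace ℂ F] (c : ℂ) {f : E → F} {x : E} (hf : AnalyticAt ℂ f x) :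
    AnalyticAt ℂ (fun y => c • f y) x := (analyticAt_const (𝕜 := ℂ) (v := c) (x := x)).smul hf

theorem analyticAt_comp' {E F G : Type*} [NormedAddCommGroup E] [NormedSpace ℂ E]
    [NormedAddCommGroup F] [NormedSpace ℂ F] [NormedAddCommGroup G] [NormedSpace ℂ G] {g : F → G}
    {f : E → F} {x : E} (hg : AnalyticAt ℂ g (f x)) (hf : AnalyticAt ℂ f x) :
    AnalyticAt ℂ (fun y => g (f y)) x := hg.comp hf

/-- `m` is the solution map of `m(w) - X(m(w))/2 = w` on the ball of radius `δ`. -/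
structure IsMidpoint (K δ : ℝ) (m : Λ → Λ) : Prop where
  pos : 0 < δ
  K_nonneg : 0 ≤ K
  small : K * (2 * δ) ^ 2 ≤ 1 / 2
  energy_small : 12 * l1Const s * δ ≤ 1
  fderiv_le : ∀ w, ‖fderiv ℂ (quartGrad (s := s) chiMult) w‖ ≤ K * ‖w‖ ^ 2
  le_cube : ∀ w, ‖quartGrad (s := s) chiMult w‖ ≤ K * ‖w‖ ^ 3
  lipschitz : ∀ r : ℝ, ∀ u v,
    ‖u‖ ≤ r → ‖v‖ ≤ r → ‖quartGrad (s := s) chiMult u - quartGrad chiMult v‖ ≤ K * r ^ 2 * ‖u - v‖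
  analytic : AnalyticOnNhd ℂ m (ball 0 δ)
  eq : ∀ w ∈ ball (0 : Λ) δ, m w - ½ • vecX (m w) = w
  norm_le : ∀ w ∈ ball (0 : Λ) δ, ‖m w‖ ≤ 2 * ‖w‖
  unique : ∀ w ∈ ball (0 : Λ) δ, ∀ m', ‖m'‖ < 2 * δ → m' - ½ • vecX m' = w → m' = m w

theorem exists_isMidpoint : ∃ K δ : ℝ, ∃ m : Λ → Λ, IsMidpoint K δ m := by
  obtain ⟨K, hK, h1, h2, h3⟩ := exists_quartGrad_bound (s := s) chiMult
  have hJ : ‖symJ s‖ ≤ 1 := ContinuousLinearMap.opNorm_le_bound _ zero_le_one fun u => by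
    rw [norm_symJ_apply, one_mul]
  obtain ⟨δ, hδ, hKδ, m, hm, hmw⟩ := exists_midpoint (analytic_vecX) hK (fun w => by
      rw [fderiv_vecX (s := s)]
      refine (ContinuousLinearMap.opNorm_comp_le _ _).trans ?_
      calc _ ≤ 1 * (K * ‖w‖ ^ 2) := by gcongr; exact h1 w
        _ = _ := one_mul _)
    (fun w => by rw [vecX, norm_symJ_apply]; exact h2 w)
  have hL := l1Const_nonneg s
  set δ' := min δ (1 / (12 * (l1Const s + 1))) with hδ'
  have hδ'0 : 0 < δ' := lt_min hδ (by positivity)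
  have hle : δ' ≤ δ := min_le_left _ _
  have hsub : ball (0 : Λ) δ' ⊆ ball 0 δ := Metric.ball_subset_ball hle
  refine ⟨K, δ', m, hδ'0, hK, ?_, ?_, h1, h2, h3, hm.mono hsub, fun w hw => (hmw w (hsub hw)).1,
    fun w hw => (hmw w (hsub hw)).2.1,
    fun w hw m' hm' => (hmw w (hsub hw)).2.2 m' (hm'.trans_le (by linarith))⟩
  · refine le_trans ?_ hKδ
    gcongr
  · have h4 : δ' ≤ 1 / (12 * (l1Const s + 1)) := min_le_right _ _
    rw [le_div_iff₀ (by positivity)] at h4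
    nlinarith

namespace IsMidpoint

variable {K δ : ℝ} {m : PSpace s → PSpace s}

/-- The transformation: the reflection of `w` in `m(w)`. -/
def tau (m : Λ → Λ) (w : Λ) : Λ := (2 : ℂ) • m w - w

theorem norm_lt (h : IsMidpoint K δ m) {w : Λ} (hw : w ∈ ball 0 δ) : ‖m w‖ < 2 * δ := by
  have h1 := h.norm_le w hw
  have h2 : ‖w‖ < δ := by simpa using hw
  linarith

theorem tau_eq (h : IsMidpoint K δ m) {w : Λ} (hw : w ∈ ball 0 δ) :
    tau m w = m w + ½ • vecX (m w) := by
  have h1 := h.eq w hw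
  unfold tau
  nth_rewrite 2 [← h1]
  module

theorem sub_eq (h : IsMidpoint K δ m) {w : Λ} (hw : w ∈ ball 0 δ) : m w - w = ½ • vecX (m w) := by
  nth_rewrite 2 [← h.eq w hw]
  abel

theorem norm_sub_le (h : IsMidpoint K δ m) {w : Λ}
    (hw : w ∈ ball 0 δ) : ‖m w - w‖ ≤ 4 * K * ‖w‖ ^ 3 := by
  have hK := h.K_nonneg
  rw [h.sub_eq hw, norm_smul, vecX, norm_symJ_apply]
  have h1 := h.le_cube (m w)
  have h2 : K * ‖m w‖ ^ 3 ≤ K * (2 * ‖w‖) ^ 3 := by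
    have := h.norm_le w hw
    gcongr
  norm_num
  nlinarith

theorem near_id (h : IsMidpoint K δ m) {w : Λ}
    (hw : w ∈ ball 0 δ) : ‖tau m w - w‖ ≤ 8 * K * ‖w‖ ^ 3 := by
  have e : tau m w - w = (2 : ℂ) • (m w - w) := by unfold tau; module
  rw [e, norm_smul]
  have := h.norm_sub_le hw
  norm_num
  linarith

theorem norm_tau_lt (h : IsMidpoint K δ m) {w : Λ} (hw : w ∈ ball 0 δ) : ‖tau m w‖ ≤ 2 * ‖w‖ := by
  have hK := h.K_nonneg
  have hwδ : ‖w‖ < δ := by simpa using hw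
  have h1 := h.near_id hw
  have h2 : 8 * K * ‖w‖ ^ 3 ≤ ‖w‖ := by
    have h3 : 8 * K * ‖w‖ ^ 3 = 2 * (K * (2 * ‖w‖) ^ 2) * ‖w‖ := by ring
    have h4 : K * (2 * ‖w‖) ^ 2 ≤ K * (2 * δ) ^ 2 := by gcongr
    rw [h3]
    nlinarith [norm_nonneg w, h.small]
  have h5 := norm_le_norm_add_norm_sub' (tau m w) w
  linarith

theorem analytic_tau (h : IsMidpoint K δ m) : AnalyticOnNhd ℂ (tau m) (ball 0 δ) := fun w hw =>
  have h1 : AnalyticAt ℂ (fun w => (2 : ℂ) • m w) w := analyticAt_const_smul _ (h.analytic w hw)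
  h1.sub analyticAt_id

theorem hasFDerivAt_vecX (w : Λ) : HasFDerivAt (vecX) (fderiv ℂ (vecX) w) w :=
    (analytic_vecX w (mem_univ w)).differentiableAt.hasFDerivAt

theorem hasFDerivAt (h : IsMidpoint K δ m) {w : Λ} (hw : w ∈ ball 0 δ) :
    HasFDerivAt m (fderiv ℂ m w) w := (h.analytic w hw).differentiableAt.hasFDerivAt

theorem fderiv_eq (h : IsMidpoint K δ m) {w : Λ} (hw : w ∈ ball 0 δ) (u : Λ) :
    fderiv ℂ m w u - ½ • fderiv ℂ (vecX) (m w) (fderiv ℂ m w u) = u := by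
  have h1 : HasFDerivAt (fun w => m w - ½ • vecX (m w)) (fderiv ℂ m w - ½ •
    (fderiv ℂ (vecX) (m w)).comp (fderiv ℂ m w)) w := (h.hasFDerivAt hw).sub (HasFDerivAt.const_smul
    (f := fun w => vecX (m w)) ((hasFDerivAt_vecX (m w)).comp w (h.hasFDerivAt hw)) ½)
  have h2 : HasFDerivAt (fun w => m w - ½ • vecX (m w)) (ContinuousLinearMap.id ℂ Λ) w := by
    refine (hasFDerivAt_id w).congr_of_eventuallyEq ?_
    filter_upwards [Metric.isOpen_ball.mem_nhds hw] with x hx using h.eq x hx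
  have := congrArg (fun L : Λ →L[ℂ] Λ => L u) (h1.unique h2)
  simpa using this

theorem hasFDerivAt_tau (h : IsMidpoint K δ m) {w : Λ} (hw : w ∈ ball 0 δ) :
    HasFDerivAt (tau m) ((2 : ℂ) • fderiv ℂ m w - ContinuousLinearMap.id ℂ _) w :=
    ((h.hasFDerivAt hw).const_smul (2 : ℂ)).sub (hasFDerivAt_id w)

theorem fderiv_tau (h : IsMidpoint K δ m) {w : Λ} (hw : w ∈ ball 0 δ) (u : Λ) :
    fderiv ℂ (tau m) w u = (2 : ℂ) • fderiv ℂ m w u - u := by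
  rw [(h.hasFDerivAt_tau hw).fderiv]
  simp

/-- The derivative of the midpoint map is a Cayley transform and hence symplectic. -/
theorem symplectic (h : IsMidpoint K δ m) {w : Λ} (hw : w ∈ ball 0 δ) (u v : Λ) :
    omegaP (fderiv ℂ (tau m) w u) (fderiv ℂ (tau m) w v) = omegaP u v := by
  have hskew := omegaP_fderiv_vecX (m w)
  set A := fderiv ℂ (vecX) (m w)
  set u' := fderiv ℂ m w u with hu'
  set v' := fderiv ℂ m w v with hv'
  have hu := h.fderiv_eq hw u
  have hv := h.fderiv_eq hw v
  rw [← hu'] at hu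
  rw [← hv'] at hv
  have e1 : fderiv ℂ (tau m) w u = u' + ½ • A u' := by
    rw [h.fderiv_tau hw, ← hu']
    have hu2 : u = u' - ½ • A u' := hu.symm
    calc _ = (2 : ℂ) • u' - (u' - ½ • A u') := congrArg _ hu2
      _ = _ := by module
  have e2 : fderiv ℂ (tau m) w v = v' + ½ • A v' := by
    rw [h.fderiv_tau hw, ← hv']
    have hv2 : v = v' - ½ • A v' := hv.symm
    calc _ = (2 : ℂ) • v' - (v' - ½ • A v') := congrArg _ hv2
      _ = _ := by module
  have hsk := hskew u' v'
  rw [e1, e2]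
  refine Eq.trans ?_ (congrArg₂ omegaP hu hv)
  rw [omegaP_eq, omegaP_eq] at hsk
  simp only [omegaP_eq, map_add, map_sub, map_smul, add_apply, sub_apply, smul_apply, smul_eq_mul]
  linear_combination hsk

/-- A perturbation of the identity by a map of norm less than one is a unit. -/
theorem isUnit_one_add {A : Λ →L[ℂ] Λ} (hA : ‖A‖ < 1) : IsUnit (1 + A) := by
  have := (Units.oneSub (-A) (by rwa [norm_neg])).isUnit
  simpa using this

theorem norm_half_fderiv (h : IsMidpoint K δ m) {w : Λ} (hw : ‖w‖ < 2 * δ) :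
    ‖½ • fderiv ℂ (quartGrad chiMult) w‖ ≤ 1 / 4 := by
  have hK := h.K_nonneg
  rw [norm_smul]
  have h1 := h.fderiv_le w
  have h2 : K * ‖w‖ ^ 2 ≤ K * (2 * δ) ^ 2 := by gcongr
  have h3 := h.small
  norm_num
  linarith

theorem isInvertible_of_isUnit {A : Λ →L[ℂ] Λ} (hA : IsUnit A) : A.IsInvertible := by
  obtain ⟨u, rfl⟩ := hA
  exact ⟨ContinuousLinearEquiv.unitsEquiv ℂ _ u, rfl⟩

theorem norm_comp_symJ_le (A : Λ →L[ℂ] Λ) : ‖(symJ s).comp A‖ ≤ ‖A‖ ∧ ‖A.comp (symJ s)‖ ≤ ‖A‖ := by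
  refine ⟨ContinuousLinearMap.opNorm_le_bound _ (norm_nonneg _) fun u => ?_,
    ContinuousLinearMap.opNorm_le_bound _ (norm_nonneg _) fun u => ?_⟩
  · rw [ContinuousLinearMap.comp_apply, norm_symJ_apply]
    exact A.le_opNorm u
  · rw [ContinuousLinearMap.comp_apply, ← norm_symJ_apply u]
    exact A.le_opNorm _

theorem norm_half_vecX (h : IsMidpoint K δ m) {w : Λ} (hw : ‖w‖ < 2 * δ) :
    ‖½ • fderiv ℂ (vecX) w‖ ≤ 1 / 4 := by
  rw [fderiv_vecX, ← ContinuousLinearMap.comp_smul]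
  exact (norm_comp_symJ_le _).1.trans (h.norm_half_fderiv hw)

theorem invertible (h : IsMidpoint K δ m) {w : Λ}
    (hw : w ∈ ball 0 δ) : (fderiv ℂ (tau m) w).IsInvertible := by
  have hA := h.norm_half_vecX (h.norm_lt hw)
  set A := ½ • fderiv ℂ (vecX) (m w) with hAdef
  obtain ⟨a, ha⟩ := isUnit_one_add (A := A) (by linarith)
  obtain ⟨b, hb⟩ := isUnit_one_add (A := -A) (by rw [norm_neg]; linarith)
  have hDm : fderiv ℂ m w = ((b⁻¹ : (Λ →L[ℂ] Λ)ˣ) : Λ →L[ℂ] Λ) := by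
    refine (Units.inv_eq_of_mul_eq_one_right (u := b) ?_).symm
    refine ContinuousLinearMap.ext fun u => ?_
    rw [hb]
    have := h.fderiv_eq hw u
    change fderiv ℂ m w u + -(A (fderiv ℂ m w u)) = u
    rw [← sub_eq_add_neg]
    exact this
  have hDt : fderiv ℂ (tau m) w = ((a * b⁻¹ : (Λ →L[ℂ] Λ)ˣ) : Λ →L[ℂ] _) := by
    rw [Units.val_mul, ← hDm, ha]
    refine ContinuousLinearMap.ext fun u => ?_
    rw [h.fderiv_tau hw]
    change _ = fderiv ℂ m w u + A (fderiv ℂ m w u)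
    have := h.fderiv_eq hw u
    nth_rewrite 2 [← this]
    change _ - (_ - A (fderiv ℂ m w u)) = _
    module
  rw [hDt]
  exact isInvertible_of_isUnit (Units.isUnit _)

theorem injOn (h : IsMidpoint K δ m) : InjOn (tau m) (ball 0 δ) := by
  intro w hw w' hw' heq
  have h1 := h.lipschitz (2 * δ) (m w) (m w') (h.norm_lt hw).le (h.norm_lt hw').le
  rw [h.tau_eq hw, h.tau_eq hw'] at heq
  have h2 : m w - m w' = -(½ • symJ s (quartGrad chiMult (m w) - quartGrad chiMult (m w'))) := by
    rw [map_sub, smul_sub]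
    change _ = -(½ • vecX (m w) - ½ • vecX (m w'))
    rw [neg_sub, sub_eq_sub_iff_add_eq_add, heq, add_comm]
  have h3 : ‖m w - m w'‖ ≤ 1 / 2 * (K * (2 * δ) ^ 2 * ‖m w - m w'‖) := by
    nth_rewrite 1 [h2]
    rw [norm_neg, norm_smul, norm_symJ_apply]
    norm_num
    exact h1
  have h4 : ‖m w - m w'‖ = 0 := by
    have h5 := h.small
    nlinarith [norm_nonneg (m w - m w')]
  have h6 : m w = m w' := sub_eq_zero.1 (norm_eq_zero.1 h4)
  rw [← h.eq w hw, ← h.eq w' hw', h6]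

/-- The transpose of the derivative of `m` with respect to the form `beta`. -/
def transp (m : Λ → Λ) (w : Λ) : Λ →L[ℂ] Λ :=
  Ring.inverse (1 + (½ • fderiv ℂ (quartGrad chiMult) (m w)).comp (symJ s))

theorem transp_aux (h : IsMidpoint K δ m) {w : Λ} (hw : w ∈ ball 0 δ) :
    ‖(½ • fderiv ℂ (quartGrad chiMult) (m w)).comp (symJ s)‖ ≤ 1 / 4 :=
    (norm_comp_symJ_le _).2.trans (h.norm_half_fderiv (h.norm_lt hw))

theorem transp_apply (h : IsMidpoint K δ m) {w : Λ} (hw : w ∈ ball 0 δ) (g : Λ) :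
    transp m w g + ½ • fderiv ℂ (quartGrad chiMult) (m w) (symJ s (transp m w g)) = g := by
  have hu := isUnit_one_add (lt_of_le_of_lt (h.transp_aux hw) (by norm_num))
  have := congrArg (fun L : Λ →L[ℂ] Λ => L g) (Ring.mul_inverse_cancel _ hu)
  exact this

theorem beta_transp (h : IsMidpoint K δ m) {w : Λ} (hw : w ∈ ball 0 δ) (g u : Λ) :
    beta g (fderiv ℂ m w u) = beta (transp m w g) u := by
  have hg := h.transp_apply hw g
  have hu := h.fderiv_eq hw u
  set g' := transp m w g
  set u' := fderiv ℂ m w u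
  have h1 : beta (fderiv ℂ (quartGrad chiMult) (m w) (symJ s g')) u' =
    -beta g' (fderiv ℂ (vecX) (m w) u') := by
    rw [beta_fderiv_chi_symm, fderiv_vecX, ContinuousLinearMap.comp_apply, beta_comm g',
      beta_symJ, neg_neg]
  refine (congrArg (fun a => beta a u') hg.symm).trans (Eq.trans ?_ (congrArg (beta g') hu))
  simp only [map_add, map_sub, map_smul, add_apply, smul_apply, smul_eq_mul]
  linear_combination ½ * h1

theorem norm_transp_le (h : IsMidpoint K δ m) {w : Λ}
    (hw : w ∈ ball 0 δ) (g : Λ) : ‖transp m w g‖ ≤ 2 * ‖g‖ := by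
  have hg := h.transp_apply hw g
  have h1 := ((½ • fderiv ℂ (quartGrad chiMult) (m w)).comp (symJ s)).le_of_opNorm_le
    (h.transp_aux hw) (transp m w g)
  have h2 : ‖transp m w g‖ ≤ ‖g‖ + 1 / 4 * ‖transp m w g‖ := by
    have e : transp m w g = g - ((½ • fderiv ℂ (quartGrad chiMult) (m w)).comp (symJ s))
      (transp m w g) := by
      nth_rewrite 2 [← hg]
      simp
    nth_rewrite 1 [e]
    exact (_root_.norm_sub_le _ _).trans (by linarith)
  linarith [norm_nonneg g]

theorem norm_transp_sub_le (h : IsMidpoint K δ m) {w : Λ} (hw : w ∈ ball 0 δ) (g : Λ) :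
    ‖transp m w g - g‖ ≤ 4 * K * ‖w‖ ^ 2 * ‖g‖ := by
  have hK := h.K_nonneg
  have hg := h.transp_apply hw g
  have e : transp m w g - g =
    -(½ • fderiv ℂ (quartGrad chiMult) (m w) (symJ s (transp m w g))) := by
    nth_rewrite 2 [← hg]
    abel
  have h1 :=
    (fderiv ℂ (quartGrad chiMult) (m w)).le_of_opNorm_le (h.fderiv_le (m w)) (symJ s (transp m w g))
  rw [norm_symJ_apply] at h1
  have h2 : K * ‖m w‖ ^ 2 * ‖transp m w g‖ ≤ K * (2 * ‖w‖) ^ 2 * (2 * ‖g‖) := by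
    have := h.norm_le w hw
    have := h.norm_transp_le hw g
    gcongr
  rw [e, norm_neg, norm_smul, show ‖½‖ = 1 / 2 by norm_num]
  linarith

theorem analytic_transp (h : IsMidpoint K δ m) : AnalyticOnNhd ℂ (transp m) (ball 0 δ) := by
  intro w hw
  have hu := isUnit_one_add (lt_of_le_of_lt (h.transp_aux hw) (by norm_num))
  have hG : AnalyticAt ℂ (fderiv ℂ (quartGrad chiMult)) (m w) :=
    (isGrad_quart chiMult).analytic_grad.fderiv (m w) (mem_univ _)
  have h1 : AnalyticAt ℂ (fun w => fderiv ℂ (quartGrad chiMult) (m w)) w :=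
    hG.comp (h.analytic w hw)
  set R : (Λ →L[ℂ] Λ) →L[ℂ] (Λ →L[ℂ] Λ) := (compL ℂ Λ Λ Λ).flip (symJ s) with hR
  have h2 : AnalyticAt ℂ (fun w => 1 + R (½ • fderiv ℂ (quartGrad chiMult) (m w))) w :=
    have h4 : AnalyticAt ℂ (fun w => ½ • fderiv ℂ (quartGrad chiMult) (m w)) w :=
      analyticAt_const_smul _ h1
    analyticAt_const.add ((R.analyticAt _).comp h4)
  obtain ⟨a, ha⟩ := hu
  have h3 : AnalyticAt ℂ Ring.inverse (1 + R (½ • fderiv ℂ (quartGrad chiMult) (m w))) := by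
    have : (1 + R (½ • fderiv ℂ (quartGrad chiMult) (m w))) = a := ha.symm
    rw [this]
    exact analyticAt_inverse a
  exact analyticAt_comp' (f := fun w => 1 + R (½ • fderiv ℂ (quartGrad chiMult) (m w))) h3 h2

/-- Gradients of compositions with the midpoint. -/
theorem isGrad_comp (h : IsMidpoint K δ m) {F : Λ → ℂ} {G : Λ → Λ} {U : Set Λ} (hF : IsGrad F G U)
    {δ' : ℝ} (hδ : δ' ≤ δ) (hU : MapsTo m (ball 0 δ') U) : IsGrad (fun w => F (m w)) (fun w =>
    transp m w (G (m w))) (ball 0 δ') := by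
  have hsub : ball (0 : Λ) δ' ⊆ ball 0 δ := Metric.ball_subset_ball hδ
  refine ⟨fun w hw => (hF.analytic _ (hU hw)).comp (h.analytic w (hsub hw)), fun w hw => ?_,
    fun w hw => ?_⟩
  · have h1 : AnalyticAt ℂ (fun w => G (m w)) w :=
      analyticAt_comp' (hF.analytic_grad _ (hU hw)) (h.analytic w (hsub hw))
    exact analyticAt_clm_apply (f := transp m) (g := fun w => G (m w))
      (h.analytic_transp w (hsub hw)) h1
  · refine ((hF.hasFDerivAt _ (hU hw)).comp w (h.hasFDerivAt (hsub hw))).congr_fderiv ?_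
    refine ContinuousLinearMap.ext fun u => ?_
    rw [ContinuousLinearMap.comp_apply]
    exact h.beta_transp (hsub hw) (G (m w)) u

/-- Gradients of compositions with the transformation. -/
theorem isGrad_comp_tau (h : IsMidpoint K δ m) {F : Λ → ℂ} {G : Λ → Λ} {U : Set Λ}
    (hF : IsGrad F G U) {δ' : ℝ} (hδ : δ' ≤ δ) (hU : MapsTo (tau m) (ball 0 δ') U) : IsGrad (fun
    w => F (tau m w)) (fun w => (2 : ℂ) • transp m w (G (tau m w)) - G (tau m w)) (ball 0 δ') := by
  have hsub : ball (0 : Λ) δ' ⊆ ball 0 δ := Metric.ball_subset_ball hδ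
  have hG : AnalyticOnNhd ℂ (fun w => G (tau m w)) (ball 0 δ') := fun w hw =>
    (hF.analytic_grad _ (hU hw)).comp (h.analytic_tau w (hsub hw))
  refine ⟨fun w hw => (hF.analytic _ (hU hw)).comp (h.analytic_tau w (hsub hw)), fun w hw => ?_,
    fun w hw => ?_⟩
  · have h1 : AnalyticAt ℂ (fun w => transp m w (G (tau m w))) w :=
      analyticAt_clm_apply (h.analytic_transp w (hsub hw)) (hG w hw)
    have h2 : AnalyticAt ℂ (fun w => (2 : ℂ) • transp m w (G (tau m w))) w :=
      analyticAt_const_smul _ h1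
    exact h2.sub (hG w hw)
  · refine ((hF.hasFDerivAt _ (hU hw)).comp w (h.hasFDerivAt_tau (hsub hw))).congr_fderiv ?_
    refine ContinuousLinearMap.ext fun u => ?_
    have := h.beta_transp (hsub hw) (G (tau m w)) u
    simp only [ContinuousLinearMap.comp_apply, sub_apply, smul_apply, map_sub, map_smul,
      ContinuousLinearMap.id_apply, smul_eq_mul, this]

end IsMidpoint

/-! ### The algebra of Fourier coefficients -/

theorem WSeq.clm_ext_single {ι : Type} {w : Weight ι} {F : Type*} [NormedAddCommGroup F]
    [NormedSpace ℂ F] {f g : WSeq w s →L[ℂ] F} (h : ∀ α, f (single α) = g (single α)) : f = g := by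
  refine ContinuousLinearMap.ext fun x => ?_
  have h1 := (WSeq.hasSum_single x).mapL f
  have h2 := (WSeq.hasSum_single x).mapL g
  refine h1.unique (h2.congr_fun ?_)
  intro α
  simp only [map_smul, h α]

theorem norm_mul_exp (c : ℂ) (n : ℤ) (x : ℝ) : ‖c * exp (I * n * x)‖ = ‖c‖ := by
  rw [norm_mul, show I * n * x = ((n * x : ℝ) : ℂ) * I by push_cast; ring,
    Complex.norm_exp_ofReal_mul_I, mul_one]

/-- The value at `x` of the function with given Fourier coefficients. -/
def evalF (x : ℝ) : Four s →L[ℂ] ℂ :=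
  LinearMap.mkContinuous
    { toFun := fun y => ∑' n : ℤ, y n * exp (I * n * x)
      map_add' := fun y z => by
        have h : ∀ y : Four s, Summable fun n : ℤ => y n * exp (I * n * x) :=
          fun y => Summable.of_norm_bounded (Four.summable_norm y) fun n =>
            (norm_mul_exp _ n x).le
        rw [← (h y).tsum_add (h z)]
        exact tsum_congr fun n => by rw [WSeq.add_apply, add_mul]
      map_smul' := fun c y => by
        rw [RingHom.id_apply, smul_eq_mul, ← tsum_mul_left]
        exact tsum_congr fun n => by rw [WSeq.smul_apply, mul_assoc] }
    (l1Const s) (fun y => by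
      refine (norm_tsum_le_tsum_norm ?_).trans (le_trans (le_of_eq ?_) (Four.tsum_norm_le y))
      · exact (Four.summable_norm y).congr fun n => (norm_mul_exp _ n x).symm
      · exact tsum_congr fun n => norm_mul_exp _ n x)

theorem evalF_apply (x : ℝ) (y : Four s) : evalF x y = ∑' n : ℤ, y n * exp (I * n * x) := rfl

theorem norm_evalF_le (x : ℝ) (y : Four s) : ‖evalF x y‖ ≤ l1Const s * ‖y‖ :=
    (evalF x).le_of_opNorm_le (LinearMap.mkContinuous_norm_le _ (l1Const_nonneg s) _) y

theorem evalF_single (x : ℝ) (m : ℤ) : evalF (s := s) x (single m) = exp (I * m * x) := by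
  rw [evalF_apply, tsum_eq_single m]
  · rw [single_same, one_mul]
  · intro n hn
    rw [single_of_ne hn, zero_mul]

/-- The product of two functions in terms of Fourier coefficients. -/
def convL : Four s →L[ℂ] Four s →L[ℂ] Four s := tri oneMult (single 0)

theorem convL_single (m n : ℤ) : convL (s := s) (single m) (single n) = single (m + n) := by
  refine WSeq.ext fun N => ?_
  change triFun _ _ _ _ N = _
  unfold triFun
  rw [tsum_eq_single (0, m)]
  · simp only [single_same, one_mul]
    change (1 : ℂ) * _ = _
    by_cases h : N = m + n
    · subst h
      rw [show m + n - 0 - m = n by ring, single_same, single_same, one_mul]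
    · rw [single_of_ne h, single_of_ne (by omega), mul_zero]
  · rintro ⟨i, j⟩ hij
    by_cases hi : i = 0
    · have hj : j ≠ m := fun h => hij (by rw [hi, h])
      simp [single_of_ne hj]
    · simp [single_of_ne hi]

theorem bilin_ext_single {F : Type*} [NormedAddCommGroup F] [NormedSpace ℂ F]
    {f g : Four s →L[ℂ] Four s →L[ℂ] F} (h : ∀ m n,
    f (single m) (single n) = g (single m) (single n)) (y z : Four s) : f y z = g y z := by
  have h1 : f = g := WSeq.clm_ext_single fun m => WSeq.clm_ext_single fun n => h m n
  rw [h1]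

theorem evalF_convL (x : ℝ) (y z : Four s) : evalF x (convL y z) = evalF x y * evalF x z := by
  have := bilin_ext_single (f := (compL ℂ (Four s) (Four s) ℂ (evalF x)).comp (convL))
    (g := (((ContinuousLinearMap.mul ℂ ℂ).comp (evalF x)).flip.comp (evalF x)).flip) (fun m n => by
      change evalF x (convL (single m) (single n)) = evalF x (single m) * evalF x (single n)
      rw [convL_single, evalF_single, evalF_single, evalF_single, ← exp_add]
      congr 1
      push_cast
      ring) y z
  exact this

theorem bpair_eq_coord (y z : Four s) : bpair y z = coord zWeight s 0 (convL y z) := by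
  refine bilin_ext_single (f := bpair)
    (g := (compL ℂ (Four s) (Four s) ℂ (coord zWeight s 0)).comp (convL)) (fun m n => ?_) y z
  change _ = coord zWeight s 0 (convL (single m) (single n))
  rw [convL_single, bpair_apply, WSeq.coord_apply, tsum_eq_single m]
  · rw [single_same, one_mul]
    by_cases h : -m = n
    · subst h
      rw [single_same, add_neg_cancel, single_same]
    · rw [single_of_ne h, single_of_ne (by omega)]
  · intro k hk
    rw [single_of_ne hk, zero_mul]

/-- The mean value of a function is its zeroth Fourier coefficient. -/
theorem mean_evalF (y : Four s) :
    ((2 * Real.pi : ℝ) : ℂ)⁻¹ * ∫ x in (0 : ℝ)..(2 * Real.pi), evalF x y = coord zWeight s 0 y := by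
  let f : ℤ → C(ℝ, ℂ) := fun n => ⟨fun x => y n * exp (I * n * x), by fun_prop⟩
  have hf : ∀ n, ∀ x : ℝ, ‖f n x‖ = ‖y n‖ := fun n x => by
    exact norm_mul_exp _ n x
  have h := intervalIntegral.hasSum_intervalIntegral_of_summable_norm (a := 0) (b := 2 * Real.pi) (f := f)
    (Summable.of_nonneg_of_le (fun n => norm_nonneg _) (fun n => by
      rw [ContinuousMap.norm_le _ (norm_nonneg (y n))]
      intro x
      exact (hf n x).le) (Four.summable_norm y))
  have h2 : ∀ n ≠ 0, ∫ x in (0 : ℝ)..(2 * Real.pi), f n x = 0 := by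
    intro n hn
    change ∫ x in (0 : ℝ)..(2 * Real.pi), y n * exp (I * n * x) = 0
    rw [intervalIntegral.integral_const_mul,
      integral_exp_mul_complex (by simpa [Complex.I_ne_zero] using hn)]
    have : exp (I * n * ((2 * Real.pi : ℝ) : ℂ)) = 1 := by
      rw [show I * n * ((2 * Real.pi : ℝ) : ℂ) = n * (2 * Real.pi * I) by
        push_cast; ring]
      exact Complex.exp_int_mul_two_pi_mul_I n
    rw [this]
    simp
  have h3 := h.unique (hasSum_single 0 h2)
  have h4 : ∫ x in (0 : ℝ)..(2 * Real.pi), evalF x y = ∫ x in (0 : ℝ)..(2 * Real.pi), f 0 x := h3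
  rw [h4]
  change _ * ∫ x in (0 : ℝ)..(2 * Real.pi), y 0 * exp (I * ((0 : ℤ) : ℂ) * x) = _
  have hpi : (Real.pi : ℂ) ≠ 0 := by exact_mod_cast Real.pi_ne_zero
  simp only [Int.cast_zero, mul_zero, zero_mul, exp_zero, mul_one,
    intervalIntegral.integral_const, sub_zero, WSeq.coord_apply, Complex.real_smul]
  push_cast
  field_simp

/-! ### Superposition operators -/

/-- The terms of the series of a superposition operator. -/
def liftSeries (p : FormalMultilinearSeries ℂ (Fin 4 → ℂ) ℂ) :
    FormalMultilinearSeries ℂ (VSpace s) (Four s) := fun n =>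
  ∑ i : Fin n → Fin 4, p n (fun k => Pi.single (i k) 1) •
    (ContinuousLinearMap.apply ℂ (Four s) (single 0 : Four s)).compContinuousMultilinearMap
    ((ContinuousMultilinearMap.mkPiAlgebraFin ℂ n (Four s →L[ℂ] Four s)).compContinuousLinearMap
    (fun k => (convL).comp (proj (R := ℂ) (φ := fun _ : Fin 4 => Four s) (i k))))

theorem evalF_list_prod (x : ℝ) (l : List (Four s)) (y : Four s) :
    evalF x ((l.map (convL)).prod y) = (l.map (evalF x)).prod * evalF x y := by
  induction l with
  | nil => simp
  | cons a l ih =>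
    rw [List.map_cons, List.prod_cons, List.map_cons, List.prod_cons]
    change evalF x (convL a ((l.map (convL)).prod y)) = _
    rw [evalF_convL, ih, mul_assoc]

theorem evalF_liftSeries (p : FormalMultilinearSeries ℂ (Fin 4 → ℂ) ℂ) (n : ℕ) (x : ℝ)
    (v : VSpace s) : evalF x (liftSeries p n fun _ => v) = p n fun _ => fun i => evalF x (v i) := by
  have h1 : (fun _ : Fin n => fun i => evalF x (v i)) = fun _ : Fin n => ∑ i : Fin 4,
    evalF x (v i) • (Pi.single i (1 : ℂ) : Fin 4 → ℂ) := by
    funext k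
    rw [pi_eq_sum_univ (fun i => evalF x (v i))]
    refine Finset.sum_congr rfl fun i _ => ?_
    congr 1
    funext j
    simp [Pi.single_apply, eq_comm]
  rw [h1, ContinuousMultilinearMap.map_sum]
  unfold liftSeries
  rw [_root_.sum_apply, map_sum]
  refine Finset.sum_congr rfl fun i _ => ?_
  rw [ContinuousMultilinearMap.map_smul_univ, _root_.smul_apply, map_smul,
    smul_eq_mul, smul_eq_mul, mul_comm]
  congr 1
  change evalF x ((List.ofFn fun k => convL (v (i k))).prod (single 0)) = _
  have h2 := evalF_list_prod x (List.ofFn fun k => v (i k)) (single 0)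
  rw [List.map_ofFn, List.map_ofFn, evalF_single] at h2
  refine h2.trans ?_
  rw [List.prod_ofFn]
  simp

instance : Nontrivial (Four s) :=
  ⟨single 0, 0, fun h => by
    have := congrArg (fun x : Four s => x 0) h
    simp only [single_same, WSeq.zero_apply] at this
    exact one_ne_zero this⟩

theorem norm_liftSeries_le (p : FormalMultilinearSeries ℂ (Fin 4 → ℂ) ℂ) (n : ℕ) :
    ‖liftSeries (s := s) p n‖ ≤ ‖p n‖ *
    (‖ContinuousLinearMap.apply ℂ (Four s) (single 0 : Four s)‖ * (4 * ‖convL (s := s)‖) ^ n) := by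
  unfold liftSeries
  refine (norm_sum_le _ _).trans ?_
  refine (Finset.sum_le_card_nsmul _ _ (‖p n‖ * (‖ContinuousLinearMap.apply ℂ (Four s) (single 0 :
    Four s)‖ * ‖convL (s := s)‖ ^ n)) fun i _ => ?_).trans (le_of_eq ?_)
  · rw [norm_smul]
    refine mul_le_mul ?_ ?_ (norm_nonneg _) (norm_nonneg _)
    · refine ((p n).le_opNorm _).trans (le_of_eq ?_)
      have : ∀ k, ‖(Pi.single (i k) (1 : ℂ) : Fin 4 → ℂ)‖ = 1 := fun k => by
        rw [Pi.norm_single, norm_one]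
      simp [this]
    · refine (ContinuousLinearMap.norm_compContinuousMultilinearMap_le _ _).trans ?_
      refine mul_le_mul_of_nonneg_left ?_ (norm_nonneg _)
      refine (ContinuousMultilinearMap.norm_compContinuousLinearMap_le _ _).trans ?_
      rw [ContinuousMultilinearMap.norm_mkPiAlgebraFin, one_mul]
      calc _ ≤ ∏ _k : Fin n, ‖convL (s := s)‖ := by
            refine Finset.prod_le_prod (fun _ _ => norm_nonneg _) fun k _ => ?_
            refine (ContinuousLinearMap.opNorm_comp_le _ _).trans ?_
            refine mul_le_of_le_one_right (norm_nonneg _) ?_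
            refine ContinuousLinearMap.opNorm_le_bound _ zero_le_one fun v => ?_
            rw [one_mul]
            exact norm_le_pi_norm v (i k)
        _ = _ := by simp
  · simp only [Finset.card_univ, Fintype.card_fun, Fintype.card_fin, nsmul_eq_mul, mul_pow]
    push_cast
    ring

theorem radius_liftSeries_pos {p : FormalMultilinearSeries ℂ (Fin 4 → ℂ) ℂ}
    (hp : 0 < p.radius) : 0 < (liftSeries (s := s) p).radius := by
  obtain ⟨r, hr0, hr⟩ := ENNReal.lt_iff_exists_nnreal_btwn.1 hp
  have hr0' : 0 < r := by exact_mod_cast hr0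
  obtain ⟨C, hC, h⟩ := p.norm_mul_pow_le_of_lt_radius hr
  set E := ‖ContinuousLinearMap.apply ℂ (Four s) (single 0 : Four s)‖
  set M : NNReal := 4 * ‖convL (s := s)‖₊ + 1 with hM
  have hM0 : 0 < M := by positivity
  refine lt_of_lt_of_le (b := ((r / M : NNReal) : ℝ≥0∞)) (by
    exact_mod_cast div_pos hr0' hM0) ?_
  refine FormalMultilinearSeries.le_radius_of_bound _ (E * C) fun n => ?_
  have h1 := norm_liftSeries_le (s := s) p n
  have h2 : (4 * ‖convL (s := s)‖) ^ n ≤ (M : ℝ) ^ n := by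
    refine pow_le_pow_left₀ (by positivity) ?_ n
    rw [hM]; push_cast; linarith
  have hM1 : (0 : ℝ) < M := by exact_mod_cast hM0
  calc _ ≤ (‖p n‖ * (E * (M : ℝ) ^ n)) * ((r / M : NNReal) : ℝ) ^ n := by
        refine mul_le_mul_of_nonneg_right (h1.trans ?_) (by positivity)
        gcongr
    _ = E * (‖p n‖ * (r : ℝ) ^ n) := by
        push_cast
        rw [div_pow]
        field_simp
    _ ≤ _ := mul_le_mul_of_nonneg_left (h n) (norm_nonneg (ContinuousLinearMap.apply ℂ (Four s) _))

/-- The terms of low degree of the power series of a function of order `N`. -/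
theorem apply_eq_zero_of_isBigO {h : (Fin 4 → ℂ) → ℂ} {p : FormalMultilinearSeries ℂ (Fin 4 → ℂ) ℂ}
    (hp : HasFPowerSeriesAt h p 0) {N : ℕ} (hN : h =O[𝓝 0] fun z => ‖z‖ ^ N) :
    ∀ n < N, ∀ z, (p n fun _ => z) = 0 := by
  intro n
  induction n using Nat.strong_induction_on with
  | _ n ih =>
  intro hn z
  have h1 := hp.isBigO_sub_partialSum_pow (n + 1)
  simp only [zero_add] at h1
  have h2 : (fun z => (p n fun _ => z)) =O[𝓝 0] fun z => ‖z‖ ^ (n + 1) := by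
    have h3 : h =O[𝓝 0] fun z => ‖z‖ ^ (n + 1) := by
      refine hN.trans (Asymptotics.IsBigO.of_bound 1 ?_)
      filter_upwards [Metric.ball_mem_nhds (0 : Fin 4 → ℂ) one_pos] with z hz
      have hz1 : ‖z‖ ≤ 1 := by simpa using (mem_ball_zero_iff.1 hz).le
      rw [one_mul, norm_pow, norm_pow, norm_norm]
      exact pow_le_pow_of_le_one (norm_nonneg _) hz1 hn
    refine (h3.sub h1).congr_left fun z => ?_
    rw [sub_sub_cancel, FormalMultilinearSeries.partialSum, Finset.sum_range_succ,
      Finset.sum_eq_zero fun k hk => ih k (Finset.mem_range.1 hk) ((Finset.mem_range.1 hk).trans hn)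
      z, zero_add]
  exact Asymptotics.IsBigO.continuousMultilinearMap_apply_eq_zero h2 z

/-- An analytic function of order `N` of four variables acts on functions on the circle as an
analytic map of order `N`. -/
theorem exists_superposition {h : (Fin 4 → ℂ) → ℂ} (hh : AnalyticAt ℂ h 0) {N : ℕ}
    (hN : h =O[𝓝 0] fun z => ‖z‖ ^ N) : ∃ H : VSpace s → Four s, AnalyticAt ℂ H 0 ∧
    (H =O[𝓝 0] fun v => ‖v‖ ^ N) ∧ ∀ᶠ v in 𝓝 0, ∀ x, evalF x (H v) = h fun i => evalF x (v i) := by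
  obtain ⟨p, hp⟩ := hh
  have hlow := apply_eq_zero_of_isBigO hp hN
  -- terms of degree below `N` vanish on the diagonal only, so they are removed
  set p' : FormalMultilinearSeries ℂ (Fin 4 → ℂ) ℂ := fun n => if n < N then 0 else p n with hp'
  have hdiag : ∀ n z, (p' n fun _ => z) = p n fun _ => z := by
    intro n z
    simp only [hp']
    split_ifs with hn
    · rw [hlow n hn]; rfl
    · rfl
  have hrad : 0 < p'.radius := by
    obtain ⟨r, hr⟩ := hp
    refine lt_of_lt_of_le (hr.r_pos.trans_le hr.r_le) ?_
    refine FormalMultilinearSeries.radius_le_of_le fun n => ?_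
    simp only [hp']
    split_ifs
    · rw [norm_zero]; exact norm_nonneg _
    · exact le_rfl
  set P := liftSeries (s := s) p' with hP
  have hPr := radius_liftSeries_pos (s := s) hrad
  have hPH := P.hasFPowerSeriesOnBall hPr
  refine ⟨P.sum, hPH.analyticAt, ?_, ?_⟩
  · have h1 := hPH.hasFPowerSeriesAt.isBigO_sub_partialSum_pow N
    simp only [zero_add] at h1
    refine h1.congr_left fun v => ?_
    rw [FormalMultilinearSeries.partialSum, Finset.sum_eq_zero fun k hk => ?_, sub_zero]
    have : p' k = 0 := if_pos (Finset.mem_range.1 hk)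
    rw [hP]
    unfold liftSeries
    simp [this]
  · obtain ⟨r, hr⟩ := hp
    have hcont : ∀ᶠ v : VSpace s in 𝓝 0, (l1Const s + 1) * ‖v‖ < (min r 1).toReal := by
      have hpos : 0 < (min r 1).toReal := ENNReal.toReal_pos
        (lt_min hr.r_pos one_pos).ne' (ne_top_of_le_ne_top ENNReal.one_ne_top (min_le_right _ _))
      have hc : Continuous fun v : VSpace s => (l1Const s + 1) * ‖v‖ := by fun_prop
      have := hc.tendsto 0
      rw [norm_zero, mul_zero] at this
      exact this.eventually (gt_mem_nhds hpos)
    have hball : ∀ᶠ v in 𝓝 0, v ∈ Metric.eball (0 : VSpace s) P.radius :=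
      Metric.eball_mem_nhds _ hPr
    filter_upwards [hcont, hball] with v hv hvb x
    have h1 := (hPH.hasSum hvb).mapL (evalF x)
    have hz : (fun i => evalF x (v i)) ∈ Metric.eball (0 : Fin 4 → ℂ) r := by
      have hn : ‖fun i => evalF x (v i)‖ ≤ (l1Const s + 1) * ‖v‖ := by
        have := l1Const_nonneg s
        refine (pi_norm_le_iff_of_nonneg (by positivity)).2 fun i => ?_
        refine (norm_evalF_le x _).trans ?_
        have := norm_le_pi_norm v i
        gcongr
        linarith
      rw [Metric.mem_eball, edist_zero_right, ← ofReal_norm]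
      refine lt_of_lt_of_le ((ENNReal.ofReal_lt_iff_lt_toReal (norm_nonneg _) (ne_top_of_le_ne_top
        ENNReal.one_ne_top (min_le_right _ _))).2 (hn.trans_lt hv)) (min_le_left _ _)
    have h2 := hr.hasSum hz
    simp only [zero_add] at h1 h2
    refine h1.unique (h2.congr_fun fun n => ?_)
    rw [hP, evalF_liftSeries, hdiag]

/-! ### The Hamiltonian of the nonlinearity -/

theorem isBigO_fderiv {E : Type*} [NormedAddCommGroup E] [NormedSpace ℂ E] {g : E → ℂ}
    (hg : AnalyticAt ℂ g 0) {N : ℕ} (hN : g =O[𝓝 0] fun z => ‖z‖ ^ (N + 2)) :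
    (fun z => fderiv ℂ g z) =O[𝓝 0] fun z => ‖z‖ ^ (N + 1) := by
  obtain ⟨C, hC0, hC⟩ := hN.exists_nonneg
  obtain ⟨r, hr, h⟩ := Metric.eventually_nhds_iff_ball.1 (hC.bound.and hg.eventually_analyticAt)
  refine Asymptotics.IsBigO.of_bound (C * 2 ^ (N + 3)) ?_
  filter_upwards [Metric.ball_mem_nhds (0 : E) (half_pos hr)] with z hz
  rw [norm_pow, norm_norm]
  refine norm_fderiv_le_pow (r := r) (fun y hy => ?_) (mem_ball_zero_iff.1 hz)
  have := h y (mem_ball_zero_iff.2 hy)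
  exact ⟨this.2.differentiableAt, by simpa using this.1⟩

/-- The values of `a, ā, b, b̄` at a point of the circle. -/
def valU (x : ℝ) (w : Λ) (i : Fin 4) : ℂ := evalF x (toV s w i)

theorem R5_eq (g : (Fin 4 → ℂ) → ℂ) (w : Λ) :
    R5 g w = ((2 * Real.pi : ℝ) : ℂ)⁻¹ * ∫ x in (0 : ℝ)..(2 * Real.pi), g (valU x w) := by
  unfold R5
  congr 2
  funext x
  congr 1
  have e : ∀ y : ℤ → ℂ, ∑' j : ℤ, y j * exp (-(I * j * x)) = ∑' j : ℤ,
    y (-j) * exp (I * j * x) := by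
    intro y
    rw [← (Equiv.neg ℤ).tsum_eq]
    exact tsum_congr fun n => by simp
  rw [e, e]
  funext i
  fin_cases i <;> rfl

theorem norm_valU_le (x : ℝ) (w : Λ) : ‖valU x w‖ ≤ l1Const s * ‖w‖ := by
  have := l1Const_nonneg s
  refine (pi_norm_le_iff_of_nonneg (by positivity)).2 fun i => ?_
  refine (norm_evalF_le x _).trans ?_
  have := norm_toV_le w i
  gcongr

/-- The Hamiltonian `R₅` is analytic near the origin and has an analytic gradient of order four. -/
theorem exists_isGrad_R5 {g : (Fin 4 → ℂ) → ℂ} (hg : Admissible g) : ∃ δ C : ℝ, ∃ G : Λ → Λ, 0 < δ ∧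
    0 ≤ C ∧ IsGrad (R5 g) G (ball 0 δ) ∧ ∀ w ∈ ball (0 : Λ) δ, ‖G w‖ ≤ C * ‖w‖ ^ 4 := by
  obtain ⟨H, hHa, -, hHe⟩ := exists_superposition (s := s) hg.analytic hg.order
  have hfd : AnalyticAt ℂ (fderiv ℂ g) 0 := hg.analytic.fderiv
  have hpart : ∀ i : Fin 4, ∃ H : VSpace s → Four s,
    AnalyticAt ℂ H 0 ∧ (H =O[𝓝 0] fun v => ‖v‖ ^ 4) ∧ ∀ᶠ v in 𝓝 0, ∀ x,
    evalF x (H v) = fderiv ℂ g (fun i => evalF x (v i)) (Pi.single i 1) := by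
    intro i
    refine exists_superposition (h := fun z => fderiv ℂ g z (Pi.single i 1))
      (analyticAt_clm_apply hfd analyticAt_const) ?_
    exact (ContinuousLinearMap.isBigO_comp (ContinuousLinearMap.apply ℂ ℂ
      (Pi.single i 1 : Fin 4 → ℂ)) _ _).trans (isBigO_fderiv (N := 3) hg.analytic hg.order)
  choose D hDa hDO hDe using hpart
  have hO : (fun v => fun i => D i v) =O[𝓝 0] fun v : VSpace s => ‖v‖ ^ 4 :=
    Asymptotics.isBigO_pi.2 hDO
  obtain ⟨C, hC0, hC⟩ := hO.exists_nonneg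
  obtain ⟨r, hr, hgr⟩ := Metric.eventually_nhds_iff_ball.1 hg.analytic.eventually_analyticAt
  obtain ⟨δ₁, hδ₁, h1⟩ :=
    Metric.eventually_nhds_iff_ball.1 (((hHa.eventually_analyticAt.and hHe).and hC.bound).and
    ((eventually_all.2 fun i => (hDa i).eventually_analyticAt).and (eventually_all.2 hDe)))
  have hL := l1Const_nonneg s
  set δ := min δ₁ (r / (l1Const s + 1)) with hδ
  have hδ0 : 0 < δ := lt_min hδ₁ (by positivity)
  have hV : ∀ w ∈ ball (0 : Λ) δ, toV s w ∈ ball (0 : VSpace s) δ₁ := by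
    intro w hw
    rw [mem_ball_zero_iff] at hw ⊢
    exact ((pi_norm_le_iff_of_nonneg (norm_nonneg _)).2 fun i => norm_toV_le w i).trans_lt
      (hw.trans_le (min_le_left _ _))
  have hU : ∀ w ∈ ball (0 : Λ) δ, ∀ x, AnalyticAt ℂ g (valU x w) := by
    intro w hw x
    refine hgr _ ?_
    rw [mem_ball_zero_iff] at hw ⊢
    refine (norm_valU_le x w).trans_lt ?_
    have h2 : ‖w‖ < r / (l1Const s + 1) := hw.trans_le (min_le_right _ _)
    rw [lt_div_iff₀ (by positivity)] at h2
    nlinarith [norm_nonneg w]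
  have hR : ∀ w ∈ ball (0 : Λ) δ, R5 g w = coord zWeight s 0 (H (toV s w)) := by
    intro w hw
    rw [R5_eq, ← mean_evalF]
    congr 2
    funext x
    exact ((h1 _ (hV w hw)).1.1.2 x).symm
  have hHat : ∀ w ∈ ball (0 : Λ) δ, AnalyticAt ℂ (fun w => H (toV s w)) w :=
    fun w hw => analyticAt_comp' (h1 _ (hV w hw)).1.1.1 ((toV s).analyticAt w)
  refine ⟨δ, ‖gradP s‖ * C, fun w => gradP s (fun i => D i (toV s w)), hδ0, by positivity,
    ⟨fun w hw => ?_, fun w hw => ?_, fun w hw => ?_⟩, fun w hw => ?_⟩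
  · have h2 : AnalyticAt ℂ (fun w => coord zWeight s 0 (H (toV s w))) w :=
      analyticAt_comp' ((coord zWeight s 0).analyticAt _) (hHat w hw)
    refine h2.congr ?_
    filter_upwards [Metric.isOpen_ball.mem_nhds hw] with y hy using (hR y hy).symm
  · refine analyticAt_comp' ((gradP s).analyticAt _) (AnalyticAt.pi fun i => ?_)
    exact analyticAt_comp' ((h1 _ (hV w hw)).2.1 i) ((toV s).analyticAt w)
  · have h2 : HasFDerivAt H (fderiv ℂ H (toV s w)) (toV s w) :=
      (h1 _ (hV w hw)).1.1.1.differentiableAt.hasFDerivAt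
    have h3 : HasFDerivAt (fun w => coord zWeight s 0 (H (toV s w)))
      ((coord zWeight s 0).comp ((fderiv ℂ H (toV s w)).comp (toV s))) w :=
      (coord zWeight s 0).hasFDerivAt.comp w (h2.comp w (toV s).hasFDerivAt)
    have h4 :
      HasFDerivAt (R5 g) ((coord zWeight s 0).comp ((fderiv ℂ H (toV s w)).comp (toV s))) w := by
      refine h3.congr_of_eventuallyEq ?_
      filter_upwards [Metric.isOpen_ball.mem_nhds hw] with y hy using hR y hy
    refine h4.congr_fderiv (ContinuousLinearMap.ext fun h => ?_)
    rw [beta_gradP]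
    simp only [bpair_eq_coord, ← map_sum, ContinuousLinearMap.comp_apply]
    rw [← mean_evalF, ← mean_evalF]
    congr 2
    funext x
    -- the chain rule at a point of the circle
    let E : VSpace s →L[ℂ] (Fin 4 → ℂ) := ContinuousLinearMap.pi fun i =>
      (evalF x).comp (proj (R := ℂ) (φ := fun _ : Fin 4 => Four s) i)
    have e1 : HasFDerivAt (fun v => evalF x (H v)) ((evalF x).comp (fderiv ℂ H (toV s w)))
      (toV s w) := (evalF x).hasFDerivAt.comp _ h2
    have e2 : HasFDerivAt (fun v => g (E v)) ((fderiv ℂ g (E (toV s w))).comp E) (toV s w) :=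
      HasFDerivAt.comp (g := g) (toV s w) (hU w hw x).differentiableAt.hasFDerivAt E.hasFDerivAt
    have e3 :
      HasFDerivAt (fun v => evalF x (H v)) ((fderiv ℂ g (E (toV s w))).comp E) (toV s w) := by
      refine e2.congr_of_eventuallyEq ?_
      filter_upwards [Metric.isOpen_ball.mem_nhds (hV w hw)] with v hv
      exact (h1 v hv).1.1.2 x
    have e4 := congrArg (fun L : VSpace s →L[ℂ] ℂ => L (toV s h)) (e1.unique e3)
    change evalF x (fderiv ℂ H (toV s w) (toV s h)) = fderiv ℂ g (E (toV s w)) (E (toV s h)) at e4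
    rw [e4, map_sum]
    have e5 : E (toV s h) = ∑ i, evalF x (toV s h i) • (Pi.single i (1 : ℂ) : Fin 4 → ℂ) := by
      rw [pi_eq_sum_univ (E (toV s h))]
      refine Finset.sum_congr rfl fun i _ => ?_
      congr 1
      funext j
      simp [Pi.single_apply, eq_comm]
    rw [e5, map_sum]
    refine Finset.sum_congr rfl fun i _ => ?_
    rw [evalF_convL, map_smul, smul_eq_mul, mul_comm, (h1 _ (hV w hw)).2.2 i x]
    rfl
  · refine ((gradP s).le_opNorm _).trans ?_
    rw [mul_assoc]
    refine mul_le_mul_of_nonneg_left ?_ (norm_nonneg _)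
    refine ((h1 _ (hV w hw)).1.2).trans ?_
    rw [norm_pow, norm_norm]
    have := (pi_norm_le_iff_of_nonneg (norm_nonneg _)).2 fun i => norm_toV_le w i
    gcongr

/-! ### Symmetries of the nonlinearity -/

/-- Analytic functions on a polydisc that vanish at its real points vanish. -/
theorem eq_zero_of_real {k : (Fin 4 → ℂ) → ℂ} {r : ℝ} (hk : AnalyticOnNhd ℂ k (ball 0 r))
    (h : ∀ t ∈ ball (0 : Fin 4 → ℂ) r, (∀ i, (t i).im = 0) → k t = 0) :
    ∀ t ∈ ball (0 : Fin 4 → ℂ) r, k t = 0 := by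
  intro t ht
  -- the complex line through `t` and its real part
  set e : ℂ → Fin 4 → ℂ := fun z i => (t i).re + z * (t i).im with he
  have hc : ∀ z, AnalyticAt ℂ e z := fun z =>
    AnalyticAt.pi fun i => analyticAt_const.add (analyticAt_id.mul analyticAt_const)
  have hU : IsPreconnected (e ⁻¹' ball 0 r) := by
    refine Convex.isPreconnected fun x hx y hy a b ha hb hab => ?_
    have := convex_ball (0 : Fin 4 → ℂ) r hx hy ha hb hab
    rw [mem_preimage]
    convert this using 1
    funext i
    have hab' : (a : ℂ) + b = 1 := by exact_mod_cast hab
    simp only [he, Pi.add_apply, Pi.smul_apply, Complex.real_smul]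
    linear_combination -((t i).re : ℂ) * hab'
  have h0 : (0 : ℂ) ∈ e ⁻¹' ball 0 r := by
    have hr : 0 < r := (norm_nonneg t).trans_lt (mem_ball_zero_iff.1 ht)
    refine mem_ball_zero_iff.2 ((pi_norm_lt_iff hr).2 fun i => ?_)
    refine lt_of_le_of_lt ?_ ((pi_norm_lt_iff hr).1 (mem_ball_zero_iff.1 ht) i)
    simpa [he] using Complex.abs_re_le_norm (t i)
  have hreal : Tendsto (fun x : ℝ => (x : ℂ)) (𝓝[≠] 0) (𝓝[≠] 0) :=
    tendsto_nhdsWithin_iff.2 ⟨(Complex.continuous_ofReal.tendsto' 0 0 rfl).mono_left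
      nhdsWithin_le_nhds, eventually_mem_nhdsWithin.mono fun x hx => by simpa using hx⟩
  have hfreq : ∃ᶠ z in 𝓝[≠] (0 : ℂ), k (e z) = 0 := by
    refine hreal.frequently (Eventually.frequently ?_)
    filter_upwards [hreal.eventually (nhdsWithin_le_nhds
      ((hc 0).continuousAt.preimage_mem_nhds (Metric.isOpen_ball.mem_nhds h0)))] with x hx
    exact h _ hx fun i => by simp [he]
  have hi : e I = t := funext fun i => by rw [he]; simp [mul_comm I, Complex.re_add_im]
  rw [← hi]
  exact AnalyticOnNhd.eqOn_zero_of_preconnected_of_frequently_eq_zero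
    (f := fun z => k (e z)) (fun z hz => (hk _ hz).comp (hc z)) hU h0 hfreq
    (by exact show e I ∈ ball 0 r by rwa [hi])

/-- The rotation `(u, ū, v, v̄) ↦ (e^{iφ} u, e^{-iφ} ū, e^{iφ} v, e^{-iφ} v̄)`. -/
def gaugeRot (φ : ℝ) (z : Fin 4 → ℂ) :
    Fin 4 → ℂ := ![exp (I * φ) * z 0, exp (-(I * φ)) * z 1, exp (I * φ) * z 2, exp (-(I * φ)) * z 3]

theorem norm_exp_I_mul (φ : ℝ) : ‖exp (I * φ)‖ = 1 := by
  rw [mul_comm, Complex.norm_exp_ofReal_mul_I]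

theorem norm_exp_neg_I_mul (φ : ℝ) : ‖exp (-(I * φ))‖ = 1 := by
  rw [show -(I * φ) = ((-φ : ℝ) : ℂ) * I by push_cast; ring, Complex.norm_exp_ofReal_mul_I]

theorem norm_gaugeRot_le (φ : ℝ) (z : Fin 4 → ℂ) : ‖gaugeRot φ z‖ ≤ ‖z‖ := by
  refine (pi_norm_le_iff_of_nonneg (norm_nonneg _)).2 fun i => ?_
  have h := norm_le_pi_norm z
  fin_cases i
  · change ‖_ * z 0‖ ≤ _; rw [norm_mul, norm_exp_I_mul, one_mul]; exact h 0
  · change ‖_ * z 1‖ ≤ _; rw [norm_mul, norm_exp_neg_I_mul, one_mul]; exact h 1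
  · change ‖_ * z 2‖ ≤ _; rw [norm_mul, norm_exp_I_mul, one_mul]; exact h 2
  · change ‖_ * z 3‖ ≤ _; rw [norm_mul, norm_exp_neg_I_mul, one_mul]; exact h 3

/-- The coordinates in which the points `(a, ā, b, b̄)` are those with real coordinates. -/
def realCoords (t : Fin 4 → ℂ) : Fin 4 → ℂ :=
  ![t 0 + I * t 1, t 0 - I * t 1, t 2 + I * t 3, t 2 - I * t 3]

theorem analyticAt_realCoords (t : Fin 4 → ℂ) : AnalyticAt ℂ realCoords t := by
  have hp : ∀ i : Fin 4, AnalyticAt ℂ (fun t : Fin 4 → ℂ => t i) t := fun i =>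
    (proj (R := ℂ) (φ := fun _ : Fin 4 => ℂ) i).analyticAt t
  refine AnalyticAt.pi fun i => ?_
  fin_cases i
  · exact (hp 0).add (analyticAt_const.mul (hp 1))
  · exact (hp 0).sub (analyticAt_const.mul (hp 1))
  · exact (hp 2).add (analyticAt_const.mul (hp 3))
  · exact (hp 2).sub (analyticAt_const.mul (hp 3))

theorem norm_realCoords_le (t : Fin 4 → ℂ) (i : Fin 4) : ‖realCoords t i‖ ≤ 2 * ‖t‖ := by
  have h := norm_le_pi_norm t
  have ha : ∀ j k, ‖t j + I * t k‖ ≤ 2 * ‖t‖ := fun j k => by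
    refine (norm_add_le _ _).trans ?_
    rw [norm_mul, Complex.norm_I, one_mul]
    linarith [h j, h k]
  have hb : ∀ j k, ‖t j - I * t k‖ ≤ 2 * ‖t‖ := fun j k => by
    refine (norm_sub_le _ _).trans ?_
    rw [norm_mul, Complex.norm_I, one_mul]
    linarith [h j, h k]
  fin_cases i
  · exact ha 0 1
  · exact hb 0 1
  · exact ha 2 3
  · exact hb 2 3

theorem exists_realCoords (z : Fin 4 → ℂ) : ∃ t, ‖t‖ ≤ ‖z‖ ∧ realCoords t = z := by
  have hI := Complex.I_mul_I
  refine ⟨![(z 0 + z 1) / 2, -I * (z 0 - z 1) / 2, (z 2 + z 3) / 2,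
    -I * (z 2 - z 3) / 2], (pi_norm_le_iff_of_nonneg (norm_nonneg z)).2 fun i => ?_, ?_⟩
  · have h := norm_le_pi_norm z
    have ha : ∀ j k, ‖(z j + z k) / 2‖ ≤ ‖z‖ := fun j k => by
      rw [norm_div, Complex.norm_ofNat, div_le_iff₀ two_pos]
      exact (norm_add_le _ _).trans (by linarith [h j, h k])
    have hb : ∀ j k, ‖-I * (z j - z k) / 2‖ ≤ ‖z‖ := fun j k => by
      rw [norm_div, norm_mul, norm_neg, Complex.norm_I, one_mul, Complex.norm_ofNat,
        div_le_iff₀ two_pos]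
      exact (norm_sub_le _ _).trans (by linarith [h j, h k])
    fin_cases i
    · exact ha 0 1
    · exact hb 0 1
    · exact ha 2 3
    · exact hb 2 3
  · funext i
    fin_cases i
    · change (z 0 + z 1) / 2 + I * (-I * (z 0 - z 1) / 2) = z 0
      linear_combination (-(z 0 - z 1) / 2) * hI
    · change (z 0 + z 1) / 2 - I * (-I * (z 0 - z 1) / 2) = z 1
      linear_combination ((z 0 - z 1) / 2) * hI
    · change (z 2 + z 3) / 2 + I * (-I * (z 2 - z 3) / 2) = z 2
      linear_combination (-(z 2 - z 3) / 2) * hI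
    · change (z 2 + z 3) / 2 - I * (-I * (z 2 - z 3) / 2) = z 3
      linear_combination ((z 2 - z 3) / 2) * hI

/-- The points `(a, ā, b, b̄)` form a totally real subspace on which analytic functions are
determined. -/
theorem eq_zero_of_totally_real {k : (Fin 4 → ℂ) → ℂ} {r : ℝ} (hr : 0 < r)
    (hk : AnalyticOnNhd ℂ k (ball 0 r)) (h : ∀ a b : ℂ, ‖a‖ < r → ‖b‖ < r →
    k ![a, conj a, b, conj b] = 0) : ∀ z ∈ ball (0 : Fin 4 → ℂ) (r / 2), k z = 0 := by
  have hball : ∀ t ∈ ball (0 : Fin 4 → ℂ) (r / 2), ‖realCoords t‖ < r := by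
    intro t ht
    rw [mem_ball_zero_iff] at ht
    exact (pi_norm_lt_iff hr).2 fun i => (norm_realCoords_le t i).trans_lt (by linarith)
  have key := eq_zero_of_real (k := fun t => k (realCoords t)) (r := r / 2) (fun t ht =>
    analyticAt_comp' (hk _ (mem_ball_zero_iff.2 (hball t ht))) (analyticAt_realCoords t)) (fun t ht
    hreal => by
      have hc : ∀ i, conj (t i) = t i := fun i => Complex.conj_eq_iff_im.2 (hreal i)
      have e1 : realCoords t =
        ![t 0 + I * t 1, conj (t 0 + I * t 1), t 2 + I * t 3, conj (t 2 + I * t 3)] := by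
        simp only [realCoords, map_add, map_mul, hc, Complex.conj_I, neg_mul, ← sub_eq_add_neg]
      have hSt := hball t ht
      rw [pi_norm_lt_iff hr] at hSt
      simp only [e1]
      exact h _ _ (hSt 0) (hSt 2))
  intro z hz
  obtain ⟨t, ht, rfl⟩ := exists_realCoords z
  exact key t (mem_ball_zero_iff.2 (ht.trans_lt (mem_ball_zero_iff.1 hz)))

theorem analyticAt_gaugeRot (φ : ℝ) (z : Fin 4 → ℂ) : AnalyticAt ℂ (gaugeRot φ) z := by
  have hp : ∀ i : Fin 4, AnalyticAt ℂ (fun t : Fin 4 → ℂ => t i) z := fun i =>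
    (proj (R := ℂ) (φ := fun _ : Fin 4 => ℂ) i).analyticAt z
  refine AnalyticAt.pi fun i => ?_
  fin_cases i
  · exact analyticAt_const.mul (hp 0)
  · exact analyticAt_const.mul (hp 1)
  · exact analyticAt_const.mul (hp 2)
  · exact analyticAt_const.mul (hp 3)

theorem conj_exp_I_mul (φ : ℝ) : conj (exp (I * φ)) = exp (-(I * φ)) := by
  rw [← Complex.exp_conj, map_mul, Complex.conj_I, Complex.conj_ofReal, neg_mul]

/-- Gauge invariance and reality of an admissible nonlinearity on a polydisc. The invariance
holds at real points by assumption and extends by analyticity. -/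
theorem Admissible.exists_ball {g : (Fin 4 → ℂ) → ℂ} (hg : Admissible g) :
    ∃ r : ℝ, 0 < r ∧ (∀ z ∈ ball (0 : Fin 4 → ℂ) r, ∀ φ, g (gaugeRot φ z) = g z) ∧ ∀ a b : ℂ,
    ‖a‖ < r → ‖b‖ < r → (g ![a, conj a, b, conj b]).im = 0 := by
  obtain ⟨F, hF⟩ := hg.gauge
  obtain ⟨r₁, hr₁, h1⟩ := Metric.eventually_nhds_iff_ball.1 hg.analytic.eventually_analyticAt
  obtain ⟨r₂, hr₂, h2⟩ := Metric.eventually_nhds_iff_ball.1 (hg.real.and hF)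
  have h2' : ∀ a b : ℂ, ‖a‖ < r₂ → ‖b‖ < r₂ → (a, b) ∈ ball (0 : ℂ × ℂ) r₂ := by
    intro a b ha hb
    rw [mem_ball_zero_iff, Prod.norm_def]
    exact max_lt ha hb
  set r := min r₁ r₂ with hr
  have hrp : 0 < r := lt_min hr₁ hr₂
  have han : ∀ z : Fin 4 → ℂ, ‖z‖ < r → AnalyticAt ℂ g z := fun z hz =>
    h1 _ (mem_ball_zero_iff.2 (hz.trans_le (min_le_left _ _)))
  refine ⟨r / 2, half_pos hrp, fun z hz φ => ?_, fun a b ha hb => ?_⟩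
  · refine sub_eq_zero.1 (eq_zero_of_totally_real (k := fun z => g (gaugeRot φ z) - g z) hrp
      (fun z hz => ?_) (fun a b ha hb => ?_) z hz)
    · rw [mem_ball_zero_iff] at hz
      exact (analyticAt_comp' (f := gaugeRot φ) (han _ ((norm_gaugeRot_le φ z).trans_lt hz))
        (analyticAt_gaugeRot φ z)).sub (han z hz)
    · have ha2 := ha.trans_le (min_le_right _ _ : r ≤ r₂)
      have hb2 := hb.trans_le (min_le_right _ _ : r ≤ r₂)
      have hEn := norm_exp_I_mul φ
      have hEc := conj_exp_I_mul φ
      set E := exp (I * φ)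
      have hEE : E * conj E = 1 := by
        rw [Complex.mul_conj, Complex.normSq_eq_norm_sq, hEn]; simp
      have e2 :
        gaugeRot φ ![a, conj a, b, conj b] = ![E * a, conj (E * a), E * b, conj (E * b)] := by
        simp only [gaugeRot, map_mul, hEc]
        rfl
      have f1 := (h2 _ (h2' a b ha2 hb2)).2
      have f2 := (h2 _ (h2' (E * a) (E * b) (by rwa [norm_mul, hEn, one_mul])
        (by rwa [norm_mul, hEn, one_mul]))).2
      simp only at f1 f2
      have e3 : ∀ c d : ℂ, E * c * conj (E * d) = c * conj d := fun c d => by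
        rw [map_mul]
        linear_combination (c * conj d) * hEE
      simp only [e2]
      rw [f2, f1, e3, e3, e3, e3, sub_self]
  · have hle : r / 2 ≤ r₂ := (half_le_self hrp.le).trans (min_le_right _ _)
    exact (h2 _ (h2' a b (ha.trans_le hle) (hb.trans_le hle))).1

/-! ### Rotations and complex conjugation -/

namespace WSeq

variable {ι : Type} {w : Weight ι}

/-- Multiplication by a sequence bounded by `B`. -/
def mulC (w : Weight ι) (s : ℝ) (m : ι → ℂ) (B : ℝ) (hm : ∀ α, ‖m α‖ ≤ B) :
    WSeq w s →L[ℂ] WSeq w s :=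
  LinearMap.mkContinuous
    { toFun := mulBdd m ⟨B, hm⟩
      map_add' := fun x y => by ext α; exact mul_add _ _ _
      map_smul' := fun c x => by ext α; exact mul_left_comm _ _ _ }
    (max B 0) (fun x => by
      refine norm_le_of_eSq_le (by positivity) ?_
      rw [ENNReal.ofReal_mul (le_max_right _ _), mul_pow, ofReal_norm, ← eSq_coe]
      unfold eSq
      rw [← ENNReal.tsum_mul_left]
      refine ENNReal.tsum_le_tsum fun α => ?_
      rw [← mul_pow]
      refine pow_le_pow_left' ?_ 2
      change _ * ‖m α * x α‖ₑ ≤ _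
      rw [enorm_mul, mul_left_comm]
      refine mul_le_mul_left ?_ _
      rw [← ofReal_norm]
      exact ENNReal.ofReal_le_ofReal ((hm α).trans (le_max_left _ _)))

@[simp] theorem mulC_apply (m : ι → ℂ) (B : ℝ) (hm : ∀ α, ‖m α‖ ≤ B) (x : WSeq w s) (α : ι) :
    mulC w s m B hm x α = m α * x α := rfl

theorem norm_mulC_le (m : ι → ℂ) (B : ℝ) (hB : 0 ≤ B) (hm : ∀ α, ‖m α‖ ≤ B) (x : WSeq w s) :
    ‖mulC w s m B hm x‖ ≤ B * ‖x‖ := by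
  have :=
    (mulC w s m B hm).le_of_opNorm_le (LinearMap.mkContinuous_norm_le _ (le_max_right B 0) _) x
  rwa [max_eq_left hB] at this

/-- The sequence of complex conjugates. -/
def conjSeq (x : WSeq w s) : WSeq w s := ⟨fun α => conj (x α), by
  refine (x.summable).congr fun α => ?_
  rw [Complex.norm_conj]⟩

@[simp] theorem conjSeq_apply (x : WSeq w s) (α : ι) : conjSeq x α = conj (x α) := rfl

theorem norm_conjSeq (x : WSeq w s) : ‖conjSeq x‖ = ‖x‖ := by
  have h := norm_sq_eq (conjSeq x)
  simp only [conjSeq_apply, Complex.norm_conj] at h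
  rw [← norm_sq_eq x] at h
  exact (pow_left_inj₀ (norm_nonneg _) (norm_nonneg _) two_ne_zero).1 h

end WSeq

/-- The multiplier of the rotation `a_j ↦ e^{i(φ + jψ)} a_j`. -/
def rotMul (φ ψ : ℝ) (α : Mode) : ℂ := exp (I * ((φ + ψ * α.1 : ℝ) : ℂ))

theorem norm_rotMul (φ ψ : ℝ) (α : Mode) : ‖rotMul φ ψ α‖ ≤ 1 := (norm_exp_I_mul _).le

theorem rotMul_mul_neg (φ ψ : ℝ) (α : Mode) : rotMul φ ψ α * rotMul (-φ) (-ψ) α = 1 := by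
  unfold rotMul
  rw [← exp_add, ← mul_add, ← Complex.ofReal_add,
    show φ + ψ * α.1 + (-φ + -ψ * α.1) = (0 : ℝ) by ring]
  simp

/-- The gauge transformations combined with the translations of the circle. -/
def rot (s φ ψ : ℝ) : PSpace s →L[ℂ] PSpace s := (WSeq.mulC fullWeight s (rotMul φ ψ) 1 (norm_rotMul
    φ ψ)).prodMap (WSeq.mulC fullWeight s (rotMul (-φ) (-ψ)) 1 (norm_rotMul (-φ) (-ψ)))

theorem rot_fst (φ ψ : ℝ) (w : Λ) (α : Mode) : (rot s φ ψ w).1 α = rotMul φ ψ α * w.1 α := rfl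

theorem rot_snd (φ ψ : ℝ) (w : Λ) (α : Mode) : (rot s φ ψ w).2 α = rotMul (-φ) (-ψ) α * w.2 α := rfl

theorem norm_rot_le (φ ψ : ℝ) (w : Λ) : ‖rot s φ ψ w‖ ≤ ‖w‖ := by
  rw [Prod.norm_def, Prod.norm_def]
  have h1 :=
    WSeq.norm_mulC_le (w := fullWeight) (s := s) (rotMul φ ψ) 1 zero_le_one (norm_rotMul φ ψ) w.1
  have h2 := WSeq.norm_mulC_le (w := fullWeight) (s := s) (rotMul (-φ) (-ψ)) 1 zero_le_one
    (norm_rotMul (-φ) (-ψ)) w.2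
  rw [one_mul] at h1 h2
  exact max_le_max h1 h2

/-- The quartic monomials are invariant under rotations. -/
theorem quart_rot (c : Mult Quad) (φ ψ : ℝ) (a a' b b' : ℤ → ℂ) : quart c (fun n => rotMul φ ψ (n,
    true) * a n) (fun n => rotMul (-φ) (-ψ) (-n, true) * a' n) (fun n => rotMul φ ψ (n, true) * b n)
    (fun n => rotMul (-φ) (-ψ) (-n, true) * b' n) = quart c a a' b b' := by
  unfold quart
  refine tsum_congr fun t => ?_
  have h : rotMul φ ψ (t.2.2, true) * rotMul φ ψ (t.1 + t.2.1 - t.2.2,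
    true) * rotMul (-φ) (-ψ) (- -t.1, true) * rotMul (-φ) (-ψ) (- -t.2.1, true) = 1 := by
    unfold rotMul
    rw [← exp_add, ← exp_add, ← exp_add, ← mul_add, ← mul_add, ← mul_add,
      ← Complex.ofReal_add, ← Complex.ofReal_add, ← Complex.ofReal_add]
    simp only
    push_cast
    rw [show (I * ((φ : ℂ) + ψ * t.2.2 + (φ + ψ * (t.1 + t.2.1 - t.2.2)) +
      (-φ + -ψ * - -(t.1 : ℂ)) + (-φ + -ψ * - -(t.2.1 : ℂ)))) = 0 by ring, exp_zero]
  linear_combination (c.1 t * (a t.2.2 * b (t.1 + t.2.1 - t.2.2) * a' (-t.1) * b' (-t.2.1))) * h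

theorem toV_rot (φ ψ : ℝ) (w : Λ) :
    ((toV s (rot s φ ψ w) 0).1 = fun n => rotMul φ ψ (n, true) * toV s w 0 n) ∧
    ((toV s (rot s φ ψ w) 1).1 = fun n => rotMul (-φ) (-ψ) (-n, true) * toV s w 1 n) ∧
    ((toV s (rot s φ ψ w) 2).1 = fun n => rotMul φ ψ (n, true) * toV s w 2 n) ∧
    ((toV s (rot s φ ψ w) 3).1 = fun n => rotMul (-φ) (-ψ) (-n, true) * toV s w 3 n) :=
    ⟨rfl, rfl, rfl, rfl⟩

theorem quartP_rot (c : Mult Quad) (φ ψ : ℝ) (w : Λ) : quartP c (rot s φ ψ w) = quartP c w := by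
  obtain ⟨h0, h1, h2, h3⟩ := toV_rot φ ψ w
  unfold quartP
  rw [h0, h1, h2, h3, quart_rot]

theorem beta_quartGrad_rot (c : Mult Quad) (φ ψ : ℝ) (w h : Λ) :
    beta (quartGrad c (rot s φ ψ w)) (rot s φ ψ h) = beta (quartGrad c w) h := by
  obtain ⟨h0, h1, h2, h3⟩ := toV_rot φ ψ w
  obtain ⟨k0, k1, k2, k3⟩ := toV_rot φ ψ h
  rw [beta_quartGrad, beta_quartGrad, h0, h1, h2, h3, k0, k1, k2, k3]
  simp only [quart_rot]

theorem rot_single (φ ψ : ℝ) (α : Mode) : rot s φ ψ (single α, 0) = rotMul φ ψ α • (single α, 0) ∧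
    rot s φ ψ (0, single α) = rotMul (-φ) (-ψ) α • (0, single α) := by
  have e : ∀ m : Mode → ℂ, ∀ hm, WSeq.mulC fullWeight s m 1 hm (single α) = m α • single α := by
    intro m hm
    ext β
    rw [WSeq.mulC_apply, WSeq.smul_apply]
    by_cases h : β = α
    · rw [h]
    · rw [single_of_ne h, mul_zero, mul_zero]
  exact ⟨Prod.ext (e (rotMul φ ψ) (norm_rotMul φ ψ)) (by simp [rot]),
    Prod.ext (by simp [rot]) (e (rotMul (-φ) (-ψ)) (norm_rotMul (-φ) (-ψ)))⟩

theorem vecX_rot (φ ψ : ℝ) (w : Λ) : vecX (rot s φ ψ w) = rot s φ ψ (vecX w) := by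
  have e := rotMul_mul_neg φ ψ
  refine Prod.ext (WSeq.ext fun α => ?_) (WSeq.ext fun α => ?_)
  · change (quartGrad chiMult (rot s φ ψ w)).2 α = rotMul φ ψ α * (quartGrad chiMult w).2 α
    have h := beta_quartGrad_rot chiMult φ ψ w (0, single α)
    rw [(rot_single φ ψ α).2, map_smul, beta_single_snd, beta_single_snd, smul_eq_mul] at h
    rw [← h, ← mul_assoc, e, one_mul]
  · change -(quartGrad chiMult (rot s φ ψ w)).1 α = rotMul (-φ) (-ψ) α * -(quartGrad chiMult w).1 α
    have h := beta_quartGrad_rot chiMult φ ψ w (single α, 0)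
    rw [(rot_single φ ψ α).1, map_smul, beta_single_fst, beta_single_fst, smul_eq_mul] at h
    rw [← h]
    linear_combination (quartGrad chiMult (rot s φ ψ w)).1 α * e α

/-- The real structure `(u, ū) ↦ (conj ū, conj u)` of the phase space. -/
def conjP (w : Λ) : Λ := (w.2.conjSeq, w.1.conjSeq)

theorem isRealPoint_iff (w : Λ) : IsRealPoint w ↔ conjP w = w := by
  constructor
  · intro h
    refine Prod.ext (WSeq.ext fun α => ?_) (WSeq.ext fun α => ?_)
    · change conj (w.2 α) = w.1 α
      rw [h α, Complex.conj_conj]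
    · exact (h α).symm
  · intro h α
    have := congrArg (fun x : Λ => x.2 α) h
    exact this.symm

theorem norm_conjP (w : Λ) : ‖conjP w‖ = ‖w‖ := by
  rw [Prod.norm_def, Prod.norm_def]
  change max ‖w.2.conjSeq‖ ‖w.1.conjSeq‖ = _
  rw [WSeq.norm_conjSeq, WSeq.norm_conjSeq, max_comm]

/-- The exchange of the two pairs of indices of a quartic monomial. -/
def swapIdx : Quad ≃ Quad where
  toFun t := (t.2.2, t.1 + t.2.1 - t.2.2, t.1)
  invFun t := (t.2.2, t.1 + t.2.1 - t.2.2, t.1)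
  left_inv t := by ext <;> simp
  right_inv t := by ext <;> simp

theorem quart_conj {c : Mult Quad} {κ : ℝ} (hc : ∀ t, c.1 (swapIdx t) = κ * conj (c.1 t))
    (a a' b b' : ℤ → ℂ) : quart c (fun n => conj (a' (-n))) (fun n => conj (a (-n)))
    (fun n => conj (b' (-n))) (fun n => conj (b (-n))) = κ * conj (quart c a a' b b') := by
  unfold quart
  rw [Complex.conj_tsum, ← tsum_mul_left, ← swapIdx.tsum_eq]
  refine tsum_congr fun t => ?_
  rw [hc]
  simp only [swapIdx, Equiv.coe_fn_mk, neg_neg, map_mul]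
  rw [show t.2.2 + (t.1 + t.2.1 - t.2.2) - t.1 = t.2.1 by ring]
  ring

theorem toV_conjP (w : Λ) : ((toV s (conjP w) 0).1 = fun n => conj (toV s w 1 (-n))) ∧
    ((toV s (conjP w) 1).1 = fun n => conj (toV s w 0 (-n))) ∧ ((toV s (conjP w) 2).1 =
    fun n => conj (toV s w 3 (-n))) ∧ ((toV s (conjP w) 3).1 = fun n => conj (toV s w 2 (-n))) := by
  refine ⟨funext fun n => ?_, rfl, funext fun n => ?_, rfl⟩
  · change conj (w.2 (n, true)) = conj (w.2 (- -n, true))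
    rw [neg_neg]
  · change conj (w.2 (n, false)) = conj (w.2 (- -n, false))
    rw [neg_neg]

theorem quartP_conjP {c : Mult Quad} {κ : ℝ} (hc : ∀ t, c.1 (swapIdx t) = κ * conj (c.1 t))
    (w : Λ) : quartP c (conjP w) = κ * conj (quartP c w) := by
  obtain ⟨h0, h1, h2, h3⟩ := toV_conjP w
  unfold quartP
  rw [h0, h1, h2, h3, quart_conj hc]

theorem beta_quartGrad_conjP {c : Mult Quad} {κ : ℝ} (hc : ∀ t, c.1 (swapIdx t) = κ * conj (c.1 t))
    (w h : Λ) : beta (quartGrad c (conjP w)) (conjP h) = κ * conj (beta (quartGrad c w) h) := by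
  obtain ⟨h0, h1, h2, h3⟩ := toV_conjP w
  obtain ⟨k0, k1, k2, k3⟩ := toV_conjP h
  rw [beta_quartGrad, beta_quartGrad, h0, h1, h2, h3, k0, k1, k2, k3]
  simp only [quart_conj hc, map_add]
  ring

theorem freq_swap (t : Quad) : freq (swapIdx t) = -freq t := by
  simp only [freq, swapIdx, Equiv.coe_fn_mk]
  ring

theorem chi_swap (t : Quad) : chiMult.1 (swapIdx t) = ((-1 : ℝ) : ℂ) * conj (chiMult.1 t) := by
  simp only [chiMult, freq_swap, map_inv₀, map_intCast]
  push_cast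
  rw [inv_neg]; ring

theorem res_swap (t : Quad) : resMult.1 (swapIdx t) = ((1 : ℝ) : ℂ) * conj (resMult.1 t) := by
  simp only [resMult, freq_swap, neg_eq_zero]
  split_ifs <;> simp

theorem one_swap (t : Quad) : oneMult.1 (swapIdx t) = ((1 : ℝ) : ℂ) * conj (oneMult.1 t) := by
  simp [oneMult]

theorem conjP_single (α : Mode) :
    conjP ((single α, 0) : Λ) = (0, single α) ∧ conjP ((0, single α) : Λ) = (single α, 0) := by
  have h1 : WSeq.conjSeq (single α : MSeq s) = single α := by
    ext β
    rw [WSeq.conjSeq_apply, WSeq.single_apply]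
    split_ifs <;> simp
  have h2 : WSeq.conjSeq (0 : MSeq s) = 0 := by
    ext β
    simp
  exact ⟨Prod.ext h2 h1, Prod.ext h1 h2⟩

theorem vecX_conjP (w : Λ) : vecX (conjP w) = conjP (vecX w) := by
  refine Prod.ext (WSeq.ext fun α => ?_) (WSeq.ext fun α => ?_)
  · change (quartGrad chiMult (conjP w)).2 α = conj (-(quartGrad chiMult w).1 α)
    have h := beta_quartGrad_conjP chi_swap w (single α, 0)
    rw [(conjP_single α).1, beta_single_snd, beta_single_fst] at h
    rw [h, map_neg]
    push_cast
    ring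
  · change -(quartGrad chiMult (conjP w)).1 α = conj ((quartGrad chiMult w).2 α)
    have h := beta_quartGrad_conjP chi_swap w (0, single α)
    rw [(conjP_single α).2, beta_single_snd, beta_single_fst] at h
    rw [h]
    push_cast
    ring

theorem quartP_real {c : Mult Quad} (hc : ∀ t, c.1 (swapIdx t) = ((1 : ℝ) : ℂ) * conj (c.1 t))
    {w : Λ} (hw : IsRealPoint w) : (quartP c w).im = 0 := by
  have h := quartP_conjP hc w
  rw [(isRealPoint_iff w).1 hw, Complex.ofReal_one, one_mul] at h
  exact Complex.conj_eq_iff_im.1 h.symm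

/-! ### Symmetries of the nonlinear Hamiltonian -/

theorem valU_rot (φ ψ x : ℝ) (w : Λ) : valU x (rot s φ ψ w) = gaugeRot φ (valU (x + ψ) w) := by
  obtain ⟨h0, h1, h2, h3⟩ := toV_rot φ ψ w
  have e1 : ∀ y : Four s, ∀ y' : Four s, (y'.1 = fun n => rotMul φ ψ (n, true) * y n) → evalF x y' =
    exp (I * φ) * evalF (x + ψ) y := by
    intro y y' hy
    rw [evalF_apply, evalF_apply, hy, ← tsum_mul_left]
    refine tsum_congr fun n => ?_
    have key :
      rotMul φ ψ (n, true) * exp (I * n * x) = exp (I * φ) * exp (I * n * ((x + ψ : ℝ) : ℂ)) := by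
      unfold rotMul
      rw [← exp_add, ← exp_add]
      congr 1
      push_cast
      ring
    linear_combination y n * key
  have e2 : ∀ y : Four s, ∀ y' : Four s, (y'.1 = fun n => rotMul (-φ) (-ψ) (-n, true) * y n) →
    evalF x y' = exp (-(I * φ)) * evalF (x + ψ) y := by
    intro y y' hy
    rw [evalF_apply, evalF_apply, hy, ← tsum_mul_left]
    refine tsum_congr fun n => ?_
    have key : rotMul (-φ) (-ψ) (-n, true) * exp (I * n * x) =
      exp (-(I * φ)) * exp (I * n * ((x + ψ : ℝ) : ℂ)) := by
      unfold rotMul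
      rw [← exp_add, ← exp_add]
      congr 1
      push_cast
      ring
    linear_combination y n * key
  funext i
  fin_cases i
  · exact e1 _ _ h0
  · exact e2 _ _ h1
  · exact e1 _ _ h2
  · exact e2 _ _ h3

theorem valU_periodic (w : Λ) : Function.Periodic (fun x => valU x w) (2 * Real.pi) := by
  intro x
  funext i
  change evalF _ _ = evalF _ _
  rw [evalF_apply, evalF_apply]
  refine tsum_congr fun n => ?_
  congr 1
  have : I * n * ((x + 2 * Real.pi : ℝ) : ℂ) = I * n * x + n * (2 * Real.pi * I) := by
    push_cast; ring
  rw [this, exp_add, Complex.exp_int_mul_two_pi_mul_I, mul_one]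

theorem exists_R5_symmetric {g : (Fin 4 → ℂ) → ℂ} (hg : Admissible g) : ∃ δ : ℝ, 0 < δ ∧ ∀ w ∈ ball
    (0 : Λ) δ, (∀ φ ψ, R5 g (rot s φ ψ w) = R5 g w) ∧ (IsRealPoint w → (R5 g w).im = 0) := by
  obtain ⟨r, hr, hrot, hreal⟩ := hg.exists_ball
  have hL := l1Const_nonneg s
  refine ⟨r / (l1Const s + 1), by positivity, fun w hw => ?_⟩
  have hval : ∀ x, ‖valU x w‖ < r := by
    intro x
    rw [mem_ball_zero_iff, lt_div_iff₀ (by positivity)] at hw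
    refine (norm_valU_le x w).trans_lt ?_
    nlinarith [norm_nonneg w]
  refine ⟨fun φ ψ => ?_, fun hw => ?_⟩
  · rw [R5_eq, R5_eq]
    congr 1
    have e : ∀ x, g (valU x (rot s φ ψ w)) = g (valU (x + ψ) w) := fun x => by
      rw [valU_rot, hrot _ (mem_ball_zero_iff.2 (hval _))]
    simp only [e]
    rw [intervalIntegral.integral_comp_add_right (fun x => g (valU x w)), zero_add,
      add_comm (2 * Real.pi)]
    have hper : Function.Periodic (fun x => g (valU x w)) (2 * Real.pi) := fun x =>
      congrArg g (valU_periodic w x)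
    have := hper.intervalIntegral_add_eq ψ 0
    rwa [zero_add] at this
  · have e : ∀ x, g (valU x w) = ((g (valU x w)).re : ℂ) := by
      intro x
      have hc : ∀ y y' : Four s,
        (y'.1 = fun n => conj (y (-n))) → evalF x y' = conj (evalF x y) := by
        intro y y' hy
        rw [evalF_apply, evalF_apply, Complex.conj_tsum, hy, ← (Equiv.neg ℤ).tsum_eq]
        refine tsum_congr fun n => ?_
        simp only [Equiv.neg_apply, neg_neg, map_mul, ← Complex.exp_conj, Complex.conj_I,
          Complex.conj_ofReal, map_intCast, Int.cast_neg]
        congr 2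
        ring
      have hfix := (isRealPoint_iff w).1 hw
      obtain ⟨-, h1, -, h3⟩ := toV_conjP w
      rw [hfix] at h1 h3
      have hv : valU x w = ![valU x w 0, conj (valU x w 0), valU x w 2, conj (valU x w 2)] := by
        funext i
        fin_cases i
        · rfl
        · exact hc _ _ h1
        · rfl
        · exact hc _ _ h3
      have hlt := (pi_norm_lt_iff hr).1 (hval x)
      have := hreal _ _ (hlt 0) (hlt 2)
      rw [← hv] at this
      exact Complex.ext (by simp) (by simpa using this)
    rw [R5_eq, show (fun x => g (valU x w)) = fun x => (((g (valU x w)).re : ℝ) : ℂ) from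
      funext e, intervalIntegral.integral_ofReal, ← Complex.ofReal_inv, ← Complex.ofReal_mul,
      Complex.ofReal_im]

/-! ### The normal form -/

theorem conj_two : conj (2 : ℂ) = 2 := Complex.conj_ofReal 2

namespace IsMidpoint

variable {K δ : ℝ} {m : PSpace s → PSpace s}

theorem map_rot (h : IsMidpoint K δ m) {w : Λ}
    (hw : w ∈ ball 0 δ) (φ ψ : ℝ) : m (rot s φ ψ w) = rot s φ ψ (m w) := by
  have hw' : rot s φ ψ w ∈ ball 0 δ := by
    rw [mem_ball_zero_iff] at hw ⊢
    exact (norm_rot_le φ ψ w).trans_lt hw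
  refine (h.unique _ hw' _ ((norm_rot_le φ ψ _).trans_lt (h.norm_lt hw)) ?_).symm
  rw [vecX_rot, ← map_smul, ← map_sub, h.eq w hw]

theorem tau_rot (h : IsMidpoint K δ m) {w : Λ} (hw : w ∈ ball 0 δ) (φ ψ : ℝ) :
    tau m (rot s φ ψ w) = rot s φ ψ (tau m w) := by
  unfold tau
  rw [h.map_rot hw, map_sub, map_smul]

theorem map_real (h : IsMidpoint K δ m) {w : Λ}
    (hw : w ∈ ball 0 δ) (hr : IsRealPoint w) : IsRealPoint (m w) := by
  rw [isRealPoint_iff] at hr ⊢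
  refine h.unique w hw _ (by rw [norm_conjP]; exact h.norm_lt hw) ?_
  rw [vecX_conjP]
  have e : conjP (m w) - ½ • conjP (vecX (m w)) = conjP (m w - ½ • vecX (m w)) := by
    refine Prod.ext (WSeq.ext fun α => ?_) (WSeq.ext fun α => ?_)
    · change conj ((m w).2 α) - ½ * conj ((vecX (m w)).2 α) =
        conj ((m w).2 α - ½ * (vecX (m w)).2 α)
      simp [conj_two]
    · change conj ((m w).1 α) - ½ * conj ((vecX (m w)).1 α) =
        conj ((m w).1 α - ½ * (vecX (m w)).1 α)
      simp [conj_two]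
  rw [e, h.eq w hw, hr]

theorem tau_real (h : IsMidpoint K δ m) {w : Λ}
    (hw : w ∈ ball 0 δ) (hr : IsRealPoint w) : IsRealPoint (tau m w) := by
  intro α
  change (2 : ℂ) * (m w).2 α - w.2 α = conj ((2 : ℂ) * (m w).1 α - w.1 α)
  rw [h.map_real hw hr α, hr α]
  simp [conj_two]

theorem norm_tau_sub (h : IsMidpoint K δ m) {w : Λ}
    (hw : w ∈ ball 0 δ) : ‖tau m w - m w‖ ≤ 4 * K * ‖w‖ ^ 3 := by
  have e : tau m w - m w = m w - w := by unfold tau; module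
  rw [e]
  exact h.norm_sub_le hw

theorem energy_eq (h : IsMidpoint K δ m) {w : Λ} (hw : w ∈ ball 0 δ) (hf : FiniteEnergy w) :
    FiniteEnergy (tau m w) ∧ P2 (tau m w) = P2 w + (Z4 (m w) - P4 (m w)) := by
  have hL := l1Const_nonneg s
  have hm : FiniteEnergy (m w) := by
    refine finiteEnergy_of_midpoint (h.eq w hw) ?_ hf
    have h1 := h.norm_lt hw
    have h2 := h.energy_small
    nlinarith
  have h1 := P2_midpoint (m w) _ rfl hm
  rwa [← h.tau_eq hw, h.eq w hw] at h1

/-- The remainder of order six. -/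
def rem6 (m : Λ → Λ) (w : Λ) : ℂ :=
  quartP resMult (m w) - quartP resMult w + (quartP oneMult (tau m w) - quartP oneMult (m w))

/-- The gradient of the remainder of order six. -/
def rem6Grad (m : Λ → Λ) (w : Λ) : Λ := transp m w (quartGrad resMult (m w)) - quartGrad resMult w +
    ((2 : ℂ) • transp m w (quartGrad oneMult (tau m w)) - quartGrad oneMult (tau m w) -
    transp m w (quartGrad oneMult (m w)))

theorem isGrad_rem6 (h : IsMidpoint K δ m) : IsGrad (rem6 m) (rem6Grad m) (ball 0 δ) :=
    ((h.isGrad_comp (isGrad_quart resMult) le_rfl (mapsTo_univ _ _)).sub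
    ((isGrad_quart resMult).mono (subset_univ _))).add ((h.isGrad_comp_tau (isGrad_quart oneMult)
    le_rfl (mapsTo_univ _ _)).sub (h.isGrad_comp (isGrad_quart oneMult) le_rfl (mapsTo_univ _ _)))

/-- Every difference in `rem6Grad` is of order five: the derivative of `m` is the identity up to a
term of order two, and `τ` and `m` are the identity up to terms of order three. -/
theorem exists_rem6Grad_bound (h : IsMidpoint K δ m) :
    ∃ C : ℝ, 0 ≤ C ∧ ∀ w ∈ ball (0 : Λ) δ, ‖rem6Grad m w‖ ≤ C * ‖w‖ ^ 5 := by
  obtain ⟨A, hA, -, hA3, hAl⟩ := exists_quartGrad_bound (s := s) resMult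
  obtain ⟨B, hB, -, hB3, hBl⟩ := exists_quartGrad_bound (s := s) oneMult
  have hK := h.K_nonneg
  refine ⟨48 * K * A + 112 * K * B, by positivity, fun w hw => ?_⟩
  have hm := h.norm_le w hw
  have ht := h.norm_tau_lt hw
  have hw0 := norm_nonneg w
  -- the transpose of the derivative of `m` is the identity up to a term of order two
  have htr : ∀ (A : ℝ) (g v : Λ), 0 ≤ A → ‖v‖ ≤ 2 * ‖w‖ → ‖g‖ ≤ A * ‖v‖ ^ 3 → ‖transp m w g - g‖ ≤
    32 * K * A * ‖w‖ ^ 5 := by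
    intro A g v hA hv hg
    have h1 := h.norm_transp_sub_le hw g
    have h2 : ‖g‖ ≤ A * (2 * ‖w‖) ^ 3 := hg.trans (by gcongr)
    calc _ ≤ 4 * K * ‖w‖ ^ 2 * (A * (2 * ‖w‖) ^ 3) := h1.trans (by gcongr)
      _ = _ := by ring
  have hlip : ∀ (A : ℝ) (G : Λ → Λ) (u v : Λ), 0 ≤ A →
    (∀ r : ℝ, ∀ u v, ‖u‖ ≤ r → ‖v‖ ≤ r → ‖G u - G v‖ ≤ A * r ^ 2 * ‖u - v‖) → ‖u‖ ≤ 2 * ‖w‖ →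
    ‖v‖ ≤ 2 * ‖w‖ → ‖u - v‖ ≤ 4 * K * ‖w‖ ^ 3 → ‖G u - G v‖ ≤ 16 * K * A * ‖w‖ ^ 5 := by
    intro A G u v hA hG hu hv huv
    calc _ ≤ A * (2 * ‖w‖) ^ 2 * (4 * K * ‖w‖ ^ 3) := (hG _ u v hu hv).trans (by gcongr)
      _ = _ := by ring
  have b1 := htr A _ (m w) hA hm (hA3 (m w))
  have b2 := hlip A _ (m w) w hA hAl hm (by linarith) (h.norm_sub_le hw)
  have b3 := htr B _ (tau m w) hB ht (hB3 (tau m w))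
  have b4 := hlip B _ (tau m w) (m w) hB hBl ht hm (h.norm_tau_sub hw)
  have b5 := htr B _ (m w) hB hm (hB3 (m w))
  have e : rem6Grad m w = (transp m w (quartGrad resMult (m w)) - quartGrad resMult (m w)) +
    (quartGrad resMult (m w) - quartGrad resMult w) + (2 : ℂ) • (transp m w (quartGrad oneMult (tau
    m w)) - quartGrad oneMult (tau m w)) + (quartGrad oneMult (tau m w) - quartGrad oneMult (m w)) -
    (transp m w (quartGrad oneMult (m w)) - quartGrad oneMult (m w)) := by
    unfold rem6Grad; module
  rw [e]
  refine (_root_.norm_sub_le _ _).trans ?_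
  refine (add_le_add (norm_add₃_le.trans (add_le_add (add_le_add (norm_add_le _ _) le_rfl) le_rfl))
    le_rfl).trans ?_
  rw [norm_smul, Complex.norm_ofNat]
  linarith

end IsMidpoint

open IsMidpoint in
/-- By the homological equation `P₂` changes by `Z₄ - P₄` at the midpoint `m(w)`, so
`(P₂ + P₄)(τ w) = (P₂ + Z₄)(w) + rem6 m w`. -/
theorem IsMidpoint.isBirkhoff {K δ : ℝ} {m : Λ → Λ} (h : IsMidpoint K δ m) {ε : ℝ} (hε : ε ≤ δ)
    {C : ℝ} (hC : 8 * K ≤ C) (hC5 : ∀ w ∈ ball (0 : Λ) δ, ‖rem6Grad m w‖ ≤ C * ‖w‖ ^ 5) :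
    IsBirkhoff s ε C (tau m) := by
  have hsub : ball (0 : Λ) ε ⊆ ball 0 δ := Metric.ball_subset_ball hε
  have hG := h.isGrad_rem6.mono hsub
  refine ⟨fun w hw => ?_, (h.analytic_tau.mono hsub).differentiableOn, h.injOn.mono hsub,
    fun w hw => h.invertible (hsub hw), fun w hw => h.tau_real (hsub hw),
    fun w hw => h.symplectic (hsub hw), fun w hw => ?_, fun w hw => ?_, fun w hw => ?_,
    rem6 m, rem6Grad m, hG.analytic.differentiableOn, hG.analytic_grad.differentiableOn, ?_,
    fun w hw => ⟨fun α => ?_, fun α => ?_, hC5 w (hsub hw)⟩, fun w hw hf => ?_⟩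
  · have h1 := h.norm_tau_lt (hsub hw)
    rw [mem_ball_zero_iff] at hw ⊢
    linarith
  · refine (h.near_id (hsub hw)).trans ?_
    gcongr
  · rw [h.tau_eq (hsub hw), mass_midpoint _ _ rfl, h.eq w (hsub hw)]
  · rw [h.tau_eq (hsub hw), momentum_midpoint _ _ rfl, h.eq w (hsub hw)]
  · have hm0 : m 0 = 0 := by
      have := h.norm_le 0 (Metric.mem_ball_self h.pos)
      rw [norm_zero, mul_zero] at this
      exact norm_le_zero_iff.1 this
    simp [rem6, tau, hm0]
  · rw [(hG.hasFDerivAt w hw).fderiv, beta_single_fst]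
  · rw [(hG.hasFDerivAt w hw).fderiv, beta_single_snd]
  · obtain ⟨h1, h2⟩ := h.energy_eq (hsub hw) hf
    refine ⟨h1, ?_⟩
    rw [h2, rem6, Z4_eq, Z4_eq, P4_eq, P4_eq]
    ring

/-- The Hamiltonian in normal form: `H ∘ τ = P₂ + Z₄ + W` where `W` is of order five and shares
the symmetries of `H`. -/
structure IsNormalForm (g : (Fin 4 → ℂ) → ℂ) (ε C : ℝ) (τ : Λ → Λ)
    (W : Λ → ℂ) (G : Λ → Λ) : Prop where
  pos : 0 < ε
  C_nonneg : 0 ≤ C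
  birkhoff : IsBirkhoff s ε C τ
  analytic : AnalyticOnNhd ℂ τ (ball 0 ε)
  isGrad : IsGrad W G (ball 0 ε)
  norm_grad_le : ∀ w ∈ ball (0 : Λ) ε, ‖G w‖ ≤ C * ‖w‖ ^ 4
  norm_le : ∀ w ∈ ball (0 : Λ) ε, ‖W w‖ ≤ C * ‖w‖ ^ 5
  real : ∀ w ∈ ball (0 : Λ) ε, IsRealPoint w → (W w).im = 0
  rot : ∀ w ∈ ball (0 : Λ) ε, ∀ φ ψ, W (rot s φ ψ w) = W w
  ham : ∀ w ∈ ball (0 : Λ) ε, FiniteEnergy w → FiniteEnergy (τ w) ∧ hamH g (τ w) = P2 w + Z4 w + W w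

theorem norm_le_of_grad {W : Λ → ℂ} {G : Λ → Λ} {ε C : ℝ} (hC : 0 ≤ C) (hG : IsGrad W G (ball 0 ε))
    (h0 : W 0 = 0) (hb : ∀ w ∈ ball (0 : Λ) ε, ‖G w‖ ≤ C * ‖w‖ ^ 4) :
    ∀ w ∈ ball (0 : Λ) ε, ‖W w‖ ≤ ‖beta (s := s)‖ * C * ‖w‖ ^ 5 := by
  intro w hw
  have hsub : Metric.closedBall (0 : Λ) ‖w‖ ⊆ ball 0 ε := by
    intro y hy
    rw [mem_closedBall_zero_iff] at hy
    rw [mem_ball_zero_iff] at hw ⊢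
    exact hy.trans_lt hw
  have key := (convex_closedBall (0 : Λ) ‖w‖).norm_image_sub_le_of_norm_hasFDerivWithin_le (f := W)
    (f' := fun y => beta (G y)) (C := ‖beta (s := s)‖ * (C * ‖w‖ ^ 4)) (fun y hy =>
    (hG.hasFDerivAt y (hsub hy)).hasFDerivWithinAt) (fun y hy => ((beta).le_opNorm _).trans (by
      have h1 := hb y (hsub hy)
      rw [mem_closedBall_zero_iff] at hy
      have h2 : C * ‖y‖ ^ 4 ≤ C * ‖w‖ ^ 4 := by gcongr
      gcongr
      exact h1.trans h2))
    (Metric.mem_closedBall_self (norm_nonneg w)) (mem_closedBall_zero_iff.2 le_rfl)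
  rw [h0, sub_zero, sub_zero] at key
  refine key.trans (le_of_eq ?_)
  ring

/-- The nonlinearity `R₅` is carried along: `W = rem6 m + R₅ ∘ τ`. -/
theorem exists_isNormalForm {g : (Fin 4 → ℂ) → ℂ} (hg : Admissible g) :
    ∃ (ε C : ℝ) (τ : Λ → Λ) (W : Λ → ℂ) (G : Λ → Λ), IsNormalForm g ε C τ W G := by
  obtain ⟨K, δ, m, hm⟩ := (exists_isMidpoint (s := s))
  obtain ⟨A, hA, hA5⟩ := hm.exists_rem6Grad_bound
  obtain ⟨δ₁, B, G₅, hδ₁, hB, hG₅, hG₅b⟩ := exists_isGrad_R5 (s := s) hg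
  obtain ⟨δ₂, hδ₂, hsym⟩ := exists_R5_symmetric (s := s) hg
  have hK := hm.K_nonneg
  set ε := min (min δ 1) (min (δ₁ / 2) (δ₂ / 2)) with hε
  have hδ := hm.pos
  have hε0 : 0 < ε := by positivity
  have hεδ : ε ≤ δ := (min_le_left _ _).trans (min_le_left _ _)
  have hε1 : ε ≤ 1 := (min_le_left _ _).trans (min_le_right _ _)
  have hεδ₁ : ε ≤ δ₁ / 2 := (min_le_right _ _).trans (min_le_left _ _)
  have hεδ₂ : ε ≤ δ₂ / 2 := (min_le_right _ _).trans (min_le_right _ _)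
  have hsub : ball (0 : Λ) ε ⊆ ball 0 δ := Metric.ball_subset_ball hεδ
  have ht : ∀ w ∈ ball (0 : Λ) ε, ‖IsMidpoint.tau m w‖ < 2 * ε := fun w hw => by
    have := hm.norm_tau_lt (hsub hw)
    rw [mem_ball_zero_iff] at hw
    linarith
  have ht₁ : MapsTo (IsMidpoint.tau m) (ball 0 ε) (ball 0 δ₁) := fun w hw =>
    mem_ball_zero_iff.2 ((ht w hw).trans_le (by linarith))
  have ht₂ : MapsTo (IsMidpoint.tau m) (ball 0 ε) (ball 0 δ₂) := fun w hw =>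
    mem_ball_zero_iff.2 ((ht w hw).trans_le (by linarith))
  set W : Λ → ℂ := fun w => IsMidpoint.rem6 m w + R5 g (IsMidpoint.tau m w) with hW
  set G : Λ → Λ := fun w => IsMidpoint.rem6Grad m w +
    ((2 : ℂ) • IsMidpoint.transp m w (G₅ (IsMidpoint.tau m w)) - G₅ (IsMidpoint.tau m w)) with hG
  have hgrad : IsGrad W G (ball 0 ε) :=
    (hm.isGrad_rem6.mono hsub).add (hm.isGrad_comp_tau hG₅ hεδ ht₁)
  have hbG : ∀ w ∈ ball (0 : Λ) ε, ‖G w‖ ≤ (A + 80 * B) * ‖w‖ ^ 4 := by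
    intro w hw
    have h1 := hA5 w (hsub hw)
    have h2 := hm.norm_transp_le (hsub hw) (G₅ (IsMidpoint.tau m w))
    have h3 := hG₅b _ (ht₁ hw)
    have h4 := hm.norm_tau_lt (hsub hw)
    have h5 : B * ‖IsMidpoint.tau m w‖ ^ 4 ≤ B * (2 * ‖w‖) ^ 4 := by gcongr
    have h6 : A * ‖w‖ ^ 5 ≤ A * ‖w‖ ^ 4 := by
      rw [mem_ball_zero_iff] at hw
      exact mul_le_mul_of_nonneg_left
        (pow_le_pow_of_le_one (norm_nonneg _) (by linarith) (by norm_num)) hA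
    refine (norm_add_le _ _).trans ?_
    refine (add_le_add h1 (norm_sub_le _ _)).trans ?_
    rw [norm_smul, Complex.norm_ofNat]
    nlinarith
  have hzero : W 0 = 0 := by
    have hm0 : m 0 = 0 := by
      have := hm.norm_le 0 (Metric.mem_ball_self hδ)
      rw [norm_zero, mul_zero] at this
      exact norm_le_zero_iff.1 this
    have ht0 : IsMidpoint.tau m 0 = 0 := by simp [IsMidpoint.tau, hm0]
    have hg0 : g 0 = 0 := by
      have := hg.order.eq_zero_imp.self_of_nhds
      exact this (by simp)
    have hR : R5 g (0 : Λ) = 0 := by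
      rw [R5_eq]
      have : ∀ x, valU x (0 : Λ) = 0 := fun x => by
        funext i; simp [valU]
      simp [this, hg0]
    simp [hW, IsMidpoint.rem6, ht0, hm0, hR]
  have hbW := norm_le_of_grad (by positivity) hgrad hzero hbG
  set C := max (max (8 * K) A) (max (A + 80 * B) (‖beta (s := s)‖ * (A + 80 * B))) with hC
  have hC1 : 8 * K ≤ C := (le_max_left _ _).trans (le_max_left _ _)
  have hC2 : A ≤ C := (le_max_right _ _).trans (le_max_left _ _)
  have hC3 : A + 80 * B ≤ C := (le_max_left _ _).trans (le_max_right _ _)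
  have hC4 : ‖beta (s := s)‖ * (A + 80 * B) ≤ C := (le_max_right _ _).trans (le_max_right _ _)
  have hbirk : IsBirkhoff s ε C (IsMidpoint.tau m) := hm.isBirkhoff hεδ hC1 fun w hw =>
    (hA5 w hw).trans (by gcongr)
  refine ⟨ε, C, IsMidpoint.tau m, W, G, hε0, hA.trans hC2, hbirk, hm.analytic_tau.mono hsub, hgrad,
    fun w hw => (hbG w hw).trans (by gcongr), fun w hw => (hbW w hw).trans (by gcongr),
    fun w hw hr => ?_, fun w hw φ ψ => ?_, fun w hw hf => ?_⟩
  · have h1 := hm.map_real (hsub hw) hr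
    have h2 := hm.tau_real (hsub hw) hr
    simp only [hW, IsMidpoint.rem6, Complex.add_im, Complex.sub_im, quartP_real res_swap h1,
      quartP_real res_swap hr, quartP_real one_swap h1, quartP_real one_swap h2,
      (hsym _ (ht₂ hw)).2 h2]
    ring
  · simp only [hW, IsMidpoint.rem6]
    rw [hm.map_rot (hsub hw), hm.tau_rot (hsub hw), quartP_rot, quartP_rot, quartP_rot, quartP_rot,
      (hsym _ (ht₂ hw)).1]
  · obtain ⟨h1, h2⟩ := hm.energy_eq (hsub hw) hf
    refine ⟨h1, ?_⟩
    simp only [hamH, hW, IsMidpoint.rem6]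
    rw [h2, Z4_eq, Z4_eq, P4_eq, P4_eq]
    ring

end

section

variable {p q : ℤ} {s : ℝ} [hs : Fact (1 / 2 < s)]

local notation "Λ" => PSpace s
local notation "𝓩" => ZSpace p q s
local notation "Ξ" => Coord p q s
local notation "Ω" => domPhi p q s
local notation "½" => (1 / 2 : ℂ)

/-! ### Action-angle coordinates for the internal modes -/

theorem extWeight_val_le (α : Ext p q) : (extWeight p q).val α ≤ 1 * fullWeight.val α.1 := by
  rw [one_mul]
  have h1 : (1 : ℝ) ≤ fullWeight.val α.1 := one_le_fullWeight α.1
  change (if α.1.1 ≠ p ∧ α.1.1 ≠ q then max 1 |((α.1.1 : ℤ) : ℝ)| else 1) ≤ _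
  split_ifs
  · exact max_le h1 (abs_le_zWeight α.1.1)
  · exact h1

theorem one_le_extWeight (α : Ext p q) : 1 ≤ (extWeight p q).val α := by
  change 1 ≤ (if α.1.1 ≠ p ∧ α.1.1 ≠ q then max 1 |((α.1.1 : ℤ) : ℝ)| else 1)
  split_ifs
  · exact le_max_left _ _
  · exact le_rfl

theorem fullWeight_le_extWeight (α : Ext p q) :
    fullWeight.val α.1 ≤ (2 + |(p : ℝ)| + |(q : ℝ)|) * (extWeight p q).val α := by
  have h1 : ∀ j : ℤ, √(1 + (j : ℝ) ^ 2) ≤ 1 + |(j : ℝ)| := fun j => by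
    rw [Real.sqrt_le_left (by positivity)]
    nlinarith [abs_nonneg (j : ℝ), sq_abs (j : ℝ)]
  have h2 : fullWeight.val α.1 ≤ 1 + |((α.1.1 : ℤ) : ℝ)| := h1 α.1.1
  refine h2.trans ?_
  have hp := abs_nonneg (p : ℝ)
  have hq := abs_nonneg (q : ℝ)
  by_cases h : α.1.1 ≠ p ∧ α.1.1 ≠ q
  · have e : (extWeight p q).val α = max 1 |((α.1.1 : ℤ) : ℝ)| := if_pos h
    rw [e]
    have h3 := le_max_left 1 |((α.1.1 : ℤ) : ℝ)|
    have h4 := le_max_right 1 |((α.1.1 : ℤ) : ℝ)|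
    nlinarith
  · have e : (extWeight p q).val α = 1 := if_neg h
    rw [e, mul_one]
    by_cases hpα : α.1.1 = p
    · rw [hpα]; linarith
    · have : α.1.1 = q := by
        by_contra hq'
        exact h ⟨hpα, hq'⟩
      rw [this]; linarith

/-- Restriction to the external modes. -/
def pullE : MSeq s →L[ℂ] 𝓩 := WSeq.pull fullWeight (extWeight p q) s Subtype.val
    ⟨Subtype.val_injective, 1, zero_le_one, fun α => by
      rw [one_mul]
      exact Real.rpow_le_rpow ((extWeight p q).pos α).le
        ((extWeight_val_le α).trans (one_mul _).le) (by linarith [hs.out])⟩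

/-- Extension by zero to the internal modes. -/
def pushE : 𝓩 →L[ℂ] MSeq s :=
    WSeq.push (extWeight p q) fullWeight s Subtype.val ⟨Subtype.val_injective,
    (2 + |(p : ℝ)| + |(q : ℝ)|) ^ s, by positivity, fun α => by
      rw [← Real.mul_rpow (by positivity) ((extWeight p q).pos α).le]
      exact Real.rpow_le_rpow (fullWeight.pos _).le (fullWeight_le_extWeight α) (by linarith [hs.out])⟩

@[simp] theorem pullE_apply (x : MSeq s) (α : Ext p q) :
    (pullE x : 𝓩) α = x α.1 := rfl

@[simp] theorem pushE_apply (x : 𝓩) (α : Ext p q) :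
    pushE x α.1 = x α := WSeq.push_apply _ _

theorem pushE_apply_int (x : 𝓩) : pushE x (p, true) = 0 ∧ pushE x (q, false) = 0 :=
    ⟨WSeq.push_apply_of_notMem _ fun k h => k.2.1 h, WSeq.push_apply_of_notMem _ fun k h => k.2.2 h⟩

theorem norm_pullE_le (x : MSeq s) : ‖(pullE x : 𝓩)‖ ≤ ‖x‖ := by
  have := WSeq.norm_pull_le (w := fullWeight) (w' := extWeight p q) (s := s) (φ := Subtype.val)
    (h := ⟨Subtype.val_injective, 1, zero_le_one, fun α => by
      rw [one_mul]
      exact Real.rpow_le_rpow ((extWeight p q).pos α).le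
        ((extWeight_val_le α).trans (one_mul _).le) (by linarith [hs.out])⟩) zero_le_one (fun α => by
      rw [one_mul]
      exact Real.rpow_le_rpow ((extWeight p q).pos α).le
        ((extWeight_val_le α).trans (one_mul _).le) (by linarith [hs.out])) x
  exact this.trans (one_mul _).le

theorem ZSpace.norm_apply_le (x : 𝓩) (α : Ext p q) : ‖x α‖ ≤ ‖x‖ :=
  WSeq.norm_apply_le (by linarith [hs.out]) (one_le_extWeight α) x

/-- A map out of the phase space is determined by its values on the external and the internal
modes. -/
theorem ext_modes {x y : MSeq s} (h : ∀ α : Ext p q, x α.1 = y α.1)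
    (hp : x (p, true) = y (p, true)) (hq : x (q, false) = y (q, false)) : x = y := by
  refine WSeq.ext fun α => ?_
  by_cases h1 : α = (p, true)
  · rw [h1, hp]
  by_cases h2 : α = (q, false)
  · rw [h2, hq]
  exact h ⟨α, h1, h2⟩

/-- The bilinear form `∑ x_α y_α` on external modes. -/
def dotZ : 𝓩 →L[ℂ] 𝓩 →L[ℂ] ℂ := WSeq.pairing (extWeight p q) s (fun _ => 1) (fun α => by
    rw [norm_one]; exact Real.one_le_rpow (one_le_extWeight α) (by linarith [hs.out]))

theorem dotZ_apply (x y : 𝓩) : dotZ x y = ∑' α, x α * y α := by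
  change ∑' α, (1 : ℂ) * (x α * y α) = _
  simp

theorem summable_dotZ (x y : 𝓩) : Summable fun α => x α * y α := by
  have := (WSeq.pairing_bound (w := extWeight p q) (s := s) (m := fun _ => 1)
    (fun α => by rw [norm_one]; exact Real.one_le_rpow (one_le_extWeight α) (by linarith [hs.out]))
    x y).1.of_norm
  simpa using this

theorem dotZ_comm (x y : 𝓩) : dotZ x y = dotZ y x := by
  rw [dotZ_apply, dotZ_apply]
  exact tsum_congr fun α => mul_comm _ _

theorem dotZ_single (x : 𝓩) (α : Ext p q) : dotZ x (single α) = x α := by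
  have :=
    WSeq.pairing_single_right (w := extWeight p q) (s := s) (m := fun _ => 1) (hm := fun α => by
      rw [norm_one]; exact Real.one_le_rpow (one_le_extWeight α) (by linarith [hs.out])) x α
  exact this.trans (one_mul _)

theorem single_dotZ (x : 𝓩) (α : Ext p q) : dotZ (single α) x =
    x α := by rw [dotZ_comm, dotZ_single]

theorem single_dotM (x : MSeq s) (α : Mode) : dotM (single α) x =
    x α := by rw [dotM_comm, dotM_single]

theorem dotM_pushE (x y : 𝓩) : dotM (pushE x) (pushE y) = dotZ x y := by
  rw [dotM_apply, dotZ_apply, ← (Subtype.val_injective (p := fun α : Mode =>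
    α ≠ (p, true) ∧ α ≠ (q, false))).tsum_eq]
  · exact tsum_congr fun α => by rw [pushE_apply, pushE_apply]
  · intro α hα
    by_contra hne
    refine hα ?_
    have : pushE x α = 0 := WSeq.push_apply_of_notMem _ fun k h => hne ⟨k, h⟩
    simp only [this, zero_mul]

theorem omegaCoord_eq (u v : Ξ) : omegaCoord u v = -((u.1 0 * v.2.1 0 - u.2.1 0 * v.1 0) +
    (u.1 1 * v.2.1 1 - u.2.1 1 * v.1 1)) - I * (dotZ u.2.2.1 v.2.2.2 - dotZ u.2.2.2 v.2.2.1) := by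
  rw [omegaCoord, Fin.sum_univ_two, dotZ_apply, dotZ_apply,
    (summable_dotZ _ _).tsum_sub (summable_dotZ _ _)]

theorem omegaCoord_nondegenerate {u : Ξ} (h : ∀ v, omegaCoord u v = 0) : u = 0 := by
  have h' := fun v => (omegaCoord_eq u v).symm.trans (h v)
  refine Prod.ext (funext fun i => ?_)
    (Prod.ext (funext fun i => ?_) (Prod.ext (WSeq.ext fun α => ?_) (WSeq.ext fun α => ?_)))
  · have := h' (0, Pi.single i 1, 0)
    fin_cases i <;> simpa using this
  · have := h' (Pi.single i 1, 0, 0)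
    fin_cases i <;> simpa using this
  · simpa [dotZ_single] using h' (0, 0, 0, single α)
  · simpa [dotZ_single] using h' (0, 0, single α, 0)

theorem omegaP_eq_dotM (u v : Λ) : omegaP u v = -I * (dotM u.1 v.2 - dotM u.2 v.1) := by
  rw [omegaP, dotM_apply, dotM_apply, (summable_dotM _ _).tsum_sub (summable_dotM _ _)]

/-- The map `toModes` in terms of the basis vectors of the internal modes. -/
theorem toModes_eq (x : Ξ) : toModes x = (pushE x.2.2.1 + (x.1 0 ^ ½ * exp (I * x.2.1 0)) •
    single (p, true) + (x.1 1 ^ ½ * exp (I * x.2.1 1)) • single (q, false),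
    pushE x.2.2.2 + (x.1 0 ^ ½ * exp (-(I * x.2.1 0))) • single (p, true) +
    (x.1 1 ^ ½ * exp (-(I * x.2.1 1))) • single (q, false)) := by
  have key : ∀ (c₁ c₂ : ℂ) (ζ : 𝓩), (⟨fullSeq c₁ c₂ ζ, fullSeq_mem c₁ c₂ ζ⟩ : MSeq s) =
    pushE ζ + c₁ • single (p, true) + c₂ • single (q, false) := by
    intro c₁ c₂ ζ
    obtain ⟨hi1, hi2⟩ := pushE_apply_int ζ
    have hne : ((p, true) : Mode) ≠ (q, false) := by simp
    obtain ⟨y, hy⟩ : ∃ y : MSeq s, y = pushE ζ + c₁ • single (p, true) + c₂ • single (q, false) :=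
      ⟨_, rfl⟩
    have hy' : ∀ α, y α = pushE ζ α + c₁ * (single (p, true) : MSeq s) α + c₂ * (single (q, false) :
      MSeq s) α := fun α => by
      rw [hy, WSeq.add_apply, WSeq.add_apply, WSeq.smul_apply, WSeq.smul_apply]
    refine Eq.trans ?_ hy
    refine ext_modes (p := p) (q := q) (fun α => ?_) ?_ ?_
    · rw [hy', pushE_apply, single_of_ne α.2.1, single_of_ne α.2.2, mul_zero, mul_zero,
        add_zero, add_zero]
      exact dif_pos α.2
    · rw [hy', hi1, single_of_ne hne, single_same, mul_zero, add_zero, zero_add, mul_one]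
      change fullSeq c₁ c₂ ζ (p, true) = _
      unfold fullSeq
      rw [dif_neg (by simp), if_pos rfl]
    · rw [hy', hi2, single_of_ne hne.symm, single_same, mul_zero, zero_add, zero_add, mul_one]
      change fullSeq c₁ c₂ ζ (q, false) = _
      unfold fullSeq
      rw [dif_neg (by simp), if_neg hne.symm]
  exact Prod.ext (key _ _ _) (key _ _ _)

/-! The coordinate functions on the space of the variables `(r, θ, z)`. -/

/-- `u ↦ r_i`. -/
def rC (p q : ℤ) (s : ℝ) (i : Fin 2) : Coord p q s →L[ℂ] ℂ := (proj (R := ℂ) (φ := fun _ : Fin 2 =>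
    ℂ) i).comp (fst ℂ _ _)

/-- `u ↦ θ_i`. -/
def thC (p q : ℤ) (s : ℝ) (i : Fin 2) : Coord p q s →L[ℂ] ℂ :=
    ((proj (R := ℂ) (φ := fun _ : Fin 2 => ℂ) i).comp (fst ℂ _ _)).comp (snd ℂ _ _)

/-- `u ↦ ζ`. -/
def zC (p q : ℤ) (s : ℝ) :
    Coord p q s →L[ℂ] ZSpace p q s := ((fst ℂ _ _).comp (snd ℂ _ _)).comp (snd ℂ _ _)

/-- `u ↦ ζ̄`. -/
def zbC (p q : ℤ) (s : ℝ) :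
    Coord p q s →L[ℂ] ZSpace p q s := ((snd ℂ _ _).comp (snd ℂ _ _)).comp (snd ℂ _ _)

@[simp] theorem rC_apply (i : Fin 2) (u : Ξ) : rC p q s i u = u.1 i := rfl
@[simp] theorem thC_apply (i : Fin 2) (u : Ξ) : thC p q s i u = u.2.1 i := rfl
@[simp] theorem zC_apply (u : Ξ) : zC p q s u = u.2.2.1 := rfl
@[simp] theorem zbC_apply (u : Ξ) : zbC p q s u = u.2.2.2 := rfl

theorem analyticAt_internal (x : Ξ) (i : Fin 2) (hx : x.1 i ∈ Complex.slitPlane) (κ : ℂ) :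
    AnalyticAt ℂ (fun x : Ξ => x.1 i ^ ½ * exp (κ * x.2.1 i)) x := by
  have h1 : AnalyticAt ℂ (fun x : Ξ => x.1 i) x := (rC p q s i).analyticAt x
  have h2 : AnalyticAt ℂ (fun x : Ξ => x.2.1 i) x := (thC p q s i).analyticAt x
  exact (h1.cpow analyticAt_const hx).mul
    (analyticAt_comp' analyticAt_cexp (analyticAt_const.mul h2))

theorem hasFDerivAt_internal (x : Ξ) (i : Fin 2) (hx : x.1 i ∈ Complex.slitPlane) (κ : ℂ) :
    ∃ L : Ξ →L[ℂ] ℂ, HasFDerivAt (fun x : Ξ => x.1 i ^ ½ * exp (κ * x.2.1 i)) L x ∧ ∀ u, L u =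
    (1 / 2 * x.1 i ^ (1 / 2 - 1 : ℂ) * u.1 i + κ * x.1 i ^ ½ * u.2.1 i) * exp (κ * x.2.1 i) := by
  have h1 : HasFDerivAt (fun x : Ξ => x.1 i) (rC p q s i) x := (rC p q s i).hasFDerivAt
  have h2 : HasFDerivAt (fun x : Ξ => x.2.1 i) (thC p q s i) x := (thC p q s i).hasFDerivAt
  have h3 : HasFDerivAt (fun x :
    Ξ => x.1 i ^ ½) ((1 / 2 * x.1 i ^ (1 / 2 - 1 : ℂ)) • rC p q s i) x := by
    have hd : HasDerivAt (fun z : ℂ => z ^ ½) (1 / 2 * x.1 i ^ (1 / 2 - 1 : ℂ)) (x.1 i) := by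
      have := (hasDerivAt_id (x.1 i)).cpow_const (c := ½) hx
      simpa using this
    exact hd.comp_hasFDerivAt x h1
  have h4 : HasFDerivAt (fun x :
    Ξ => exp (κ * x.2.1 i)) (exp (κ * x.2.1 i) • (κ • thC p q s i)) x := (h2.const_mul κ).cexp
  refine ⟨_, h3.mul h4, fun u => ?_⟩
  simp only [add_apply, smul_apply, smul_eq_mul, rC_apply, thC_apply]
  ring

theorem analyticAt_toModes {x : Ξ}
    (hx : ∀ i, x.1 i ∈ Complex.slitPlane) : AnalyticAt ℂ (toModes (p := p) (q := q) (s := s)) x := by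
  have e : (toModes (p := p) (q := q) (s := s)) = _ := funext (toModes_eq)
  rw [e]
  have hc : ∀ (i : Fin 2) (κ : ℂ) (α : Mode), AnalyticAt ℂ (fun x : Ξ =>
      (x.1 i ^ ½ * exp (κ * x.2.1 i)) • (single α : MSeq s)) x :=
    fun i κ α => (analyticAt_internal x i (hx i) κ).smul analyticAt_const
  have hz : ∀ L : Ξ →L[ℂ] 𝓩, AnalyticAt ℂ (fun x => pushE (L x)) x :=
    fun L => ((pushE).comp L).analyticAt x
  simp only [← neg_mul]
  exact (((hz (zC p q s)).add (hc 0 I _)).add (hc 1 I _)).prod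
    (((hz (zbC p q s)).add (hc 0 (-I) _)).add (hc 1 (-I) _))

/-- The derivative of `toModes`. -/
theorem hasFDerivAt_toModes {x : Ξ} (hx : ∀ i, x.1 i ∈ Complex.slitPlane) :
    ∃ L : Ξ →L[ℂ] Λ, HasFDerivAt (toModes (p := p) (q := q) (s := s)) L x ∧ ∀ u,
    L u = (pushE u.2.2.1 + ((1 / 2 * x.1 0 ^ (1 / 2 - 1 : ℂ) * u.1 0 + I * x.1 0 ^ (1 / 2 :
    ℂ) * u.2.1 0) * exp (I * x.2.1 0)) • single (p, true) + ((1 / 2 * x.1 1 ^ (1 / 2 - 1 :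
    ℂ) * u.1 1 + I * x.1 1 ^ ½ * u.2.1 1) * exp (I * x.2.1 1)) • single (q, false), pushE u.2.2.2 +
    ((1 / 2 * x.1 0 ^ (1 / 2 - 1 : ℂ) * u.1 0 + -I * x.1 0 ^ ½ * u.2.1 0) * exp (-I * x.2.1 0)) •
    single (p, true) + ((1 / 2 * x.1 1 ^ (1 / 2 - 1 : ℂ) * u.1 1 + -I * x.1 1 ^ ½ * u.2.1 1) *
    exp (-I * x.2.1 1)) • single (q, false)) := by
  obtain ⟨L0, h0, e0⟩ := hasFDerivAt_internal x 0 (hx 0) I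
  obtain ⟨L1, h1, e1⟩ := hasFDerivAt_internal x 1 (hx 1) I
  obtain ⟨M0, k0, f0⟩ := hasFDerivAt_internal x 0 (hx 0) (-I)
  obtain ⟨M1, k1, f1⟩ := hasFDerivAt_internal x 1 (hx 1) (-I)
  have e : (toModes (p := p) (q := q) (s := s)) = _ := funext (toModes_eq)
  have hz : ∀ L : Ξ →L[ℂ] 𝓩, HasFDerivAt (fun x => pushE (L x)) ((pushE).comp L) x := fun L =>
    ((pushE).comp L).hasFDerivAt
  have H := (((hz (zC p q s)).add (h0.smul_const (single (p, true) : MSeq s))).add (h1.smul_const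
    (single (q, false) : MSeq s))).prodMk (((hz (zbC p q s)).add (k0.smul_const (single (p, true) :
    MSeq s))).add (k1.smul_const (single (q, false) : MSeq s)))
  refine ⟨_, by rw [e]; simp only [← neg_mul]; exact H, fun u => ?_⟩
  rw [← e0, ← e1, ← f0, ← f1]
  rfl

theorem cpow_half_mul {y : ℂ} (hy : y ∈ Complex.slitPlane) : y ^ ½ * y ^ (1 / 2 - 1 : ℂ) = 1 := by
  rw [← Complex.cpow_add _ _ (Complex.slitPlane_ne_zero hy)]
  norm_num

/-- The map `toModes` is symplectic. -/
theorem omegaP_fderiv_toModes {x : Ξ} (hx : ∀ i, x.1 i ∈ Complex.slitPlane) (u v : Ξ) :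
    omegaP (fderiv ℂ (toModes (p := p) (q := q) (s := s)) x u) (fderiv ℂ toModes x v) =
    omegaCoord u v := by
  obtain ⟨L, hL, e⟩ := hasFDerivAt_toModes hx
  obtain ⟨i1, i2⟩ := pushE_apply_int u.2.2.1
  obtain ⟨i3, i4⟩ := pushE_apply_int u.2.2.2
  obtain ⟨j1, j2⟩ := pushE_apply_int v.2.2.1
  obtain ⟨j3, j4⟩ := pushE_apply_int v.2.2.2
  have hne : ((p, true) : Mode) ≠ (q, false) := by simp
  rw [hL.fderiv, e, e, omegaP_eq_dotM, omegaCoord_eq]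
  simp only [map_add, map_smul, add_apply, smul_apply, smul_eq_mul, dotM_single, single_dotM,
    dotM_pushE, i1, i2, i3, i4, j1, j2, j3, j4, single_same, single_of_ne hne,
    single_of_ne hne.symm, mul_zero, add_zero, zero_add, mul_one]
  have hI := Complex.I_mul_I
  have hE : ∀ t : ℂ, exp (I * t) * exp (-I * t) = 1 := fun t => by
    rw [← exp_add, neg_mul, add_neg_cancel, exp_zero]
  have a0 := cpow_half_mul (hx 0)
  have a1 := cpow_half_mul (hx 1)
  have b0 := hE (x.2.1 0)
  have b1 := hE (x.2.1 1)
  generalize x.1 0 ^ ½ = A0 at *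
  generalize x.1 1 ^ ½ = A1 at *
  generalize x.1 0 ^ (1 / 2 - 1 : ℂ) = B0 at *
  generalize x.1 1 ^ (1 / 2 - 1 : ℂ) = B1 at *
  generalize exp (I * x.2.1 0) = E0 at *
  generalize exp (I * x.2.1 1) = E1 at *
  generalize exp (-I * x.2.1 0) = F0 at *
  generalize exp (-I * x.2.1 1) = F1 at *
  linear_combination (-(u.2.1 0 * v.1 0 - u.1 0 * v.2.1 0) * I * I * A0 * B0) * b0 +
    (-(u.2.1 1 * v.1 1 - u.1 1 * v.2.1 1) * I * I * A1 * B1) * b1 +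
    (-(u.2.1 0 * v.1 0 - u.1 0 * v.2.1 0) * I * I) * a0 + (-(u.2.1 1 * v.1 1 - u.1 1 * v.2.1 1) *
    I * I) * a1 + (-(u.2.1 0 * v.1 0 - u.1 0 * v.2.1 0) - (u.2.1 1 * v.1 1 - u.1 1 * v.2.1 1)) * hI

theorem injective_toModes {x : Ξ} (hx : ∀ i, x.1 i ∈ Complex.slitPlane) :
    Function.Injective (fderiv ℂ (toModes (p := p) (q := q) (s := s)) x) :=
  (injective_iff_map_eq_zero _).2 fun u hu => omegaCoord_nondegenerate fun v => by
    rw [← omegaP_fderiv_toModes hx, hu, omegaP_eq_dotM]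
    simp

end

section

variable {p q : ℤ} [hpq : Fact (p ≠ q)] {s : ℝ} [hs : Fact (1 / 2 < s)]

local notation "Λ" => PSpace s
local notation "𝓩" => ZSpace p q s
local notation "Ξ" => Coord p q s
local notation "Ω" => domPhi p q s
local notation "½" => (1 / 2 : ℂ)

/-! ### Elimination of the angles -/

variable (p q) in
/-- The hyperbolic modes: `p₋`, paired with the angle `θ₁`, and `q₊`, paired with `θ₂`. -/
def hyp (i : Fin 2) : Ext p q :=
  if i = 0 then ⟨(p, false), by simp [hpq.out]⟩ else ⟨(q, true), by simp [hpq.out.symm]⟩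

local notation "η" => hyp p q

theorem hyp_val_zero : (η 0).1 = (p, false) := rfl
theorem hyp_val_one : (η 1).1 = (q, true) := rfl

theorem hyp_one_ne : η 1 ≠ η 0 := fun h => by
  have := congrArg Subtype.val h
  rw [hyp_val_zero, hyp_val_one] at this
  simp at this

theorem extWeight_hyp (i : Fin 2) : (extWeight p q).val (η i) = 1 := by
  refine if_neg fun h => ?_
  fin_cases i
  · exact h.1 rfl
  · exact h.2 rfl

theorem norm_single_hyp (i : Fin 2) : ‖(single (η i) : 𝓩)‖ = 1 := by
  rw [WSeq.norm_single, extWeight_hyp, Real.one_rpow]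

theorem ell_or_hyp (α : Ext p q) : (∃ β : Ell p q, β.toExt = α) ∨ α = η 0 ∨ α = η 1 := by
  by_cases hp : α.1.1 = p
  · refine Or.inr (Or.inl (Subtype.ext (Prod.ext hp ?_)))
    by_contra h
    exact α.2.1 (Prod.ext hp (by simpa [hyp] using h))
  by_cases hq : α.1.1 = q
  · refine Or.inr (Or.inr (Subtype.ext (Prod.ext hq ?_)))
    by_contra h
    exact α.2.2 (Prod.ext hq (by simpa [hyp] using h))
  exact Or.inl ⟨⟨α.1, hp, hq⟩, rfl⟩

theorem toExt_ne_hyp (α : Ell p q) (i : Fin 2) : α.toExt ≠ η i := fun h => by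
  fin_cases i
  · exact α.2.1 (congrArg (fun β : Ext p q => β.1.1) h)
  · exact α.2.2 (congrArg (fun β : Ext p q => β.1.1) h)

theorem extCoord_hyp (ζ : 𝓩) : extCoord ζ (p, false) = ζ (η 0) ∧ extCoord ζ (q, true) = ζ (η 1) :=
    ⟨dif_pos (η 0).2, dif_pos (η 1).2⟩

/-- Multiplication of the hyperbolic components of `ζ` by `e^{icθ₁}` and `e^{icθ₂}`. -/
def hypRot (c : ℂ) (θ : C2) (ζ : ZSpace p q s) : ZSpace p q s := ζ + ((exp (c * θ 0) - 1) *
    ζ (hyp p q 0)) • single (hyp p q 0) + ((exp (c * θ 1) - 1) * ζ (hyp p q 1)) • single (hyp p q 1)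

theorem hypRot_apply (c : ℂ) (θ : C2) (ζ : 𝓩) (α : Ext p q) :
    hypRot c θ ζ α = ζ α + ((exp (c * θ 0) - 1) * ζ (η 0)) * (single (η 0) : 𝓩) α +
    ((exp (c * θ 1) - 1) * ζ (η 1)) * (single (η 1) : 𝓩) α := by
  rw [hypRot, WSeq.add_apply, WSeq.add_apply, WSeq.smul_apply, WSeq.smul_apply]

theorem hypRot_hyp (c : ℂ) (θ : C2) (ζ : 𝓩) (i : Fin 2) :
    hypRot c θ ζ (η i) = exp (c * θ i) * ζ (η i) := by
  rw [hypRot_apply]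
  fin_cases i
  · simp only [Fin.zero_eta, single_same, single_of_ne (hyp_one_ne).symm]
    ring
  · simp only [Fin.mk_one, single_same, single_of_ne (hyp_one_ne)]
    ring

theorem hypRot_ell (c : ℂ) (θ : C2) (ζ : 𝓩) (α : Ell p q) : hypRot c θ ζ α.toExt = ζ α.toExt := by
  rw [hypRot_apply, single_of_ne (toExt_ne_hyp α 0), single_of_ne (toExt_ne_hyp α 1)]
  ring

theorem ZSpace.ext_ell_hyp {x y : 𝓩} (h : ∀ α : Ell p q, x α.toExt = y α.toExt)
    (h' : ∀ i, x (η i) = y (η i)) : x = y := by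
  refine WSeq.ext fun α => ?_
  rcases ell_or_hyp α with ⟨β, rfl⟩ | rfl | rfl
  exacts [h β, h' 0, h' 1]

theorem hypRot_neg (c : ℂ) (θ : C2) (ζ : 𝓩) : hypRot (-c) θ (hypRot c θ ζ) = ζ := by
  refine ZSpace.ext_ell_hyp (fun α => ?_) (fun i => ?_)
  · rw [hypRot_ell, hypRot_ell]
  · rw [hypRot_hyp, hypRot_hyp, ← mul_assoc, ← exp_add, neg_mul, neg_add_cancel, exp_zero, one_mul]

theorem hypRot_eq_mulBdd (c : ℂ) (θ : C2) (ζ : 𝓩) :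
    WSeq.mulBdd (phase c θ) (phase_bdd c θ) ζ = hypRot (I * c) θ ζ := by
  refine ZSpace.ext_ell_hyp (fun α => ?_) (fun i => ?_)
  · rw [hypRot_ell]
    change phase c θ α.toExt * ζ α.toExt = _
    rw [phase, if_neg, if_neg, one_mul]
    · exact fun h => α.2.1 (congrArg Prod.fst h)
    · exact fun h => α.2.2 (congrArg Prod.fst h)
  · rw [hypRot_hyp]
    change phase c θ (η i) * ζ (η i) = _
    congr 1
    fin_cases i
    · change phase c θ (η 0) = _
      rw [phase, if_neg (by rw [hyp_val_zero]; simp), if_pos (hyp_val_zero)]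
      rfl
    · change phase c θ (η 1) = _
      rw [phase, if_pos (hyp_val_one)]
      rfl

theorem hypRot_norm_le (c : ℂ) (θ : C2) (ζ : 𝓩) {B : ℝ}
    (hB : 1 ≤ B) (h : ∀ i, ‖exp (c * θ i)‖ ≤ B) : ‖hypRot c θ ζ‖ ≤ B * ‖ζ‖ := by
  classical
  have hm : ∀ α : Ext p q, ‖(if α = η 0 then exp (c * θ 0) else
      if α = η 1 then exp (c * θ 1) else 1 : ℂ)‖ ≤ B := fun α => by
    split_ifs
    · exact h 0
    · exact h 1
    · rw [norm_one]; exact hB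
  have e : hypRot c θ ζ = WSeq.mulC (extWeight p q) s _ B hm ζ := by
    refine ZSpace.ext_ell_hyp (fun α => ?_) (fun i => ?_)
    · rw [hypRot_ell, WSeq.mulC_apply, if_neg (toExt_ne_hyp α 0),
        if_neg (toExt_ne_hyp α 1), one_mul]
    · rw [hypRot_hyp, WSeq.mulC_apply]
      fin_cases i
      · exact congrArg (· * _) (if_pos rfl).symm
      · exact congrArg (· * _) ((if_neg (hyp_one_ne)).trans (if_pos rfl)).symm
  rw [e]
  exact WSeq.norm_mulC_le _ B (by linarith) hm ζ

/-- The angle elimination (`κ = 1`, `c = i`) and its inverse (`κ = -1`, `c = -i`). -/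
def elim (κ c : ℂ) (x : Ξ) : Ξ := (fun i => x.1 i - κ * (x.2.2.1 (η i) * x.2.2.2 (η i)), x.2.1,
    (hypRot c x.2.1 x.2.2.1, hypRot (-c) x.2.1 x.2.2.2))

theorem angleElim_eq (x : Ξ) : angleElim x = elim 1 I x := by
  refine Prod.ext (funext fun i => ?_) (Prod.ext rfl (Prod.ext ?_ ?_))
  · obtain ⟨e1, e2⟩ := extCoord_hyp x.2.2.1
    obtain ⟨e3, e4⟩ := extCoord_hyp x.2.2.2
    change ![x.1 0 - _, x.1 1 - _] i = x.1 i - 1 * (x.2.2.1 (η i) * x.2.2.2 (η i))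
    rw [e1, e2, e3, e4, one_mul]
    fin_cases i <;> rfl
  · exact (hypRot_eq_mulBdd 1 _ _).trans (by rw [mul_one]; rfl)
  · exact (hypRot_eq_mulBdd (-1) _ _).trans (by rw [mul_neg, mul_one]; rfl)

theorem elim_elim (κ c : ℂ) (x : Ξ) : elim (-κ) (-c) (elim κ c x) = x := by
  refine Prod.ext (funext fun i => ?_) (Prod.ext rfl (Prod.ext ?_ ?_))
  · change x.1 i - κ * (x.2.2.1 (η i) * x.2.2.2 (η i)) - -κ *
      (hypRot c x.2.1 x.2.2.1 (η i) * hypRot (-c) x.2.1 x.2.2.2 (η i)) = x.1 i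
    have h : exp (c * x.2.1 i) * exp (-c * x.2.1 i) = 1 := by
      rw [← exp_add, neg_mul, add_neg_cancel, exp_zero]
    rw [hypRot_hyp, hypRot_hyp]
    linear_combination κ * (x.2.2.1 (η i) * x.2.2.2 (η i)) * h
  · exact hypRot_neg c x.2.1 x.2.2.1
  · exact hypRot_neg (-c) x.2.1 x.2.2.2

/-- `u ↦ ζ_α`, where `ζ` is given by `L`. -/
def compC (L : Ξ →L[ℂ] 𝓩) (α : Ext p q) : Ξ →L[ℂ] ℂ := (coord (extWeight p q) s α).comp L

@[simp] theorem compC_apply (L : Ξ →L[ℂ] 𝓩) (α : Ext p q) (u : Ξ) :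
    compC L α u = (L u) α := rfl

theorem analyticAt_hypRot (c : ℂ) (L : Ξ →L[ℂ] 𝓩)
    (x : Ξ) : AnalyticAt ℂ (fun x : Ξ => hypRot c x.2.1 (L x)) x := by
  have h : ∀ i, AnalyticAt ℂ (fun x : Ξ => ((exp (c * x.2.1 i) - 1) * (L x) (η i)) • (single (η i) :
    𝓩)) x := fun i => by
    have h2 : AnalyticAt ℂ (fun x : Ξ => x.2.1 i) x := (thC p q s i).analyticAt x
    have h3 : AnalyticAt ℂ (fun x : Ξ => (L x) (η i)) x := (compC L (η i)).analyticAt x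
    exact (((analyticAt_comp' (g := exp) analyticAt_cexp
      (analyticAt_const.mul h2)).sub analyticAt_const).mul h3).smul analyticAt_const
  exact ((L.analyticAt x).add (h 0)).add (h 1)

theorem analyticAt_elim (κ c : ℂ) (x : Ξ) : AnalyticAt ℂ (elim κ c) x := by
  have h1 : AnalyticAt ℂ (fun x : Ξ => fun i =>
      x.1 i - κ * (x.2.2.1 (η i) * x.2.2.2 (η i))) x := by
    refine AnalyticAt.pi fun i => ?_
    have h2 : AnalyticAt ℂ (fun x : Ξ => x.1 i) x := (rC p q s i).analyticAt x
    have h3 : AnalyticAt ℂ (fun x : Ξ => x.2.2.1 (η i)) x := (compC (zC p q s) (η i)).analyticAt x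
    have h4 : AnalyticAt ℂ (fun x : Ξ => x.2.2.2 (η i)) x := (compC (zbC p q s) (η i)).analyticAt x
    exact h2.sub (analyticAt_const.mul (h3.mul h4))
  have h5 : AnalyticAt ℂ (fun x : Ξ => x.2.1) x := ((fst ℂ _ _).comp (snd ℂ _ _)).analyticAt x
  exact h1.prod
    (h5.prod ((analyticAt_hypRot c (zC p q s) x).prod (analyticAt_hypRot (-c) (zbC p q s) x)))

theorem surjective_elim (x : Ξ) : Function.Surjective (fderiv ℂ (elim 1 I) x) := by
  set y := elim 1 I x
  have d1 := (analyticAt_elim 1 I x).differentiableAt.hasFDerivAt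
  have d2 := (analyticAt_elim (-1) (-I) y).differentiableAt.hasFDerivAt
  have i2 : elim 1 I ∘ elim (-1) (-I) = (id : Ξ → _) := funext fun z => by
    simpa using elim_elim (-1) (-I) z
  rw [← elim_elim 1 I x] at d1
  have e := (d1.comp y d2).unique (i2 ▸ hasFDerivAt_id y)
  rw [elim_elim] at e
  exact fun v => ⟨_, congrArg (fun L : Ξ →L[ℂ] Ξ => L v) e⟩

theorem hasFDerivAt_hypRot (c : ℂ) (L : Ξ →L[ℂ] 𝓩) (x : Ξ) :
    ∃ D : Ξ →L[ℂ] 𝓩, HasFDerivAt (fun x : Ξ => hypRot c x.2.1 (L x)) D x ∧ ∀ u, D u = L u +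
    (exp (c * x.2.1 0) * (c * u.2.1 0) * (L x) (η 0) + (exp (c * x.2.1 0) - 1) * (L u) (η 0)) •
    single (η 0) + (exp (c * x.2.1 1) * (c * u.2.1 1) * (L x) (η 1) +
    (exp (c * x.2.1 1) - 1) * (L u) (η 1)) • single (η 1) := by
  have h : ∀ i,
    HasFDerivAt (fun x : Ξ => (exp (c * x.2.1 i) - 1) * (L x) (η i)) ((exp (c * x.2.1 i) - 1) •
    compC L (η i) + (L x) (η i) • (exp (c * x.2.1 i) • (c • thC p q s i))) x := fun i => by
    have h2 : HasFDerivAt (fun x : Ξ => x.2.1 i) (thC p q s i) x := (thC p q s i).hasFDerivAt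
    have h3 : HasFDerivAt (fun x : Ξ => (L x) (η i)) (compC L (η i)) x :=
      (compC L (η i)).hasFDerivAt
    exact (((h2.const_mul c).cexp).sub_const 1).mul h3
  refine ⟨_, (L.hasFDerivAt.add ((h 0).smul_const (single (η 0) : 𝓩))).add
    ((h 1).smul_const (single (η 1) : 𝓩)), fun u => ?_⟩
  simp only [add_apply, smul_apply, ContinuousLinearMap.smulRight_apply, smul_eq_mul, compC_apply,
    thC_apply]
  congr 2
  · congr 1; ring
  · ring

/-- The angle elimination is symplectic. -/
theorem omegaCoord_fderiv_elim (x u v : Ξ) :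
    omegaCoord (fderiv ℂ (elim 1 I) x u) (fderiv ℂ (elim 1 I) x v) = omegaCoord u v := by
  obtain ⟨D1, h1, e1⟩ := hasFDerivAt_hypRot I (zC p q s) x
  obtain ⟨D2, h2, e2⟩ := hasFDerivAt_hypRot (-I) (zbC p q s) x
  have hA : ∀ i, HasFDerivAt (fun x : Ξ =>
      x.1 i - 1 * (x.2.2.1 (η i) * x.2.2.2 (η i)))
      (rC p q s i - (1 : ℂ) • (x.2.2.1 (η i) • compC (zbC p q s) (η i) +
        x.2.2.2 (η i) • compC (zC p q s) (η i))) x := fun i => by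
    have k1 : HasFDerivAt (fun x : Ξ => x.1 i) (rC p q s i) x := (rC p q s i).hasFDerivAt
    have k2 : HasFDerivAt (fun x : Ξ => x.2.2.1 (η i)) (compC (zC p q s) (η i)) x :=
      (compC (zC p q s) (η i)).hasFDerivAt
    have k3 : HasFDerivAt (fun x : Ξ => x.2.2.2 (η i)) (compC (zbC p q s) (η i)) x :=
      (compC (zbC p q s) (η i)).hasFDerivAt
    exact k1.sub ((k2.mul k3).const_mul 1)
  have hth : HasFDerivAt (fun x : Ξ => x.2.1) ((fst ℂ _ _).comp (snd ℂ _ _)) x :=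
    ContinuousLinearMap.hasFDerivAt ((fst ℂ C2 (𝓩 × 𝓩)).comp (snd ℂ C2 _))
  have H := (hasFDerivAt_pi.2 hA).prodMk (hth.prodMk (h1.prodMk h2))
  have H' : fderiv ℂ (elim 1 I) x = _ := H.fderiv
  have ea : ∀ (u : Ξ) i, (fderiv ℂ (elim 1 I) x u).1 i =
    u.1 i - (x.2.2.1 (η i) * u.2.2.2 (η i) + x.2.2.2 (η i) * u.2.2.1 (η i)) := fun u i => by
      rw [H']
      exact congrArg (u.1 i - ·) (one_mul _)
  have eb : ∀ u : Ξ, (fderiv ℂ (elim 1 I) x u).2.1 = u.2.1 := fun u => by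
    rw [H']; rfl
  have ec : ∀ u : Ξ, (fderiv ℂ (elim 1 I) x u).2.2.1 = D1 u := fun u => by
    rw [H']; rfl
  have ed : ∀ u : Ξ, (fderiv ℂ (elim 1 I) x u).2.2.2 = D2 u := fun u => by
    rw [H']; rfl
  rw [omegaCoord_eq, omegaCoord_eq]
  simp only [ea, eb, ec, ed, e1, e2, map_add, map_smul, add_apply, smul_apply, smul_eq_mul,
    dotZ_single, single_dotZ, single_same, single_of_ne (hyp_one_ne),
    single_of_ne (hyp_one_ne).symm, mul_zero, add_zero, mul_one, zC_apply, zbC_apply]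
  have hI := Complex.I_mul_I
  have hE : ∀ t : ℂ, exp (I * t) * exp (-I * t) = 1 := fun t => by
    rw [← exp_add, neg_mul, add_neg_cancel, exp_zero]
  have b0 := hE (x.2.1 0)
  have b1 := hE (x.2.1 1)
  generalize exp (I * x.2.1 0) = E0 at *
  generalize exp (I * x.2.1 1) = E1 at *
  generalize exp (-I * x.2.1 0) = F0 at *
  generalize exp (-I * x.2.1 1) = F1 at *
  generalize dotZ u.2.2.1 v.2.2.2 = d1
  generalize dotZ u.2.2.2 v.2.2.1 = d2
  linear_combination (-I * ((I * u.2.1 0 * x.2.2.1 (η 0) + u.2.2.1 (η 0)) * (-I * v.2.1 0 *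
    x.2.2.2 (η 0) + v.2.2.2 (η 0)) - (-I * u.2.1 0 * x.2.2.2 (η 0) + u.2.2.2 (η 0)) * (I * v.2.1 0 *
    x.2.2.1 (η 0) + v.2.2.1 (η 0)))) * b0 + (-I * ((I * u.2.1 1 * x.2.2.1 (η 1) + u.2.2.1 (η 1)) *
    (-I * v.2.1 1 * x.2.2.2 (η 1) + v.2.2.2 (η 1)) - (-I * u.2.1 1 * x.2.2.2 (η 1) +
    u.2.2.2 (η 1)) * (I * v.2.1 1 * x.2.2.1 (η 1) + v.2.2.1 (η 1)))) * b1 -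
    ((u.2.1 0 * x.2.2.1 (η 0) * v.2.2.2 (η 0) - v.2.1 0 * x.2.2.2 (η 0) * u.2.2.1 (η 0) +
    u.2.1 0 * x.2.2.2 (η 0) * v.2.2.1 (η 0) - v.2.1 0 * x.2.2.1 (η 0) * u.2.2.2 (η 0)) +
    (u.2.1 1 * x.2.2.1 (η 1) * v.2.2.2 (η 1) - v.2.1 1 * x.2.2.2 (η 1) * u.2.2.1 (η 1) +
    u.2.1 1 * x.2.2.2 (η 1) * v.2.2.1 (η 1) - v.2.1 1 * x.2.2.1 (η 1) * u.2.2.2 (η 1))) * hI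

variable {ρ : C2} {x : Coord p q s}

/-- The internal modes `p₊` and `q₋`. -/
def intM (p q : ℤ) (i : Fin 2) : Mode := if i = 0 then (p, true) else (q, false)

local notation "ι" => intM p q

theorem toModes_int (y : Ξ) (i : Fin 2) : (toModes y).1 (ι i) = y.1 i ^ (1 / 2 :
    ℂ) * exp (I * y.2.1 i) ∧ (toModes y).2 (ι i) = y.1 i ^ ½ * exp (-(I * y.2.1 i)) := by
  have h0 : ∀ (c₁ c₂ : ℂ) (ζ : Ext p q → ℂ), fullSeq c₁ c₂ ζ (ι 0) = c₁ := fun c₁ c₂ ζ => by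
    unfold fullSeq
    rw [dif_neg (by simp [intM])]
    exact if_pos rfl
  have h1 : ∀ (c₁ c₂ : ℂ) (ζ : Ext p q → ℂ), fullSeq c₁ c₂ ζ (ι 1) = c₂ := fun c₁ c₂ ζ => by
    unfold fullSeq
    rw [dif_neg (by simp [intM]), if_neg (by simp [intM])]
  fin_cases i
  · exact ⟨h0 _ _ _, h0 _ _ _⟩
  · exact ⟨h1 _ _ _, h1 _ _ _⟩

theorem toModes_ext (y : Ξ) (α : Ext p q) :
    (toModes y).1 α.1 = y.2.2.1 α ∧ (toModes y).2 α.1 = y.2.2.2 α := ⟨dif_pos α.2, dif_pos α.2⟩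

theorem pullE_toModes (y : Ξ) : pullE (toModes y).1 = y.2.2.1 ∧ pullE (toModes y).2 = y.2.2.2 :=
    ⟨WSeq.ext fun α => (toModes_ext y α).1, WSeq.ext fun α => (toModes_ext y α).2⟩

theorem PSpace.ext_modes {w w' : Λ} (h : ∀ α : Ext p q, w.1 α.1 = w'.1 α.1) (h' : ∀ α : Ext p q,
    w.2 α.1 = w'.2 α.1) (hi : ∀ i, w.1 (ι i) = w'.1 (ι i)) (hi' : ∀ i, w.2 (ι i) = w'.2 (ι i)) : w =
    w' := Prod.ext (CoupledNLS.ext_modes h (hi 0) (hi 1)) (CoupledNLS.ext_modes h' (hi' 0) (hi' 1))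

/-! ### The internal modes as a large solution -/

/-- The point with actions `ρ + r` after the elimination of the angles, as a set of modes. The
parameter `ρ` is allowed to be complex. -/
def psi (ρ : C2) (x : Ξ) : Λ := toModes (ρ + (angleElim x).1, (angleElim x).2)

/-- The actions `ρ_i + r_i - ζ ζ̄` of the internal modes of `psi ρ x`. -/
def act (ρ : C2) (x : Ξ) (i : Fin 2) : ℂ := ρ i + (x.1 i - x.2.2.1 (η i) * x.2.2.2 (η i))

/-- The point `√ν ψ_ρ(x)`, at which the transformation `τ` is applied. -/
abbrev Psi (ν : ℝ) (ρ : C2) (x : Ξ) : Λ := (√ν : ℂ) • psi ρ x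

theorem psi_eq (ρ : C2) (x : Ξ) : psi ρ x = toModes ((ρ, 0) + elim 1 I x) := by
  rw [psi, angleElim_eq]
  refine congrArg toModes (Prod.ext rfl ?_)
  exact (zero_add _).symm

theorem elim_act (ρ : C2) (x : Ξ) (i : Fin 2) : ((ρ, 0) + elim 1 I x).1 i = act ρ x i := by
  change ρ i + (x.1 i - 1 * _) = _
  rw [one_mul]; rfl

theorem elim_rest (ρ : C2) (x : Ξ) : ((ρ, 0) + elim 1 I x).2 = (elim 1 I x).2 := zero_add _

theorem psi_int (ρ : C2) (x : Ξ) (i : Fin 2) : (psi ρ x).1 (ι i) = act ρ x i ^ ½ * exp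
    (I * x.2.1 i) ∧ (psi ρ x).2 (ι i) = act ρ x i ^ ½ * exp (-(I * x.2.1 i)) := by
  have h := toModes_int ((ρ, 0) + elim 1 I x) i
  rw [elim_act, elim_rest, ← psi_eq] at h
  exact h

theorem pullE_psi (ρ : C2) (x : Ξ) :
    pullE (psi ρ x).1 = hypRot I x.2.1 x.2.2.1 ∧ pullE (psi ρ x).2 = hypRot (-I) x.2.1 x.2.2.2 := by
  have h := pullE_toModes ((ρ, 0) + elim 1 I x)
  rw [elim_rest, ← psi_eq] at h
  exact h

/-- The complex neighbourhood of the set of parameters. -/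
def paramC : Set C2 := {ρ | ∃ ρ₀ ∈ paramD, ‖ρ - (fun i => ((ρ₀ i : ℝ) : ℂ))‖ < 1 / 10}

/-- A real parameter as a complex one. -/
def cparam : (Fin 2 → ℝ) →L[ℝ] C2 := ContinuousLinearMap.pi fun i => Complex.ofRealCLM.comp (proj i)

@[simp] theorem cparam_apply (ρ : Fin 2 → ℝ) (i : Fin 2) : cparam ρ i = (ρ i : ℂ) := rfl

theorem cparam_mem {ρ : Fin 2 → ℝ} (h : ρ ∈ paramD) : cparam ρ ∈ paramC :=
  ⟨ρ, h, by rw [show cparam ρ - (fun i => ((ρ i : ℝ) : ℂ)) = 0 from sub_self _]; norm_num⟩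

theorem isOpen_paramC : IsOpen paramC := by
  have : paramC = ⋃ ρ₀ ∈ paramD, ball (fun i => ((ρ₀ i : ℝ) : ℂ)) (1 / 10) := by
    ext ρ
    simp only [paramC, mem_ofPred_eq, mem_iUnion, Metric.mem_ball, dist_eq_norm, exists_prop]
  rw [this]
  exact isOpen_biUnion fun _ _ => Metric.isOpen_ball

theorem isOpen_domO (σ μ : ℝ) : IsOpen (domO p q s σ μ) := by
  have h1 : IsOpen {x : Ξ | ‖x.1‖ < μ ^ 2} := isOpen_lt (by fun_prop) continuous_const
  have h2 : IsOpen {x : Ξ | ∀ i, |(x.2.1 i).im| < σ} := by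
    simp only [ofPred_forall]
    exact isOpen_iInter_of_finite fun i =>
      isOpen_lt ((Complex.continuous_im.comp (thC p q s i).continuous).abs) continuous_const
  have h3 : IsOpen {x : Ξ | ‖x.2.2‖ < μ} := isOpen_lt (by fun_prop) continuous_const
  exact h1.inter (h2.inter h3)

theorem isOpen_domPhi : IsOpen Ω := isOpen_domO _ _

theorem exp_bounds : (Real.exp (-(1 / 2)) / 2) ^ 2 ≤ 1 / 10 ∧ Real.exp (-(1 / 2)) / 2 ≤ 1 / 2 ∧
    Real.exp (1 / 2) * (Real.exp (-(1 / 2)) / 2) = 1 / 2 ∧ Real.exp (1 / 2) ≤ 2 ∧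
    1 / 4 < Real.exp (-(1 / 2)) / 2 := by
  have h1 : Real.exp (-(1 / 2)) ^ 2 = Real.exp (-1) := by
    rw [← Real.exp_nat_mul]; norm_num
  have h2 := Real.exp_neg_one_lt_d9
  have h3 := Real.exp_neg_one_gt_d9
  have h4 := Real.exp_pos (-(1 / 2))
  have h5 : Real.exp (1 / 2) * Real.exp (-(1 / 2)) = 1 := by rw [← Real.exp_add]; norm_num
  have h6 : 1 / 2 < Real.exp (-(1 / 2)) := by nlinarith
  have h7 := Real.exp_pos (1 / 2)
  refine ⟨by nlinarith, ?_, by linarith, by nlinarith, by linarith⟩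
  have : Real.exp (-(1 / 2)) ≤ 1 := Real.exp_le_one_iff.2 (by norm_num)
  linarith

theorem domPhi_bounds (hx : x ∈ Ω) : (∀ i, ‖x.1 i‖ ≤ 1 / 10) ∧ (∀ α β, ‖x.2.2.1 α * x.2.2.2 β‖ ≤
    1 / 10) ∧ (∀ i, |(x.2.1 i).im| < 1 / 2) ∧ ‖x.2.2.1‖ ≤ 1 / 2 ∧ ‖x.2.2.2‖ ≤ 1 / 2 ∧ ∀ i,
    ‖exp (I * x.2.1 i)‖ ≤ Real.exp (1 / 2) ∧ ‖exp (-I * x.2.1 i)‖ ≤ Real.exp (1 / 2) := by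
  obtain ⟨h1, h2, h3⟩ := hx
  obtain ⟨e1, e2, -⟩ := exp_bounds
  have z1 := (norm_fst_le x.2.2).trans h3.le
  have z2 := (norm_snd_le x.2.2).trans h3.le
  refine ⟨fun i => (norm_le_pi_norm x.1 i).trans (h1.le.trans e1), fun α β => ?_, h2,
    z1.trans e2, z2.trans e2, fun i => ?_⟩
  · rw [norm_mul]
    have k1 := (ZSpace.norm_apply_le x.2.2.1 α).trans z1
    have k2 := (ZSpace.norm_apply_le x.2.2.2 β).trans z2
    have := mul_le_mul k1 k2 (norm_nonneg _) ((norm_nonneg _).trans k1)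
    nlinarith
  · have hi := abs_lt.1 (h2 i)
    rw [Complex.norm_exp, Complex.norm_exp]
    constructor
    · refine Real.exp_le_exp.2 ?_
      simp only [Complex.mul_re, Complex.I_re, Complex.I_im]
      linarith
    · refine Real.exp_le_exp.2 ?_
      simp only [Complex.mul_re, Complex.neg_re, Complex.neg_im, Complex.I_re, Complex.I_im]
      linarith

theorem norm_act_sub_le (ρ : C2) (hx : x ∈ Ω) (i : Fin 2) : ‖act ρ x i - ρ i‖ ≤ 1 / 5 := by
  obtain ⟨h1, h2, -⟩ := domPhi_bounds hx
  rw [act, add_sub_cancel_left]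
  refine (norm_sub_le _ _).trans ?_
  have := h1 i
  have := h2 (η i) (η i)
  linarith

theorem act_bounds (hρ : ρ ∈ paramC) (hx : x ∈ Ω) (i : Fin 2) :
    7 / 10 ≤ (act ρ x i).re ∧ ‖act ρ x i‖ ≤ 5 / 2 := by
  obtain ⟨ρ₀, h0, h1⟩ := hρ
  have h2 : ‖ρ i - ((ρ₀ i : ℝ) : ℂ)‖ ≤ 1 / 10 :=
    (norm_le_pi_norm (ρ - fun i => ((ρ₀ i : ℝ) : ℂ)) i).trans h1.le
  have h3 := norm_act_sub_le ρ hx i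
  have h4 : ‖act ρ x i - ((ρ₀ i : ℝ) : ℂ)‖ ≤ 3 / 10 := by
    have := norm_add_le (act ρ x i - ρ i) (ρ i - ((ρ₀ i : ℝ) : ℂ))
    rw [sub_add_sub_cancel] at this
    linarith
  have h5 : 1 ≤ ρ₀ i := h0.1 i
  have h6 : ρ₀ i ≤ 2 := h0.2 i
  constructor
  · have h7 := (Complex.abs_re_le_norm _).trans h4
    rw [Complex.sub_re, Complex.ofReal_re] at h7
    have := (abs_le.1 h7).1
    linarith
  · have h7 := norm_add_le (act ρ x i - ((ρ₀ i : ℝ) : ℂ)) ((ρ₀ i : ℝ) : ℂ)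
    rw [sub_add_cancel, Complex.norm_real, Real.norm_of_nonneg (by linarith)] at h7
    have : ρ₀ i ≤ 2 := h6
    have h8 : ‖act ρ x i - ((ρ₀ i : ℝ) : ℂ)‖ ≤ 3 / 10 := h4
    linarith

theorem act_slitPlane (hρ : ρ ∈ paramC) (hx : x ∈ Ω) (i : Fin 2) :
    ((ρ, 0) + elim 1 I x).1 i ∈ Complex.slitPlane := by
  rw [elim_act]
  exact Or.inl (by linarith [(act_bounds hρ hx i).1])

theorem analyticAt_psi (hρ : ρ ∈ paramC) (hx : x ∈ Ω) :
    AnalyticAt ℂ (fun y : C2 × Ξ => psi y.1 y.2) (ρ, x) := by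
  have e : (fun y : C2 × Ξ => psi y.1 y.2) = fun y => toModes ((y.1, 0) + elim 1 I y.2) :=
    funext fun y => psi_eq y.1 y.2
  rw [e]
  have h1 : AnalyticAt ℂ (fun y : C2 × Ξ =>
      ((y.1, 0) : Ξ)) (ρ, x) := analyticAt_fst.prod analyticAt_const
  have h2 : AnalyticAt ℂ (fun y : C2 × Ξ => elim 1 I y.2) (ρ, x) := analyticAt_comp' (g := elim 1 I)
    (f := fun y : C2 × Ξ => y.2) (analyticAt_elim 1 I x) analyticAt_snd
  exact analyticAt_comp' (g := toModes) (f := fun y : C2 × Ξ => ((y.1, 0) : Ξ) + elim 1 I y.2)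
    (analyticAt_toModes (act_slitPlane hρ hx)) (h1.add h2)

theorem analyticAt_psi_right (hρ : ρ ∈ paramC) (hx : x ∈ Ω) :
    AnalyticAt ℂ (psi ρ) x := analyticAt_comp' (g := fun y : C2 × Ξ => psi y.1 y.2)
    (f := fun x => (ρ, x)) (analyticAt_psi hρ hx) (analyticAt_const.prod analyticAt_id)

theorem fderiv_psi (hρ : ρ ∈ paramC) (hx : x ∈ Ω) :
    fderiv ℂ (psi ρ) x = (fderiv ℂ toModes ((ρ, 0) + elim 1 I x)).comp (fderiv ℂ (elim 1 I) x) := by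
  have h1 := (analyticAt_elim 1 I x).differentiableAt.hasFDerivAt.const_add ((ρ, 0) : Ξ)
  have h2 := (analyticAt_toModes (act_slitPlane hρ hx)).differentiableAt.hasFDerivAt
  have e : psi ρ = fun x : Ξ => toModes ((ρ, 0) + elim 1 I x) := funext fun y => psi_eq ρ y
  rw [e]
  exact (h2.comp x h1).fderiv

theorem omegaP_fderiv_psi (hρ : ρ ∈ paramC) (hx : x ∈ Ω) (u v : Ξ) :
    omegaP (fderiv ℂ (psi ρ) x u) (fderiv ℂ (psi ρ) x v) = omegaCoord u v := by
  rw [fderiv_psi hρ hx, ContinuousLinearMap.comp_apply, ContinuousLinearMap.comp_apply,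
    omegaP_fderiv_toModes (act_slitPlane hρ hx), omegaCoord_fderiv_elim]

theorem norm_cpow_half (z : ℂ) : ‖z ^ ½‖ = √‖z‖ := by
  rw [show ½ = ((1 / 2 : ℝ) : ℂ) by push_cast; rfl, Complex.norm_cpow_real, Real.sqrt_eq_rpow]

theorem act_ne_zero (hρ : ρ ∈ paramC) (hx : x ∈ Ω) (i : Fin 2) : act ρ x i ≠ 0 := fun h => by
  have := (act_bounds hρ hx i).1
  rw [h, Complex.zero_re] at this
  linarith

/-- The internal modes of `psi ρ x` are bounded from above and from below. -/
theorem psi_int_bounds (hρ : ρ ∈ paramC) (hx : x ∈ Ω) (i : Fin 2) : (1 / 4 ≤ ‖(psi ρ x).1 (ι i)‖ ∧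
    ‖(psi ρ x).1 (ι i)‖ ≤ 4) ∧ (1 / 4 ≤ ‖(psi ρ x).2 (ι i)‖ ∧ ‖(psi ρ x).2 (ι i)‖ ≤ 4) := by
  obtain ⟨e1, e2⟩ := psi_int ρ x i
  obtain ⟨h1, h2⟩ := (domPhi_bounds hx).2.2.2.2.2 i
  obtain ⟨a1, a2⟩ := act_bounds hρ hx i
  have h0 := exp_bounds.2.2.2.1
  have hE : exp (I * x.2.1 i) * exp (-I * x.2.1 i) = 1 := by
    rw [← exp_add, neg_mul, add_neg_cancel, exp_zero]
  have hE' := congrArg norm hE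
  rw [norm_mul, norm_one] at hE'
  have h3 : 1 / 2 ≤ ‖act ρ x i ^ ½‖ ∧ ‖act ρ x i ^ ½‖ ≤ 2 := by
    rw [norm_cpow_half]
    have := (Complex.re_le_norm (act ρ x i))
    exact ⟨Real.le_sqrt_of_sq_le (by linarith), Real.sqrt_le_iff.2 ⟨by norm_num, by linarith⟩⟩
  rw [← neg_mul] at e2
  rw [e1, e2, norm_mul, norm_mul]
  have n1 := norm_nonneg (exp (I * x.2.1 i))
  have n2 := norm_nonneg (exp (-I * x.2.1 i))
  have k1 : 1 / 2 ≤ ‖exp (I * x.2.1 i)‖ := by nlinarith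
  have k2 : 1 / 2 ≤ ‖exp (-I * x.2.1 i)‖ := by nlinarith
  refine ⟨⟨?_, ?_⟩, ?_, ?_⟩ <;> nlinarith

theorem norm_hypRot_le (hx : x ∈ Ω) :
    ‖hypRot I x.2.1 x.2.2.1‖ ≤ 1 / 2 ∧ ‖hypRot (-I) x.2.1 x.2.2.2‖ ≤ 1 / 2 := by
  have h := (domPhi_bounds hx).2.2.2.2.2
  have h1 : (1 : ℝ) ≤ Real.exp (1 / 2) := Real.one_le_exp (by norm_num)
  have z1 := (norm_fst_le x.2.2).trans hx.2.2.le
  have z2 := (norm_snd_le x.2.2).trans hx.2.2.le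
  have e := exp_bounds.2.2.1
  exact ⟨(hypRot_norm_le _ _ _ h1 fun i => (h i).1).trans
      ((mul_le_mul_of_nonneg_left z1 (by positivity)).trans e.le),
    (hypRot_norm_le _ _ _ h1 fun i => (h i).2).trans
      ((mul_le_mul_of_nonneg_left z2 (by positivity)).trans e.le)⟩

/-- A bound that is uniform in the complex parameters; after scaling, `√ν psi ρ x` is of size `√ν`. -/
theorem exists_psi_bound : ∃ M : ℝ, 1 ≤ M ∧ ∀ ρ ∈ paramC, ∀ x ∈ Ω, ‖psi ρ x‖ ≤ M := by
  set P := ‖(pushE : 𝓩 →L[ℂ] MSeq s)‖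
  set N := ‖(single (p, true) : MSeq s)‖
  set N' := ‖(single (q, false) : MSeq s)‖
  refine ⟨1 + P + 4 * N + 4 * N', ?_, fun ρ hρ x hx => ?_⟩
  · have : 0 ≤ P := norm_nonneg _
    have : 0 ≤ N := norm_nonneg _
    have : 0 ≤ N' := norm_nonneg _
    linarith
  have h0 := psi_int_bounds hρ hx 0
  have h1 := psi_int_bounds hρ hx 1
  have h2 := pullE_psi ρ x
  have h3 := norm_hypRot_le hx
  have key : ∀ y : MSeq s, ‖(pullE y : 𝓩)‖ ≤ 1 / 2 → ‖y (p, true)‖ ≤ 4 → ‖y (q, false)‖ ≤ 4 → ‖y‖ ≤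
    1 + P + 4 * N + 4 * N' := by
    intro y hy hp hq
    have e : y = pushE (pullE y : 𝓩) + y (p, true) • (single (p, true) : MSeq s) + y (q, false) •
      (single (q, false) : MSeq s) := by
      obtain ⟨z, hz⟩ : ∃ z : MSeq s, z = pushE (pullE y : 𝓩) + y (p, true) • (single (p, true) :
        MSeq s) + y (q, false) • (single (q, false) : MSeq s) := ⟨_, rfl⟩
      obtain ⟨i1, i2⟩ := pushE_apply_int (pullE y : 𝓩)
      have hne : ((p, true) : Mode) ≠ (q, false) := by simp
      have hz' : ∀ α, z α = pushE (pullE y : 𝓩) α + y (p, true) * (single (p, true) : MSeq s) α + y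
        (q, false) * (single (q, false) : MSeq s) α := fun α => by
        rw [hz, WSeq.add_apply, WSeq.add_apply, WSeq.smul_apply, WSeq.smul_apply]
      refine Eq.trans ?_ hz
      refine CoupledNLS.ext_modes (p := p) (q := q) (fun α => ?_) ?_ ?_
      · rw [hz', pushE_apply, single_of_ne α.2.1, single_of_ne α.2.2, pullE_apply]
        ring
      · rw [hz', i1, single_of_ne hne, single_same]
        ring
      · rw [hz', i2, single_of_ne hne.symm, single_same]
        ring
    rw [e]
    refine (norm_add_le _ _).trans (add_le_add ((norm_add_le _ _).trans (add_le_add ?_ ?_)) ?_)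
    · refine ((pushE).le_opNorm _).trans ?_
      have : 0 ≤ P := norm_nonneg _
      change P * _ ≤ _
      nlinarith
    · rw [norm_smul]
      exact mul_le_mul_of_nonneg_right hp (norm_nonneg _)
    · rw [norm_smul]
      exact mul_le_mul_of_nonneg_right hq (norm_nonneg _)
  exact norm_prod_le_iff.2 ⟨key _ (by rw [h2.1]; exact h3.1) h0.1.2 h1.1.2,
    key _ (by rw [h2.2]; exact h3.2) h0.2.2 h1.2.2⟩

theorem exp_shift (c : ℂ) (hc : c = I ∨ c = -I) (t : ℂ) (k : ℤ) :
    exp (c * (t + 2 * Real.pi * (k : ℂ))) = exp (c * t) := by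
  rw [mul_add, exp_add]
  have : exp (c * (2 * Real.pi * (k : ℂ))) = 1 := by
    rw [Complex.exp_eq_one_iff]
    rcases hc with rfl | rfl
    · exact ⟨k, by ring⟩
    · exact ⟨-k, by push_cast; ring⟩
  rw [this, mul_one]

theorem psi_shiftAngle (ρ : C2) (k : Fin 2 → ℤ) (x : Ξ) : psi ρ (shiftAngle k x) = psi ρ x := by
  have hr : ∀ (c : ℂ), (c = I ∨ c = -I) → ∀ ζ : 𝓩,
    hypRot c (shiftAngle k x).2.1 ζ = hypRot c x.2.1 ζ := fun c hc ζ => by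
    unfold hypRot
    simp only [shiftAngle, exp_shift c hc]
  have e1 := pullE_psi ρ (shiftAngle k x)
  rw [hr _ (Or.inl rfl), hr _ (Or.inr rfl)] at e1
  have e2 := pullE_psi ρ x
  refine PSpace.ext_modes (p := p) (q := q) (fun α => ?_) (fun α => ?_) (fun i => ?_) (fun i => ?_)
  · rw [← pullE_apply, ← pullE_apply, e1.1, e2.1]; rfl
  · rw [← pullE_apply, ← pullE_apply, e1.2, e2.2]; rfl
  · rw [(psi_int ρ x i).1, (psi_int ρ _ i).1]
    simp only [shiftAngle, exp_shift _ (Or.inl rfl)]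
    rfl
  · rw [(psi_int ρ x i).2, (psi_int ρ _ i).2, ← neg_mul, ← neg_mul]
    simp only [shiftAngle, exp_shift _ (Or.inr rfl)]
    rfl

theorem cpow_half_sq {z : ℂ} (hz : z ≠ 0) : z ^ ½ * z ^ ½ = z := by
  rw [← Complex.cpow_add _ _ hz]
  norm_num

/-- The point `psi ρ x` and the angles determine `x`. -/
theorem psi_inj (hρ : ρ ∈ paramC) {x y : Ξ} (hx : x ∈ Ω) (hy : y ∈ Ω) (h : psi ρ x = psi ρ y)
    (hθ : x.2.1 = y.2.1) : x = y := by
  have e1 := pullE_psi ρ x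
  have e2 := pullE_psi ρ y
  rw [h, hθ] at e1
  have z1 := e1.1.symm.trans e2.1
  have z2 := e1.2.symm.trans e2.2
  have z1' := (hypRot_neg _ y.2.1 x.2.2.1).symm.trans
    ((congrArg (hypRot _ _) z1).trans (hypRot_neg _ y.2.1 y.2.2.1))
  have z2' := (hypRot_neg _ y.2.1 x.2.2.2).symm.trans
    ((congrArg (hypRot _ _) z2).trans (hypRot_neg _ y.2.1 y.2.2.2))
  refine Prod.ext (funext fun i => ?_) (Prod.ext hθ (Prod.ext z1' z2'))
  have e3 := (psi_int ρ x i).1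
  rw [h, (psi_int ρ y i).1, hθ] at e3
  have e4 := mul_right_cancel₀ (Complex.exp_ne_zero _) e3
  have e5 : act ρ x i = act ρ y i := by
    rw [← cpow_half_sq (act_ne_zero hρ hx i), ← e4, cpow_half_sq (act_ne_zero hρ hy i)]
  unfold act at e5
  rw [z1', z2'] at e5
  linear_combination e5

theorem psi_real {ρ : Fin 2 → ℝ} (hρ : ρ ∈ paramD) (hx : x ∈ Ω) (hr : IsRealCoord x) :
    IsRealPoint (psi (cparam ρ) x) := by
  obtain ⟨r1, r2, r3⟩ := hr
  have hE : ∀ i, conj (exp (I * x.2.1 i)) = exp (-I * x.2.1 i) := fun i => by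
      rw [← Complex.exp_conj, map_mul, Complex.conj_I, Complex.conj_eq_iff_im.2 (r2 i)]
  have e := pullE_psi (cparam ρ) x
  have hext : ∀ α : Ext p q, (psi (cparam ρ) x).2 α.1 = conj ((psi (cparam ρ) x).1 α.1) := by
    intro α
    rw [← pullE_apply, ← pullE_apply, e.1, e.2]
    rcases ell_or_hyp α with ⟨β, rfl⟩ | rfl | rfl
    · rw [hypRot_ell, hypRot_ell, r3]
    · rw [hypRot_hyp, hypRot_hyp, r3, map_mul, hE]
    · rw [hypRot_hyp, hypRot_hyp, r3, map_mul, hE]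
  have hint : ∀ i, (psi (cparam ρ) x).2 (ι i) = conj ((psi (cparam ρ) x).1 (ι i)) := by
    intro i
    rw [(psi_int _ x i).1, (psi_int _ x i).2, map_mul, hE, neg_mul]
    congr 1
    have h1 : (act (cparam ρ) x i).im = 0 := by
      rw [act, r3]
      simp [r1 i, Complex.mul_conj]
    have h2 : 0 ≤ (act (cparam ρ) x i).re := by
      linarith [(act_bounds (cparam_mem hρ) hx i).1]
    have h3 : act (cparam ρ) x i = ((act (cparam ρ) x i).re : ℂ) := Complex.ext rfl h1
    rw [h3, show ½ = ((1 / 2 : ℝ) : ℂ) by push_cast; rfl, ← Complex.ofReal_cpow h2,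
      Complex.conj_ofReal]
  intro α
  by_cases h1 : α = (p, true)
  · rw [h1]; exact hint 0
  by_cases h2 : α = (q, false)
  · rw [h2]; exact hint 1
  exact hext ⟨α, h1, h2⟩

theorem toModes_rescale {ν : ℝ} (hν : 0 < ν) (y : Ξ) :
    toModes (rescale ν y) = (√ν : ℂ) • toModes y := by
  have hc : ∀ z : ℂ, ((ν : ℂ) * z) ^ ½ = (√ν : ℂ) * z ^ ½ := fun z => by
    rcases eq_or_ne z 0 with rfl | hz
    · simp
    · have h0 : (ν : ℂ) ≠ 0 := by exact_mod_cast hν.ne'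
      rw [Complex.cpow_def_of_ne_zero (mul_ne_zero h0 hz), Complex.log_ofReal_mul hν hz, add_mul,
        exp_add, ← Complex.cpow_def_of_ne_zero hz, Real.sqrt_eq_rpow,
        Complex.ofReal_cpow hν.le, Complex.cpow_def_of_ne_zero h0, Complex.ofReal_log hν.le]
      push_cast
      rfl
  refine PSpace.ext_modes (p := p) (q := q) (fun α => ?_) (fun α => ?_) (fun i => ?_) (fun i => ?_)
  · rw [(toModes_ext _ α).1]
    exact congrArg (_ * ·) (toModes_ext y α).1.symm
  · rw [(toModes_ext _ α).2]
    exact congrArg (_ * ·) (toModes_ext y α).2.symm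
  · rw [(toModes_int _ i).1]
    refine Eq.trans ?_ (congrArg ((√ν : ℂ) * ·) (toModes_int y i).1.symm)
    rw [← mul_assoc, ← hc]
    rfl
  · rw [(toModes_int _ i).2]
    refine Eq.trans ?_ (congrArg ((√ν : ℂ) * ·) (toModes_int y i).2.symm)
    rw [← mul_assoc, ← hc]
    rfl

theorem hypRot_smul (c : ℂ) (θ : C2) (a : ℂ) (ζ : 𝓩) : hypRot c θ (a • ζ) = a • hypRot c θ ζ := by
  refine ZSpace.ext_ell_hyp (fun α => ?_) (fun i => ?_)
  · rw [hypRot_ell, WSeq.smul_apply, WSeq.smul_apply, hypRot_ell]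
  · rw [hypRot_hyp, WSeq.smul_apply, WSeq.smul_apply, hypRot_hyp]
    ring

theorem angleElim_rescale {ν : ℝ} (hν : 0 < ν) (x : Ξ) :
    angleElim (rescale ν x) = rescale ν (elim 1 I x) := by
  rw [angleElim_eq]
  refine Prod.ext (funext fun i => ?_)
    (Prod.ext rfl (Prod.ext (hypRot_smul _ _ _ _) (hypRot_smul _ _ _ _)))
  change (ν : ℂ) * x.1 i - 1 * (((√ν : ℂ) * x.2.2.1 (η i)) * ((√ν : ℂ) * x.2.2.2 (η i))) = (ν : ℂ) *
    (x.1 i - 1 * (x.2.2.1 (η i) * x.2.2.2 (η i)))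
  have h : (√ν : ℂ) * (√ν : ℂ) = ν := by
    rw [← Complex.ofReal_mul, Real.mul_self_sqrt hν.le]
  linear_combination -(x.2.2.1 (η i) * x.2.2.2 (η i)) * h

theorem toModes_shiftAction {ν : ℝ} (hν : 0 < ν) (ρ : Fin 2 → ℝ) (x : Ξ) :
    toModes (shiftAction ν ρ (angleElim (rescale ν x))) = Psi ν (cparam ρ) x := by
  rw [Psi, psi_eq, ← toModes_rescale hν, angleElim_rescale hν]
  refine congrArg toModes (Prod.ext (funext fun i => ?_) (Prod.ext ?_ ?_))
  · change ((ν * ρ i : ℝ) : ℂ) + (ν : ℂ) * _ = (ν : ℂ) * ((ρ i : ℂ) + _)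
    push_cast; ring
  · exact (zero_add _).symm
  · exact congrArg ((√ν : ℂ) • ·) (zero_add _).symm

open Classical in
theorem norm_rotE_le (φ ψ : ℝ) (α : Ext p q) :
    ‖(if α = η 0 ∨ α = η 1 then 1 else rotMul φ ψ α.1 : ℂ)‖ ≤ 1 := by
  split_ifs
  · exact norm_one.le
  · exact norm_rotMul φ ψ α.1

open Classical in
/-- Rotation of the elliptic modes; the hyperbolic modes are fixed. -/
def rotE (φ ψ : ℝ) : 𝓩 →L[ℂ] 𝓩 := WSeq.mulC (extWeight p q) s
    (fun α => if α = η 0 ∨ α = η 1 then 1 else rotMul φ ψ α.1) 1 (norm_rotE_le φ ψ)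

theorem rotE_hyp (φ ψ : ℝ) (ζ : 𝓩) (i : Fin 2) : rotE φ ψ ζ (η i) = ζ (η i) := by
  refine (WSeq.mulC_apply _ _ _ _ _).trans ?_
  rw [if_pos (by fin_cases i <;> simp), one_mul]

theorem rotE_ell (φ ψ : ℝ) (ζ : 𝓩) (α : Ell p q) :
    rotE φ ψ ζ α.toExt = rotMul φ ψ α.1 * ζ α.toExt := by
  refine (WSeq.mulC_apply _ _ _ _ _).trans ?_
  rw [if_neg]
  · rfl
  · rintro (h | h)
    exacts [toExt_ne_hyp α 0 h, toExt_ne_hyp α 1 h]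

/-- The symmetry of the coordinates that corresponds to `rot s φ ψ`: the angles are translated by
`φ + pψ` and `φ + qψ`, the elliptic modes are rotated, and the hyperbolic modes are fixed. -/
def rotC (φ ψ : ℝ) (x : Ξ) : Ξ := (x.1, fun i => x.2.1 i + ((φ + ψ * (ι i).1 : ℝ) : ℂ),
    (rotE φ ψ x.2.2.1, rotE (-φ) (-ψ) x.2.2.2))

theorem hyp_intM (i : Fin 2) : (η i).1.1 = (ι i).1 := by
  fin_cases i <;> rfl

theorem psi_rotC (ρ : C2) (φ ψ : ℝ) (x : Ξ) : psi ρ (rotC φ ψ x) = rot s φ ψ (psi ρ x) := by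
  have e1 := pullE_psi ρ (rotC φ ψ x)
  have e2 := pullE_psi ρ x
  have hA : ∀ i, act ρ (rotC φ ψ x) i = act ρ x i := fun i => by
    change ρ i + (x.1 i - rotE φ ψ x.2.2.1 (η i) * rotE (-φ) (-ψ) x.2.2.2 (η i)) = _
    rw [rotE_hyp, rotE_hyp]
    rfl
  have hE : ∀ i, exp (I * (rotC φ ψ x).2.1 i) = rotMul φ ψ (ι i) * exp (I * x.2.1 i) := fun i => by
    rw [rotMul, ← exp_add, add_comm, ← mul_add]
    rfl
  have hE' : ∀ i, exp (-I * (rotC φ ψ x).2.1 i) = rotMul (-φ) (-ψ) (ι i) * exp (-I * x.2.1 i) :=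
    fun i => by
    rw [rotMul, ← exp_add]
    congr 1
    change -I * (x.2.1 i + ((φ + ψ * (ι i).1 : ℝ) : ℂ)) = _
    push_cast
    ring
  refine PSpace.ext_modes (p := p) (q := q) (fun α => ?_) (fun α => ?_) (fun i => ?_) (fun i => ?_)
  · rw [rot_fst, ← pullE_apply, ← pullE_apply, e1.1, e2.1]
    have hh : ∀ i, hypRot I (rotC φ ψ x).2.1 (rotC φ ψ x).2.2.1 (η i) =
      rotMul φ ψ (η i).1 * hypRot I x.2.1 x.2.2.1 (η i) := fun i => by
      rw [hypRot_hyp, hypRot_hyp, hE]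
      change _ * rotE φ ψ x.2.2.1 (η i) = _
      rw [rotE_hyp, rotMul, rotMul, hyp_intM, mul_assoc]
    rcases ell_or_hyp α with ⟨β, rfl⟩ | rfl | rfl
    · rw [hypRot_ell, hypRot_ell]
      exact rotE_ell φ ψ _ β
    · exact hh 0
    · exact hh 1
  · rw [rot_snd, ← pullE_apply, ← pullE_apply, e1.2, e2.2]
    have hh : ∀ i, hypRot (-I) (rotC φ ψ x).2.1 (rotC φ ψ x).2.2.2 (η i) =
      rotMul (-φ) (-ψ) (η i).1 * hypRot (-I) x.2.1 x.2.2.2 (η i) := fun i => by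
        rw [hypRot_hyp, hypRot_hyp, hE']
        change _ * rotE (-φ) (-ψ) x.2.2.2 (η i) = _
        rw [rotE_hyp, rotMul, rotMul, hyp_intM, mul_assoc]
    rcases ell_or_hyp α with ⟨β, rfl⟩ | rfl | rfl
    · rw [hypRot_ell, hypRot_ell]
      exact rotE_ell (-φ) (-ψ) _ β
    · exact hh 0
    · exact hh 1
  · rw [rot_fst, (psi_int ρ _ i).1, (psi_int ρ _ i).1, hA, hE]
    ring
  · rw [rot_snd, (psi_int ρ _ i).2, (psi_int ρ _ i).2, hA, ← neg_mul, ← neg_mul, hE']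
    ring

/-! ### The change of variables `Φ_ρ` -/

theorem norm_log_le_of_near_one {u : ℂ} (hu : ‖u - 1‖ ≤ 1 / 10) : ‖log u‖ ≤ 3 / 20 := by
  have := Complex.norm_log_one_add_half_le_self (z := u - 1) (by linarith)
  rw [add_sub_cancel] at this
  linarith

theorem ne_zero_of_near_one {u : ℂ} (hu : ‖u - 1‖ ≤ 1 / 10) : u ≠ 0 := fun h => by
  rw [h] at hu
  norm_num at hu

theorem slitPlane_of_near_one {u : ℂ} (hu : ‖u - 1‖ ≤ 1 / 10) : u ∈ Complex.slitPlane := by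
  left
  have := (abs_le.1 ((Complex.abs_re_le_norm _).trans hu)).1
  rw [Complex.sub_re, Complex.one_re] at this
  linarith

/-- The principal branches are compatible as long as the total argument stays below `π`. -/
theorem cpow_half_mul_near_one {A u v : ℂ} (hA : 0 < A.re) (hu : ‖u - 1‖ ≤ 1 / 10)
    (hv : ‖v - 1‖ ≤ 1 / 10) : (A * u * v) ^ ½ = A ^ ½ * exp ((log u + log v) / 2) := by
  have hA0 : A ≠ 0 := fun h => by rw [h] at hA; simp at hA
  have hu0 := ne_zero_of_near_one hu
  have hv0 := ne_zero_of_near_one hv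
  have h1 : |(log A).im| < Real.pi / 2 := by
    rw [Complex.log_im, Complex.abs_arg_lt_pi_div_two_iff]
    exact Or.inl hA
  have h2 := (Complex.abs_im_le_norm _).trans (norm_log_le_of_near_one hu)
  have h3 := (Complex.abs_im_le_norm _).trans (norm_log_le_of_near_one hv)
  have hpi := Real.pi_gt_three
  have e : log (A * u * v) = log A + log u + log v := by
    rw [← Complex.log_exp (x := log A + log u + log v)]
    · rw [exp_add, exp_add, Complex.exp_log hA0, Complex.exp_log hu0, Complex.exp_log hv0]
    · simp only [Complex.add_im]
      linarith [(abs_lt.1 h1).1, (abs_le.1 h2).1, (abs_le.1 h3).1]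
    · simp only [Complex.add_im]
      linarith [(abs_lt.1 h1).2, (abs_le.1 h2).2, (abs_le.1 h3).2]
  rw [Complex.cpow_def_of_ne_zero (mul_ne_zero (mul_ne_zero hA0 hu0) hv0), e,
    Complex.cpow_def_of_ne_zero hA0, ← exp_add]
  congr 1
  ring

theorem norm_mul_sub_one_le {u v : ℂ} (hu : ‖u - 1‖ ≤ 1 / 10) (hv : ‖v - 1‖ ≤ 1 / 10) :
    ‖u * v - 1‖ ≤ 21 / 100 := by
  have e : u * v - 1 = (u - 1) * (v - 1) + (u - 1) + (v - 1) := by ring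
  rw [e]
  refine (norm_add₃_le).trans ?_
  rw [norm_mul]
  have := mul_le_mul hu hv (norm_nonneg _) (by norm_num)
  linarith

/-- The coordinates of the modes `w'` near the modes `w` with the angles `θ`: the angles of `w'`
are continued from those of `w`. -/
def recoord (p q : ℤ) (θ : C2) (w w' : PSpace s) : Coord p q s :=
    (fun i => w'.1 (intM p q i) * w'.2 (intM p q i), fun i => θ i + (log (w'.1 (intM p q i) / w.1
    (intM p q i)) - log (w'.2 (intM p q i) / w.2 (intM p q i))) / (2 * I), (pullE w'.1, pullE w'.2))

theorem analyticAt_mode {E : Type*} [NormedAddCommGroup E] [NormedSpace ℂ E] {w : E → Λ} {x : E}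
    (hw : AnalyticAt ℂ w x) (α : Mode) :
    AnalyticAt ℂ (fun y => (w y).1 α) x ∧ AnalyticAt ℂ (fun y => (w y).2 α) x :=
    ⟨(((coord fullWeight s α).comp (fst ℂ (MSeq s) (MSeq s))).analyticAt (w x)).comp hw,
    (((coord fullWeight s α).comp (snd ℂ (MSeq s) (MSeq s))).analyticAt (w x)).comp hw⟩

theorem analyticAt_recoord {E : Type*} [NormedAddCommGroup E] [NormedSpace ℂ E] {θ : E → Fin 2 → ℂ}
    {w w' : E → Λ} {x : E} (hθ : AnalyticAt ℂ θ x) (hw : AnalyticAt ℂ w x) (hw' : AnalyticAt ℂ w' x)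
    (h : ∀ i, ‖(w' x).1 (ι i) / (w x).1 (ι i) - 1‖ ≤ 1 / 10 ∧
    ‖(w' x).2 (ι i) / (w x).2 (ι i) - 1‖ ≤ 1 / 10 ∧ (w x).1 (ι i) ≠ 0 ∧ (w x).2 (ι i) ≠ 0) :
    AnalyticAt ℂ (fun y => recoord p q (θ y) (w y) (w' y)) x := by
  have hI : AnalyticAt ℂ (fun y => fun i => (w' y).1 (ι i) * (w' y).2 (ι i)) x :=
    AnalyticAt.pi fun i => (analyticAt_mode hw' _).1.mul (analyticAt_mode hw' _).2
  have hth : AnalyticAt ℂ (fun y => fun i => θ y i +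
    (log ((w' y).1 (ι i) / (w y).1 (ι i)) - log ((w' y).2 (ι i) / (w y).2 (ι i))) / (2 * I)) x := by
    refine AnalyticAt.pi fun i => ?_
    have t : AnalyticAt ℂ (fun y => θ y i) x := analyticAt_comp' (g := proj (R := ℂ) (φ := fun _ :
      Fin 2 => ℂ) i) (ContinuousLinearMap.analyticAt _ _) hθ
    exact t.add (((((analyticAt_mode hw' _).1.div (analyticAt_mode hw _).1 (h i).2.2.1).clog
      (slitPlane_of_near_one (h i).1)).sub
      (((analyticAt_mode hw' _).2.div (analyticAt_mode hw _).2 (h i).2.2.2).clog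
        (slitPlane_of_near_one (h i).2.1))).div analyticAt_const (by simp))
  have hz1 : AnalyticAt ℂ (fun y => (pullE (w' y).1 : 𝓩)) x :=
    (((pullE).comp (fst ℂ (MSeq s) (MSeq s))).analyticAt (w' x)).comp hw'
  have hz2 : AnalyticAt ℂ (fun y => (pullE (w' y).2 : 𝓩)) x :=
    (((pullE).comp (snd ℂ (MSeq s) (MSeq s))).analyticAt (w' x)).comp hw'
  exact hI.prod (hth.prod (hz1.prod hz2))

/-- `recoord` inverts `toModes` near `w`. The logarithms are principal, so that no angle jumps. -/
theorem toModes_recoord (θ : C2) {w w' : Λ} (A : C2) (hA : ∀ i, 0 < (A i).re) (h1 : ∀ i, w.1 (ι i) =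
    A i ^ ½ * exp (I * θ i)) (h2 : ∀ i, w.2 (ι i) = A i ^ ½ * exp (-(I * θ i)))
    (h3 : ∀ i, ‖w'.1 (ι i) / w.1 (ι i) - 1‖ ≤ 1 / 10)
    (h4 : ∀ i, ‖w'.2 (ι i) / w.2 (ι i) - 1‖ ≤ 1 / 10) : toModes (recoord p q θ w w') = w' ∧ ∀ i,
    (recoord p q θ w w').1 i = A i * ((w'.1 (ι i) / w.1 (ι i)) * (w'.2 (ι i) / w.2 (ι i))) := by
  have hA0 : ∀ i, A i ≠ 0 := fun i h => by have := hA i; rw [h] at this; simp at this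
  have hw1 : ∀ i, w.1 (ι i) ≠ 0 := fun i => by
    rw [h1]
    exact mul_ne_zero ((Complex.cpow_ne_zero_iff_of_exponent_ne_zero (by norm_num)).2 (hA0 i))
      (Complex.exp_ne_zero _)
  have hw2 : ∀ i, w.2 (ι i) ≠ 0 := fun i => by
    rw [h2]
    exact mul_ne_zero ((Complex.cpow_ne_zero_iff_of_exponent_ne_zero (by norm_num)).2 (hA0 i))
      (Complex.exp_ne_zero _)
  have hww : ∀ i, w.1 (ι i) * w.2 (ι i) = A i := fun i => by
    have hE : exp (I * θ i) * exp (-(I * θ i)) = 1 := by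
      rw [← exp_add, add_neg_cancel, exp_zero]
    rw [h1, h2]
    linear_combination (A i ^ ½ * A i ^ ½) * hE + cpow_half_sq (hA0 i)
  have hI : ∀ i, (recoord p q θ w w').1 i =
    A i * ((w'.1 (ι i) / w.1 (ι i)) * (w'.2 (ι i) / w.2 (ι i))) := fun i => by
      rw [← hww i]
      change w'.1 (ι i) * w'.2 (ι i) = _
      have := hw1 i
      have := hw2 i
      field_simp
  refine ⟨?_, hI⟩
  have key : ∀ i, (recoord p q θ w w').1 i ^ ½ = A i ^ (1 / 2 :
    ℂ) * exp ((log (w'.1 (ι i) / w.1 (ι i)) + log (w'.2 (ι i) / w.2 (ι i))) / 2) := fun i => by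
    rw [hI, ← mul_assoc]
    exact cpow_half_mul_near_one (hA i) (h3 i) (h4 i)
  have hIinv : ∀ z : ℂ, I * (z / (2 * I)) = z / 2 := fun z => by
    have := Complex.I_ne_zero
    field_simp
  refine PSpace.ext_modes (p := p) (q := q) (fun α => (toModes_ext _ α).1)
    (fun α => (toModes_ext _ α).2) (fun i => ?_) (fun i => ?_)
  · rw [(toModes_int _ i).1, key, mul_assoc, ← exp_add]
    have e : (log (w'.1 (ι i) / w.1 (ι i)) + log (w'.2 (ι i) / w.2 (ι i))) / 2 +
      I * (recoord p q θ w w').2.1 i = I * θ i + log (w'.1 (ι i) / w.1 (ι i)) := by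
      change _ + I * (θ i + _ / (2 * I)) = _
      rw [mul_add, hIinv]
      ring
    rw [e, exp_add, Complex.exp_log (ne_zero_of_near_one (h3 i)), ← mul_assoc, ← h1,
      mul_div_cancel₀ _ (hw1 i)]
  · rw [(toModes_int _ i).2, key, mul_assoc, ← exp_add]
    have e : (log (w'.1 (ι i) / w.1 (ι i)) + log (w'.2 (ι i) / w.2 (ι i))) / 2 +
      -(I * (recoord p q θ w w').2.1 i) = -(I * θ i) + log (w'.2 (ι i) / w.2 (ι i)) := by
      change _ + -(I * (θ i + _ / (2 * I))) = _
      rw [mul_add, hIinv]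
      ring
    rw [e, exp_add, Complex.exp_log (ne_zero_of_near_one (h4 i)), ← mul_assoc, ← h2,
      mul_div_cancel₀ _ (hw2 i)]

/-- A right inverse of the derivative of `toModes` is the derivative of `recoord`. -/
theorem surjective_toModes (hx : ∀ i, 0 < (x.1 i).re) :
    Function.Surjective (fderiv ℂ (toModes (p := p) (q := q) (s := s)) x) := by
  set w := toModes x with hw
  have hne : ∀ i, w.1 (ι i) ≠ 0 ∧ w.2 (ι i) ≠ 0 := fun i => by
    have h0 : x.1 i ≠ 0 := fun h => by simpa [h] using hx i
    rw [hw, (toModes_int x i).1, (toModes_int x i).2]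
    simp [Complex.cpow_eq_zero_iff, h0, Complex.exp_ne_zero]
  have e : ∀ i, w.1 (ι i) / w.1 (ι i) - 1 = 0 ∧ w.2 (ι i) / w.2 (ι i) - 1 = 0 := fun i => by
    rw [div_self (hne i).1, div_self (hne i).2, sub_self]; simp
  have hR := analyticAt_recoord (θ := fun _ => x.2.1) (w := fun _ => w) (w' := id)
    analyticAt_const analyticAt_const analyticAt_id (x := w) fun i =>
      ⟨by simp [(e i).1], by simp [(e i).2], hne i⟩
  have key := fun w' => toModes_recoord (w := w) (w' := w') x.2.1 x.1 hx
    (fun i => (toModes_int x i).1) (fun i => (toModes_int x i).2)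
  have hx' : recoord p q x.2.1 w w = x := by
    refine Prod.ext (funext fun i => ?_)
      (Prod.ext (funext fun i => ?_) (Prod.ext (pullE_toModes x).1 (pullE_toModes x).2))
    · rw [(key w (by simp [e]) (by simp [e])).2, div_self (hne i).1, div_self (hne i).2,
        one_mul, mul_one]
    · change x.2.1 i + (log _ - log _) / _ = _
      rw [div_self (hne i).1, div_self (hne i).2, sub_self, zero_div, add_zero]
  have near : ∀ᶠ w' in 𝓝 w, toModes (recoord p q x.2.1 w w') = w' := by
    have k : ∀ i, ∀ᶠ w' in 𝓝 w, ‖w'.1 (ι i) / w.1 (ι i) - 1‖ < 1 / 10 ∧ ‖w'.2 (ι i) / w.2 (ι i) - 1‖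
      < 1 / 10 := fun i => by
      have c := analyticAt_mode (analyticAt_id (𝕜 := ℂ) (z := w)) (ι i)
      have c1 := ((c.1.continuousAt.div_const (w.1 (ι i))).sub_const 1).norm
      have c2 := ((c.2.continuousAt.div_const (w.2 (ι i))).sub_const 1).norm
      exact (c1.eventually_lt_const (by simp [e])).and (c2.eventually_lt_const (by simp [e]))
    filter_upwards [eventually_all.2 k] with w' k
    exact (key w' (fun i => (k i).1.le) fun i => (k i).2.le).1
  have hT := (analyticAt_toModes fun i => Or.inl (hx i)).differentiableAt.hasFDerivAt
  rw [← hx'] at hT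
  have := (hT.comp w hR.differentiableAt.hasFDerivAt).unique
    ((hasFDerivAt_id w).congr_of_eventuallyEq near)
  rw [hx'] at this
  exact fun v => ⟨_, congrArg (fun L : Λ →L[ℂ] Λ => L v) this⟩

theorem surjective_psi (hρ : ρ ∈ paramC) (hx : x ∈ Ω) :
    Function.Surjective (fderiv ℂ (psi ρ) x) := by
  rw [fderiv_psi hρ hx]
  exact (surjective_toModes fun i => by
    rw [elim_act]; linarith [(act_bounds hρ hx i).1]).comp (surjective_elim x)

/-- The scale `ν` is so small that `√ν psi ρ x` lies in the domain of `τ` and is moved by `τ` by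
much less than its internal modes. -/
structure IsSmall (p q : ℤ) (τ : PSpace s → PSpace s) (ε ν : ℝ) : Prop where
  pos : 0 < ν
  mem_ball : ∀ ρ ∈ paramC, ∀ x ∈ domPhi p q s, Psi ν ρ x ∈ ball (0 : PSpace s) ε
  close : ∀ ρ ∈ paramC, ∀ x ∈ domPhi p q s, ‖τ (Psi ν ρ x) - Psi ν ρ x‖ ≤ √ν / 40

/-- The change of variables `Φ_ρ`, also for complex `ρ`. -/
def PhiC (ν : ℝ) (τ : Λ → Λ) (ρ : C2) (x : Ξ) : Ξ := recoord p q x.2.1 (Psi ν ρ x) (τ (Psi ν ρ x))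

theorem norm_mode_le (w : Λ) (α : Mode) : ‖w.1 α‖ ≤ ‖w‖ ∧ ‖w.2 α‖ ≤ ‖w‖ :=
  ⟨(WSeq.norm_apply_le (by linarith [hs.out]) (one_le_fullWeight α) w.1).trans (norm_fst_le w),
    (WSeq.norm_apply_le (by linarith [hs.out]) (one_le_fullWeight α) w.2).trans (norm_snd_le w)⟩

variable {τ : PSpace s → PSpace s} {ε C ν : ℝ}

theorem IsSmall.ratio (h : IsSmall p q τ ε ν) (hρ : ρ ∈ paramC) (hx : x ∈ Ω) (i : Fin 2) :
    ‖(τ (Psi ν ρ x)).1 (ι i) / (Psi ν ρ x).1 (ι i) - 1‖ ≤ 1 / 10 ∧ ‖(τ (Psi ν ρ x)).2 (ι i) /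
    (Psi ν ρ x).2 (ι i) - 1‖ ≤ 1 / 10 ∧ (Psi ν ρ x).1 (ι i) ≠ 0 ∧ (Psi ν ρ x).2 (ι i) ≠ 0 := by
  have hν : 0 < √ν := Real.sqrt_pos.2 h.pos
  have hc := h.close ρ hρ x hx
  have hb := psi_int_bounds hρ hx i
  have hn := norm_mode_le (τ (Psi ν ρ x) - Psi ν ρ x) (ι i)
  have key : ∀ a b c : ℂ, ‖a - (√ν : ℂ) * b‖ ≤ √ν / 40 → 1 / 4 ≤ ‖b‖ → c = (√ν : ℂ) * b → ‖a / c -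
    1‖ ≤ 1 / 10 ∧ c ≠ 0 := by
    intro a b c h1 h2 hc
    subst hc
    have h3 : (√ν : ℂ) * b ≠ 0 := by
      refine mul_ne_zero (by exact_mod_cast hν.ne') ?_
      rw [← norm_pos_iff]; linarith
    have h4 : ‖(√ν : ℂ) * b‖ = √ν * ‖b‖ := by
      rw [norm_mul, Complex.norm_real, Real.norm_of_nonneg hν.le]
    rw [div_sub_one h3, norm_div, h4, div_le_iff₀ (by nlinarith)]
    exact ⟨by nlinarith, h3⟩
  obtain ⟨k1, k2⟩ := key ((τ (Psi ν ρ x)).1 (ι i)) _ _ (hn.1.trans hc) hb.1.1 rfl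
  obtain ⟨k3, k4⟩ := key ((τ (Psi ν ρ x)).2 (ι i)) _ _ (hn.2.trans hc) hb.2.1 rfl
  exact ⟨k1, k3, k2, k4⟩

theorem ofReal_mul_cpow_half {ν : ℝ} (hν : 0 < ν) {z : ℂ} (hz : z ≠ 0) :
    ((ν : ℂ) * z) ^ ½ = (√ν : ℂ) * z ^ ½ := by
  have h0 : (ν : ℂ) ≠ 0 := by exact_mod_cast hν.ne'
  rw [Complex.cpow_def_of_ne_zero (mul_ne_zero h0 hz), Complex.log_ofReal_mul hν hz, add_mul,
    exp_add, ← Complex.cpow_def_of_ne_zero hz, Real.sqrt_eq_rpow,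
    Complex.ofReal_cpow hν.le, Complex.cpow_def_of_ne_zero h0, Complex.ofReal_log hν.le]
  push_cast
  rfl

theorem IsSmall.toModes_PhiC (h : IsSmall p q τ ε ν) (hρ : ρ ∈ paramC) (hx : x ∈ Ω) : toModes
    (PhiC ν τ ρ x) = τ (Psi ν ρ x) ∧ ∀ i, ‖(PhiC ν τ ρ x).1 i - ν * act ρ x i‖ ≤ ν * (21 / 40) := by
  have hr := h.ratio hρ hx
  have hA := act_bounds hρ hx
  have e := ofReal_mul_cpow_half h.pos (z := act ρ x 0)
  have key := toModes_recoord x.2.1 (w := Psi ν ρ x) (w' := τ (Psi ν ρ x))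
    (fun i => (ν : ℂ) * act ρ x i) (fun i => by
      rw [Complex.re_ofReal_mul]
      exact mul_pos h.pos (by linarith [(hA i).1]))
    (fun i => by
      rw [ofReal_mul_cpow_half h.pos (act_ne_zero hρ hx i), mul_assoc]
      exact congrArg ((√ν : ℂ) * ·) (psi_int ρ x i).1)
    (fun i => by
      rw [ofReal_mul_cpow_half h.pos (act_ne_zero hρ hx i), mul_assoc]
      exact congrArg ((√ν : ℂ) * ·) (psi_int ρ x i).2)
    (fun i => (hr i).1) (fun i => (hr i).2.1)
  refine ⟨key.1, fun i => ?_⟩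
  refine (congrArg norm (congrArg (· - (ν : ℂ) * act ρ x i) (key.2 i))).trans_le ?_
  rw [← mul_sub_one, norm_mul, norm_mul, Complex.norm_real, Real.norm_of_nonneg h.pos.le, mul_assoc]
  refine mul_le_mul_of_nonneg_left ?_ h.pos.le
  have :=
    mul_le_mul (hA i).2 (norm_mul_sub_one_le (hr i).1 (hr i).2.1) (norm_nonneg _) (by norm_num)
  linarith

theorem IsSmall.slitPlane (h : IsSmall p q τ ε ν) (hρ : ρ ∈ paramC) (hx : x ∈ Ω) (i : Fin 2) :
    (PhiC ν τ ρ x).1 i ∈ Complex.slitPlane := by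
  left
  have h1 := (abs_le.1 ((Complex.abs_re_le_norm _).trans ((h.toModes_PhiC hρ hx).2 i))).1
  have h2 := (act_bounds hρ hx i).1
  have h3 := h.pos
  rw [Complex.sub_re, Complex.re_ofReal_mul] at h1
  nlinarith

theorem IsSmall.analyticAt_PhiC (h : IsSmall p q τ ε ν) (hτ : AnalyticOnNhd ℂ τ (ball 0 ε))
    (hρ : ρ ∈ paramC) (hx : x ∈ Ω) : AnalyticAt ℂ (fun y : C2 × Ξ => PhiC ν τ y.1 y.2) (ρ, x) := by
  have hr := h.ratio hρ hx
  have h1 := analyticAt_const_smul (√ν : ℂ) (analyticAt_psi hρ hx)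
  have h0 : AnalyticAt ℂ τ (Psi ν ρ x) := hτ _ (h.mem_ball ρ hρ x hx)
  have h2 : AnalyticAt ℂ (fun y : C2 × Ξ => τ (Psi ν y.1 y.2)) (ρ, x) := h0.fun_comp_of_eq h1 rfl
  have t : AnalyticAt ℂ (fun y : C2 × Ξ => y.2.2.1) (ρ, x) :=
    (((fst ℂ C2 _).comp (snd ℂ C2 _)).comp (snd ℂ C2 Ξ)).analyticAt _
  exact analyticAt_recoord (θ := fun y : C2 × Ξ => y.2.2.1) (w := fun y : C2 × Ξ => Psi ν y.1 y.2)
    (w' := fun y : C2 × Ξ => τ (Psi ν y.1 y.2)) t h1 h2 hr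

theorem IsSmall.analyticAt_PhiC_right (h : IsSmall p q τ ε ν) (hτ : AnalyticOnNhd ℂ τ (ball 0 ε))
    (hρ : ρ ∈ paramC) (hx : x ∈ Ω) : AnalyticAt ℂ (PhiC ν τ ρ : Ξ → Ξ) x :=
    analyticAt_comp' (g := fun y : C2 × Ξ => PhiC ν τ y.1 y.2) (f := fun x => (ρ, x))
    (h.analyticAt_PhiC hτ hρ hx) (analyticAt_const.prod analyticAt_id)

/-- The derivative of `toModes ∘ Φ_ρ = τ ∘ (√ν psi ρ)`. -/
theorem IsSmall.fderiv_PhiC (h : IsSmall p q τ ε ν) (hτ : AnalyticOnNhd ℂ τ (ball 0 ε)) (hρ : ρ ∈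
    paramC) (hx : x ∈ Ω) (u : Ξ) : fderiv ℂ toModes (PhiC ν τ ρ x) (fderiv ℂ (PhiC ν τ ρ) x u) =
    fderiv ℂ τ (Psi ν ρ x) ((√ν : ℂ) • fderiv ℂ (psi ρ) x u) := by
  have d1 := (analyticAt_toModes (h.slitPlane hρ hx)).differentiableAt.hasFDerivAt
  have d2 := (h.analyticAt_PhiC_right hτ hρ hx).differentiableAt.hasFDerivAt
  have d3 := (hτ _ (h.mem_ball ρ hρ x hx)).differentiableAt.hasFDerivAt
  have d4 := (analyticAt_psi_right hρ hx).differentiableAt.hasFDerivAt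
  have d5 := HasFDerivAt.const_smul (f := fun x => psi ρ x) d4 (√ν : ℂ)
  refine congrArg (fun L : Ξ →L[ℂ] Λ => L u)
    ((d1.comp x d2).unique ((d3.comp x d5).congr_of_eventuallyEq ?_))
  filter_upwards [isOpen_domPhi.mem_nhds hx] with y hy
  exact (h.toModes_PhiC hρ hy).1

theorem omegaP_smul (a : ℂ) (u v : Λ) : omegaP (a • u) (a • v) = a * a * omegaP u v := by
  rw [omegaP_eq_dotM, omegaP_eq_dotM]
  simp only [Prod.smul_fst, Prod.smul_snd, map_smul, smul_apply, smul_eq_mul]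
  ring

theorem IsSmall.omegaCoord_fderiv_PhiC (h : IsSmall p q τ ε ν) (hB : IsBirkhoff s ε C τ)
    (hτ : AnalyticOnNhd ℂ τ (ball 0 ε)) (hρ : ρ ∈ paramC) (hx : x ∈ Ω) (u v : Ξ) :
    omegaCoord (fderiv ℂ (PhiC ν τ ρ) x u) (fderiv ℂ (PhiC ν τ ρ) x v) = ν * omegaCoord u v := by
  refine (omegaP_fderiv_toModes (h.slitPlane hρ hx) _ _).symm.trans ?_
  rw [h.fderiv_PhiC hτ hρ hx, h.fderiv_PhiC hτ hρ hx, hB.symplectic _ (h.mem_ball _ hρ x hx),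
    omegaP_smul, omegaP_fderiv_psi hρ hx, ← Complex.ofReal_mul, Real.mul_self_sqrt h.pos.le]

/-- `Φ_ρ` is injective because `Φ_ρ(x)` determines `psi ρ x`, which in turn determines `x` up to the
angles and the angular shift. Its derivative is injective because a nondegenerate form is pulled back
to a multiple of one. -/
theorem isSymplecticFamily (h : IsSmall p q τ ε ν) (hB : IsBirkhoff s ε C τ) (hτ : AnalyticOnNhd ℂ τ
    (ball 0 ε)) : IsSymplecticFamily ν (fun ρ x => (PhiC ν τ (cparam ρ) x : Ξ)) where
  mapsTo ρ hρ x hx := by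
    have hc := cparam_mem hρ
    have hν := h.pos
    have hr := h.ratio hc hx
    refine ⟨?_, fun i => ?_, ?_⟩
    · rw [one_pow, mul_one, pi_norm_lt_iff hν]
      intro i
      have h1 := (h.toModes_PhiC hc hx).2 i
      have h2 := norm_act_sub_le (cparam ρ) hx i
      have h3 : ‖(ν : ℂ) * act (cparam ρ) x i - ((ν * ρ i : ℝ) : ℂ)‖ ≤ ν * (1 / 5) := by
        rw [Complex.ofReal_mul, ← mul_sub, norm_mul, Complex.norm_real, Real.norm_of_nonneg hν.le]
        exact mul_le_mul_of_nonneg_left h2 hν.le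
      have h4 := norm_add_le ((PhiC ν τ (cparam ρ) x).1 i - ν * act (cparam ρ) x i)
        ((ν : ℂ) * act (cparam ρ) x i - ((ν * ρ i : ℝ) : ℂ))
      rw [sub_add_sub_cancel] at h4
      refine (h4.trans (add_le_add h1 h3)).trans_lt ?_
      nlinarith
    · have h1 := (domPhi_bounds hx).2.2.1 i
      have h2 := norm_log_le_of_near_one (hr i).1
      have h3 := norm_log_le_of_near_one (hr i).2.1
      have h4 := (norm_sub_le _ _).trans (add_le_add h2 h3)
      have h5 := Complex.abs_im_le_norm
        ((log ((τ (Psi ν (cparam ρ) x)).1 (ι i) / (Psi ν (cparam ρ) x).1 (ι i)) -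
        log ((τ (Psi ν (cparam ρ) x)).2 (ι i) / (Psi ν (cparam ρ) x).2 (ι i))) / (2 * I))
      rw [norm_div, norm_mul, Complex.norm_I, mul_one, Complex.norm_ofNat] at h5
      change |(x.2.1 i + _).im| < 1
      rw [Complex.add_im]
      refine (abs_add_le _ _).trans_lt ?_
      linarith
    · rw [mul_one]
      have hsq : 0 < √ν := Real.sqrt_pos.2 hν
      have h1 := h.close _ hc x hx
      have h2 := pullE_psi (cparam ρ) x
      have h3 := norm_hypRot_le hx
      have key : ∀ (a b : MSeq s), ‖(pullE b : 𝓩)‖ ≤ 1 / 2 → ‖a - (√ν : ℂ) • b‖ ≤ √ν / 40 →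
        ‖(pullE a : 𝓩)‖ ≤ √ν * (3 / 4) := by
        intro a b k1 k2
        have e : (pullE a : 𝓩) = pullE (a - (√ν : ℂ) • b) + (√ν : ℂ) • pullE b := by
          rw [map_sub, map_smul, sub_add_cancel]
        rw [e]
        refine (norm_add_le _ _).trans ?_
        rw [norm_smul, Complex.norm_real, Real.norm_of_nonneg hsq.le]
        have := (norm_pullE_le (p := p) (q := q) (a - (√ν : ℂ) • b)).trans k2
        nlinarith
      have k1 := key _ (psi (cparam ρ) x).1 (by rw [h2.1]; exact h3.1) ((norm_fst_le _).trans h1)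
      have k2 := key _ (psi (cparam ρ) x).2 (by rw [h2.2]; exact h3.2) ((norm_snd_le _).trans h1)
      exact (norm_prod_le_iff.2 ⟨k1, k2⟩).trans_lt (by linarith)
  equivariant ρ hρ x hx k := by
    change recoord p q (shiftAngle k x).2.1 (Psi ν _ (shiftAngle k x))
      (τ (Psi ν _ (shiftAngle k x))) = _
    rw [Psi, psi_shiftAngle]
    refine Prod.ext rfl (Prod.ext (funext fun i => ?_) rfl)
    exact add_right_comm _ _ _
  holo ρ hρ x hx :=
    (h.analyticAt_PhiC_right hτ (cparam_mem hρ) hx).differentiableAt.differentiableWithinAt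
  injOn ρ hρ x hx y hy hxy := by
    have hc := cparam_mem hρ
    have hsq : (√ν : ℂ) ≠ 0 := by exact_mod_cast (Real.sqrt_pos.2 h.pos).ne'
    have e1 : τ (Psi ν (cparam ρ) x) = τ (Psi ν (cparam ρ) y) :=
      (h.toModes_PhiC hc hx).1.symm.trans ((congrArg toModes hxy).trans (h.toModes_PhiC hc hy).1)
    have e2 := hB.injOn (h.mem_ball _ hc x hx) (h.mem_ball _ hc y hy) e1
    refine psi_inj hc hx hy (smul_right_injective _ hsq e2) (funext fun i => ?_)
    have e3 : (PhiC ν τ (cparam ρ) x).2.1 i = (PhiC ν τ (cparam ρ) y).2.1 i :=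
      congrArg (fun z : Ξ => z.2.1 i) hxy
    change x.2.1 i + _ = y.2.1 i + _ at e3
    rw [e2] at e3
    exact add_right_cancel e3
  invertible ρ hρ x hx := by
    have hc := cparam_mem hρ
    refine ⟨ContinuousLinearEquiv.ofBijective _ (LinearMap.ker_eq_bot'.2 fun u hu =>
      omegaCoord_nondegenerate fun v => ?_) (LinearMap.range_eq_top.2 fun v => ?_),
      ContinuousLinearEquiv.coe_ofBijective _ _ _⟩
    · have e := h.omegaCoord_fderiv_PhiC hB hτ hc hx u v
      have hu' : fderiv ℂ (PhiC ν τ (cparam ρ)) x u = 0 := hu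
      rw [hu', omegaCoord_eq] at e
      have hν : (ν : ℂ) ≠ 0 := by exact_mod_cast h.pos.ne'
      simpa [hν] using e.symm
    · obtain ⟨E, hE⟩ := hB.invertible _ (h.mem_ball _ hc x hx)
      have hsq : (√ν : ℂ) ≠ 0 := by exact_mod_cast (Real.sqrt_pos.2 h.pos).ne'
      obtain ⟨u, hu⟩ := surjective_psi hc hx ((√ν : ℂ)⁻¹ • E.symm (fderiv ℂ toModes _ v))
      refine ⟨u, injective_toModes (h.slitPlane hc hx) ((h.fderiv_PhiC hτ hc hx u).trans ?_)⟩
      rw [hu, smul_inv_smul₀ hsq, ← hE]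
      exact E.apply_symm_apply _
  real ρ hρ x hx hr := by
    have hc := cparam_mem hρ
    have hrat := h.ratio hc hx
    have h1 := psi_real hρ hx hr
    have h2 : IsRealPoint (Psi ν (cparam ρ) x) := fun α => by
      change (√ν : ℂ) * (psi (cparam ρ) x).2 α = conj ((√ν : ℂ) * _)
      rw [map_mul, Complex.conj_ofReal, h1 α]
    have h3 := hB.real _ (h.mem_ball _ hc x hx) h2
    have hreal : ∀ t : ℝ, ((t : ℂ) * I / (2 * I)).im = 0 := fun t => by
      rw [mul_div_mul_right _ _ Complex.I_ne_zero, show (t : ℂ) / 2 = ((t / 2 : ℝ) : ℂ) by push_cast; rfl,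
        Complex.ofReal_im]
    refine ⟨fun i => ?_, fun i => ?_, fun α => h3 α.1⟩
    · change (_ * (τ (Psi ν (cparam ρ) x)).2 (ι i)).im = 0
      rw [h3, Complex.mul_conj, Complex.ofReal_im]
    · change (x.2.1 i + (log _ -
        log ((τ (Psi ν (cparam ρ) x)).2 (ι i) / (Psi ν (cparam ρ) x).2 (ι i))) / (2 * I)).im = 0
      rw [h3, h2, ← map_div₀, Complex.log_conj _ (Complex.mem_slitPlane_iff_arg.1
        (slitPlane_of_near_one (hrat i).1)).1, Complex.sub_conj, Complex.add_im, hr.2.1 i, zero_add]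
      exact hreal _
  analytic := by
    rintro ⟨ρ, x⟩ ⟨hρ, hx⟩
    have h1 := (h.analyticAt_PhiC hτ (cparam_mem hρ) hx).restrictScalars (𝕜 := ℝ)
    have h2 : AnalyticAt ℝ (fun y : (Fin 2 → ℝ) × Ξ => (cparam y.1, y.2)) (ρ, x) :=
      ((cparam.comp (fst ℝ _ _)).prod (snd ℝ (Fin 2 → ℝ) Ξ)).analyticAt _
    exact AnalyticAt.comp (f := fun y : (Fin 2 → ℝ) × Ξ => (cparam y.1, y.2))
      (g := fun y : C2 × Ξ => PhiC ν τ y.1 y.2) h1 h2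
  symplectic ρ hρ x hx := h.omegaCoord_fderiv_PhiC hB hτ (cparam_mem hρ) hx

theorem norm_PhiC_sub_le (hν : 0 < ν) (ρ : Fin 2 → ℝ) (x : Ξ) : ‖(PhiC ν τ (cparam ρ) x).2.2 -
    (angleElim (rescale ν x)).2.2‖ ≤ ‖τ (Psi ν (cparam ρ) x) - Psi ν (cparam ρ) x‖ := by
  have e := pullE_psi (cparam ρ) x
  have e1 : (angleElim (rescale ν x)).2.2 =
    (pullE (Psi ν (cparam ρ) x).1, pullE (Psi ν (cparam ρ) x).2) := by
    rw [Psi, angleElim_rescale hν, Prod.smul_fst, Prod.smul_snd, map_smul, map_smul, e.1, e.2]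
    rfl
  rw [e1]
  set w := Psi ν (cparam ρ) x with hw
  have e2 : (PhiC ν τ (cparam ρ) x).2.2 - (pullE w.1, pullE w.2) =
    ((pullE (τ w - w).1, pullE (τ w - w).2) : 𝓩 × 𝓩) := by
    rw [Prod.fst_sub, Prod.snd_sub, map_sub, map_sub]
    rfl
  rw [e2]
  exact norm_prod_le_iff.2 ⟨(norm_pullE_le _).trans (norm_fst_le _),
    (norm_pullE_le _).trans (norm_snd_le _)⟩

end

section

variable {p q : ℤ} [hpq : Fact (p ≠ q)] {s : ℝ} [hs : Fact (1 / 2 < s)] {ρ : C2}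
  {x : Coord p q s}

local notation "Λ" => PSpace s
local notation "𝓩" => ZSpace p q s
local notation "Ξ" => Coord p q s
local notation "Ω" => domPhi p q s
local notation "½" => (1 / 2 : ℂ)
local notation "ι" => intM p q
local notation "η" => hyp p q

/-! ### Functions with bounded gradients belong to the class `𝒯` -/

/-- The inclusion `z ↦ (0, 0, z)`. -/
def inZ (p q : ℤ) (s : ℝ) : ZSpace p q s × ZSpace p q s →L[ℂ] Coord p q s :=
  (inr ℂ C2 _).comp (inr ℂ C2 _)

theorem norm_inZ (z : 𝓩 × 𝓩) : ‖((0, 0, z) : Ξ)‖ = ‖z‖ := by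
  simp [Prod.norm_def]

theorem Ell.toExt_injective : Function.Injective (Ell.toExt : Ell p q → Ext p q) := fun _ _ h =>
  Subtype.ext (congrArg (fun γ : Ext p q => γ.1) h)

theorem extWeight_toExt (α : Ell p q) : (extWeight p q).val α.toExt = (ellWeight p q).val α :=
  if_pos α.2

/-- Restriction to the elliptic modes. -/
def pullL (p q : ℤ) [Fact (p ≠ q)] (s : ℝ) : ZSpace p q s →L[ℂ] YSpace p q s :=
    WSeq.pull (extWeight p q) (ellWeight p q) s Ell.toExt ⟨Ell.toExt_injective, 1, zero_le_one,
    fun α => by rw [extWeight_toExt, one_mul]⟩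

/-- Extension by zero to the hyperbolic modes. -/
def pushL (p q : ℤ) [Fact (p ≠ q)] (s : ℝ) : YSpace p q s →L[ℂ] ZSpace p q s :=
    WSeq.push (ellWeight p q) (extWeight p q) s Ell.toExt ⟨Ell.toExt_injective, 1, zero_le_one,
    fun α => by rw [extWeight_toExt, one_mul]⟩

theorem pushL_single (α : Ell p q) : pushL p q s (single α) = single α.toExt := WSeq.push_single α

theorem norm_pullL_le (x : 𝓩) : ‖pullL p q s x‖ ≤ ‖x‖ :=
  (WSeq.norm_pull_le zero_le_one (fun α => by rw [extWeight_toExt, one_mul]) x).trans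
    (one_mul _).le

theorem norm_pushL_le (x : YSpace p q s) : ‖pushL p q s x‖ ≤ ‖x‖ :=
  (WSeq.norm_push_le zero_le_one (fun α => by rw [extWeight_toExt, one_mul]) x).trans
    (one_mul _).le

theorem analyticAt_partial_fderiv {P E V : Type*} [NormedAddCommGroup P] [NormedSpace ℂ P]
    [NormedAddCommGroup E] [NormedSpace ℂ E] [NormedAddCommGroup V] [NormedSpace ℂ V] [CompleteSpace
    V] {f : P → E → V} {ρ : P} {x : E} (h : AnalyticAt ℂ (fun y : P × E => f y.1 y.2) (ρ, x)) :
    AnalyticAt ℂ (fun y : P × E => fderiv ℂ (f y.1) y.2) (ρ, x) := by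
  have h1 : AnalyticAt ℂ (fun y : P × E => (fderiv ℂ (fun y : P × E => f y.1 y.2) y).comp (inr ℂ P
    E)) (ρ, x) := ((compL ℂ E (P × E) V).flip (inr ℂ P E)).analyticAt _ |>.comp h.fderiv
  refine h1.congr ?_
  filter_upwards [h.eventually_analyticAt] with y hy
  have h2 : HasFDerivAt (fun z : E => (y.1, z)) (inr ℂ P E) y.2 := hasFDerivAt_prodMk_right y.1 y.2
  have h3 : HasFDerivAt (fun y : P × E => f y.1 y.2) (fderiv ℂ (fun y : P × E => f y.1 y.2) y)
    (y.1, y.2) := hy.differentiableAt.hasFDerivAt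
  exact (HasFDerivAt.comp (g := fun y : P × E => f y.1 y.2) (f := fun z : E => (y.1, z)) y.2
    h3 h2).fderiv.symm

theorem analyticAt_right {P E V : Type*} [NormedAddCommGroup P] [NormedSpace ℂ P]
    [NormedAddCommGroup E] [NormedSpace ℂ E] [NormedAddCommGroup V] [NormedSpace ℂ V]
    {f : P → E → V} {ρ : P} {x : E} (h : AnalyticAt ℂ (fun y : P × E => f y.1 y.2) (ρ, x)) :
    AnalyticAt ℂ (f ρ) x := AnalyticAt.fun_comp_of_eq (g := fun y :
    P × E => f y.1 y.2) (f := fun x => (ρ, x)) h (analyticAt_const.prod analyticAt_id) rfl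

theorem analyticAt_left {P E V : Type*} [NormedAddCommGroup P] [NormedSpace ℂ P]
    [NormedAddCommGroup E] [NormedSpace ℂ E] [NormedAddCommGroup V] [NormedSpace ℂ V]
    {f : P → E → V} {ρ : P} {x : E} (h : AnalyticAt ℂ (fun y : P × E => f y.1 y.2) (ρ, x)) :
    AnalyticAt ℂ (fun ρ => f ρ x) ρ := AnalyticAt.fun_comp_of_eq (g := fun y :
    P × E => f y.1 y.2) (f := fun ρ => (ρ, x)) h (analyticAt_id.prod analyticAt_const) rfl

/-- A function `F` of the complex parameter `ρ` and of `x`, analytic and bounded by `B` together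
with the elliptic part of its gradient in `z`, which is given by `Γ`; real for real data, periodic in
the angles, and invariant under the rotations `rotC`. -/
structure IsGood (F : C2 → Ξ → ℂ)
    (Γ : C2 → Ξ → 𝓩 × 𝓩) (B : ℝ) : Prop where
  analytic : ∀ ρ ∈ paramC, ∀ x ∈ Ω, AnalyticAt ℂ (fun y : C2 × Ξ => F y.1 y.2) (ρ, x)
  norm_le : ∀ ρ ∈ paramC, ∀ x ∈ Ω, ‖F ρ x‖ ≤ B
  analytic_grad : ∀ ρ ∈ paramC, ∀ x ∈ Ω, AnalyticAt ℂ (fun y : C2 × Ξ => Γ y.1 y.2) (ρ, x)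
  norm_grad_le : ∀ ρ ∈ paramC, ∀ x ∈ Ω, ‖Γ ρ x‖ ≤ B
  grad_fst : ∀ ρ ∈ paramC, ∀ x ∈ Ω, ∀ α : Ell p q,
    (Γ ρ x).1 α.toExt = fderiv ℂ (F ρ) x (eZeta α.toExt)
  grad_snd : ∀ ρ ∈ paramC, ∀ x ∈ Ω, ∀ α : Ell p q,
    (Γ ρ x).2 α.toExt = fderiv ℂ (F ρ) x (eZetaBar α.toExt)
  periodic : ∀ ρ ∈ paramC, ∀ x ∈ Ω, ∀ k, F ρ (shiftAngle k x) = F ρ x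
  real : ∀ ρ ∈ paramD, ∀ x ∈ Ω, IsRealCoord x → (F (cparam ρ) x).im = 0
  rot : ∀ ρ ∈ paramC, ∀ x ∈ Ω, ∀ φ ψ, F ρ (rotC φ ψ x) = F ρ x

/-- The points at a distance of at least `1/40` from the boundary of the domain. -/
def domInner (p q : ℤ) (s : ℝ) : Set (Coord p q s) := {x | ball x (1 / 40) ⊆ domPhi p q s}

theorem domInner_subset : domInner p q s ⊆ Ω := fun _ hx =>
  hx (Metric.mem_ball_self (by norm_num))

theorem domO_subset_domInner {σ μ : ℝ} (hσ : σ ≤ 1 / 4) (hμ : 0 < μ)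
    (hμ' : μ ≤ Real.exp (-(1 / 2)) / 4) : domO p q s σ μ ⊆ domInner p q s := by
  intro x hx y hy
  obtain ⟨h1, h2, h3⟩ := hx
  rw [mem_ball_iff_norm] at hy
  have e := exp_bounds.2.2.2.2
  have hm : μ ^ 2 ≤ (Real.exp (-(1 / 2)) / 4) ^ 2 := pow_le_pow_left₀ hμ.le hμ' 2
  refine ⟨?_, fun i => ?_, ?_⟩
  · have k1 := (norm_fst_le (y - x)).trans_lt hy
    have k2 := norm_add_le x.1 (y - x).1
    rw [Prod.fst_sub, add_sub_cancel] at k2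
    rw [Prod.fst_sub] at k1
    nlinarith
  · have k1 := ((norm_fst_le (y - x).2).trans (norm_snd_le (y - x))).trans_lt hy
    have k2 := (Complex.abs_im_le_norm _).trans ((norm_le_pi_norm (y - x).2.1 i).trans k1.le)
    have k3 : (y - x).2.1 i = y.2.1 i - x.2.1 i := rfl
    rw [k3, Complex.sub_im] at k2
    have := abs_lt.1 (h2 i)
    have := abs_le.1 k2
    rw [abs_lt]
    constructor <;> linarith
  · have k1 := ((norm_snd_le (y - x).2).trans (norm_snd_le (y - x))).trans_lt hy
    have k2 := norm_add_le x.2.2 (y - x).2.2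
    rw [Prod.snd_sub, Prod.snd_sub, add_sub_cancel] at k2
    rw [Prod.snd_sub, Prod.snd_sub] at k1
    linarith

/-- Cauchy's estimate for the derivative with respect to a real parameter in the closed square. -/
theorem param_deriv {V : Type*} [NormedAddCommGroup V] [NormedSpace ℂ V] [CompleteSpace V]
    {K : C2 → V} {B : ℝ} (hK : ∀ ρ ∈ paramC, AnalyticAt ℂ K ρ) (hB : ∀ ρ ∈ paramC, ‖K ρ‖ ≤ B) :
    ContDiffOn ℝ 1 (fun ρ => K (cparam ρ)) paramD ∧ ∀ ρ ∈ paramD,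
    ‖fderivWithin ℝ (fun ρ => K (cparam ρ)) paramD ρ‖ ≤ 20 * B := by
  constructor
  · intro ρ hρ
    have h1 := ((hK _ (cparam_mem hρ)).restrictScalars (𝕜 := ℝ)).fun_comp_of_eq
      (f := fun ρ => cparam ρ) (x := ρ) (cparam.analyticAt ρ) rfl
    exact h1.contDiffAt.contDiffWithinAt
  · intro ρ hρ
    have hB0 : 0 ≤ B := (norm_nonneg _).trans (hB _ (cparam_mem hρ))
    have h1 := (hK _ (cparam_mem hρ)).differentiableAt.hasFDerivAt
    have h2 := (h1.restrictScalars ℝ).comp ρ cparam.hasFDerivAt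
    have hu : UniqueDiffWithinAt ℝ paramD ρ := by
      have : UniqueDiffOn ℝ paramD := by
        refine uniqueDiffOn_convex (convex_Icc 1 2) ?_
        have : (fun _ => 3 / 2 : Fin 2 → ℝ) ∈ interior paramD := by
          refine mem_interior.2 ⟨Set.pi univ fun _ => Ioo 1 2, fun x hx => ?_,
            isOpen_set_pi finite_univ fun _ _ => isOpen_Ioo, fun i _ => by norm_num⟩
          exact ⟨fun i => (hx i (mem_univ i)).1.le, fun i => (hx i (mem_univ i)).2.le⟩
        exact ⟨_, this⟩
      exact this ρ hρ
    have h3 : fderivWithin ℝ (fun ρ => K (cparam ρ)) paramD ρ = _ :=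
      h2.hasFDerivWithinAt.fderivWithin hu
    rw [h3]
    refine ContinuousLinearMap.opNorm_le_bound _ (by positivity) fun v => ?_
    have h4 := norm_fderiv_le_of_bound (f := K) (x := cparam ρ) (r := 1 / 10) (B := B) (by norm_num)
      (fun ρ' h' => (hK ρ' ⟨ρ, hρ, mem_ball_iff_norm.1 h'⟩).differentiableAt.differentiableWithinAt)
      (fun ρ' h' => hB ρ' ⟨ρ, hρ, mem_ball_iff_norm.1 h'⟩)
    have h5 : ‖cparam v‖ ≤ ‖v‖ := (pi_norm_le_iff_of_nonneg (norm_nonneg _)).2 fun i => by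
      rw [cparam_apply, Complex.norm_real]
      exact norm_le_pi_norm v i
    change ‖fderiv ℂ K (cparam ρ) (cparam v)‖ ≤ _
    refine ((fderiv ℂ K (cparam ρ)).le_opNorm _).trans ?_
    have h6 : 2 * B / (1 / 10) = 20 * B := by ring
    rw [h6] at h4
    exact mul_le_mul h4 h5 (norm_nonneg _) (by positivity)

namespace IsGood

variable {F : C2 → Coord p q s → ℂ}
  {Γ : C2 → Coord p q s → ZSpace p q s × ZSpace p q s} {B : ℝ}

theorem norm_fderiv_le {V : Type*} [NormedAddCommGroup V] [NormedSpace ℂ V] {K : Ξ → V}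
    {B : ℝ} (hK : ∀ x ∈ Ω, AnalyticAt ℂ K x) (hB : ∀ x ∈ Ω, ‖K x‖ ≤ B)
    (hx : x ∈ domInner p q s) : ‖fderiv ℂ K x‖ ≤ 80 * B := by
  have := norm_fderiv_le_of_bound (f := K) (x := x) (r := 1 / 40) (B := B) (by norm_num)
    (fun y hy => (hK y (hx hy)).differentiableAt.differentiableWithinAt) fun y hy => hB y (hx hy)
  linarith

/-- The gradient: the elliptic part is given by `Γ`, and the hyperbolic part by the derivatives. -/
def gradFull (F : C2 → Ξ → ℂ) (Γ : C2 → Ξ → 𝓩 × 𝓩) (ρ : C2) (x : Ξ) :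
    𝓩 × 𝓩 := ((Γ ρ x).1 + (fderiv ℂ (F ρ) x (eZeta (η 0)) - (Γ ρ x).1 (η 0)) • single (η 0) +
    (fderiv ℂ (F ρ) x (eZeta (η 1)) - (Γ ρ x).1 (η 1)) • single (η 1),
    (Γ ρ x).2 + (fderiv ℂ (F ρ) x (eZetaBar (η 0)) - (Γ ρ x).2 (η 0)) • single (η 0) +
    (fderiv ℂ (F ρ) x (eZetaBar (η 1)) - (Γ ρ x).2 (η 1)) • single (η 1))

theorem correct_apply (y : 𝓩) (d : Ext p q → ℂ) (h : ∀ α : Ell p q, y α.toExt = d α.toExt)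
    (α : Ext p q) :
    (y + (d (η 0) - y (η 0)) • single (η 0) + (d (η 1) - y (η 1)) • single (η 1) : 𝓩) α = d α := by
  rw [WSeq.add_apply, WSeq.add_apply, WSeq.smul_apply, WSeq.smul_apply]
  rcases ell_or_hyp α with ⟨β, rfl⟩ | rfl | rfl
  · rw [h, single_of_ne (toExt_ne_hyp β 0), single_of_ne (toExt_ne_hyp β 1)]
    ring
  · rw [single_same, single_of_ne (hyp_one_ne).symm]
    ring
  · rw [single_same, single_of_ne (hyp_one_ne)]
    ring

theorem gradFull_apply (h : IsGood F Γ B) (hρ : ρ ∈ paramC) (hx : x ∈ Ω) (α : Ext p q) :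
    (gradFull F Γ ρ x).1 α = dZeta (F ρ) x α ∧ (gradFull F Γ ρ x).2 α = dZetaBar (F ρ) x α :=
    ⟨correct_apply (Γ ρ x).1 (dZeta (F ρ) x) (h.grad_fst ρ hρ x hx) α,
    correct_apply (Γ ρ x).2 (dZetaBar (F ρ) x) (h.grad_snd ρ hρ x hx) α⟩

theorem hasGradZ (h : IsGood F Γ B) (hρ : ρ ∈ paramC) (hx : x ∈ Ω) :
    HasGradZ (F ρ) x ∧ gradZ (F ρ) x = gradFull F Γ ρ x := by
  have h1 : dZeta (F ρ) x = (gradFull F Γ ρ x).1.1 :=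
    funext fun α => (h.gradFull_apply hρ hx α).1.symm
  have h2 : dZetaBar (F ρ) x = (gradFull F Γ ρ x).2.1 :=
    funext fun α => (h.gradFull_apply hρ hx α).2.symm
  exact ⟨⟨h1 ▸ (gradFull F Γ ρ x).1.2, h2 ▸ (gradFull F Γ ρ x).2.2⟩,
    Prod.ext (WSeq.ofFun_of_eq fun α => congrFun h1 α) (WSeq.ofFun_of_eq fun α => congrFun h2 α)⟩

theorem analyticAt_gradFull (h : IsGood F Γ B) (hρ : ρ ∈ paramC) (hx : x ∈ Ω) :
    AnalyticAt ℂ (fun y : C2 × Ξ => gradFull F Γ y.1 y.2) (ρ, x) := by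
  have hD := analyticAt_partial_fderiv (h.analytic ρ hρ x hx)
  have hv : ∀ v, AnalyticAt ℂ (fun y : C2 × Ξ => fderiv ℂ (F y.1) y.2 v) (ρ, x) := fun v =>
    analyticAt_clm_apply (f := fun y : C2 × Ξ => fderiv ℂ (F y.1) y.2) (g := fun _ => v) hD
    analyticAt_const
  have hG := h.analytic_grad ρ hρ x hx
  have h1 : AnalyticAt ℂ (fun y : C2 × Ξ => (Γ y.1 y.2).1) (ρ, x) :=
    ((fst ℂ 𝓩 𝓩).analyticAt _).comp hG
  have h2 : AnalyticAt ℂ (fun y : C2 × Ξ => (Γ y.1 y.2).2) (ρ, x) :=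
    ((snd ℂ 𝓩 𝓩).analyticAt _).comp hG
  have c1 : ∀ α, AnalyticAt ℂ (fun y : C2 × Ξ => (Γ y.1 y.2).1 α) (ρ, x) :=
    fun α => ((coord (extWeight p q) s α).analyticAt _).comp h1
  have c2 : ∀ α, AnalyticAt ℂ (fun y : C2 × Ξ => (Γ y.1 y.2).2 α) (ρ, x) :=
    fun α => ((coord (extWeight p q) s α).analyticAt _).comp h2
  exact ((h1.add (((hv _).sub (c1 _)).smul analyticAt_const)).add (((hv _).sub (c1 _)).smul
    analyticAt_const)).prod ((h2.add (((hv _).sub (c2 _)).smul analyticAt_const)).add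
    (((hv _).sub (c2 _)).smul analyticAt_const))

theorem norm_gradFull_le (h : IsGood F Γ B) (hρ : ρ ∈ paramC)
    (hx : x ∈ domInner p q s) : ‖gradFull F Γ ρ x‖ ≤ 163 * B := by
  have hx' := domInner_subset hx
  have hG := h.norm_grad_le ρ hρ x hx'
  have hD := norm_fderiv_le (fun y hy => analyticAt_right (h.analytic ρ hρ y hy)) (h.norm_le ρ hρ) hx
  have key : ∀ (y : 𝓩) (d : Ext p q → ℂ), ‖y‖ ≤ B → (∀ i, ‖d (η i)‖ ≤ 80 * B) →
    ‖y + (d (η 0) - y (η 0)) • single (η 0) + (d (η 1) - y (η 1)) • single (η 1)‖ ≤ 163 * B := by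
    intro y d hy hd
    have k : ∀ i, ‖(d (η i) - y (η i)) • (single (η i) : 𝓩)‖ ≤ 81 * B := fun i => by
      rw [norm_smul, norm_single_hyp, mul_one]
      have := (ZSpace.norm_apply_le y (η i)).trans hy
      have := norm_sub_le (d (η i)) (y (η i))
      linarith [hd i]
    refine norm_add₃_le.trans ?_
    linarith [k 0, k 1]
  have hn : ∀ z : 𝓩 × 𝓩, ‖z‖ ≤ 1 → ‖fderiv ℂ (F ρ) x (0, 0, z)‖ ≤ 80 * B := fun z hz => by
    refine ((fderiv ℂ (F ρ) x).le_opNorm _).trans ?_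
    rw [norm_inZ]
    have := norm_nonneg (fderiv ℂ (F ρ) x)
    nlinarith
  refine norm_prod_le_iff.2 ⟨key _ (dZeta (F ρ) x) ((norm_fst_le _).trans hG) fun i => hn _ ?_,
    key _ (dZetaBar (F ρ) x) ((norm_snd_le _).trans hG) fun i => hn _ ?_⟩
  · exact norm_prod_le_iff.2 ⟨(norm_single_hyp i).le, norm_zero.trans_le zero_le_one⟩
  · exact norm_prod_le_iff.2 ⟨norm_zero.trans_le zero_le_one, (norm_single_hyp i).le⟩

/-- The operator `∇²_{ζ_ℒ ζ̄_ℒ} F`, obtained from the derivative of the gradient. -/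
def hessOp (Γ : C2 → Ξ → 𝓩 × 𝓩) (ρ : C2) (x : Ξ) :
    YSpace p q s →L[ℂ] YSpace p q s := ((pullL p q s).comp (fst ℂ _ _)).comp
    ((fderiv ℂ (Γ ρ) x).comp ((inZ p q s).comp ((inr ℂ _ _).comp (pushL p q s))))

theorem hessEntry_eq (h : IsGood F Γ B) (hρ : ρ ∈ paramC) (hx : x ∈ Ω) (α β : Ell p q) :
    hessEntry (F ρ) x α β = fderiv ℂ (fderiv ℂ (F ρ)) x (eZeta α.toExt) (eZetaBar β.toExt) := by
  have h1 := (analyticAt_right (h.analytic ρ hρ x hx)).fderiv.differentiableAt.hasFDerivAt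
  have h2 := h1.clm_apply (hasFDerivAt_const (eZetaBar β.toExt) x)
  refine (congrArg (fun L : Ξ →L[ℂ] ℂ => L (eZeta α.toExt)) h2.fderiv).trans ?_
  simp

theorem fderiv_symm (h : IsGood F Γ B) (hρ : ρ ∈ paramC) (hx : x ∈ Ω) (u v : Ξ) :
    fderiv ℂ (fderiv ℂ (F ρ)) x u v = fderiv ℂ (fderiv ℂ (F ρ)) x v u :=
  ((analyticAt_right (h.analytic ρ hρ x hx)).contDiffAt.isSymmSndFDerivAt (n := ⊤) (by simp)).eq u v

theorem hasHess (h : IsGood F Γ B) (hρ : ρ ∈ paramC)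
    (hx : x ∈ Ω) : HasHess (F ρ) x ∧ hess (F ρ) x = hessOp Γ ρ x := by
  have hM : IsMatrixOp (hessEntry (F ρ) x) (hessOp Γ ρ x) := by
    intro y α
    have h0 := ((coord (ellWeight p q) s α).comp (hessOp Γ ρ x)).hasSum (WSeq.hasSum_single y)
    refine h0.congr_fun fun β => ?_
    rw [map_smul, smul_eq_mul, mul_comm]
    congr 1
    have e1 : hessOp Γ ρ x (single β) = pullL p q s (fderiv ℂ (Γ ρ) x (eZetaBar β.toExt)).1 := by
      change pullL p q s (fderiv ℂ (Γ ρ) x (inZ p q s (0, pushL p q s (single β)))).1 = _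
      rw [pushL_single]
      rfl
    have hG := (analyticAt_right (h.analytic_grad ρ hρ x hx)).differentiableAt.hasFDerivAt
    have hG' := ((coord (extWeight p q) s α.toExt).comp (fst ℂ 𝓩 𝓩)).hasFDerivAt.comp x hG
    have h1 := (analyticAt_right (h.analytic ρ hρ x hx)).fderiv.differentiableAt.hasFDerivAt
    have h2 := h1.clm_apply (hasFDerivAt_const (eZeta α.toExt) x)
    have h3 := hG'.unique (h2.congr_of_eventuallyEq (by
      filter_upwards [isOpen_domPhi.mem_nhds hx] with y hy
      exact h.grad_fst ρ hρ y hy α))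
    have h4 := congrArg (fun L : Ξ →L[ℂ] ℂ => L (eZetaBar β.toExt)) h3
    rw [h.hessEntry_eq hρ hx]
    rw [h.fderiv_symm hρ hx]
    refine Eq.trans ?_ (Eq.trans h4.symm ?_)
    · simp
    · change _ = (hessOp Γ ρ x (single β)) α
      rw [e1]
      rfl
  have hH : HasHess (F ρ) x := ⟨_, hM⟩
  refine ⟨hH, ?_⟩
  rw [hess, dif_pos hH]
  exact ContinuousLinearMap.ext fun y => WSeq.ext fun α => (hH.choose_spec y α).unique (hM y α)

theorem analyticAt_hessOp (h : IsGood F Γ B) (hρ : ρ ∈ paramC) (hx : x ∈ Ω) :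
    AnalyticAt ℂ (fun y : C2 × Ξ => hessOp Γ y.1 y.2) (ρ, x) := by
  have hD := analyticAt_partial_fderiv (h.analytic_grad ρ hρ x hx)
  have h1 := (((compL ℂ (YSpace p q s) Ξ (𝓩 × 𝓩)).flip
    ((inZ p q s).comp ((inr ℂ _ _).comp (pushL p q s)))).analyticAt _).comp hD
  exact ((compL ℂ (YSpace p q s) (𝓩 × 𝓩)
    (YSpace p q s) ((pullL p q s).comp (fst ℂ _ _))).analyticAt _).comp h1

theorem norm_hessOp_le (h : IsGood F Γ B) (hρ : ρ ∈ paramC)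
    (hx : x ∈ domInner p q s) : ‖hessOp Γ ρ x‖ ≤ 163 * B := by
  have hB : 0 ≤ B := (norm_nonneg _).trans (h.norm_le ρ hρ x (domInner_subset hx))
  have hD := norm_fderiv_le (fun y hy => analyticAt_right (h.analytic_grad ρ hρ y hy))
    (h.norm_grad_le ρ hρ) hx
  refine ContinuousLinearMap.opNorm_le_bound _ (by positivity) fun y => ?_
  have e : hessOp Γ ρ x y = pullL p q s (fderiv ℂ (Γ ρ) x (0, 0, (0, pushL p q s y))).1 := rfl
  rw [e]
  refine ((norm_pullL_le _).trans (norm_fst_le _)).trans (((fderiv ℂ (Γ ρ) x).le_opNorm _).trans ?_)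
  rw [norm_inZ]
  have h1 : ‖((0, pushL p q s y) : 𝓩 × 𝓩)‖ ≤ ‖y‖ :=
    norm_prod_le_iff.2 ⟨norm_zero.trans_le (norm_nonneg _), norm_pushL_le y⟩
  exact mul_le_mul (hD.trans (by linarith)) h1 (norm_nonneg _) (by positivity)

/-- A good function belongs to the class `𝒯` on the smaller domains. -/
theorem memT (h : IsGood F Γ B) {σ μ : ℝ} (hσ : σ ≤ 1 / 4) (hμ : 0 < μ)
    (hμ' : μ ≤ Real.exp (-(1 / 2)) / 4) : MemT (s := s) σ μ (fun ρ => F (cparam ρ)) := by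
  have hsub : domO p q s σ μ ⊆ Ω := (domO_subset_domInner hσ hμ hμ').trans domInner_subset
  have hO : IsOpen (domO p q s σ μ) := isOpen_domO σ μ
  refine ⟨fun ρ hρ x hx k => h.periodic _ (cparam_mem hρ) x (hsub hx) k, ?_, fun ρ hρ x hx => ?_,
    fun ρ hρ x hx => h.real ρ hρ x (hsub hx), fun ρ hρ x hx => ?_, fun ρ hρ x hx => ?_,
    fun x hx ρ hρ => ?_, fun ρ hρ x hx => ?_, fun ρ hρ x hx => ?_, fun x hx ρ hρ => ?_⟩
  · rintro ⟨ρ, x⟩ ⟨hρ, hx⟩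
    have h1 := (h.analytic _ (cparam_mem hρ) x (hsub hx)).restrictScalars (𝕜 := ℝ)
    have h2 : AnalyticAt ℝ (fun y : (Fin 2 → ℝ) × Ξ => (cparam y.1, y.2)) (ρ, x) :=
      ((cparam.comp (fst ℝ _ _)).prod (snd ℝ (Fin 2 → ℝ) Ξ)).analyticAt _
    exact (AnalyticAt.comp (f := fun y : (Fin 2 → ℝ) × Ξ => (cparam y.1, y.2))
      (g := fun y : C2 × Ξ => F y.1 y.2) h1 h2).contDiffAt.contDiffWithinAt
  · exact (analyticAt_right
      (h.analytic _ (cparam_mem hρ) x (hsub hx))).differentiableAt.differentiableWithinAt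
  · exact (h.hasGradZ (cparam_mem hρ) (hsub hx)).1
  · refine ((analyticAt_right (h.analyticAt_gradFull (cparam_mem hρ)
      (hsub hx))).differentiableAt.congr_of_eventuallyEq ?_).differentiableWithinAt
    filter_upwards [hO.mem_nhds hx] with y hy
    exact (h.hasGradZ (cparam_mem hρ) (hsub hy)).2
  · have h1 := ((analyticAt_left (h.analyticAt_gradFull (cparam_mem hρ) (hsub hx))).restrictScalars
      (𝕜 := ℝ)).fun_comp_of_eq (f := fun ρ => cparam ρ) (x := ρ) (cparam.analyticAt ρ) rfl
    exact h1.contDiffAt.contDiffWithinAt.congr (fun ρ' h' =>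
      (h.hasGradZ (cparam_mem h') (hsub hx)).2) (h.hasGradZ (cparam_mem hρ) (hsub hx)).2
  · exact (h.hasHess (cparam_mem hρ) (hsub hx)).1
  · refine ((analyticAt_right (h.analyticAt_hessOp (cparam_mem hρ)
      (hsub hx))).differentiableAt.congr_of_eventuallyEq ?_).differentiableWithinAt
    filter_upwards [hO.mem_nhds hx] with y hy
    exact (h.hasHess (cparam_mem hρ) (hsub hy)).2
  · have h1 := ((analyticAt_left (h.analyticAt_hessOp (cparam_mem hρ) (hsub hx))).restrictScalars
      (𝕜 := ℝ)).fun_comp_of_eq (f := fun ρ => cparam ρ) (x := ρ) (cparam.analyticAt ρ) rfl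
    exact h1.contDiffAt.contDiffWithinAt.congr
      (fun ρ' h' => (h.hasHess (cparam_mem h') (hsub hx)).2) (h.hasHess (cparam_mem hρ) (hsub hx)).2

theorem enorm_le_ofReal {V : Type*} [SeminormedAddCommGroup V] {v : V} {b : ℝ} (h : ‖v‖ ≤ b) :
    ‖v‖ₑ ≤ ENNReal.ofReal b := by
  rw [← ofReal_norm]
  exact ENNReal.ofReal_le_ofReal h

/-- The gradient and the Hessian are controlled by Cauchy estimates in `x`, the derivatives in `ρ` by
Cauchy estimates in the complex parameter. -/
theorem normT_le (h : IsGood F Γ B) {σ μ : ℝ} (hσ : σ ≤ 1 / 4) (hμ : 0 < μ)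
    (hμ' : μ ≤ Real.exp (-(1 / 2)) / 4) :
    normT (s := s) σ μ (fun ρ => F (cparam ρ)) ≤ ENNReal.ofReal (3260 * B) := by
  have hsub := domO_subset_domInner (p := p) (q := q) (s := s) hσ hμ hμ'
  have hμ1 : ENNReal.ofReal μ ≤ 1 := by
    rw [ENNReal.ofReal_le_one]
    linarith [exp_bounds.2.1]
  have hμ2 : ENNReal.ofReal (μ ^ 2) ≤ 1 := by
    rw [ENNReal.ofReal_pow hμ.le]
    exact pow_le_one₀ zero_le hμ1
  refine iSup₂_le fun ρ hρ => iSup₂_le fun x hx => ?_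
  have hc := cparam_mem hρ
  have hx1 := hsub hx
  have hx2 := domInner_subset hx1
  have hB : 0 ≤ B := (norm_nonneg _).trans (h.norm_le _ hc x hx2)
  have d0 := (param_deriv (K := fun ρ => F ρ x) (fun ρ hρ => analyticAt_left (h.analytic ρ hρ x hx2))
    (fun ρ hρ => h.norm_le ρ hρ x hx2)).2 ρ hρ
  have d1 := (param_deriv (K := fun ρ => gradFull F Γ ρ x) (fun ρ hρ => analyticAt_left
    (h.analyticAt_gradFull hρ hx2)) (fun ρ hρ => h.norm_gradFull_le hρ hx1)).2 ρ hρ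
  have d2 := (param_deriv (K := fun ρ => hessOp Γ ρ x) (fun ρ hρ => analyticAt_left
    (h.analyticAt_hessOp hρ hx2)) (fun ρ hρ => h.norm_hessOp_le hρ hx1)).2 ρ hρ
  have e1 : fderivWithin ℝ (fun ρ' => gradZ (F (cparam ρ')) x) paramD ρ = fderivWithin ℝ (fun ρ' =>
    gradFull F Γ (cparam ρ') x) paramD ρ := fderivWithin_congr (fun ρ' h' => (h.hasGradZ (cparam_mem
    h') hx2).2) (h.hasGradZ hc hx2).2
  have e2 : fderivWithin ℝ (fun ρ' => hess (F (cparam ρ')) x) paramD ρ = fderivWithin ℝ (fun ρ' =>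
    hessOp Γ (cparam ρ') x) paramD ρ := fderivWithin_congr (fun ρ' h' => (h.hasHess (cparam_mem h')
    hx2).2) (h.hasHess hc hx2).2
  have hsmall : ∀ a b : ℝ≥0∞,
    a ≤ 1 → b ≤ ENNReal.ofReal (3260 * B) → a * b ≤ ENNReal.ofReal (3260 * B) := fun a b ha hb =>
    (mul_le_mul' ha hb).trans (one_mul _).le
  refine max_le (max_le (enorm_le_ofReal ?_) (enorm_le_ofReal ?_))
    (max_le (hsmall _ _ hμ1 (max_le (enorm_le_ofReal ?_) (enorm_le_ofReal ?_)))
    (hsmall _ _ hμ2 (max_le (enorm_le_ofReal ?_) (enorm_le_ofReal ?_))))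
  · exact (h.norm_le _ hc x hx2).trans (by linarith)
  · exact d0.trans (by linarith)
  · rw [(h.hasGradZ hc hx2).2]
    exact (h.norm_gradFull_le hc hx1).trans (by linarith)
  · rw [e1]
    exact d1.trans (by linarith)
  · rw [(h.hasHess hc hx2).2]
    exact (h.norm_hessOp_le hc hx1).trans (by linarith)
  · rw [e2]
    exact d2.trans (by linarith)

end IsGood

/-! ### Jets -/

/-- The curve `t ↦ (t² r, θ, t z)` through the point `x = (r, θ, z)`; along it, the jet is the
Taylor polynomial of degree two. -/
def scaleC (x : Ξ) (t : ℂ) : Ξ := (t ^ 2 • x.1, x.2.1, t • x.2.2)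

theorem scaleC_zero (x : Ξ) : scaleC x 0 = (0, x.2.1, 0) := by
  simp [scaleC]

theorem hasDerivAt_scaleC (x : Ξ) (t : ℂ) :
    HasDerivAt (scaleC x) ((2 * t) • (x.1, 0, 0) + (0, 0, x.2.2) : Ξ) t := by
  have h1 : HasDerivAt (fun t : ℂ => t ^ 2 • x.1) ((2 * t) • x.1) t := by
    have := (hasDerivAt_pow 2 t).smul_const x.1
    simpa using this
  have h2 : HasDerivAt (fun t : ℂ => t • x.2.2) x.2.2 t := by
    have := (hasDerivAt_id t).smul_const x.2.2
    simpa using this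
  have h3 := h1.prodMk ((hasDerivAt_const t x.2.1).prodMk h2)
  have e : ((2 * t) • (x.1, 0, 0) + (0, 0, x.2.2) : Ξ) = ((2 * t) • x.1, 0, x.2.2) := by
    simp
  rw [e]
  exact h3

theorem analyticAt_scaleC (x : Ξ) (t : ℂ) : AnalyticAt ℂ (scaleC x) t := by
  have : Differentiable ℂ (scaleC x) := fun t => (hasDerivAt_scaleC x t).differentiableAt
  exact this.analyticAt t

theorem scaleC_mem (hx : x ∈ Ω) {t : ℂ} (ht : ‖t‖ ≤ 1) : scaleC x t ∈ Ω := by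
  obtain ⟨h1, h2, h3⟩ := hx
  refine ⟨?_, h2, ?_⟩
  · refine lt_of_le_of_lt ?_ h1
    change ‖t ^ 2 • x.1‖ ≤ _
    rw [norm_smul, norm_pow]
    have := pow_le_one₀ (n := 2) (norm_nonneg t) ht
    nlinarith [norm_nonneg x.1]
  · refine lt_of_le_of_lt ?_ h3
    change ‖t • x.2.2‖ ≤ _
    rw [norm_smul]
    nlinarith [norm_nonneg x.2.2]

theorem base_mem (hx : x ∈ Ω) : ((0, x.2.1, 0) : Ξ) ∈ Ω := by
  rw [← scaleC_zero]
  exact scaleC_mem hx (by simp)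

theorem shiftAngle_mem (hx : x ∈ Ω) (k : Fin 2 → ℤ) : shiftAngle k x ∈ Ω := by
  refine ⟨hx.1, fun i => ?_, hx.2.2⟩
  have : (shiftAngle k x).2.1 i = x.2.1 i + ((2 * Real.pi * k i : ℝ) : ℂ) := by
    simp [shiftAngle]
  rw [this, Complex.add_im, Complex.ofReal_im, add_zero]
  exact hx.2.1 i

theorem rotC_mem (hx : x ∈ Ω) (φ ψ : ℝ) : rotC φ ψ x ∈ Ω := by
  refine ⟨hx.1, fun i => ?_, ?_⟩
  · change |(x.2.1 i + ((φ + ψ * (ι i).1 : ℝ) : ℂ)).im| < _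
    rw [Complex.add_im, Complex.ofReal_im, add_zero]
    exact hx.2.1 i
  · have hn : ∀ (φ ψ : ℝ) (z : 𝓩), ‖rotE φ ψ z‖ ≤ ‖z‖ := fun φ ψ z =>
      (WSeq.norm_mulC_le _ 1 zero_le_one (norm_rotE_le φ ψ) z).trans (one_mul _).le
    refine lt_of_le_of_lt (norm_prod_le_iff.2 ⟨?_, ?_⟩) hx.2.2
    · exact (hn φ ψ x.2.2.1).trans (norm_fst_le x.2.2)
    · exact (hn (-φ) (-ψ) x.2.2.2).trans (norm_snd_le x.2.2)

/-- The jet in terms of the second order Taylor polynomial along the curve `scaleC`. -/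
theorem jet_eq_deriv {f : Ξ → ℂ} (hf : AnalyticAt ℂ f (0, x.2.1, 0)) : jet f x = f (scaleC x 0) +
    deriv (fun t => f (scaleC x t)) 0 + ½ * deriv (deriv fun t => f (scaleC x t)) 0 := by
  have hf0 : AnalyticAt ℂ f (scaleC x 0) := by rw [scaleC_zero]; exact hf
  have h1 : deriv (fun t => f (scaleC x t)) =ᶠ[𝓝 0] fun t =>
      fderiv ℂ f (scaleC x t) ((2 * t) • (x.1, 0, 0) + (0, 0, x.2.2)) := by
    have := (analyticAt_scaleC x 0).continuousAt.eventually hf0.eventually_analyticAt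
    filter_upwards [this] with t ht
    exact (ht.differentiableAt.hasFDerivAt.comp_hasDerivAt t (hasDerivAt_scaleC x t)).deriv
  have h2 : HasDerivAt (fun t => fderiv ℂ f (scaleC x t) ((2 * t) • (x.1, 0, 0) + (0, 0, x.2.2)))
    (fderiv ℂ (fderiv ℂ f) (scaleC x 0) ((2 * (0 : ℂ)) • (x.1, 0, 0) + (0, 0, x.2.2)) ((2 * (0 :
    ℂ)) • (x.1, 0, 0) + (0, 0, x.2.2)) + fderiv ℂ f (scaleC x 0) ((2 : ℂ) • (x.1, 0, 0))) 0 := by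
    have k1 := hf0.fderiv.differentiableAt.hasFDerivAt.comp_hasDerivAt 0 (hasDerivAt_scaleC x 0)
    have k2 : HasDerivAt (fun t : ℂ => ((2 * t) • (x.1, 0, 0) + (0, 0, x.2.2) : Ξ)) ((2 : ℂ) • (x.1,
      0, 0)) 0 := by
      have := ((((hasDerivAt_id (0 : ℂ)).const_mul (2 : ℂ)).smul_const
        ((x.1, 0, 0) : Ξ)).add_const ((0, 0, x.2.2) : Ξ))
      simpa using this
    exact k1.clm_apply k2
  have h3 : HasFDerivAt (fun y => fderiv ℂ f y (0, 0, x.2.2))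
    ((fderiv ℂ (fderiv ℂ f) (0, x.2.1, 0)).flip (0, 0, x.2.2)) (0, x.2.1, 0) := by
    have := hf.fderiv.differentiableAt.hasFDerivAt.clm_apply
      (hasFDerivAt_const ((0, 0, x.2.2) : Ξ) ((0, x.2.1, 0) : Ξ))
    simpa using this
  have h4 : deriv (fun t => f (scaleC x t)) 0 =
    fderiv ℂ f (scaleC x 0) ((2 * (0 : ℂ)) • (x.1, 0, 0) + (0, 0, x.2.2)) := h1.eq_of_nhds
  rw [h1.deriv_eq, h2.deriv, h4, jet, h3.fderiv, scaleC_zero]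
  simp only [mul_zero, zero_smul, zero_add, ContinuousLinearMap.flip_apply, map_smul, smul_eq_mul]
  ring

/-- Functions that agree up to `c t²` and to terms of third order along the curve `scaleC x` have
jets that differ by `c`. -/
theorem jet_eq_of_isBigO {f f' : Ξ → ℂ} {c : ℂ} (hf : AnalyticAt ℂ f (0, x.2.1, 0))
    (hf' : AnalyticAt ℂ f' (0, x.2.1, 0)) (h : (fun t => f (scaleC x t) - f' (scaleC x t) - c * t ^ 2)
      =O[𝓝 0] fun t : ℂ => ‖t‖ ^ 3) : jet f x = jet f' x + c := by
  rw [jet_eq_deriv hf, jet_eq_deriv hf']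
  rw [← scaleC_zero] at hf hf'
  have ha : AnalyticAt ℂ (fun t => f (scaleC x t)) 0 := hf.fun_comp_of_eq (analyticAt_scaleC x 0) rfl
  have ha' : AnalyticAt ℂ (fun t => f' (scaleC x t)) 0 :=
    hf'.fun_comp_of_eq (analyticAt_scaleC x 0) rfl
  have hD : AnalyticAt ℂ (fun t => f (scaleC x t) - f' (scaleC x t) - c * t ^ 2) 0 :=
    (ha.sub ha').sub (analyticAt_const.mul (analyticAt_id.pow 2) (f := fun _ => c))
  have hd : ∀ g : ℂ → ℂ, ∀ n, (fun t => fderiv ℂ g t) =O[𝓝 0] (fun t : ℂ => ‖t‖ ^ n) →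
      deriv g =O[𝓝 0] fun t : ℂ => ‖t‖ ^ n := fun g n hg => by
    refine (Asymptotics.IsBigO.of_bound 1 (Eventually.of_forall fun t => ?_)).trans hg
    rw [one_mul, norm_deriv_eq_norm_fderiv]
  have hz : ∀ g : ℂ → ℂ, ∀ n, n ≠ 0 → g =O[𝓝 0] (fun t : ℂ => ‖t‖ ^ n) → g 0 = 0 := fun g n hn hg =>
    Asymptotics.IsBigO.eq_zero_of_norm_pow (x₀ := 0) (by simpa using hg) hn
  have h1 := hd _ _ (isBigO_fderiv hD (N := 1) h)
  have h2 := hd _ _ (isBigO_fderiv hD.deriv (N := 0) h1)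
  have d1 : deriv (fun t => f (scaleC x t) - f' (scaleC x t) - c * t ^ 2) =ᶠ[𝓝 0] fun t =>
      deriv (fun t => f (scaleC x t)) t - deriv (fun t => f' (scaleC x t)) t - c * (2 * t) := by
    filter_upwards [ha.eventually_analyticAt, ha'.eventually_analyticAt] with t k k'
    exact (((k.differentiableAt.hasDerivAt.sub k'.differentiableAt.hasDerivAt).sub
      ((hasDerivAt_pow 2 t).const_mul c)).congr_deriv (by simp)).deriv
  have d2 := d1.deriv_eq.trans
    ((ha.deriv.differentiableAt.hasDerivAt.sub ha'.deriv.differentiableAt.hasDerivAt).sub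
    (((hasDerivAt_id (0 : ℂ)).const_mul (2 : ℂ)).const_mul c)).deriv
  have e0 := hz _ 3 (by norm_num) h
  have e1 := d1.eq_of_nhds.symm.trans (hz _ 2 (by norm_num) h1)
  have e2 := d2.symm.trans (hz _ 1 (by norm_num) h2)
  simp at e0 e1 e2
  linear_combination e0 + e1 + ½ * e2

/-- The derivative of a real analytic function is real. -/
theorem deriv_real {φ : ℂ → ℂ} (ha : AnalyticAt ℂ φ 0)
    (h : ∀ᶠ t : ℝ in 𝓝 0, (φ t).im = 0) : ∀ᶠ t : ℝ in 𝓝 0, (deriv φ t).im = 0 := by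
  have h1 : ∀ᶠ t : ℝ in 𝓝 0, AnalyticAt ℂ φ (t : ℂ) := by
    have := Complex.continuous_ofReal.tendsto (0 : ℝ)
    rw [Complex.ofReal_zero] at this
    exact this.eventually ha.eventually_analyticAt
  filter_upwards [h1, h.eventually_nhds] with t ht1 ht2
  have h2 := ht1.differentiableAt.hasDerivAt.comp_ofReal
  have h3 := (Complex.imCLM.hasFDerivAt (x := φ t)).comp_hasDerivAt t h2
  have h4 : HasDerivAt (fun _ : ℝ => (0 : ℝ)) 0 t := hasDerivAt_const t 0
  exact (h4.congr_of_eventuallyEq ht2).unique h3 |>.symm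

namespace IsGood

variable {F : C2 → Coord p q s → ℂ}
  {Γ : C2 → Coord p q s → ZSpace p q s × ZSpace p q s} {B : ℝ}

theorem mono (h : IsGood F Γ B) {B' : ℝ} (hB : B ≤ B') : IsGood F Γ B' :=
  { h with
    norm_le := fun ρ hρ x hx => (h.norm_le ρ hρ x hx).trans hB
    norm_grad_le := fun ρ hρ x hx => (h.norm_grad_le ρ hρ x hx).trans hB }

theorem congr {F' : C2 → Ξ → ℂ} (h : IsGood F Γ B) (e : ∀ ρ ∈ paramC, ∀ x ∈ Ω, F' ρ x = F ρ x) :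
    IsGood F' Γ B := by
  have hd : ∀ ρ ∈ paramC, ∀ x ∈ Ω, fderiv ℂ (F' ρ) x = fderiv ℂ (F ρ) x :=
    fun ρ hρ x hx => Filter.EventuallyEq.fderiv_eq (by
      filter_upwards [isOpen_domPhi.mem_nhds hx] with y hy using e ρ hρ y hy)
  refine ⟨fun ρ hρ x hx => (h.analytic ρ hρ x hx).congr ?_, fun ρ hρ x hx => ?_, h.analytic_grad,
    h.norm_grad_le, fun ρ hρ x hx α => ?_, fun ρ hρ x hx α => ?_, fun ρ hρ x hx k => ?_,
    fun ρ hρ x hx hr => ?_, fun ρ hρ x hx φ ψ => ?_⟩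
  · filter_upwards [(isOpen_paramC.prod isOpen_domPhi).mem_nhds (⟨hρ, hx⟩ :
      (ρ, x) ∈ paramC ×ˢ Ω)] with y hy using (e y.1 hy.1 y.2 hy.2).symm
  · rw [e ρ hρ x hx]; exact h.norm_le ρ hρ x hx
  · rw [hd ρ hρ x hx]; exact h.grad_fst ρ hρ x hx α
  · rw [hd ρ hρ x hx]; exact h.grad_snd ρ hρ x hx α
  · rw [e ρ hρ x hx, e ρ hρ _ (shiftAngle_mem hx k), h.periodic ρ hρ x hx]
  · rw [e _ (cparam_mem hρ) x hx, h.real ρ hρ x hx hr]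
  · rw [e ρ hρ x hx, e ρ hρ _ (rotC_mem hx φ ψ), h.rot ρ hρ x hx]

theorem add_smul {F' : C2 → Ξ → ℂ} {Γ' : C2 → Ξ → 𝓩 × 𝓩} {B' : ℝ} (h : IsGood F Γ B)
    (h' : IsGood F' Γ' B') (c c' : ℝ) : IsGood (fun ρ x => c * F ρ x + c' * F' ρ x)
      (fun ρ x => (c : ℂ) • Γ ρ x + (c' : ℂ) • Γ' ρ x) (|c| * B + |c'| * B') := by
  have hd : ∀ ρ ∈ paramC, ∀ x ∈ Ω, ∀ v, fderiv ℂ (fun x => c * F ρ x + c' * F' ρ x) x v =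
      c * fderiv ℂ (F ρ) x v + c' * fderiv ℂ (F' ρ) x v := fun ρ hρ x hx v =>
    congrArg (fun L : Ξ →L[ℂ] ℂ => L v) (((analyticAt_right
      (h.analytic ρ hρ x hx)).differentiableAt.hasFDerivAt.const_mul (c : ℂ)).add ((analyticAt_right
      (h'.analytic ρ hρ x hx)).differentiableAt.hasFDerivAt.const_mul (c' : ℂ))).fderiv
  have hn : ∀ {V : Type} [NormedAddCommGroup V] [NormedSpace ℂ V] {u v : V}, ‖u‖ ≤ B → ‖v‖ ≤ B' →
      ‖(c : ℂ) • u + (c' : ℂ) • v‖ ≤ |c| * B + |c'| * B' := fun hu hv => by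
    refine (norm_add_le _ _).trans ?_
    rw [norm_smul, norm_smul, Complex.norm_real, Complex.norm_real]
    exact add_le_add (mul_le_mul_of_nonneg_left hu (abs_nonneg c))
      (mul_le_mul_of_nonneg_left hv (abs_nonneg c'))
  refine ⟨fun ρ hρ x hx => (analyticAt_const.mul (h.analytic ρ hρ x hx)).add (analyticAt_const.mul
    (h'.analytic ρ hρ x hx)), fun ρ hρ x hx => hn (h.norm_le ρ hρ x hx) (h'.norm_le ρ hρ x hx),
    fun ρ hρ x hx => (analyticAt_const_smul _ (h.analytic_grad ρ hρ x hx)).add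
    (analyticAt_const_smul _ (h'.analytic_grad ρ hρ x hx)), fun ρ hρ x hx =>
    hn (h.norm_grad_le ρ hρ x hx) (h'.norm_grad_le ρ hρ x hx), fun ρ hρ x hx α => ?_,
    fun ρ hρ x hx α => ?_, fun ρ hρ x hx k => ?_, fun ρ hρ x hx hr => ?_, fun ρ hρ x hx φ ψ => ?_⟩
  · rw [hd ρ hρ x hx, ← h.grad_fst ρ hρ x hx, ← h'.grad_fst ρ hρ x hx]
    rfl
  · rw [hd ρ hρ x hx, ← h.grad_snd ρ hρ x hx, ← h'.grad_snd ρ hρ x hx]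
    rfl
  · rw [h.periodic ρ hρ x hx, h'.periodic ρ hρ x hx]
  · rw [Complex.add_im, Complex.im_ofReal_mul, Complex.im_ofReal_mul, h.real ρ hρ x hx hr,
      h'.real ρ hρ x hx hr, mul_zero, mul_zero, add_zero]
  · rw [h.rot ρ hρ x hx, h'.rot ρ hρ x hx]

theorem analyticAt_scale (h : IsGood F Γ B) (hρ : ρ ∈ paramC) (hx : x ∈ Ω) {t : ℂ} (ht : ‖t‖ ≤ 1) :
    AnalyticAt ℂ (fun t => F ρ (scaleC x t)) t := (analyticAt_right
    (h.analytic ρ hρ _ (scaleC_mem hx ht))).fun_comp_of_eq (analyticAt_scaleC x t) rfl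

theorem jet_eq (h : IsGood F Γ B) (hρ : ρ ∈ paramC) (hx : x ∈ Ω) : jet (F ρ) x = F ρ (scaleC x 0) +
    deriv (fun t => F ρ (scaleC x t)) 0 + ½ * deriv (deriv fun t => F ρ (scaleC x t)) 0 :=
    jet_eq_deriv (analyticAt_right (h.analytic ρ hρ _ (base_mem hx)))

theorem norm_jet_le (h : IsGood F Γ B) (hρ : ρ ∈ paramC) (hx : x ∈ Ω) : ‖jet (F ρ) x‖ ≤ 11 * B := by
  have ha : ∀ t ∈ ball (0 : ℂ) 1, AnalyticAt ℂ (fun t => F ρ (scaleC x t)) t := fun t ht =>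
    h.analyticAt_scale hρ hx (mem_ball_zero_iff.1 ht).le
  have hb : ∀ t ∈ ball (0 : ℂ) 1, ‖F ρ (scaleC x t)‖ ≤ B := fun t ht =>
    h.norm_le ρ hρ _ (scaleC_mem hx (mem_ball_zero_iff.1 ht).le)
  have h1 : ∀ t ∈ ball (0 : ℂ) (1 / 2), ‖deriv (fun t => F ρ (scaleC x t)) t‖ ≤ 4 * B := by
    intro t ht
    have hsub : ball t (1 / 2) ⊆ ball (0 : ℂ) 1 := fun u hu => by
      rw [mem_ball_zero_iff] at ht ⊢
      rw [mem_ball_iff_norm] at hu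
      have := norm_add_le (u - t) t
      rw [sub_add_cancel] at this
      linarith
    rw [norm_deriv_eq_norm_fderiv]
    have := norm_fderiv_le_of_bound (f := fun t => F ρ (scaleC x t)) (x := t) (r := 1 / 2) (B := B)
      (by norm_num) (fun u hu => (ha u (hsub hu)).differentiableAt.differentiableWithinAt)
      (fun u hu => hb u (hsub hu))
    linarith
  have h2 : ‖deriv (deriv fun t => F ρ (scaleC x t)) 0‖ ≤ 16 * B := by
    rw [norm_deriv_eq_norm_fderiv]
    have := norm_fderiv_le_of_bound (f := deriv fun t => F ρ (scaleC x t)) (x := 0) (r := 1 / 2)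
      (B := 4 * B) (by norm_num) (fun u hu => (ha u (Metric.ball_subset_ball (by norm_num)
        hu)).deriv.differentiableAt.differentiableWithinAt) h1
    linarith
  have h3 : ‖deriv (fun t => F ρ (scaleC x t)) 0‖ ≤ 2 * B := by
    rw [norm_deriv_eq_norm_fderiv]
    have := norm_fderiv_le_of_bound (f := fun t => F ρ (scaleC x t)) (x := 0) (r := 1) (B := B)
      (by norm_num) (fun u hu => (ha u hu).differentiableAt.differentiableWithinAt) hb
    linarith
  have h4 := hb 0 (Metric.mem_ball_self one_pos)
  rw [h.jet_eq hρ hx]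
  refine norm_add₃_le.trans ?_
  rw [norm_mul]
  have : ‖½‖ = 1 / 2 := by norm_num
  rw [this]
  linarith

/-- The gradient of the jet. -/
def jetGrad (Γ : C2 → Ξ → 𝓩 × 𝓩) (ρ : C2) (x : Ξ) :
    𝓩 × 𝓩 := Γ ρ (0, x.2.1, 0) + fderiv ℂ (Γ ρ) (0, x.2.1, 0) (0, 0, x.2.2)

theorem norm_jetGrad_le (h : IsGood F Γ B) (hρ : ρ ∈ paramC)
    (hx : x ∈ Ω) : ‖jetGrad Γ ρ x‖ ≤ 11 * B := by
  have hB : 0 ≤ B := (norm_nonneg _).trans (h.norm_le ρ hρ x hx)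
  have hl : ∀ t : ℂ, HasDerivAt (fun t : ℂ => ((0, x.2.1, t • x.2.2) : Ξ)) (0, 0, x.2.2) t :=
    fun t => by
      have h2 : HasDerivAt (fun t : ℂ => t • x.2.2) x.2.2 t := by
        have := (hasDerivAt_id t).smul_const x.2.2
        simpa using this
      exact (hasDerivAt_const t (0 : C2)).prodMk ((hasDerivAt_const t x.2.1).prodMk h2)
  have hm : ∀ t ∈ ball (0 : ℂ) 1, ((0, x.2.1, t • x.2.2) : Ξ) ∈ Ω := by
    intro t ht
    have := scaleC_mem (x := ((0, x.2.1, x.2.2) : Ξ))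
      ⟨by rw [norm_zero]; exact (norm_nonneg _).trans_lt hx.1, hx.2⟩ (mem_ball_zero_iff.1 ht).le
    simpa [scaleC] using this
  have hd : ∀ t ∈ ball (0 : ℂ) 1, HasDerivAt (fun t : ℂ => Γ ρ (0, x.2.1, t • x.2.2))
    (fderiv ℂ (Γ ρ) (0, x.2.1, t • x.2.2) (0, 0, x.2.2)) t := fun t ht =>
    (analyticAt_right (h.analytic_grad ρ hρ _ (hm t ht))).differentiableAt.hasFDerivAt.comp_hasDerivAt
      t (hl t)
  have h1 := norm_fderiv_le_of_bound (f := fun t : ℂ => Γ ρ (0, x.2.1, t • x.2.2)) (x := 0) (r := 1)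
    (B := B) one_pos (fun t ht => (hd t ht).differentiableAt.differentiableWithinAt)
    (fun t ht => h.norm_grad_le ρ hρ _ (hm t ht))
  rw [← norm_deriv_eq_norm_fderiv, (hd 0 (Metric.mem_ball_self one_pos)).deriv, zero_smul] at h1
  have h2 := h.norm_grad_le ρ hρ _ (base_mem hx)
  refine (norm_add_le _ _).trans ?_
  linarith

theorem jet_deriv (h : IsGood F Γ B) (hρ : ρ ∈ paramC) (hx : x ∈ Ω)
    (hd : DifferentiableAt ℂ (jet (F ρ)) x) (v : 𝓩 × 𝓩) :
    fderiv ℂ (jet (F ρ)) x (0, 0, v) = fderiv ℂ (F ρ) (0, x.2.1, 0) (0, 0, v) +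
    fderiv ℂ (fderiv ℂ (F ρ)) (0, x.2.1, 0) (0, 0, x.2.2) (0, 0, v) := by
  have h1 := (analyticAt_right (h.analytic ρ hρ _ (base_mem hx))).fderiv.differentiableAt.hasFDerivAt
  have hsym := h.fderiv_symm hρ (base_mem hx) (0, 0, v) (0, 0, x.2.2)
  have h2 : ∀ z : 𝓩 × 𝓩, fderiv ℂ (fun y => fderiv ℂ (F ρ) y (0, 0, z)) (0, x.2.1, 0) (0, 0, z) =
    fderiv ℂ (fderiv ℂ (F ρ)) (0, x.2.1, 0) (0, 0, z) (0, 0, z) := fun z => by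
    have := h1.clm_apply (hasFDerivAt_const ((0, 0, z) : Ξ) ((0, x.2.1, 0) : Ξ))
    rw [this.fderiv]
    simp
  set D1 := fderiv ℂ (F ρ) (0, x.2.1, 0)
  set D2 := fderiv ℂ (fderiv ℂ (F ρ)) (0, x.2.1, 0)
  have e : ∀ t : ℂ, jet (F ρ) (x + t • (0, 0, v)) = jet (F ρ) x + t * (D1 (0, 0, v) + D2 (0, 0,
    x.2.2) (0, 0, v)) + t ^ 2 * (½ * D2 (0, 0, v) (0, 0, v)) := fun t => by
    have e0 : x + t • ((0, 0, v) : Ξ) = (x.1, x.2.1, x.2.2 + t • v) := by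
      refine Prod.ext ?_ (Prod.ext ?_ rfl)
      · simp
      · simp
    have e1 : ((0, 0, x.2.2 + t • v) : Ξ) = (0, 0, x.2.2) + t • (0, 0, v) := by simp
    rw [e0]
    unfold jet
    dsimp only
    rw [h2, h2, e1]
    simp only [map_add, map_smul, add_apply, smul_apply, smul_eq_mul, hsym]
    change _ + D1 (x.1, 0, 0) + _ + _ = _ + D1 (x.1, 0, 0) + _ + _ + _ + _
    ring
  have hline : HasDerivAt (fun t : ℂ => x + t • ((0, 0, v) : Ξ)) (0, 0, v) 0 := by
    have := ((hasDerivAt_id (0 : ℂ)).smul_const ((0, 0, v) : Ξ)).const_add x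
    simpa using this
  have hd' : HasFDerivAt (jet (F ρ)) (fderiv ℂ (jet (F ρ)) x) (x + (0 : ℂ) • ((0, 0, v) : Ξ)) := by
    rw [zero_smul, add_zero]; exact hd.hasFDerivAt
  have k1 := hd'.comp_hasDerivAt (0 : ℂ) hline
  have k2 : HasDerivAt (fun t : ℂ => jet (F ρ) x + t * (D1 (0, 0, v) + D2 (0, 0, x.2.2) (0, 0, v)) +
    t ^ 2 * (½ * D2 (0, 0, v) (0, 0, v))) (D1 (0, 0, v) + D2 (0, 0, x.2.2) (0, 0, v)) 0 := by
    have :=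
      (((hasDerivAt_id (0 : ℂ)).mul_const (D1 (0, 0, v) + D2 (0, 0, x.2.2) (0, 0, v))).const_add
      (jet (F ρ) x)).add ((hasDerivAt_pow 2 (0 : ℂ)).mul_const (½ * D2 (0, 0, v) (0, 0, v)))
    exact this.congr_deriv (by simp)
  exact k1.unique (k2.congr_of_eventuallyEq (Eventually.of_forall e))

theorem analyticAt_jet_args (ρ : C2) (x : Ξ) :
    AnalyticAt ℂ (fun y : C2 × Ξ => (y.1, ((0, y.2.2.1, 0) : Ξ))) (ρ, x) ∧
    AnalyticAt ℂ (fun y : C2 × Ξ => ((0, 0, y.2.2.2) : Ξ)) (ρ, x) :=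
    ⟨analyticAt_fst.prod (analyticAt_const.prod ((((fst ℂ C2 _).comp (snd ℂ C2 _)).comp
    (snd ℂ C2 Ξ)).analyticAt _ |>.prod analyticAt_const)), analyticAt_const.prod
    (analyticAt_const.prod ((((snd ℂ C2 _).comp (snd ℂ C2 _)).comp (snd ℂ C2 Ξ)).analyticAt _))⟩

theorem analyticAt_jet (h : IsGood F Γ B) (hρ : ρ ∈ paramC) (hx : x ∈ Ω) :
    AnalyticAt ℂ (fun y : C2 × Ξ => jet (F y.1) y.2) (ρ, x) := by
  obtain ⟨hb, hz⟩ := analyticAt_jet_args ρ x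
  have hr : AnalyticAt ℂ (fun y : C2 × Ξ =>
      ((y.2.1, 0, 0) : Ξ)) (ρ, x) :=
    (((fst ℂ C2 _).comp (snd ℂ C2 Ξ)).analyticAt _).prod analyticAt_const
  have hF := h.analytic ρ hρ _ (base_mem hx)
  have hD := analyticAt_partial_fderiv hF
  have hD2 := analyticAt_partial_fderiv (f := fun ρ x => fderiv ℂ (F ρ) x) hD
  have k0 := hF.fun_comp_of_eq hb rfl
  have k1 := hD.fun_comp_of_eq hb rfl
  have k2 := hD2.fun_comp_of_eq hb rfl
  have k3 := analyticAt_clm_apply (analyticAt_clm_apply k2 hz) hz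
  refine (((k0.add (analyticAt_clm_apply k1 hr)).add (analyticAt_clm_apply k1 hz)).add
    (analyticAt_const.mul k3 (f := fun _ => ½))).congr ?_
  have hnear : ∀ᶠ y : C2 × Ξ in 𝓝 (ρ, x), y.1 ∈ paramC ∧ y.2 ∈ Ω :=
    (isOpen_paramC.prod isOpen_domPhi).mem_nhds ⟨hρ, hx⟩
  filter_upwards [hnear] with y hy
  have h1 :=
    (analyticAt_right (h.analytic _ hy.1 _ (base_mem hy.2))).fderiv.differentiableAt.hasFDerivAt
  have h2 := h1.clm_apply (hasFDerivAt_const ((0, 0, y.2.2.2) : Ξ) ((0, y.2.2.1, 0) : Ξ))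
  unfold jet
  rw [h2.fderiv]
  simp

theorem analyticAt_jetGrad (h : IsGood F Γ B) (hρ : ρ ∈ paramC) (hx : x ∈ Ω) :
    AnalyticAt ℂ (fun y : C2 × Ξ => jetGrad Γ y.1 y.2) (ρ, x) := by
  obtain ⟨hb, hz⟩ := analyticAt_jet_args ρ x
  have hF := h.analytic_grad ρ hρ _ (base_mem hx)
  have hD := analyticAt_partial_fderiv hF
  exact (hF.fun_comp_of_eq hb rfl).add (analyticAt_clm_apply (hD.fun_comp_of_eq hb rfl) hz)

/-- The jet of a good function is good. -/
theorem jet (h : IsGood F Γ B) : IsGood (fun ρ => CoupledNLS.jet (F ρ)) (jetGrad Γ) (11 * B) := by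
  have hev : ∀ ρ ∈ paramC, ∀ x ∈ Ω, ∀ y ∈ Ω, (∀ t : ℂ, ‖t‖ ≤ 1 →
    F ρ (scaleC y t) = F ρ (scaleC x t)) → CoupledNLS.jet (F ρ) y = CoupledNLS.jet (F ρ) x := by
    intro ρ hρ x hx y hy hxy
    have e : (fun t => F ρ (scaleC y t)) =ᶠ[𝓝 0] fun t => F ρ (scaleC x t) := by
      filter_upwards [Metric.ball_mem_nhds (0 : ℂ) one_pos] with t ht
      exact hxy t (mem_ball_zero_iff.1 ht).le
    rw [h.jet_eq hρ hx, h.jet_eq hρ hy, e.deriv_eq, e.deriv.deriv_eq, hxy 0 (by simp)]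
  have hdir : ∀ ρ ∈ paramC, ∀ x ∈ Ω, ∀ (α : Ell p q) (P : 𝓩 × 𝓩 →L[ℂ] 𝓩) (v : 𝓩 × 𝓩),
    (∀ y ∈ Ω, (P (Γ ρ y)) α.toExt = fderiv ℂ (F ρ) y (0, 0, v)) →
    (P (jetGrad Γ ρ x)) α.toExt = fderiv ℂ (CoupledNLS.jet (F ρ)) x (0, 0, v) := by
    intro ρ hρ x hx α P v hv
    have hx0 := base_mem hx
    rw [h.jet_deriv hρ hx (analyticAt_right (f := fun ρ => CoupledNLS.jet (F ρ)) (h.analyticAt_jet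
      hρ hx)).differentiableAt, ← hv _ hx0, jetGrad, map_add, WSeq.add_apply]
    congr 1
    have hG := (analyticAt_right (h.analytic_grad ρ hρ _ hx0)).differentiableAt.hasFDerivAt
    have hG' := ((coord (extWeight p q) s α.toExt).comp P).hasFDerivAt.comp ((0, x.2.1, 0) : Ξ) hG
    have h1 := (analyticAt_right (h.analytic ρ hρ _ hx0)).fderiv.differentiableAt.hasFDerivAt
    have h2 := h1.clm_apply (hasFDerivAt_const ((0, 0, v) : Ξ) ((0, x.2.1, 0) : Ξ))
    have h3 := hG'.unique (h2.congr_of_eventuallyEq (by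
      filter_upwards [isOpen_domPhi.mem_nhds hx0] with y hy
      exact hv y hy))
    have h4 := congrArg (fun L : Ξ →L[ℂ] ℂ => L (0, 0, x.2.2)) h3
    refine Eq.trans ?_ (h4.trans ?_)
    · rfl
    · simp
  refine ⟨fun ρ hρ x hx => h.analyticAt_jet hρ hx, fun ρ hρ x hx => h.norm_jet_le hρ hx,
    fun ρ hρ x hx => h.analyticAt_jetGrad hρ hx, fun ρ hρ x hx => h.norm_jetGrad_le hρ hx,
    fun ρ hρ x hx α => ?_, fun ρ hρ x hx α => ?_,
    fun ρ hρ x hx k => ?_, fun ρ hρ x hx hr => ?_, fun ρ hρ x hx φ ψ => ?_⟩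
  · exact hdir ρ hρ x hx α (fst ℂ _ _) (single α.toExt, 0) fun y hy => h.grad_fst ρ hρ y hy α
  · exact hdir ρ hρ x hx α (snd ℂ _ _) (0, single α.toExt) fun y hy => h.grad_snd ρ hρ y hy α
  · exact hev ρ hρ x hx _ (shiftAngle_mem hx k) fun t ht =>
      h.periodic ρ hρ (scaleC x t) (scaleC_mem hx ht) k
  · have hc := cparam_mem hρ
    have hre : ∀ᶠ t : ℝ in 𝓝 0, (F (cparam ρ) (scaleC x t)).im = 0 := by
      filter_upwards [Metric.ball_mem_nhds (0 : ℝ) one_pos] with t ht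
      have ht' : ‖(t : ℂ)‖ ≤ 1 := by rw [Complex.norm_real]; exact (mem_ball_zero_iff.1 ht).le
      refine h.real ρ hρ _ (scaleC_mem hx ht') ⟨fun i => ?_, hr.2.1, fun α => ?_⟩
      · change ((t : ℂ) ^ 2 * x.1 i).im = 0
        rw [← Complex.ofReal_pow, Complex.im_ofReal_mul, hr.1 i, mul_zero]
      · change (t : ℂ) * x.2.2.2 α = conj ((t : ℂ) * x.2.2.1 α)
        rw [map_mul, Complex.conj_ofReal, hr.2.2 α]
    have ha := h.analyticAt_scale hc hx (t := 0) (by simp)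
    have h1 := deriv_real ha hre
    have h2 := (deriv_real ha.deriv h1).self_of_nhds
    have h0 := hre.self_of_nhds
    have h1 := h1.self_of_nhds
    rw [Complex.ofReal_zero] at h0 h1 h2
    change (CoupledNLS.jet (F (cparam ρ)) x).im = 0
    rw [h.jet_eq hc hx, Complex.add_im, Complex.add_im, h0, h1,
      show ½ = ((1 / 2 : ℝ) : ℂ) by push_cast; rfl, Complex.im_ofReal_mul, h2]
    ring
  · refine hev ρ hρ x hx _ (rotC_mem hx φ ψ) fun t ht => ?_
    refine Eq.trans ?_ (h.rot ρ hρ (scaleC x t) (scaleC_mem hx ht) φ ψ)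
    congr 1
    refine Prod.ext rfl (Prod.ext rfl ?_)
    exact Prod.ext (map_smul _ _ _).symm (map_smul _ _ _).symm

end IsGood

/-! ### The restricted class -/

theorem snd_fderiv_affine {E : Type*} [NormedAddCommGroup E] [NormedSpace ℂ E] {F : E → ℂ}
    {A : E → E} {L : E →L[ℂ] E} {x : E} (hA : ∀ y, HasFDerivAt A L y) (hF : AnalyticAt ℂ F (A x))
    (h : ∀ᶠ y in 𝓝 x, F (A y) = F y) (u v : E) :
    fderiv ℂ (fderiv ℂ F) (A x) (L u) (L v) = fderiv ℂ (fderiv ℂ F) x u v := by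
  have h1 : (fun y => (fderiv ℂ F (A y)).comp L) =ᶠ[𝓝 x] fderiv ℂ F := by
    filter_upwards [h.eventually_nhds,
      (hA x).continuousAt.eventually hF.eventually_analyticAt] with y hy hFy
    exact ((hFy.differentiableAt.hasFDerivAt.comp y (hA y)).congr_of_eventuallyEq
      (hy.mono fun z hz => hz.symm)).fderiv.symm
  have h2 : HasFDerivAt (fun y => fderiv ℂ F (A y)) ((fderiv ℂ (fderiv ℂ F) (A x)).comp L) x :=
    hF.fderiv.differentiableAt.hasFDerivAt.comp x (hA x)
  have h3 : HasFDerivAt (fun y => (fderiv ℂ F (A y)).comp L) (((compL ℂ E E ℂ).flip L).comp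
    ((fderiv ℂ (fderiv ℂ F) (A x)).comp L)) x := ((compL ℂ E E ℂ).flip L).hasFDerivAt.comp x h2
  have h4 := (h3.congr_of_eventuallyEq h1.symm).fderiv
  rw [h4]
  rfl

/-- The linear part of `rotC`. -/
def rotCL (φ ψ : ℝ) : Ξ →L[ℂ] Ξ := (ContinuousLinearMap.id ℂ _).prodMap ((ContinuousLinearMap.id ℂ
    _).prodMap ((rotE φ ψ).prodMap (rotE (-φ) (-ψ))))

theorem hasFDerivAt_rotC (φ ψ : ℝ) (x : Ξ) : HasFDerivAt (rotC φ ψ) (rotCL φ ψ) x := by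
  have e : rotC φ ψ = fun x :
    Ξ => rotCL φ ψ x + ((0, fun i => ((φ + ψ * (ι i).1 : ℝ) : ℂ), 0) : Ξ) := by
    funext y
    exact Prod.ext (add_zero _).symm (Prod.ext rfl (add_zero _).symm)
  rw [e]
  exact (rotCL φ ψ).hasFDerivAt.add_const _

theorem hasFDerivAt_shiftAngle (k : Fin 2 → ℤ) (x : Ξ) :
    HasFDerivAt (shiftAngle k) (ContinuousLinearMap.id ℂ Ξ) x := by
  have e : shiftAngle k = fun x : Ξ => x + ((0, fun i => 2 * Real.pi * (k i : ℂ), 0) : Ξ) := by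
    funext y
    exact Prod.ext (add_zero _).symm (Prod.ext rfl (add_zero _).symm)
  rw [e]
  exact (hasFDerivAt_id x).add_const _

theorem rotE_single (φ ψ : ℝ) (α : Ell p q) :
    rotE φ ψ (single α.toExt : 𝓩) = rotMul φ ψ α.1 • single α.toExt := by
  refine ZSpace.ext_ell_hyp (fun β => ?_) (fun i => ?_)
  · rw [rotE_ell, WSeq.smul_apply]
    by_cases h : β = α
    · rw [h]
    · rw [single_of_ne fun h' => h (Ell.toExt_injective h'), mul_zero, mul_zero]
  · rw [rotE_hyp, WSeq.smul_apply, single_of_ne (toExt_ne_hyp α i).symm, mul_zero]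

theorem integral_exp_Icc (n : ℤ) (hn : n ≠ 0) :
    ∫ t in Set.Icc (0 : ℝ) (2 * Real.pi), exp (-(I * (n * (t : ℂ)))) = 0 := by
  rw [integral_Icc_eq_integral_Ioc, ← intervalIntegral.integral_of_le (by positivity)]
  have hc : -(I * (n : ℂ)) ≠ 0 :=
    neg_ne_zero.2 (mul_ne_zero Complex.I_ne_zero (by exact_mod_cast hn))
  have e : ∀ t : ℝ, exp (-(I * (n * (t : ℂ)))) = exp (-(I * (n : ℂ)) * t) :=
    fun t => by congr 1; ring
  simp only [e]
  rw [integral_exp_mul_complex hc]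
  have h1 : exp (-(I * (n : ℂ)) * ((2 * Real.pi : ℝ) : ℂ)) = 1 :=
    Complex.exp_eq_one_iff.2 ⟨-n, by push_cast; ring⟩
  rw [h1]
  simp

namespace IsGood

variable {F : C2 → Coord p q s → ℂ}
  {Γ : C2 → Coord p q s → ZSpace p q s × ZSpace p q s} {B : ℝ}

theorem real_angle_mem (θ : Fin 2 → ℝ) : ((0, fun i => (θ i : ℂ), 0) : Ξ) ∈ Ω := by
  have h := Real.exp_pos (-(1 / 2))
  refine ⟨?_, fun i => ?_, ?_⟩
  · change ‖(0 : C2)‖ < _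
    rw [norm_zero]; positivity
  · change |((θ i : ℂ)).im| < _
    rw [Complex.ofReal_im, abs_zero]; norm_num
  · change ‖(0 : 𝓩 × 𝓩)‖ < _
    rw [norm_zero]; positivity

/-- By the rotation symmetry, an elliptic entry of the Hessian at `(0, θ, 0)` is a multiple of a
single exponential. -/
theorem hessEntry_angle (h : IsGood F Γ B) (hρ : ρ ∈ paramC) (α β : Ell p q) (θ : Fin 2 → ℝ) :
    hessEntry (F ρ) (0, fun i => (θ i : ℂ), 0) α β = hessEntry (F ρ) (0, fun _ => ((0 : ℝ) : ℂ),
    0) α β * exp (-(I * (((α.1.1 - β.1.1 : ℤ) : ℂ) / ((p - q : ℤ) : ℂ) * (θ 0 - θ 1)))) := by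
  have hpq' : ((p : ℝ) - q) ≠ 0 := sub_ne_zero.2 (by exact_mod_cast hpq.out)
  set ψ := (θ 0 - θ 1) / ((p : ℝ) - q) with hψ
  set φ := θ 0 - ψ * p with hφ
  have hx0 := real_angle_mem (p := p) (q := q) (s := s) (fun _ => 0)
  have hx := real_angle_mem (p := p) (q := q) (s := s) θ
  have eR : rotC φ ψ ((0, fun _ => ((0 : ℝ) : ℂ), 0) : Ξ) = (0, fun i => (θ i : ℂ), 0) := by
    refine Prod.ext rfl (Prod.ext (funext fun i => ?_) ?_)
    · change ((0 : ℝ) : ℂ) + ((φ + ψ * (ι i).1 : ℝ) : ℂ) = (θ i : ℂ)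
      rw [← Complex.ofReal_add, zero_add]
      congr 1
      fin_cases i
      · change φ + ψ * (p : ℝ) = θ 0
        rw [hφ]; ring
      · change φ + ψ * (q : ℝ) = θ 1
        have : ψ * ((p : ℝ) - q) = θ 0 - θ 1 := div_mul_cancel₀ _ hpq'
        rw [hφ]; linarith
    · exact Prod.ext (map_zero _) (map_zero _)
  have hF : AnalyticAt ℂ (F ρ) (rotC φ ψ ((0, fun _ => ((0 : ℝ) : ℂ), 0) : Ξ)) := by
    rw [eR]; exact analyticAt_right (h.analytic ρ hρ _ hx)
  have key := snd_fderiv_affine (hasFDerivAt_rotC φ ψ) hF (by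
    filter_upwards [isOpen_domPhi.mem_nhds hx0] with y hy
    exact h.rot ρ hρ y hy φ ψ) (eZeta α.toExt) (eZetaBar β.toExt)
  have e1 : rotCL φ ψ (eZeta α.toExt : Ξ) = rotMul φ ψ α.1 • eZeta α.toExt := by
    refine Prod.ext (smul_zero _).symm (Prod.ext (smul_zero _).symm (Prod.ext ?_ ?_))
    · exact rotE_single φ ψ α
    · exact (map_zero (rotE (-φ) (-ψ))).trans (smul_zero (rotMul φ ψ α.1)).symm
  have e2 : rotCL φ ψ (eZetaBar β.toExt : Ξ) = rotMul (-φ) (-ψ) β.1 • eZetaBar β.toExt := by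
    refine Prod.ext (smul_zero _).symm (Prod.ext (smul_zero _).symm (Prod.ext ?_ ?_))
    · exact (map_zero (rotE φ ψ)).trans (smul_zero (rotMul (-φ) (-ψ) β.1)).symm
    · exact rotE_single (-φ) (-ψ) β
  rw [eR, e1, e2, map_smul, map_smul, smul_apply, smul_eq_mul, smul_eq_mul,
    ← h.hessEntry_eq hρ hx, ← h.hessEntry_eq hρ hx0] at key
  rw [← key]
  have hE : rotMul φ ψ α.1 * rotMul (-φ) (-ψ) β.1 * exp
    (-(I * (((α.1.1 - β.1.1 : ℤ) : ℂ) / ((p - q : ℤ) : ℂ) * (θ 0 - θ 1)))) = 1 := by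
    have hψ' : (ψ : ℂ) = (θ 0 - θ 1) / (p - q) := by rw [hψ]; push_cast; rfl
    rw [rotMul, rotMul, ← exp_add, ← exp_add, Complex.exp_eq_one_iff]
    refine ⟨0, ?_⟩
    push_cast
    rw [hψ']
    ring
  linear_combination -hessEntry (F ρ) (0, fun i => (θ i : ℂ), 0) α β * hE

theorem hessEntry_periodic (h : IsGood F Γ B) (hρ : ρ ∈ paramC) (α β : Ell p q)
    (hH : hessEntry (F ρ) (0, fun _ => ((0 : ℝ) : ℂ), 0) α β ≠ 0) :
    ∃ c : ℤ, α.1.1 - β.1.1 = c * (p - q) := by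
  have hx0 := real_angle_mem (p := p) (q := q) (s := s) (fun _ => 0)
  have hx := real_angle_mem (p := p) (q := q) (s := s) ![2 * Real.pi, 0]
  have eR : shiftAngle ![1, 0] ((0, fun _ => ((0 : ℝ) : ℂ), 0) : Ξ) =
    (0, fun i => ((![2 * Real.pi, 0] : Fin 2 → ℝ) i : ℂ), 0) := by
    refine Prod.ext rfl (Prod.ext (funext fun i => ?_) rfl)
    fin_cases i <;> simp [shiftAngle]
  have hF : AnalyticAt ℂ (F ρ) (shiftAngle ![1, 0] ((0, fun _ => ((0 : ℝ) : ℂ), 0) : Ξ)) := by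
    rw [eR]; exact analyticAt_right (h.analytic ρ hρ _ hx)
  have key := snd_fderiv_affine (hasFDerivAt_shiftAngle ![1, 0]) hF (by
    filter_upwards [isOpen_domPhi.mem_nhds hx0] with y hy
    exact h.periodic ρ hρ y hy _) (eZeta α.toExt) (eZetaBar β.toExt)
  rw [eR, ContinuousLinearMap.id_apply, ContinuousLinearMap.id_apply, ← h.hessEntry_eq hρ hx,
    ← h.hessEntry_eq hρ hx0, h.hessEntry_angle hρ α β ![2 * Real.pi, 0]] at key
  have h1 := mul_left_cancel₀ hH (key.trans (mul_one _).symm)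
  obtain ⟨n, hn⟩ := Complex.exp_eq_one_iff.1 h1
  refine ⟨-n, ?_⟩
  have hpq' : (((p - q : ℤ) : ℂ)) ≠ 0 := by exact_mod_cast sub_ne_zero.2 hpq.out
  have hpi : (2 * (Real.pi : ℂ) * I) ≠ 0 := Complex.two_pi_I_ne_zero
  have h2 : ((α.1.1 - β.1.1 : ℤ) : ℂ) / ((p - q : ℤ) : ℂ) = -n := by
    refine mul_right_cancel₀ hpi ?_
    simp only [Matrix.cons_val_zero, Matrix.cons_val_one, Matrix.cons_val_fin_one] at hn
    push_cast at hn ⊢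
    linear_combination -hn
  rw [div_eq_iff hpq'] at h2
  exact_mod_cast h2

/-- A monomial `e^{ik·θ} ζ_α ζ̄_β` that occurs in the jet satisfies `j_α - j_β = k₂ (p - q)`. -/
theorem jetCoeff_ne_zero (h : IsGood F Γ B) (hρ : ρ ∈ paramC) (α β : Ell p q) (k : Fin 2 → ℤ)
    (hk : jetCoeff (F ρ) k α β ≠ 0) : α.1.1 - β.1.1 = k 1 * (p - q) ∧ k 0 = -k 1 := by
  set H := hessEntry (F ρ) (0, fun _ => ((0 : ℝ) : ℂ), 0) α β with hHdef
  have hH : H ≠ 0 := fun h0 => hk (by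
    unfold jetCoeff
    refine integral_eq_zero_of_ae (Eventually.of_forall fun θ => ?_)
    change _ * hessEntry (F ρ) (0, fun i => (θ i : ℂ), 0) α β = 0
    rw [h.hessEntry_angle hρ α β θ, ← hHdef, h0, zero_mul, mul_zero])
  obtain ⟨c, hc⟩ := h.hessEntry_periodic hρ α β hH
  have hpq' : (((p - q : ℤ) : ℂ)) ≠ 0 := by exact_mod_cast sub_ne_zero.2 hpq.out
  set n : Fin 2 → ℤ := ![k 0 + c, k 1 - c] with hn
  have e : ∀ θ : Fin 2 → ℝ, exp (-(I * ∑ i, (k i : ℂ) * (θ i : ℂ))) * hessEntry (F ρ) (0, (fun i =>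
    (θ i : ℂ)), 0) α β = H * ∏ i, exp (-(I * (n i * (θ i : ℂ)))) := fun θ => by
    rw [h.hessEntry_angle hρ α β θ, hc, Fin.sum_univ_two, Fin.prod_univ_two, Int.cast_mul,
      mul_div_cancel_right₀ _ hpq', mul_left_comm, ← exp_add, ← exp_add]
    congr 2
    simp only [hn, Matrix.cons_val_zero, Matrix.cons_val_one, Matrix.cons_val_fin_one]
    push_cast
    ring
  have e2 : jetCoeff (F ρ) k α β = H * ∏ i, ∫ t in Set.Icc (0 : ℝ) (2 * Real.pi),
    exp (-(I * (n i * (t : ℂ)))) := by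
    unfold jetCoeff
    simp only [e]
    rw [integral_const_mul]
    congr 1
    rw [← integral_fintype_prod_eq_prod]
    congr 1
    rw [← Measure.restrict_pi_pi, Set.pi_univ_Icc]
    rfl
  rw [e2, Fin.prod_univ_two] at hk
  have hn0 : n 0 = 0 := by
    by_contra h0
    exact hk (by rw [integral_exp_Icc _ h0, zero_mul, mul_zero])
  have hn1 : n 1 = 0 := by
    by_contra h0
    exact hk (by rw [integral_exp_Icc _ h0, mul_zero, mul_zero])
  simp only [hn, Matrix.cons_val_zero, Matrix.cons_val_one, Matrix.cons_val_fin_one] at hn0 hn1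
  have : c = k 1 := by linarith
  exact ⟨by rw [hc, this], by linarith⟩

/-- As `j_α = ± j_β` in a cluster, an occurring monomial with `k ≠ 0` has `2 |j_α| = |k₂| |p - q|`. -/
theorem memTRes (h : IsGood F Γ B) {σ μ : ℝ} (hσ : σ ≤ 1 / 4) (hμ : 0 < μ)
    (hμ' : μ ≤ Real.exp (-(1 / 2)) / 4) : MemTRes (s := s) σ μ (fun ρ => F (cparam ρ)) := by
  refine ⟨h.memT hσ hμ hμ', |(p : ℝ) - q|, fun ρ hρ k hk0 α β hαβ hk => Or.inr ?_⟩
  obtain ⟨h1, h2⟩ := h.jetCoeff_ne_zero (cparam_mem hρ) α β k hk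
  have hk1 : k 1 ≠ 0 := fun h0 => hk0 (funext fun i => by
    fin_cases i
    · change k 0 = 0
      rw [h2, h0, neg_zero]
    · exact h0)
  have hne : α.1.1 - β.1.1 ≠ 0 := by
    rw [h1]
    exact mul_ne_zero hk1 (sub_ne_zero.2 hpq.out)
  -- The modes lie in the same cluster, and their wave numbers differ: they are opposite.
  have h3 : β.1.1 = -α.1.1 := by
    rcases abs_eq_abs.1 hαβ with h3 | h3
    · exact absurd (sub_eq_zero.2 h3) hne
    · linarith
  have hα : α.1.1 ≠ 0 := fun h0 => hne (by rw [h3, h0]; simp)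
  have h4 : (ellWeight p q).val α = |((α.1.1 : ℤ) : ℝ)| := by
    refine max_eq_right ?_
    rw [← Int.cast_abs]
    exact_mod_cast Int.one_le_abs hα
  have h5 : 2 * |((α.1.1 : ℤ) : ℝ)| = |(k 1 : ℝ)| * |(p : ℝ) - q| := by
    have h6 : ((α.1.1 : ℤ) : ℝ) - ((β.1.1 : ℤ) : ℝ) = (k 1 : ℝ) * ((p : ℝ) - q) := by
      exact_mod_cast h1
    rw [h3] at h6
    rw [← abs_mul, ← h6]
    push_cast
    rw [sub_neg_eq_add, ← two_mul, abs_mul, abs_two]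
  have h6 : |(k 1 : ℝ)| ≤ ‖k‖ := by
    have := norm_le_pi_norm k 1
    rwa [Int.norm_eq_abs] at this
  rw [h4]
  have := abs_nonneg ((α.1.1 : ℤ) : ℝ)
  have := mul_le_mul_of_nonneg_right h6 (abs_nonneg ((p : ℝ) - q))
  linarith

end IsGood

/-! ### Functions of the modes as functions of the coordinates -/

/-- In the elliptic directions `psi ρ` is affine. -/
theorem psi_add_ell (ρ : C2) (x : Ξ) (α β : Ell p q) (t t' : ℂ) : psi ρ (x +
    (t • eZeta α.toExt + t' • eZetaBar β.toExt)) = psi ρ x + (t • single α.1, t' • single β.1) := by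
  set y : Ξ := x + (t • eZeta α.toExt + t' • eZetaBar β.toExt) with hy
  have y1 : y.1 = x.1 := by rw [hy]; funext i; simp [eZeta, eZetaBar]
  have y2 : y.2.1 = x.2.1 := by rw [hy]; funext i; simp [eZeta, eZetaBar]
  have z1 : y.2.2.1 = x.2.2.1 + t • single α.toExt := by rw [hy]; simp [eZeta, eZetaBar]
  have z2 : y.2.2.2 = x.2.2.2 + t' • single β.toExt := by rw [hy]; simp [eZeta, eZetaBar]
  have hh : ∀ (γ : Ell p q) i, (single γ.toExt : 𝓩) (η i) = 0 := fun γ i =>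
    single_of_ne (toExt_ne_hyp γ i).symm
  have hr : ∀ (c c' : ℂ) (ζ : 𝓩) (γ : Ell p q), hypRot c x.2.1 (ζ + c' • single γ.toExt) =
    hypRot c x.2.1 ζ + c' • single γ.toExt := fun c c' ζ γ => by
    simp only [hypRot, WSeq.add_apply, WSeq.smul_apply, hh, mul_zero, add_zero]
    abel
  have hi : ∀ (γ : Ell p q) i, (single γ.1 : MSeq s) (ι i) = 0 := fun γ i => single_of_ne (by
      fin_cases i
      · exact fun e => γ.2.1 (congrArg Prod.fst e).symm
      · exact fun e => γ.2.2 (congrArg Prod.fst e).symm)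
  have hA : ∀ i, act ρ y i = act ρ x i := fun i => by
    rw [act, act, y1, z1, z2, WSeq.add_apply, WSeq.add_apply, WSeq.smul_apply, WSeq.smul_apply, hh,
      hh, mul_zero, mul_zero, add_zero, add_zero]
  have e := pullE_psi ρ y
  have e' := pullE_psi ρ x
  have hs2 : ∀ γ : Ell p q, pullE (single γ.1 : MSeq s) = (single γ.toExt : 𝓩) := fun γ => by
    refine Subtype.ext (funext fun δ => ?_)
    rw [pullE_apply]
    by_cases h : δ = γ.toExt
    · rw [h]
      exact (single_same γ.1).trans (single_same γ.toExt).symm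
    · rw [single_of_ne h]
      exact single_of_ne fun e => h (Subtype.ext e)
  rw [y2, z1, z2, hr, hr, ← e'.1, ← e'.2, ← hs2, ← hs2, ← map_smul, ← map_smul, ← map_add,
    ← map_add] at e
  refine PSpace.ext_modes (p := p) (q := q) (fun γ => ?_) (fun γ => ?_) (fun i => ?_) (fun i => ?_)
  · exact congrArg (fun z : 𝓩 => z γ) e.1
  · exact congrArg (fun z : 𝓩 => z γ) e.2
  · rw [(psi_int ρ y i).1, hA, y2, ← (psi_int ρ x i).1]
    exact ((congrArg (fun z => (psi ρ x).1 (ι i) + t * z) (hi α i)).trans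
      (by rw [mul_zero, add_zero])).symm
  · rw [(psi_int ρ y i).2, hA, y2, ← (psi_int ρ x i).2]
    exact ((congrArg (fun z => (psi ρ x).2 (ι i) + t' * z) (hi β i)).trans
      (by rw [mul_zero, add_zero])).symm

theorem fderiv_psi_ell (hρ : ρ ∈ paramC) (hx : x ∈ Ω) (α β : Ell p q) (c c' : ℂ) : fderiv ℂ (psi ρ)
    x (c • eZeta α.toExt + c' • eZetaBar β.toExt) = (c • single α.1, c' • single β.1) := by
  have h := (analyticAt_psi_right hρ hx).differentiableAt.hasFDerivAt.hasLineDerivAt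
    (c • eZeta α.toExt + c' • eZetaBar β.toExt)
  have e : (fun t : ℂ => psi ρ (x + t • (c • eZeta α.toExt + c' • eZetaBar β.toExt))) = fun t : ℂ =>
    psi ρ x + t • ((c • single α.1, c' • single β.1) : Λ) := by
    funext t
    rw [smul_add, smul_smul, smul_smul, psi_add_ell, mul_smul, mul_smul]
    rfl
  have h' := (hasDerivAt_id (0 : ℂ)).smul_const ((c • single α.1, c' • single β.1) : Λ)
  rw [one_smul] at h'
  exact HasDerivAt.unique (by simpa only [HasLineDerivAt, e, id] using h) (by simpa only [id] using h'.const_add (psi ρ x))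

/-- A family of functions of the modes that is invariant under the rotations `rot` is a good
function of the coordinates. Only its gradient in the elliptic directions is a restriction of the
gradient with respect to the modes. -/
theorem isGood_comp {W : C2 → Λ → ℂ} {G : C2 → Λ → Λ} {a B B' : ℝ} {U : Set Λ} (ha : 0 ≤ a)
    (hU : ∀ ρ ∈ paramC, ∀ x ∈ Ω, (a : ℂ) • psi ρ x ∈ U)
    (hW : ∀ ρ ∈ paramC, ∀ w ∈ U, AnalyticAt ℂ (fun y : C2 × Λ => W y.1 y.2) (ρ, w))
    (hG : ∀ ρ ∈ paramC, ∀ w ∈ U, AnalyticAt ℂ (fun y : C2 × Λ => G y.1 y.2) (ρ, w))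
    (hd : ∀ ρ ∈ paramC, ∀ w ∈ U, HasFDerivAt (W ρ) (beta (G ρ w)) w) (hB : ∀ ρ ∈ paramC, ∀ x ∈ Ω,
    ‖W ρ ((a : ℂ) • psi ρ x)‖ ≤ B) (hB' : ∀ ρ ∈ paramC, ∀ x ∈ Ω, ‖G ρ ((a : ℂ) • psi ρ x)‖ ≤ B')
    (hr : ∀ ρ ∈ paramD, ∀ w ∈ U, IsRealPoint w → (W (cparam ρ) w).im = 0)
    (hrot : ∀ ρ ∈ paramC, ∀ w ∈ U, ∀ φ ψ, W ρ (rot s φ ψ w) = W ρ w) :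
    ∃ Γ, IsGood (fun ρ (x : Ξ) => W ρ ((a : ℂ) • psi ρ x)) Γ (max B (a * B')) := by
  have hψ : ∀ ρ ∈ paramC, ∀ x ∈ Ω, AnalyticAt ℂ (fun y : C2 × Ξ => (y.1, (a : ℂ) • psi y.1 y.2)) (ρ,
    x) := fun ρ hρ x hx => analyticAt_fst.prod (analyticAt_const_smul _ (analyticAt_psi hρ hx))
  have hf : ∀ ρ ∈ paramC, ∀ x ∈ Ω, ∀ v, fderiv ℂ (fun x => W ρ ((a : ℂ) • psi ρ x)) x v =
    beta (G ρ ((a : ℂ) • psi ρ x)) ((a : ℂ) • fderiv ℂ (psi ρ) x v) := fun ρ hρ x hx v => by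
      have h1 : HasFDerivAt (fun x => (a : ℂ) • psi ρ x) ((a : ℂ) • fderiv ℂ (psi ρ) x) x :=
        (analyticAt_psi_right hρ hx).differentiableAt.hasFDerivAt.const_smul (a : ℂ)
      exact congrArg (fun L : Ξ →L[ℂ] ℂ => L v) ((hd ρ hρ _ (hU ρ hρ x hx)).comp x h1).fderiv
  refine ⟨fun ρ x => (a : ℂ) • (pullE (G ρ ((a : ℂ) • psi ρ x)).1, pullE (G ρ ((a : ℂ) •
    psi ρ x)).2), fun ρ hρ x hx => ?_, fun ρ hρ x hx => (hB ρ hρ x hx).trans (le_max_left _ _),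
    fun ρ hρ x hx => ?_, fun ρ hρ x hx => le_trans ?_ (le_max_right _ _), fun ρ hρ x hx α => ?_,
    fun ρ hρ x hx α => ?_, fun ρ hρ x hx k => ?_, fun ρ hρ x hx h => ?_, fun ρ hρ x hx φ ψ => ?_⟩
  · exact (hW ρ hρ _ (hU ρ hρ x hx)).fun_comp_of_eq (hψ ρ hρ x hx) rfl
  · have h1 := (hG ρ hρ _ (hU ρ hρ x hx)).fun_comp_of_eq (hψ ρ hρ x hx) rfl
    refine analyticAt_const_smul _ (AnalyticAt.prod ?_ ?_)
    · exact ((pullE).analyticAt _).comp (((fst ℂ (MSeq s) (MSeq s)).analyticAt _).comp h1)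
    · exact ((pullE).analyticAt _).comp (((snd ℂ (MSeq s) (MSeq s)).analyticAt _).comp h1)
  · rw [norm_smul, Complex.norm_real, Real.norm_of_nonneg ha]
    refine mul_le_mul_of_nonneg_left (le_trans (max_le ?_ ?_) (hB' ρ hρ x hx)) ha
    · exact (norm_pullE_le _).trans (norm_fst_le _)
    · exact (norm_pullE_le _).trans (norm_snd_le _)
  · have h1 := fderiv_psi_ell hρ hx α α 1 0
    rw [one_smul, zero_smul, add_zero, one_smul, zero_smul] at h1
    rw [hf ρ hρ x hx, h1, map_smul, beta_single_fst]
    rfl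
  · have h1 := fderiv_psi_ell hρ hx α α 0 1
    rw [one_smul, zero_smul, zero_add, one_smul, zero_smul] at h1
    rw [hf ρ hρ x hx, h1, map_smul, beta_single_snd]
    rfl
  · rw [psi_shiftAngle]
  · refine hr ρ hρ _ (hU _ (cparam_mem hρ) x hx) fun α => ?_
    have h1 := psi_real hρ hx h α
    change (a : ℂ) * (psi (cparam ρ) x).2 α = conj ((a : ℂ) * (psi (cparam ρ) x).1 α)
    rw [h1, map_mul, Complex.conj_ofReal]
  · rw [psi_rotC, ← map_smul, hrot ρ hρ _ (hU ρ hρ x hx)]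

theorem norm_Psi_le {M : ℝ} (hM : ∀ ρ ∈ paramC, ∀ x ∈ Ω, ‖psi ρ x‖ ≤ M) (ν : ℝ) (hρ : ρ ∈ paramC)
    (hx : x ∈ Ω) : ‖Psi ν ρ x‖ ≤ √ν * M := by
  rw [norm_smul, Complex.norm_real, Real.norm_of_nonneg (Real.sqrt_nonneg ν)]
  exact mul_le_mul_of_nonneg_left (hM ρ hρ x hx) (Real.sqrt_nonneg ν)

/-- The normal form at the distance `ν^{1/2}` from the origin. -/
theorem IsNormalForm.isGood {g : (Fin 4 → ℂ) → ℂ} {ε C M ν : ℝ} {τ : Λ → Λ} {W : Λ → ℂ} {G : Λ → Λ}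
    (h : IsNormalForm g ε C τ W G) (hU : ∀ ρ ∈ paramC, ∀ x ∈ Ω, Psi ν ρ x ∈ ball 0 ε)
    (hM : ∀ ρ ∈ paramC, ∀ x ∈ Ω, ‖psi ρ x‖ ≤ M) (hM1 : 1 ≤ M) :
    ∃ Γ, IsGood (fun ρ (x : Ξ) => W (Psi ν ρ x)) Γ (C * M ^ 5 * √ν ^ 5) := by
  have ha := Real.sqrt_nonneg ν
  have hC := h.C_nonneg
  obtain ⟨Γ, h1⟩ := isGood_comp (W := fun _ => W) (G := fun _ => G) ha hU (fun ρ _ w hw =>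
    (h.isGrad.analytic w hw).fun_comp_of_eq analyticAt_snd rfl) (fun ρ _ w hw =>
    (h.isGrad.analytic_grad w hw).fun_comp_of_eq analyticAt_snd rfl) (fun ρ _ w hw =>
    h.isGrad.hasFDerivAt w hw) (fun ρ hρ x hx => (h.norm_le _ (hU ρ hρ x hx)).trans
    (mul_le_mul_of_nonneg_left (pow_le_pow_left₀ (norm_nonneg _) (norm_Psi_le hM ν hρ hx) 5) hC))
    (fun ρ hρ x hx => (h.norm_grad_le _ (hU ρ hρ x hx)).trans (mul_le_mul_of_nonneg_left
    (pow_le_pow_left₀ (norm_nonneg _) (norm_Psi_le hM ν hρ hx) 4) hC)) (fun ρ _ w hw hr =>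
    h.real w hw hr) (fun ρ _ w hw => h.rot w hw)
  refine ⟨Γ, h1.mono (max_le (le_of_eq (by ring)) ?_)⟩
  calc √ν * (C * (√ν * M) ^ 4) = C * √ν ^ 5 * M ^ 4 := by ring
    _ ≤ C * √ν ^ 5 * M ^ 5 :=
      mul_le_mul_of_nonneg_left (pow_le_pow_right₀ hM1 (by norm_num)) (by positivity)
    _ = _ := by ring

/-! ### The quartic resonant part -/

/-- Multiplication of `a` by `ρ₂` and of `b` by `ρ₁`. -/
def actD (s : ℝ) (ρ : C2) : MSeq s →L[ℂ] MSeq s :=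
  ρ 1 • (modeIncl s true).comp (modeComp s true) + ρ 0 • (modeIncl s false).comp (modeComp s false)

theorem actD_apply (ρ : C2) (x : MSeq s) (α : Mode) :
    actD s ρ x α = (if α.2 then ρ 1 else ρ 0) * x α := by
  obtain ⟨j, b⟩ := α
  change ρ 1 * modeIncl s true (modeComp s true x) (j, b) +
    ρ 0 * modeIncl s false (modeComp s false x) (j, b) = _
  cases b
  · rw [modeIncl_apply, modeIncl_apply_ne (by decide), mul_zero, zero_add]
    rfl
  · rw [modeIncl_apply, modeIncl_apply_ne (by decide), mul_zero, add_zero]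
    rfl

/-- `Z₄` without the terms `∑ (ρ₂ a_j ā_j + ρ₁ b_j b̄_j) - ρ₁ρ₂`. Its expansion up to degree two in the
displacement from the torus of the actions `ρ` is `cross`. -/
def resFun (ρ : C2) (w : Λ) : ℂ := quartP resMult w - dotM (actD s ρ w.1) w.2 + ρ 0 * ρ 1

/-- The gradient of `resFun ρ`. -/
def resGrad (ρ : C2) (w : Λ) : Λ := quartGrad resMult w - (actD s ρ w.2, actD s ρ w.1)

theorem dotM_actD (ρ : C2) (x y : MSeq s) : dotM (actD s ρ x) y = dotM (actD s ρ y) x := by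
  rw [dotM_apply, dotM_apply]
  refine tsum_congr fun α => ?_
  rw [actD_apply, actD_apply]
  ring

theorem hasFDerivAt_resFun (ρ : C2) (w : Λ) : HasFDerivAt (resFun ρ) (beta (resGrad ρ w)) w := by
  let L : Λ →L[ℂ] MSeq s →L[ℂ] ℂ := (dotM).comp ((actD s ρ).comp (fst ℂ _ _))
  have h1 : HasFDerivAt (fun w : Λ => dotM (actD s ρ w.1)) L w := L.hasFDerivAt
  have h := (((isGrad_quart resMult).hasFDerivAt w (mem_univ w)).sub
    (h1.clm_apply (snd ℂ _ _).hasFDerivAt)).add_const (ρ 0 * ρ 1)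
  refine h.congr_fderiv (ContinuousLinearMap.ext fun u => ?_)
  change beta (quartGrad resMult w) u - (dotM (actD s ρ w.1) u.2 + dotM (actD s ρ u.1) w.2) =
    beta (quartGrad resMult w - _) u
  rw [map_sub, sub_apply, beta_apply (actD s ρ w.2, actD s ρ w.1), dotM_actD ρ u.1]
  ring

theorem analyticAt_actD (ρ : C2) : AnalyticAt ℂ (actD s) ρ := by
  let L : C2 →L[ℂ] MSeq s →L[ℂ] MSeq s := (proj 1).smulRight ((modeIncl s true).comp (modeComp s
    true)) + (proj 0).smulRight ((modeIncl s false).comp (modeComp s false))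
  exact L.analyticAt ρ

theorem norm_param_le (hρ : ρ ∈ paramC) (i : Fin 2) : 7 / 10 ≤ (ρ i).re ∧ ‖ρ i‖ ≤ 5 / 2 := by
  have : Fact ((0 : ℤ) ≠ 1) := ⟨zero_ne_one⟩
  have h0 : (0 : Coord 0 1 1) ∈ domPhi 0 1 1 := by
    have := exp_bounds.2.2.2.2
    refine ⟨?_, fun i => ?_, ?_⟩
    · rw [Prod.fst_zero, norm_zero]; nlinarith
    · simp
    · rw [Prod.snd_zero, Prod.snd_zero, norm_zero]; linarith
  have h := act_bounds hρ h0 i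
  have e : act ρ (0 : Coord 0 1 1) i = ρ i := by
    change ρ i + (0 - 0 * 0) = _
    ring
  rwa [e] at h

theorem exists_isGood_resFun : ∃ Γ B, IsGood (fun ρ (x : Ξ) => resFun ρ (psi ρ x)) Γ B := by
  obtain ⟨M, hM1, hM⟩ := exists_psi_bound (s := s) (p := p) (q := q)
  obtain ⟨K, hK, -, hK3, -⟩ := exists_quartGrad_bound (s := s) resMult
  set N := 5 / 2 * (‖(modeIncl s true).comp (modeComp s true)‖ +
    ‖(modeIncl s false).comp (modeComp s false)‖) with hN
  have hN0 : 0 ≤ N := by positivity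
  have hD : ∀ ρ ∈ paramC, ‖actD s ρ‖ ≤ N := fun ρ hρ => by
    refine (norm_add_le _ _).trans ?_
    rw [norm_smul, norm_smul, hN, mul_add]
    exact add_le_add (mul_le_mul_of_nonneg_right (norm_param_le hρ 1).2 (norm_nonneg _))
      (mul_le_mul_of_nonneg_right (norm_param_le hρ 0).2 (norm_nonneg _))
  have hDx : ∀ ρ ∈ paramC, ∀ x : MSeq s, ∀ m, ‖x‖ ≤ m → ‖actD s ρ x‖ ≤ N * m := fun ρ hρ x m hx =>
    ((actD s ρ).le_opNorm x).trans (mul_le_mul (hD ρ hρ) hx (norm_nonneg _) hN0)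
  have hψ : ∀ ρ ∈ paramC, ∀ x ∈ Ω, ‖((1 : ℝ) : ℂ) • psi ρ x‖ ≤ M := fun ρ hρ x hx => by
      rw [Complex.ofReal_one, one_smul]
      exact hM ρ hρ x hx
  have h4 : ∀ w : Λ, 4 * quartP resMult w = beta (quartGrad resMult w) w := fun w => by
      rw [beta_quartGrad]
      unfold quartP
      ring
  have hQ : ∀ w : Λ, ‖w‖ ≤ M → ‖quartP resMult w‖ ≤ ‖beta (s := s)‖ * (K * M ^ 3) * M :=
    fun w hw => by
      have h1 := (beta).le_opNorm₂ (quartGrad resMult w) w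
      rw [← h4, norm_mul, Complex.norm_ofNat] at h1
      have h2 : ‖beta (s := s)‖ * ‖quartGrad resMult w‖ * ‖w‖ ≤ ‖beta (s := s)‖ * (K * M ^ 3) * M := by
        gcongr
        exact (hK3 w).trans (by gcongr)
      linarith [norm_nonneg (quartP resMult w)]
  have h := isGood_comp (p := p) (q := q) (W := (resFun (s := s))) (G := resGrad) (a := 1) (U :=
    univ) (B := ‖beta (s := s)‖ * (K * M ^ 3) * M + ‖dotM (s := s)‖ * (N * M) * M + 5 / 2 * (5 / 2))
    (B' := K * M ^ 3 + N * M) zero_le_one (fun _ _ _ _ => mem_univ _) (fun ρ _ w _ => ?_) (fun ρ _ w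
    _ => ?_) (fun ρ _ w _ => hasFDerivAt_resFun ρ w) (fun ρ hρ x hx => ?_) (fun ρ hρ x hx => ?_)
    (fun ρ hρ w _ hw => ?_) (fun ρ _ w _ φ ψ => ?_)
  · simp only [Complex.ofReal_one, one_smul] at h
    exact h.imp fun _ h => ⟨_, h⟩
  · have hy : AnalyticAt ℂ (fun y : C2 × Λ => y.1) (ρ, w) := analyticAt_fst
    have h1 : AnalyticAt ℂ (fun y : C2 × Λ => dotM (actD s y.1 y.2.1) y.2.2) (ρ, w) :=
      analyticAt_clm_apply (((dotM).analyticAt _).fun_comp_of_eq (analyticAt_clm_apply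
      ((analyticAt_actD ρ).fun_comp_of_eq hy rfl) (analyticAt_fst.fun_comp_of_eq analyticAt_snd
      rfl)) rfl) (analyticAt_snd.fun_comp_of_eq analyticAt_snd rfl)
    exact (((((isGrad_quart resMult).analytic w (mem_univ w)).fun_comp_of_eq analyticAt_snd
      rfl).sub h1).add ((((proj (R := ℂ) (φ := fun _ : Fin 2 => ℂ) 0).analyticAt
        _).comp hy).mul (((proj (R := ℂ) (φ := fun _ : Fin 2 => ℂ) 1).analyticAt
        _).comp hy)))
  · have hy : AnalyticAt ℂ (fun y : C2 × Λ => actD s y.1) (ρ, w) :=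
      (analyticAt_actD ρ).fun_comp_of_eq analyticAt_fst rfl
    exact (((isGrad_quart resMult).analytic_grad w (mem_univ w)).fun_comp_of_eq analyticAt_snd
      rfl).sub ((analyticAt_clm_apply hy (analyticAt_snd.fun_comp_of_eq analyticAt_snd rfl)).prod
      (analyticAt_clm_apply hy (analyticAt_fst.fun_comp_of_eq analyticAt_snd rfl)))
  · have hw := hψ ρ hρ x hx
    refine (norm_add_le _ _).trans (add_le_add
      ((norm_sub_le _ _).trans (add_le_add (hQ _ hw) (((dotM).le_opNorm₂ _ _).trans ?_))) ?_)
    · gcongr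
      · exact hDx ρ hρ _ _ ((norm_fst_le _).trans hw)
      · exact (norm_snd_le _).trans hw
    · rw [norm_mul]
      exact mul_le_mul (norm_param_le hρ 0).2 (norm_param_le hρ 1).2 (norm_nonneg _) (by norm_num)
  · have hw := hψ ρ hρ x hx
    refine (norm_sub_le _ _).trans (add_le_add ((hK3 _).trans (by gcongr)) (max_le ?_ ?_))
    · exact hDx ρ hρ _ _ ((norm_snd_le _).trans hw)
    · exact hDx ρ hρ _ _ ((norm_fst_le _).trans hw)
  · have e : dotM (actD s (cparam ρ) w.1) w.2 =
      ((∑' α, (if α.2 then ρ 1 else ρ 0) * Complex.normSq (w.1 α) : ℝ) : ℂ) := by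
      rw [dotM_apply, Complex.ofReal_tsum]
      refine tsum_congr fun α => ?_
      rw [actD_apply, hw α, mul_assoc, Complex.mul_conj]
      split_ifs <;> push_cast <;> rfl
    rw [resFun, e, Complex.add_im, Complex.sub_im, quartP_real res_swap hw]
    simp
  · rw [resFun, quartP_rot, resFun]
    congr 2
    rw [dotM_apply, dotM_apply]
    refine tsum_congr fun α => ?_
    rw [actD_apply, actD_apply]
    change _ * (rotMul φ ψ α * w.1 α) * (rotMul (-φ) (-ψ) α * w.2 α) = _
    linear_combination ((if α.2 then ρ 1 else ρ 0) * w.1 α * w.2 α) * rotMul_mul_neg φ ψ α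

/-- The coupling `√(ρ₁ρ₂) (b_p a_q + b̄_p ā_q)` of the hyperbolic modes. -/
def cross (ρ : C2) (x : Ξ) : ℂ :=
    ρ 0 ^ ½ * ρ 1 ^ ½ * (x.2.2.1 (η 0) * x.2.2.1 (η 1) + x.2.2.2 (η 0) * x.2.2.2 (η 1))

/-- Inclusion and exclusion for the sum over the triples with `k = i` or `k = j`. -/
theorem hasSum_resonant {A B C D : ℤ → ℂ} (hA : Summable fun j => ‖A j‖)
    (hB : Summable fun j => ‖B j‖) (hC : Summable fun j => ‖C j‖) (hD : Summable fun j => ‖D j‖)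
    {f : Quad → ℂ} (hf : ∀ i j, f (i, j, i) = A i * B j) (hf' : ∀ i j, f (i, j, j) = C j * D i)
    (hAB : Summable fun j => A j * B j) : HasSum (fun t : Quad => if t.2.2 = t.1 ∨ t.2.2 = t.2.1
    then f t else 0) ((∑' j, A j) * (∑' j, B j) + (∑' j, C j) * (∑' j, D j) - ∑' j, A j * B j) := by
  have key : ∀ {T : Type} (φ : T → Quad), φ.Injective → ∀ {P : Quad → Prop} [DecidablePred P], (∀ t,
    P t ↔ t ∈ range φ) → ∀ {z : ℂ}, HasSum (f ∘ φ) z → HasSum (fun t => if P t then f t else 0) z :=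
    fun φ hφ P _ hP z hz => by
    refine (hφ.hasSum_iff fun t ht => if_neg fun h => ht ((hP t).1 h)).1 ?_
    exact hz.congr_fun fun t => if_pos ((hP _).2 ⟨t, rfl⟩)
  have h1 := key (fun u : ℤ × ℤ => (u.1, u.2,
    u.1)) (fun u v h => by simp_all [Prod.ext_iff]) (P := fun t => t.2.2 =
    t.1) (fun t => ⟨fun h => ⟨(t.1, t.2.1), Prod.ext rfl (Prod.ext rfl h.symm)⟩, fun ⟨_, h⟩ => h ▸ rfl⟩) (z := (∑' j, A j) * (∑' j, B j)) (by
      rw [tsum_mul_tsum_of_summable_norm hA hB]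
      exact ((summable_mul_of_summable_norm hA hB).hasSum).congr_fun fun u => hf _ _)
  have h2 := key (fun u : ℤ × ℤ => (u.2, u.1,
    u.1)) (fun u v h => by simp_all [Prod.ext_iff]) (P := fun t => t.2.2 =
    t.2.1) (fun t => ⟨fun h => ⟨(t.2.1, t.1), Prod.ext rfl (Prod.ext rfl h.symm)⟩, fun ⟨_, h⟩ => h ▸ rfl⟩) (z := (∑' j, C j) * (∑' j, D j)) (by
      rw [tsum_mul_tsum_of_summable_norm hC hD]
      exact ((summable_mul_of_summable_norm hC hD).hasSum).congr_fun fun u => hf' _ _)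
  have h3 :=
    key (fun j : ℤ => (j, j, j)) (fun u v h => by simp_all [Prod.ext_iff]) (P := fun t => t.2.2 =
    t.1 ∧ t.2.2 = t.2.1) (fun t => ⟨fun h => ⟨t.2.2, Prod.ext h.1 (Prod.ext h.2 rfl)⟩,
    fun ⟨_, h⟩ => h ▸ ⟨rfl, rfl⟩⟩) (z := ∑' j, A j * B j) (hAB.hasSum.congr_fun fun u => hf _ _)
  refine ((h1.add h2).sub h3).congr_fun fun t => ?_
  by_cases h : t.2.2 = t.1 <;> by_cases h' : t.2.2 = t.2.1 <;> simp [h, h']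

/-- The sum over all `j` except `p` and `q`. -/
def restSum (p q : ℤ) (f : ℤ → ℂ) : ℂ := ∑' j, if j = p ∨ j = q then 0 else f j

theorem tsum_eq_restSum {f : ℤ → ℂ} (hf : Summable f) : ∑' j, f j = f p + f q + restSum p q f := by
  have h1 := hf.sum_add_tsum_compl (s := {p, q})
  have h2 : ∑' j : ↑((({p, q} : Finset ℤ) : Set ℤ)ᶜ), f j = restSum p q f := by
    rw [tsum_subtype, restSum]
    refine tsum_congr fun j => ?_
    by_cases h : j = p ∨ j = q <;> simp [Set.indicator, h]
  rw [← h1, h2, Finset.sum_pair hpq.out]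

theorem summable_modes (x y : MSeq s) (b b' : Bool) :
    Summable fun j : ℤ => ‖x (j, b) * y (j, b')‖ :=
    ((Four.summable_norm (modeComp s b x)).mul_right ‖modeComp s b' y‖).of_nonneg_of_le (fun _ =>
    norm_nonneg _) fun j => by
      rw [norm_mul]
      exact mul_le_mul_of_nonneg_left (Four.norm_apply_le (modeComp s b' y) j) (norm_nonneg _)

theorem summable_modes₄ (w : Λ) : Summable fun j : ℤ => w.1 (j, true) * w.2 (j, true) * (w.1 (j,
    false) * w.2 (j, false)) := (summable_mul_of_summable_norm (summable_modes w.1 w.2 true true)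
    (summable_modes w.1 w.2 false false)).comp_injective (i := fun j : ℤ => (j, j)) fun _ _ h =>
    (Prod.ext_iff.1 h).1

/-- As `k² + l² - i² - j² = 2 (k - i)(k - j)` for `i + j = k + l`, only the monomials
`|a_i|² |b_j|²` and `a_j b̄_j b_i ā_i` are resonant. -/
theorem resFun_eq (ρ : C2) (w : Λ) :
    resFun ρ w = (∑' j, w.1 (j, true) * w.2 (j, true)) * (∑' j, w.1 (j, false) * w.2 (j, false)) +
    (∑' j, w.1 (j, true) * w.2 (j, false)) * (∑' j, w.1 (j, false) * w.2 (j, true)) - (∑' j,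
    w.1 (j, true) * w.2 (j, true) * (w.1 (j, false) * w.2 (j, false))) - (ρ 1 * (∑' j, w.1 (j,
    true) * w.2 (j, true)) + ρ 0 * (∑' j, w.1 (j, false) * w.2 (j, false))) + ρ 0 * ρ 1 := by
  have h := hasSum_resonant (summable_modes w.1 w.2 true true) (summable_modes w.1 w.2 false false)
    (summable_modes w.1 w.2 true false) (summable_modes w.1 w.2 false true)
    (f := fun t => w.1 (t.2.2, true) * w.1 (t.1 + t.2.1 - t.2.2, false) * w.2 (t.1,
    true) * w.2 (t.2.1, false)) (fun i j => by
      rw [add_sub_cancel_left]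
      ring) (fun i j => by
      rw [add_sub_cancel_right]
      ring) (summable_modes₄ w)
  have e : actD s ρ w.1 = ρ 1 • modeIncl s true (modeComp s true w.1) +
    ρ 0 • modeIncl s false (modeComp s false w.1) := rfl
  rw [resFun, ← Z4_eq, e, map_add, map_smul, map_smul, add_apply, smul_apply, smul_apply,
    dotM_modeIncl, dotM_modeIncl, ← h.tsum_eq, smul_eq_mul, smul_eq_mul]
  congr 2
  refine tsum_congr fun t => if_congr ?_ rfl rfl
  have : t.2.2 ^ 2 + (t.1 + t.2.1 - t.2.2) ^ 2 - (t.1 ^ 2 + t.2.1 ^ 2) =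
    2 * ((t.2.2 - t.1) * (t.2.2 - t.2.1)) := by ring
  rw [← sub_eq_zero, this, mul_eq_zero, mul_eq_zero, sub_eq_zero, sub_eq_zero]
  simp

theorem psi_hyp (ρ : C2) (x : Ξ) (i : Fin 2) : (psi ρ x).1 (η i).1 = exp (I * x.2.1 i) * x.2.2.1
    (η i) ∧ (psi ρ x).2 (η i).1 = exp (-(I * x.2.1 i)) * x.2.2.2 (η i) := by
  have e := pullE_psi ρ x
  rw [← pullE_apply, e.1, hypRot_hyp, ← pullE_apply, e.2, hypRot_hyp, neg_mul]
  exact ⟨rfl, rfl⟩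

theorem psi_ell (ρ : C2) (x : Ξ) (α : Ell p q) :
    (psi ρ x).1 α.1 = x.2.2.1 α.toExt ∧ (psi ρ x).2 α.1 = x.2.2.2 α.toExt := by
  have e := pullE_psi ρ x
  have h1 := congrArg (fun z : 𝓩 => z α.toExt) e.1
  have h2 := congrArg (fun z : 𝓩 => z α.toExt) e.2
  exact ⟨h1.trans (hypRot_ell _ _ _ _), h2.trans (hypRot_ell _ _ _ _)⟩

theorem restSum_congr_smul {f g : ℤ → ℂ} (c : ℂ)
    (h : ∀ j, j ≠ p → j ≠ q → g j = c * f j) : restSum p q g = c * restSum p q f := by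
  rw [restSum, restSum, ← tsum_mul_left]
  refine tsum_congr fun j => ?_
  by_cases hj : j = p ∨ j = q
  · rw [if_pos hj, if_pos hj, mul_zero]
  · rw [if_neg hj, if_neg hj, h j (fun e => hj (Or.inl e)) fun e => hj (Or.inr e)]

/-- Up to the coupling of the hyperbolic modes, `resFun` vanishes to third order on the torus:
there it is `(S_a - ρ₁)(S_b - ρ₂)` plus the terms `a_j b̄_j b_i ā_i` with `i ≠ j`, where `S_a` and
`S_b` are the masses of `a` and of `b`. -/
theorem resFun_scaleC (hρ : ρ ∈ paramC) (hx : x ∈ Ω) : ∃ c₁ c₂ c₃ c₄ : ℂ, ∀ t : ℂ,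
    ‖t‖ ≤ 1 → resFun ρ (psi ρ (scaleC x t)) = t ^ 2 * (act ρ (scaleC x t) 0 ^ ½ * act ρ (scaleC x t)
    1 ^ (1 / 2 : ℂ) * (x.2.2.1 (η 0) * x.2.2.1 (η 1) + x.2.2.2 (η 0) * x.2.2.2 (η 1)) +
    t * (act ρ (scaleC x t) 0 ^ ½ * c₁ + act ρ (scaleC x t) 1 ^ ½ * c₂) + t ^ 2 * (c₃ + c₄)) := by
  set R := fun (u v : Mode → ℂ) (b b' : Bool) => restSum p q fun j => u (j, b) * v (j, b') with hR
  set w := psi ρ x with hw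
  set d := x.2.2.1 (η 0) with hd
  set c := x.2.2.1 (η 1) with hc
  set d' := x.2.2.2 (η 0) with hd'
  set c' := x.2.2.2 (η 1) with hc'
  refine ⟨d' * R w.1 w.2 false true + d * R w.1 w.2 true false, c * R w.1 w.2 false true +
    c' * R w.1 w.2 true false, (x.1 0 - d * d' + c * c' + R w.1 w.2 true true) * (x.1 1 - c * c' +
    d * d' + R w.1 w.2 false false), R w.1 w.2 true false * R w.1 w.2 false true - restSum p q
    (fun j => w.1 (j, true) * w.2 (j, true) * (w.1 (j, false) * w.2 (j, false))), fun t ht => ?_⟩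
  have hy := scaleC_mem hx ht
  set y := scaleC x t with hy'
  set v := psi ρ y with hv
  have hA : ∀ i, act ρ y i ^ ½ * act ρ y i ^ ½ = act ρ y i :=
    fun i => cpow_half_sq (act_ne_zero hρ hy i)
  have hA0 : act ρ y 0 = ρ 0 + t ^ 2 * (x.1 0 - d * d') := by
    change ρ 0 + (t ^ 2 * x.1 0 - t * d * (t * d')) = _
    ring
  have hA1 : act ρ y 1 = ρ 1 + t ^ 2 * (x.1 1 - c * c') := by
    change ρ 1 + (t ^ 2 * x.1 1 - t * c * (t * c')) = _
    ring
  have hE : ∀ i, exp (I * y.2.1 i) * exp (-(I * y.2.1 i)) = 1 :=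
    fun i => by rw [← exp_add, add_neg_cancel, exp_zero]
  obtain ⟨ap, ap'⟩ : v.1 (p, true) = _ ∧ v.2 (p, true) = _ := psi_int ρ y 0
  obtain ⟨bq, bq'⟩ : v.1 (q, false) = _ ∧ v.2 (q, false) = _ := psi_int ρ y 1
  obtain ⟨bp, bp'⟩ : v.1 (p, false) = _ * (t * d) ∧ v.2 (p, false) = _ * (t * d') := psi_hyp ρ y 0
  obtain ⟨aq, aq'⟩ : v.1 (q, true) = _ * (t * c) ∧ v.2 (q, true) = _ * (t * c') := psi_hyp ρ y 1
  have hell : ∀ j b, j ≠ p → j ≠ q → v.1 (j, b) = t * w.1 (j, b) ∧ v.2 (j, b) = t * w.2 (j, b) :=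
    fun j b hp hq => by
      have h1 := psi_ell ρ y ⟨(j, b), hp, hq⟩
      have h2 := psi_ell ρ x ⟨(j, b), hp, hq⟩
      exact ⟨h1.1.trans (congrArg (t * ·) h2.1.symm), h1.2.trans (congrArg (t * ·) h2.2.symm)⟩
  have hrest : ∀ b b', R v.1 v.2 b b' = t ^ 2 * R w.1 w.2 b b' := fun b b' =>
    restSum_congr_smul _ fun j hp hq => by
      rw [(hell j b hp hq).1, (hell j b' hp hq).2]
      ring
  have hrest4 : restSum p q (fun j => v.1 (j, true) * v.2 (j, true) *
    (v.1 (j, false) * v.2 (j, false))) = t ^ 4 * restSum p q (fun j => w.1 (j, true) * w.2 (j,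
    true) * (w.1 (j, false) * w.2 (j, false))) := restSum_congr_smul _ fun j hp hq => by
      rw [(hell j true hp hq).1, (hell j false hp hq).2, (hell j true hp hq).2,
        (hell j false hp hq).1]
      ring
  have hsplit : ∀ b b', ∑' j, v.1 (j, b) * v.2 (j, b') = v.1 (p, b) * v.2 (p, b') + v.1 (q, b) * v.2
    (q, b') + t ^ 2 * R w.1 w.2 b b' := fun b b' => by
    rw [← hrest]
    exact tsum_eq_restSum (summable_modes v.1 v.2 b b').of_norm
  rw [resFun_eq, hsplit, hsplit, hsplit, hsplit, tsum_eq_restSum (p := p) (q := q) (summable_modes₄ v),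
    hrest4, ap, ap', bq, bq', bp, bp', aq, aq']
  set E0 := exp (I * y.2.1 0)
  set E0' := exp (-(I * y.2.1 0))
  set E1 := exp (I * y.2.1 1)
  set E1' := exp (-(I * y.2.1 1))
  set r0 := act ρ y 0 ^ ½
  set r1 := act ρ y 1 ^ ½
  have e0 : E0 * E0' = 1 := hE 0
  have e1 : E1 * E1' = 1 := hE 1
  have a0 := (hA 0).trans hA0
  have a1 := (hA 1).trans hA1
  have k1 : r0 * E0 * (r0 * E0') = ρ 0 + t ^ 2 * (x.1 0 - d * d') := by
    linear_combination a0 + r0 * r0 * e0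
  have k2 : r1 * E1 * (r1 * E1') = ρ 1 + t ^ 2 * (x.1 1 - c * c') := by
    linear_combination a1 + r1 * r1 * e1
  have k3 : E1 * (t * c) * (E1' * (t * c')) = t ^ 2 * (c * c') := by
    linear_combination t ^ 2 * c * c' * e1
  have k4 : E0 * (t * d) * (E0' * (t * d')) = t ^ 2 * (d * d') := by
    linear_combination t ^ 2 * d * d' * e0
  have k5 : r0 * E0 * (E0' * (t * d')) = t * (r0 * d') := by linear_combination t * r0 * d' * e0
  have k6 : E1 * (t * c) * (r1 * E1') = t * (r1 * c) := by linear_combination t * r1 * c * e1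
  have k7 : E0 * (t * d) * (r0 * E0') = t * (r0 * d) := by linear_combination t * r0 * d * e0
  have k8 : r1 * E1 * (E1' * (t * c')) = t * (r1 * c') := by linear_combination t * r1 * c' * e1
  rw [k1, k2, k3, k4, k5, k6, k7, k8]
  linear_combination t ^ 2 * d * d' * a0 + t ^ 2 * c * c' * a1

/-- The terms of degree at most two of `resFun` in the displacement from the torus add up to `cross`. -/
theorem isBigO_resFun (hρ : ρ ∈ paramC) (hx : x ∈ Ω) : (fun t => resFun ρ (psi ρ (scaleC x t)) -
    cross ρ (scaleC x t)) =O[𝓝 0] fun t : ℂ => ‖t‖ ^ 3 := by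
  obtain ⟨c₁, c₂, c₃, c₄, h⟩ := resFun_scaleC hρ hx
  set k := x.2.2.1 (η 0) * x.2.2.1 (η 1) + x.2.2.2 (η 0) * x.2.2.2 (η 1) with hk
  set r := fun (i : Fin 2) (t : ℂ) => act ρ (scaleC x t) i ^ ½ with hr
  set G :=
    fun t : ℂ => r 0 t * r 1 t * k + t * (r 0 t * c₁ + r 1 t * c₂) + t ^ 2 * (c₃ + c₄) with hGd
  have hact : ∀ i t, act ρ (scaleC x t) i = ρ i + t ^ 2 * (x.1 i - x.2.2.1 (η i) * x.2.2.2 (η i)) :=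
    fun i t => by
    change ρ i + (t ^ 2 * x.1 i - t * _ * (t * _)) = _
    ring
  have h0 : ∀ i, r i 0 = ρ i ^ ½ := fun i => by
    simp only [hr, hact]
    simp
  have hd : ∀ i, DifferentiableAt ℂ (r i) 0 := fun i => by
    have e : r i = fun t => (ρ i + t ^ 2 * (x.1 i - x.2.2.1 (η i) * x.2.2.2 (η i))) ^ ½ :=
      funext fun t => by
      rw [hr, ← hact]
    rw [e]
    refine DifferentiableAt.cpow (by fun_prop) (by fun_prop) (Or.inl ?_)
    simp only [ne_eq, OfNat.ofNat_ne_zero, not_false_eq_true, zero_pow, zero_mul, add_zero]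
    exact lt_of_lt_of_le (by norm_num) (norm_param_le hρ i).1
  have hGd' : DifferentiableAt ℂ G 0 := ((((hd 0).mul (hd 1)).mul_const k).add
    (differentiableAt_id.mul (((hd 0).mul_const c₁).add ((hd 1).mul_const c₂)))).add
    ((differentiableAt_id.pow 2).mul_const _)
  have hG0 : G 0 = ρ 0 ^ ½ * ρ 1 ^ ½ * k := by
    simp only [hGd, h0]
    ring
  have key := (Asymptotics.isBigO_refl (fun t : ℂ => t ^ 2) (𝓝 0)).mul hGd'.isBigO_sub
  simp only [← norm_pow]
  refine Asymptotics.IsBigO.norm_right ?_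
  refine key.congr' ?_ (Eventually.of_forall fun t => by ring)
  filter_upwards [Metric.ball_mem_nhds (0 : ℂ) one_pos] with t ht
  rw [h t (mem_ball_zero_iff.1 ht).le, hG0]
  change _ = _ - ρ 0 ^ ½ * ρ 1 ^ ½ * (t * _ * (t * _) + t * _ * (t * _))
  simp only [hGd, hr, hk]
  ring

/-- As `cross` is the jet of `resFun`, the difference of the two is a good function. -/
theorem exists_isGood_sub : ∃ Γ B, 0 ≤ B ∧
    IsGood (fun ρ (x : Ξ) => resFun ρ (psi ρ x) - cross ρ x) Γ B := by
  obtain ⟨Γ, B, h⟩ := exists_isGood_resFun (s := s) (p := p) (q := q)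
  have h' := h.add_smul h.jet 1 (-1)
  refine ⟨_, _, abs_nonneg _, (h'.mono (le_abs_self _)).congr fun ρ hρ x hx => ?_⟩
  have e := jet_eq_of_isBigO (f := fun x => resFun ρ (psi ρ x)) (f' := fun _ => 0) (c := cross ρ x)
    (analyticAt_right (f := fun ρ x => resFun ρ (psi ρ x)) (h.analytic ρ hρ _ (base_mem hx)))
    analyticAt_const ((isBigO_resFun hρ hx).congr_left fun t => by
      change _ - _ * (t * _ * (t * _) + t * _ * (t * _)) = _ - 0 - _ * (_ * _ + _ * _) * _
      ring)
  rw [e]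
  simp [jet, sub_eq_add_neg]

/-! ### The Hamiltonian in the new coordinates -/

/-- The internal and the hyperbolic modes. -/
def coreModes (p q : ℤ) : Finset Mode := {(p, true), (q, false), (p, false), (q, true)}

/-- The elliptic modes are the modes outside of `coreModes`. -/
def ellEquiv (p q : ℤ) : Ell p q ≃ {α : Mode // α ∉ coreModes p q} :=
  Equiv.subtypeEquivRight fun α => by
    obtain ⟨j, b⟩ := α
    cases b <;> simp [coreModes, and_comm]

theorem hasSum_psi (hρ : ρ ∈ paramC) (hx : x ∈ Ω) (m : Mode → ℂ)
    (hm : Summable fun α : Ell p q => m α.1 * (x.2.2.1 α.toExt * x.2.2.2 α.toExt)) :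
    HasSum (fun α => m α * ((psi ρ x).1 α * (psi ρ x).2 α)) (∑' α : Ell p q,
    m α.1 * (x.2.2.1 α.toExt * x.2.2.2 α.toExt) +
    (m (p, true) * act ρ x 0 + (m (q, false) * act ρ x 1 + (m (p, false) *
    (x.2.2.1 (η 0) * x.2.2.2 (η 0)) + m (q, true) * (x.2.2.1 (η 1) * x.2.2.2 (η 1)))))) := by
  have hE : ∀ i, exp (I * x.2.1 i) * exp (-(I * x.2.1 i)) = 1 :=
    fun i => by rw [← exp_add, add_neg_cancel, exp_zero]
  have hi : ∀ i, (psi ρ x).1 (ι i) * (psi ρ x).2 (ι i) = act ρ x i := fun i => by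
    rw [(psi_int ρ x i).1, (psi_int ρ x i).2]
    linear_combination act ρ x i ^ ½ * act ρ x i ^ ½ * hE i + cpow_half_sq (act_ne_zero hρ hx i)
  have hh : ∀ i, (psi ρ x).1 (η i).1 * (psi ρ x).2 (η i).1 = x.2.2.1 (η i) * x.2.2.2 (η i) :=
    fun i => by
    rw [(psi_hyp ρ x i).1, (psi_hyp ρ x i).2]
    linear_combination x.2.2.1 (η i) * x.2.2.2 (η i) * hE i
  have e : m (p, true) * act ρ x 0 + (m (q, false) * act ρ x 1 + (m (p,
    false) * (x.2.2.1 (η 0) * x.2.2.2 (η 0)) + m (q, true) * (x.2.2.1 (η 1) * x.2.2.2 (η 1)))) =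
    ∑ α ∈ coreModes p q, m α * ((psi ρ x).1 α * (psi ρ x).2 α) := by
    rw [← hi 0, ← hi 1, ← hh 0, ← hh 1, coreModes, Finset.sum_insert (by simp [hpq.out]),
      Finset.sum_insert (by simp [hpq.out.symm]), Finset.sum_pair (by simp)]
    rfl
  rw [e]
  refine (Finset.hasSum_compl_iff (coreModes p q)).1 ((ellEquiv p q).hasSum_iff.1 ?_)
  refine hm.hasSum.congr_fun fun α => ?_
  have h := psi_ell ρ x α
  exact congrArg₂ (fun a b => m α.1 * (a * b)) h.1 h.2

theorem finiteEnergy_psi (ρ : C2)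
    (hx : FiniteEnergyCoord x) (c : ℂ) : FiniteEnergy (c • psi ρ x) := by
  refine (Finset.summable_compl_iff (coreModes p q)).1 ((ellEquiv p q).summable_iff.1 ?_)
  have h : Function.Injective (Ell.toExt : Ell p q → Ext p q) := fun α β e =>
    Subtype.ext (congrArg (fun γ : Ext p q => γ.1) e)
  refine ((hx.comp_injective h).mul_left (‖c‖ ^ 2)).congr fun α => ?_
  have e := psi_ell ρ x α
  change ‖c‖ ^ 2 * ((α.1.1 : ℝ) ^ 2 * (‖x.2.2.1 α.toExt‖ ^ 2 + ‖x.2.2.2 α.toExt‖ ^ 2)) =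
    (α.1.1 : ℝ) ^ 2 * (‖c * (psi ρ x).1 α.1‖ ^ 2 + ‖c * (psi ρ x).2 α.1‖ ^ 2)
  rw [e.1, e.2, norm_mul, norm_mul]
  ring

theorem h0_eq (ν : ℝ) {ρ : Fin 2 → ℝ} (hρ : ρ ∈ paramD) (x : Ξ) :
    h0 ν ρ x = ((p : ℂ) ^ 2 + ν * ρ 1) * x.1 0 + ((q : ℂ) ^ 2 + ν * ρ 0) * x.1 1 + ∑' α : Ell p q,
    (Lam ν ρ α.1 : ℂ) * (x.2.2.1 α.toExt * x.2.2.2 α.toExt) + ν * ((ρ 0 - ρ 1) *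
    (x.2.2.1 (η 0) * x.2.2.2 (η 0) - x.2.2.1 (η 1) * x.2.2.2 (η 1)) + cross (cparam ρ) x) := by
  have h0 : ∀ i, 0 ≤ ρ i := fun i => zero_le_one.trans (hρ.1 i)
  have hc : ∀ i, cparam ρ i ^ ½ = ((√(ρ i) : ℝ) : ℂ) := fun i => by
    rw [Real.sqrt_eq_rpow, Complex.ofReal_cpow (h0 i)]
    push_cast
    rfl
  have hz : zHyp x = ![x.2.2.1 (η 0), x.2.2.1 (η 1), x.2.2.2 (η 0), x.2.2.2 (η 1)] := by
    rw [zHyp, (extCoord_hyp _).1, (extCoord_hyp _).2, (extCoord_hyp _).1, (extCoord_hyp _).2]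
  rw [CoupledNLS.h0, hz, cross, hc, hc, Fin.sum_univ_two]
  simp only [hypK, Real.sqrt_mul (h0 0), Matrix.mulVec, dotProduct, Fin.sum_univ_four, Matrix.map_apply,
    Matrix.smul_apply, Matrix.of_apply, Matrix.cons_val', Matrix.cons_val_zero, Matrix.cons_val_one,
    Matrix.cons_val, Omega, smul_eq_mul]
  push_cast
  ring

/-- Scaling by `√ν` gives `P₂`, `Z₄` and `W` the factors `ν`, `ν²` and one. The terms of degree at most
two make up `C_{ν,ρ}` and `h₀`, and the rest is the perturbation. -/
theorem hamiltonian_identity {g : (Fin 4 → ℂ) → ℂ} {ε C ν : ℝ} {τ : Λ → Λ} {W : Λ → ℂ} {G : Λ → Λ}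
    (h : IsNormalForm g ε C τ W G) (hν : 0 < ν) {ρ : Fin 2 → ℝ} (hρ : ρ ∈ paramD) (hx : x ∈ Ω)
    (hfe : FiniteEnergyCoord x) (hε : Psi ν (cparam ρ) x ∈ ball 0 ε) :
    FiniteEnergy (τ (Psi ν (cparam ρ) x)) ∧ (1 / (ν : ℂ)) * (hamH g (τ (Psi ν (cparam ρ) x)) -
    (constC p q ν ρ : ℂ)) = h0 ν ρ x + (ν * (resFun (cparam ρ) (psi (cparam ρ) x) -
    cross (cparam ρ) x) + ((ν⁻¹ : ℝ) : ℂ) * W (Psi ν (cparam ρ) x)) := by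
  obtain ⟨hf, hH⟩ := h.ham _ hε (finiteEnergy_psi _ hfe _)
  refine ⟨hf, ?_⟩
  set w := psi (cparam ρ) x with hw
  have hν2 : (√ν : ℂ) * √ν = ν := by
    rw [← Complex.ofReal_mul, Real.mul_self_sqrt hν.le]
  have hP2 : P2 ((√ν : ℂ) • w) = ν * P2 w := by
    rw [P2, P2, ← tsum_mul_left]
    refine tsum_congr fun α => ?_
    change _ * (_ * w.1 α * (_ * w.2 α)) = _
    linear_combination (α.1 : ℂ) ^ 2 * (w.1 α * w.2 α) * hν2
  have hZ4 : Z4 ((√ν : ℂ) • w) = ν ^ 2 * Z4 w := by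
    rw [Z4, Z4, ← tsum_mul_left]
    refine tsum_congr fun t => ?_
    rw [mul_ite, mul_zero]
    refine if_congr Iff.rfl ?_ rfl
    change _ * w.1 _ * (_ * w.1 _) * (_ * w.2 _) * (_ * w.2 _) = _
    rw [← hν2]
    ring
  have hs1 : Summable fun α : Ell p q =>
      (α.1.1 : ℂ) ^ 2 * (x.2.2.1 α.toExt * x.2.2.2 α.toExt) := by
    have hi : Function.Injective (Ell.toExt : Ell p q → Ext p q) := fun α β e =>
      Subtype.ext (congrArg (fun γ : Ext p q => γ.1) e)
    refine Summable.of_norm_bounded (hfe.comp_injective hi) fun α => ?_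
    rw [norm_mul, norm_mul, norm_pow, Complex.norm_intCast, sq_abs]
    refine mul_le_mul_of_nonneg_left ?_ (sq_nonneg _)
    nlinarith [sq_nonneg (‖x.2.2.1 α.toExt‖ - ‖x.2.2.2 α.toExt‖),
      sq_nonneg (‖x.2.2.1 α.toExt‖ + ‖x.2.2.2 α.toExt‖)]
  set m : Mode → ℂ := fun α => if α.2 then cparam ρ 1 else cparam ρ 0 with hm
  have hs2 : Summable fun α : Ell p q => m α.1 * (x.2.2.1 α.toExt * x.2.2.2 α.toExt) := by
    have h1 := (summable_dotM (actD s (cparam ρ) w.1) w.2).comp_injective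
      (Subtype.val_injective : Function.Injective (Subtype.val : Ell p q → Mode))
    refine h1.congr fun α => ?_
    have e := psi_ell (cparam ρ) x α
    rw [Function.comp_apply, actD_apply, e.1, e.2, mul_assoc]
  have e1 := (hasSum_psi (cparam_mem hρ) hx (fun α => (α.1 : ℂ) ^ 2) hs1).tsum_eq
  have e2 := (hasSum_psi (cparam_mem hρ) hx m hs2).tsum_eq
  have hdot : dotM (actD s (cparam ρ) w.1) w.2 = ∑' α, m α * (w.1 α * w.2 α) := by
    rw [dotM_apply]
    exact tsum_congr fun α => by rw [actD_apply, mul_assoc]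
  have hL : ∑' α : Ell p q, (Lam ν ρ α.1 : ℂ) * (x.2.2.1 α.toExt * x.2.2.2 α.toExt) = ∑' α :
    Ell p q, (α.1.1 : ℂ) ^ 2 * (x.2.2.1 α.toExt * x.2.2.2 α.toExt) + ν * ∑' α : Ell p q,
    m α.1 * (x.2.2.1 α.toExt * x.2.2.2 α.toExt) := by
    rw [← tsum_mul_left, ← hs1.tsum_add (hs2.mul_left _)]
    refine tsum_congr fun α => ?_
    rw [Lam, hm]
    simp only [cparam_apply]
    split_ifs <;> push_cast <;> ring
  have hνc : (ν : ℂ) ≠ 0 := Complex.ofReal_ne_zero.2 hν.ne'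
  rw [hH, hP2, hZ4, h0_eq ν hρ, hL, resFun, ← Z4_eq, hdot, e2, P2, e1, constC]
  simp only [hm, act, cparam_apply]
  push_cast
  field_simp
  ring

/-! ### The choice of the scale -/

theorem IsBirkhoff.mono {ε C C' : ℝ} {τ : Λ → Λ} (h : IsBirkhoff s ε C τ)
    (hC : C ≤ C') : IsBirkhoff s ε C' τ :=
  { h with
    near_id := fun w hw => (h.near_id w hw).trans (by gcongr)
    normalForm := by
      obtain ⟨R, G, h1, h2, h3, h4, h5⟩ := h.normalForm
      exact ⟨R, G, h1, h2, h3, fun w hw => ⟨(h4 w hw).1, (h4 w hw).2.1,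
        (h4 w hw).2.2.trans (by gcongr)⟩, h5⟩ }

/-- Since `τ` is cubically close to the identity, it moves points of size `√ν` by `O(ν^{3/2})`. -/
theorem IsNormalForm.isSmall {g : (Fin 4 → ℂ) → ℂ} {ε C M ν : ℝ} {τ : Λ → Λ} {W : Λ → ℂ} {G : Λ → Λ}
    (h : IsNormalForm g ε C τ W G) (hν : 0 < ν) (hM : ∀ ρ ∈ paramC, ∀ x ∈ Ω, ‖psi ρ x‖ ≤ M)
    (hε : √ν * M < ε) (hC : C * M ^ 3 * ν ≤ 1 / 40) : IsSmall p q τ ε ν ∧ ∀ ρ ∈ paramC, ∀ x ∈ Ω,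
    ‖τ (Psi ν ρ x) - Psi ν ρ x‖ ≤ C * M ^ 3 * ν * √ν := by
  have hU : ∀ ρ ∈ paramC, ∀ x ∈ Ω, Psi ν ρ x ∈ ball 0 ε := fun ρ hρ x hx =>
    mem_ball_zero_iff.2 ((norm_Psi_le hM ν hρ hx).trans_lt hε)
  have hn : ∀ ρ ∈ paramC, ∀ x ∈ Ω, ‖τ (Psi ν ρ x) - Psi ν ρ x‖ ≤ C * M ^ 3 * ν * √ν :=
    fun ρ hρ x hx => by
    refine ((h.birkhoff.near_id _ (hU ρ hρ x hx)).trans (mul_le_mul_of_nonneg_left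
      (pow_le_pow_left₀ (norm_nonneg _) (norm_Psi_le hM ν hρ hx) 3) h.C_nonneg)).trans (le_of_eq ?_)
    have e := Real.mul_self_sqrt hν.le
    linear_combination C * M ^ 3 * √ν * e
  have := Real.sqrt_nonneg ν
  refine ⟨⟨hν, hU, fun ρ hρ x hx => (hn ρ hρ x hx).trans ?_⟩, hn⟩
  nlinarith

end

end

end CoupledNLS

theorem mainTheorem5 (p q : ℤ) (hpq : p ≠ q) (g : (Fin 4 → ℂ) → ℂ) (hg : Admissible g) :
    ∃ σ₀ μ₀ : ℝ, 0 < σ₀ ∧ σ₀ ≤ 1 / 2 ∧ 0 < μ₀ ∧ μ₀ ≤ Real.exp (-(1 / 2)) / 2 ∧ ∀ s : ℝ,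
    1 / 2 < s → ∃ ν₀ C ε : ℝ, 0 < ν₀ ∧ 0 < C ∧ 0 < ε ∧ ∃ τ : PSpace s → PSpace s,
    IsBirkhoff s ε C τ ∧ ∀ ν : ℝ, 0 < ν → ν ≤ ν₀ → ∃ (Φ : (Fin 2 → ℝ) → Coord p q s →
    Coord p q s) (f : (Fin 2 → ℝ) → Coord p q s → ℂ), IsSymplecticFamily ν Φ ∧ (∀ ρ ∈ paramD,
    ∀ x ∈ domPhi p q s, toModes (shiftAction ν ρ (angleElim (rescale ν x))) ∈ Metric.ball 0 ε ∧
    toModes (Φ ρ x) = τ (toModes (shiftAction ν ρ (angleElim (rescale ν x))))) ∧ (∀ ρ ∈ paramD,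
    ∀ x ∈ domPhi p q s, ‖(Φ ρ x).2.2 - (angleElim (rescale ν x)).2.2‖ ≤ C * ν ^ (3 / 2 : ℝ)) ∧
    (∀ ρ ∈ paramD, ∀ x ∈ domPhi p q s, FiniteEnergyCoord x → FiniteEnergy (toModes (Φ ρ x)) ∧
    (1 / (ν : ℂ)) * (hamH g (toModes (Φ ρ x)) - (constC p q ν ρ : ℂ)) = h0 ν ρ x + f ρ x) ∧
    (∀ σ μ : ℝ, 0 < σ → σ ≤ σ₀ → 0 < μ → μ ≤ μ₀ → MemTRes σ μ f ∧
    normT σ μ f ≤ ENNReal.ofReal (C * ν) ∧ MemT σ μ (fun ρ => jet (f ρ)) ∧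
    normT σ μ (fun ρ => jet (f ρ)) ≤ ENNReal.ofReal (C * ν ^ (3 / 2 : ℝ))) := by
  refine ⟨1 / 4, Real.exp (-(1 / 2)) / 4, by norm_num, by norm_num, by positivity,
    by linarith [Real.exp_pos (-(1 / 2))], fun s hs => ?_⟩
  have : Fact (1 / 2 < s) := ⟨hs⟩
  have : Fact (p ≠ q) := ⟨hpq⟩
  obtain ⟨ε, C, τ, W, G, h⟩ := exists_isNormalForm (s := s) hg
  obtain ⟨M, hM1, hM⟩ := exists_psi_bound (s := s) (p := p) (q := q)
  obtain ⟨Γ, B, hB0, hF1⟩ := exists_isGood_sub (s := s) (p := p) (q := q)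
  have hC := h.C_nonneg
  have hε := h.pos
  have hM0 : 0 < M := by linarith
  have hM35 : C * M ^ 3 ≤ C * M ^ 5 :=
    mul_le_mul_of_nonneg_left (pow_le_pow_right₀ hM1 (by norm_num)) hC
  have hCM : 0 ≤ C * M ^ 3 := by positivity
  refine ⟨min 1 (min ((ε / (2 * M)) ^ 2) (1 / (40 * (C * M ^ 3 + 1)))),
    1 + C + 3260 * (B + 11 * (C * M ^ 5)), ε, by positivity, by positivity, hε, τ,
    h.birkhoff.mono (by nlinarith), fun ν hν hν' => ?_⟩
  have hν1 : ν ≤ 1 := hν'.trans (min_le_left _ _)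
  have hν2 : ν ≤ (ε / (2 * M)) ^ 2 := hν'.trans ((min_le_right _ _).trans (min_le_left _ _))
  have hν3 : ν ≤ 1 / (40 * (C * M ^ 3 + 1)) :=
    hν'.trans ((min_le_right _ _).trans (min_le_right _ _))
  have hεM : Real.sqrt ν * M < ε := by
    have h1 := Real.sqrt_le_iff.2 ⟨by positivity, hν2⟩
    calc Real.sqrt ν * M ≤ ε / (2 * M) * M := mul_le_mul_of_nonneg_right h1 hM0.le
      _ = ε / 2 := by field_simp
      _ < ε := half_lt_self hε
  have hsm : C * M ^ 3 * ν ≤ 1 / 40 := by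
    rw [le_div_iff₀ (by positivity)] at hν3
    nlinarith
  have e32 : ν ^ (3 / 2 : ℝ) = ν * Real.sqrt ν := by
    rw [Real.sqrt_eq_rpow, ← Real.rpow_one_add' hν.le (by norm_num)]
    norm_num
  have h32 : ν ^ (3 / 2 : ℝ) ≤ ν := by
    rw [e32]
    exact mul_le_of_le_one_right hν.le (Real.sqrt_le_one.2 hν1)
  have h32' : 0 ≤ ν ^ (3 / 2 : ℝ) := by positivity
  obtain ⟨hS, hτ⟩ := h.isSmall hν hM hεM hsm
  obtain ⟨Γ', hW⟩ := h.isGood hS.mem_ball hM hM1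
  have e15 : ν⁻¹ * Real.sqrt ν ^ 5 = ν ^ (3 / 2 : ℝ) := by
    rw [e32, inv_mul_eq_iff_eq_mul₀ hν.ne']
    linear_combination Real.sqrt ν * (Real.sqrt ν ^ 2 + ν) * Real.sq_sqrt hν.le
  let F := fun (c : ℝ) ρ (x : Coord p q s) =>
    (c : ℂ) * (resFun ρ (psi ρ x) - cross ρ x) + ((ν⁻¹ : ℝ) : ℂ) * W (Psi ν ρ x)
  have hF : ∀ c, IsGood (F c) _ _ := fun c => hF1.add_smul hW c ν⁻¹
  -- The first summand of `F ν` has a vanishing jet.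
  have hJ := (hF 0).jet.congr (F' := fun ρ => jet (F ν ρ)) fun ρ hρ x hx => by
    have ha := fun c => analyticAt_right (f := F c) ((hF c).analytic ρ hρ _ (base_mem hx))
    refine (jet_eq_of_isBigO (c := 0) (ha ν) (ha 0) ?_).trans (add_zero _)
    refine ((isBigO_resFun hρ hx).const_mul_left (ν : ℂ)).congr_left fun t => ?_
    simp only [F]
    push_cast
    ring
  refine ⟨fun ρ x => PhiC ν τ (cparam ρ) x, fun ρ => F ν (cparam ρ),
    isSymplecticFamily hS h.birkhoff h.analytic, fun ρ hρ x hx => ?_, fun ρ hρ x hx => ?_,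
    fun ρ hρ x hx hfe => ?_, fun σ μ _ hσ hμ hμ' => ⟨(hF ν).memTRes hσ hμ hμ',
      ((hF ν).normT_le hσ hμ hμ').trans (ENNReal.ofReal_le_ofReal ?_), hJ.memT hσ hμ hμ',
      (hJ.normT_le hσ hμ hμ').trans (ENNReal.ofReal_le_ofReal ?_)⟩⟩
  · rw [toModes_shiftAction hν]
    exact ⟨hS.mem_ball _ (cparam_mem hρ) x hx, (hS.toModes_PhiC (cparam_mem hρ) hx).1⟩
  · refine ((norm_PhiC_sub_le hν ρ x).trans (hτ _ (cparam_mem hρ) x hx)).trans ?_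
    rw [mul_assoc, ← e32]
    exact mul_le_mul_of_nonneg_right (by nlinarith) h32'
  · rw [(hS.toModes_PhiC (cparam_mem hρ) hx).1]
    exact hamiltonian_identity h hν hρ hx hfe (hS.mem_ball _ (cparam_mem hρ) x hx)
  · rw [abs_of_pos hν, abs_of_pos (inv_pos.2 hν), mul_left_comm ν⁻¹, e15]
    have := mul_le_mul_of_nonneg_left h32 (hCM.trans hM35)
    nlinarith
  · rw [abs_zero, zero_mul, zero_add, abs_of_pos (inv_pos.2 hν), mul_left_comm ν⁻¹, e15]
    nlinarith
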